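/- A translation surface is a closed connected surface with a Euclidean structure with cone-singularities of angles in $2\pi\mathbb N$ whose charts change by translations; two translation surfaces are equal if there is a homeomorphism between them that reads as a translation in local charts. Points of cone angle $>2\pi$ are called singular, and $\mathcal H_2$ denotes the set of translation surfaces of genus two with exactly one singular point, of cone angle $6\pi$. A saddle connection is a straight segment joining singular points with no singular point in its interior. Two translation surfaces $S,T$ have the same absolute periods if some homeomorphism $f:S\to T$ satisfies $\int_{f\circ\gamma}\omega_T=\int_\gamma\omega_S$ for all loops $\gamma$ in $S$ (such an $f$ preserves orientation). A fake $S$, for $S\in\mathcal H_2$, is an element of $\mathcal H_2$ different from $S$ with the same absolute periods as $S$. Let $S\in\mathcal H_2$ have a unique horizontal closed saddle connection $\gamma$ of length $1$, oriented from left to right. A twin of $\gamma$ is a straight segment $\eta\neq\gamma$ with the same starting point and the same developed image as $\gamma$. Let $\gamma_L$ (respectively $\gamma_R$) be the twin for which the angle measured clockwise (respectively counterclockwise) from the end of $\gamma$ to $\gamma_L$ (respectively $\gamma_R$) is $\pi$, and suppose that this twin is embedded. The left (respectively right) surgery cuts $S$ along $\gamma$ and $\gamma_L$ (respectively $\gamma_R$)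 and glues the four sides of the cuts in the other way that is coherent with orientations: the left side of each segment is glued to the right side of the other one. Theorem. Let $\operatorname{Oct}_0$ be the translation surface obtained by gluing opposite sides of the regular octagon in $\mathbb C$ of edge length one with an edge equal to $[0,1]$. Left and right surgeries can be iterated on $\operatorname{Oct}_0$: for $n\in\mathbb Z$ there is a well-defined translation surface $\operatorname{Oct}_n$ obtained from $\operatorname{Oct}_0$ by $n$ left surgeries ($|n|$ right surgeries if $n<0$). Each $\operatorname{Oct}_n$ has exactly one horizontal closed saddle connection of length one (oriented from left to right), lies in $\mathcal H_2$ (in particular has genus two), and has the same absolute periods as $\operatorname{Oct}_0$. If $n\neq m$, then $\operatorname{Oct}_n\neq\operatorname{Oct}_m$. In particular the surfaces $\operatorname{Oct}_n$, $n\neq0$, form an infinite family of pairwise different fake octagons. -/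

import Mathlib

open Set Filter Topology unitInterval

noncomputable section

/-- A translation surface: a compact connected Hausdorff space with a Euclidean structure with
cone-singularities of angles in `2πℕ`, whose charts change by translations.  The structure is
recorded by local developing maps: for `q` close to `p`, the number `dev p q` is `∫_p^q ω`, where
`ω` is the holomorphic 1-form of the structure.  Only the germ of `dev` along the diagonal is
meaningful, and only that germ is used anywhere below. -/
structure TranslationSurface where
  carrier : Type
  [top : TopologicalSpace carrier]
  [t2 : T2Space carrier]
  [compact : CompactSpace carrier]
  [connected : ConnectedSpace carrier]
  /-- `dev p` is, near `p`, the developing map normalised to vanish at `p`. -/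
  dev : carrier → carrier → ℂ
  /-- In a suitable local coordinate `φ` centred at `p`, the developing map is `φ ^ k`
  (cone angle `2πk`; regular point if `k = 1`). -/
  exists_chart : ∀ p : carrier, ∃ k : ℕ, 1 ≤ k ∧ ∃ φ : OpenPartialHomeomorph carrier ℂ,
    p ∈ φ.source ∧ φ p = 0 ∧ ∀ q ∈ φ.source, dev p q = (φ q) ^ k
  /-- Developing maps at nearby points differ by a translation. -/
  dev_translation : ∀ p : carrier, ∀ᶠ q in 𝓝 p, ∀ᶠ r in 𝓝 q, dev q r = dev p r - dev p q

attribute [instance] TranslationSurface.top TranslationSurface.t2 TranslationSurface.compact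
  TranslationSurface.connected

instance : CoeSort TranslationSurface Type := ⟨TranslationSurface.carrier⟩

namespace TranslationSurface

/-- Equality in the moduli space: a homeomorphism that reads as a translation in local charts. -/
def Isomorphic (S T : TranslationSurface) : Prop :=
  ∃ f : S ≃ₜ T, ∀ p, ∀ᶠ q in 𝓝 p, T.dev (f p) (f q) = S.dev p q

/-- The total angle of `S` at `p` is `2πk`. -/
def HasConeAngle (S : TranslationSurface) (p : S) (k : ℕ) : Prop :=
  1 ≤ k ∧ ∃ φ : OpenPartialHomeomorph S ℂ,
    p ∈ φ.source ∧ φ p = 0 ∧ ∀ q ∈ φ.source, S.dev p q = (φ q) ^ k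

/-- Regular points: total angle `2π`. -/
def IsRegular (S : TranslationSurface) (p : S) : Prop := S.HasConeAngle p 1

/-- Singular points (saddles): total angle `2πk` with `k ≥ 2`. -/
def IsSingular (S : TranslationSurface) (p : S) : Prop := ∃ k, 2 ≤ k ∧ S.HasConeAngle p k

/-- `S` has genus `g`: some (hence any) finite cell decomposition of `S` has Euler characteristic
`2 - 2g`. -/
def HasGenus (S : TranslationSurface) (g : ℕ) : Prop :=
  ∃ cw : Topology.CWComplex (univ : Set S),
    (∀ n, Finite (cw.cell n)) ∧ (∀ n, 3 ≤ n → IsEmpty (cw.cell n)) ∧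
    (Nat.card (cw.cell 0) : ℤ) - Nat.card (cw.cell 1) + Nat.card (cw.cell 2) = 2 - 2 * g

/-- The minimal stratum `ℋ₂`: genus two, and a unique singular point, of cone angle `6π`. -/
def InH2 (S : TranslationSurface) : Prop :=
  S.HasGenus 2 ∧ ∃ p, S.HasConeAngle p 3 ∧ ∀ q, q ≠ p → S.IsRegular q

/-- `∫_γ ω = z`: the developing map of `S`, continued along the path `γ` from the value `0`,
ends at the value `z`. -/
def HasPeriod (S : TranslationSurface) (γ : C(I, S)) (z : ℂ) : Prop :=
  ∃ F : C(I, ℂ), F 0 = 0 ∧ F 1 = z ∧ ∀ s, ∀ᶠ t in 𝓝 s, S.dev (γ s) (γ t) = F t - F s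

/-- `S` and `T` have the same absolute periods: some homeomorphism identifies the classes
`[ω_S] ∈ H¹(S; ℂ)` and `[ω_T] ∈ H¹(T; ℂ)`, i.e. all loops keep their periods.  Such a homeomorphism
preserves orientation, hence intersection numbers, because the areas `(i/2) ∫ ω ∧ ω̄` of
`S` and `T` are both positive; so the periods agree as polarized modules. -/
def SameAbsolutePeriods (S T : TranslationSurface) : Prop :=
  ∃ f : S ≃ₜ T, ∀ γ : C(I, S), γ 0 = γ 1 →
    ∀ z, S.HasPeriod γ z ↔ T.HasPeriod ((f : C(S, T)).comp γ) z

/-- `T` is a fake `S` (for `S` in `ℋ₂`): different from `S`, with the same absolute periods and in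
the same minimal stratum. -/
def IsFake (S T : TranslationSurface) : Prop :=
  ¬ T.Isomorphic S ∧ S.SameAbsolutePeriods T ∧ T.InH2

/-- `c` is a straight segment, parametrised proportionally to length, with developed image the
nonzero vector `v`, and without singular points in its interior. -/
structure IsSegment (S : TranslationSurface) (c : C(I, S)) (v : ℂ) : Prop where
  ne_zero : v ≠ 0
  straight : ∀ s, ∀ᶠ t in 𝓝 s, S.dev (c s) (c t) = (((t : ℝ) - (s : ℝ) : ℝ) : ℂ) * v
  regular : ∀ t, 0 < t → t < 1 → S.IsRegular (c t)

/-- `γ` is a horizontal closed saddle connection of length one, oriented from left to right. -/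
def IsUnitHorizontalSaddle (S : TranslationSurface) (γ : C(I, S)) : Prop :=
  S.IsSegment γ 1 ∧ γ 0 = γ 1 ∧ S.IsSingular (γ 0)

/-- `η` is a twin of `γ`: another segment with the same starting point and the same developed
image `v`. -/
def IsTwin (S : TranslationSurface) (γ η : C(I, S)) (v : ℂ) : Prop :=
  S.IsSegment γ v ∧ S.IsSegment η v ∧ η 0 = γ 0 ∧ η ≠ γ

/-- For `H` the upper (lower) half-plane, and `γ` a closed segment and `η` a segment starting at
the end of `γ`, both with developed image `1`: the angle on the left (right) side of the
concatenation `γ · η`, between the end of `γ` and the start of `η`, is exactly `π`.  That is, a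
Euclidean half-disc in `H` develops into `S` with centre at that point, and its two boundary
radii are the end of `γ` and the start of `η`. -/
def HalfDiscAt (S : TranslationSurface) (H : Set ℂ) (γ η : C(I, S)) : Prop :=
  ∃ r : ℝ, 0 < r ∧ ∃ f : ℂ → S, ContinuousOn f (H ∩ Metric.ball 0 r) ∧
    (∀ z ∈ H ∩ Metric.ball 0 r, S.dev (γ 1) (f z) = z) ∧
    (∀ t : I, (t : ℝ) < r → f ((t : ℝ) : ℂ) = η t ∧ f (-((t : ℝ) : ℂ)) = γ (unitInterval.symm t))

/-- The germ, at the point `c t`, of the left side of the segment `c` with developed image `v`. -/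
def leftSide (S : TranslationSurface) (c : C(I, S)) (v : ℂ) (t : I) : Filter S :=
  𝓝 (c t) ⊓ 𝓟 {q | 0 < (S.dev (c t) q / v).im}

/-- The germ, at the point `c t`, of the right side of the segment `c` with developed image `v`. -/
def rightSide (S : TranslationSurface) (c : C(I, S)) (v : ℂ) (t : I) : Filter S :=
  𝓝 (c t) ⊓ 𝓟 {q | (S.dev (c t) q / v).im < 0}

/-- `T` is obtained from `S` by cutting along the segments `γ` and `η` with the same developed
image `v`, and gluing back in the other way: the left side of `γ` with the right side of `η` (this
gives the segment `γ'` of `T`), and the left side of `η` with the right side of `γ` (this gives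
`η'`).  The map `h` is the identification of the complements of the cuts. -/
def IsSurgery (S T : TranslationSurface) (γ η : C(I, S)) (v : ℂ) : Prop :=
  ∃ γ' η' : C(I, T), T.IsSegment γ' v ∧ T.IsSegment η' v ∧
  ∃ h : OpenPartialHomeomorph S T,
    h.source = (range γ ∪ range η)ᶜ ∧ h.target = (range γ' ∪ range η')ᶜ ∧
    (∀ x ∈ h.source, ∀ᶠ y in 𝓝 x, T.dev (h x) (h y) = S.dev x y) ∧
    ∀ t : I, 0 < t → t < 1 →
      Tendsto h (S.leftSide γ v t) (𝓝 (γ' t)) ∧ Tendsto h (S.rightSide η v t) (𝓝 (γ' t)) ∧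
      Tendsto h (S.leftSide η v t) (𝓝 (η' t)) ∧ Tendsto h (S.rightSide γ v t) (𝓝 (η' t))

/-- Saddle connection surgery along a unit horizontal closed saddle connection `γ` (oriented from
left to right) and an embedded twin of it forming an angle `π` with the end of `γ`, on the
side given by the half-plane `H`. -/
def IsSideSurgery (H : Set ℂ) (S T : TranslationSurface) : Prop :=
  ∃ γ η : C(I, S), S.IsUnitHorizontalSaddle γ ∧ S.IsTwin γ η 1 ∧ Function.Injective η ∧
    S.HalfDiscAt H γ η ∧ S.IsSurgery T γ η 1

/-- `T` is obtained from `S` by a left surgery. -/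
def IsLeftSurgery (S T : TranslationSurface) : Prop := IsSideSurgery {z | 0 ≤ z.im} S T

/-- `T` is obtained from `S` by a right surgery. -/
def IsRightSurgery (S T : TranslationSurface) : Prop := IsSideSurgery {z | z.im ≤ 0} S T

/-- The direction of the `j`-th edge (counterclockwise) of the regular octagon. -/
def octEdge (j : ℕ) : ℂ := Complex.exp (Real.pi * Complex.I / 4) ^ j

/-- The `j`-th vertex of the regular octagon having the segment `[0,1]` as its edge number `0`. -/
def octVertex (j : ℕ) : ℂ := ∑ i ∈ Finset.range j, octEdge i

/-- The closed regular octagon of edge length one, with an edge in `[0,1]`. -/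
def octagon : Set ℂ := convexHull ℝ (octVertex '' {j | j < 8})

/-- The translation that identifies an edge of the octagon with the opposite edge (edge `j` starts
at vertex `j`, and its translate, edge `j + 4` reversed, starts at vertex `j + 5`). -/
def octGlue (z w : ℂ) : Prop :=
  ∃ j : ℕ, ∃ s ∈ Icc (0 : ℝ) 1, z = octVertex j + s * octEdge j ∧
    w = octVertex (j + 5) + s * octEdge j

/-- `S` is the octagon: the quotient, by `π`, of the regular octagon under the identification of
opposite edges by translations, with the translation structure inherited from `ℂ`. -/
def IsOctagon (S : TranslationSurface) : Prop :=
  ∃ π : ℂ → S, ContinuousOn π octagon ∧ π '' octagon = univ ∧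
    (∀ z ∈ octagon, ∀ w ∈ octagon, π z = π w ↔ Relation.EqvGen octGlue z w) ∧
    ∀ z ∈ octagon, ∀ᶠ w in 𝓝[octagon] z, S.dev (π z) (π w) = w - z

/-- `Oct n` is obtained from the octagon by `n` left surgeries if `n ≥ 0`, and by `-n` right
surgeries if `n ≤ 0`. -/
structure IsOctFamily (Oct : ℤ → TranslationSurface) : Prop where
  zero : (Oct 0).IsOctagon
  left : ∀ n, 0 ≤ n → (Oct n).IsLeftSurgery (Oct (n + 1))
  right : ∀ n, n ≤ 0 → (Oct n).IsRightSurgery (Oct (n - 1))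

end TranslationSurface

end

/-!
The horizontal diagonals cut the regular octagon into two trapezoids and a rectangle. Glued up, it
consists of two horizontal cylinders, one of circumference `L = 1 + √2` and height `1` and one of
circumference `1 + L`, whose boundaries are made of three horizontal saddle connections, of lengths
`1`, `L` and `L`. The edge of length `1` bounds the second cylinder on both sides; each of the
other two edges lies between the two cylinders. All surfaces of the family have this shape, and
only the twist of the cylinders varies: `surf t` is a single topological space, `Model`, with a
developing map in which the upper side of each cylinder is displaced by an amount depending on the
real parameter `t`. The octagon is `surf 0` (`isOctagon_surf`), and `Oct n` is `surf n`.

*Surgery adds one to the twist.* In `surf t` the twins of the short edge are the initial segments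
of length one of the two long edges. Exchanging the sides of the two cuts amounts to displacing one
cylinder horizontally by one with respect to the other, and the result is `surf (t + 1)` or
`surf (t - 1)` (`isLeftSurgery_surf`, `isRightSurgery_surf`). Statements of this kind are checked on
presentations of a surface as a quotient of planar pieces: two surfaces presented by the same pieces
are compared by comparing which points of the pieces are identified
(`isomorphic_of_presentations`, `isSurgery_of_presentations`,
`sameAbsolutePeriods_of_presentations`).

*The family is determined by the octagon.* A horizontal segment that leaves the vertex to the right
runs along one of the three edges (`eq_seg_of_isSegment`), so the short edge is the only unit
horizontal saddle connection. Its twin on a given side is unique, since the two bound a half disc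
(`HalfDiscAt.eq_of_isSegment`). Two surfaces obtained by surgery along the same cuts are identified
away from the new segments; the identification extends over the interior points of these segments
because its values on one side determine it there, and then over the finitely many remaining points
because small punctured neighbourhoods are connected (`exists_homeomorph_extension`,
`IsSurgery.isomorphic`).

*Absolute periods.* The surgery map from `surf t` to `surf (t + 1)` displaces the cylinders, and it
is discontinuous only along the two cuts. A neighbourhood of the cuts has a boundary circle that
follows the upper side of the short edge and both sides of its twin, hence has length three; along
it the new gluing is the old one rotated by one unit. Composing with a fractional Dehn twist in a
collar at this circle makes the map continuous; the difference of the developing maps is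
then a single-valued function, so that all absolute periods agree (`sameAbsolutePeriods_add_one`).

*The surfaces are different.* A translation from `surf t` to `surf t'` preserves the short edge,
hence its twins, hence the long edges pointwise, hence also the vertical segment that crosses the
first cylinder from a given point of a long edge. Where it lands on the other long edge gives `t`
modulo `L` (`exists_of_isomorphic`), and as `L` is irrational, different integers `t` give
different surfaces (`not_isomorphic_surf`).

The genus is read off from a cell decomposition with one vertex, five edges and two faces
(`hasGenus_surf`), and the cone angle `6π` of the vertex from six half discs arranged cyclically
(`exists_coneChart`, `hasChart_vertex`).
-/

noncomputable section

namespace TranslationSurface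

section

/-! ### Local geometry of translation surfaces -/

lemma eq_of_eventually_eq_of_isPreconnected {X Y : Type*} [TopologicalSpace X] {s : Set X}
    (hs : IsPreconnected s) {u : X → Y} (hu : ∀ x ∈ s, ∀ᶠ y in 𝓝[s] x, u y = u x)
    {x y : X} (hx : x ∈ s) (hy : y ∈ s) : u x = u y :=
  hs.induction₂ (fun x y => u x = u y) (fun x hx => (hu x hx).mono fun _ h => h.symm)
    (fun _ _ _ _ _ _ h h' => h.trans h') (fun _ _ _ _ h => h.symm) hx hy

/-- Two continuous `k`-th roots of the same nowhere vanishing function on a connected set agree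
as soon as they agree at one point. -/
lemma eqOn_of_pow_eq {X : Type*} [TopologicalSpace X] {s : Set X} (hs : IsPreconnected s)
    {u v : X → ℂ} (hu : ContinuousOn u s) (hv : ContinuousOn v s) {k : ℕ} (hk : 1 ≤ k)
    (huv : ∀ x ∈ s, u x ^ k = v x ^ k) (hv0 : ∀ x ∈ s, v x ≠ 0) {x₀ : X} (hx₀ : x₀ ∈ s)
    (h₀ : u x₀ = v x₀) : EqOn u v s := by
  have hq : ContinuousOn (fun x => u x / v x) s := hu.div hv hv0
  have hfin : {z : ℂ | z ^ k = 1}.Finite := by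
    have := (Polynomial.nthRoots k (1 : ℂ)).toFinset.finite_toSet
    refine this.subset fun z hz => ?_
    simpa [Polynomial.mem_nthRoots hk] using hz
  have hq1 : ∀ x ∈ s, (u x / v x) ^ k = 1 := fun x hx => by
    rw [div_pow, huv x hx, div_self (pow_ne_zero _ (hv0 x hx))]
  have hconst : ∀ x ∈ s, ∀ᶠ y in 𝓝[s] x, u y / v y = u x / v x := by
    intro x hx
    have hopen : ({z : ℂ | z ^ k = 1} \ {u x / v x})ᶜ ∈ 𝓝 (u x / v x) :=
      (hfin.subset sdiff_subset).isClosed.isOpen_compl.mem_nhds (by simp)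
    filter_upwards [hq x hx hopen, self_mem_nhdsWithin] with y hy hys
    by_contra hne
    exact hy ⟨hq1 y hys, hne⟩
  intro x hx
  have := eq_of_eventually_eq_of_isPreconnected (u := fun x => u x / v x) hs hconst hx hx₀
  simp only [h₀, div_self (hv0 x₀ hx₀)] at this
  rwa [div_eq_one_iff_eq (hv0 x hx)] at this

variable {S T : TranslationSurface}

lemma HasConeAngle.dev_self {p : S} {k : ℕ} (h : S.HasConeAngle p k) : S.dev p p = 0 := by
  obtain ⟨hk, φ, hp, h0, hφ⟩ := h
  rw [hφ p hp, h0, zero_pow (by omega)]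

lemma exists_hasConeAngle (p : S) : ∃ k, S.HasConeAngle p k := by
  obtain ⟨k, hk, h⟩ := S.exists_chart p
  exact ⟨k, hk, h⟩

@[simp] lemma dev_self (p : S) : S.dev p p = 0 := (exists_hasConeAngle p).choose_spec.dev_self

lemma eventually_continuousAt_dev (p : S) : ∀ᶠ q in 𝓝 p, ContinuousAt (S.dev p) q := by
  obtain ⟨k, hk, φ, hp, h0, hφ⟩ := S.exists_chart p
  filter_upwards [φ.open_source.mem_nhds hp] with q hq
  have : S.dev p =ᶠ[𝓝 q] fun r => φ r ^ k := by
    filter_upwards [φ.open_source.mem_nhds hq] with r hr using hφ r hr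
  rw [continuousAt_congr this]
  exact (φ.continuousAt hq).pow k

lemma continuousAt_dev (p : S) : ContinuousAt (S.dev p) p :=
  (eventually_continuousAt_dev p).self_of_nhds

lemma tendsto_dev (p : S) : Tendsto (S.dev p) (𝓝 p) (𝓝 0) := by
  simpa using (continuousAt_dev p).tendsto

lemma IsRegular.exists_injOn {p : S} (h : S.IsRegular p) :
    ∃ N ∈ 𝓝 p, InjOn (S.dev p) N := by
  obtain ⟨-, φ, hp, h0, hφ⟩ := h
  refine ⟨φ.source, φ.open_source.mem_nhds hp, fun x hx y hy hxy => ?_⟩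
  rw [hφ x hx, hφ y hy, pow_one, pow_one] at hxy
  exact φ.injOn hx hy hxy

/-- A cone angle larger than `2π` makes the developing map non-injective, so that singular points
are not regular. -/
lemma IsSingular.not_isRegular {p : S} (h : S.IsSingular p) : ¬ S.IsRegular p := by
  intro hr
  obtain ⟨k, hk2, -, φ, hp, h0, hφ⟩ := h
  obtain ⟨N, hN, hinj⟩ := hr.exists_injOn
  have hk0 : k ≠ 0 := by omega
  obtain ⟨ζ, hζ⟩ : ∃ ζ : ℂ, IsPrimitiveRoot ζ k := ⟨_, Complex.isPrimitiveRoot_exp k hk0⟩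
  have hnhds : φ.target ∩ φ.symm ⁻¹' N ∈ 𝓝 (0 : ℂ) := by
    have h0t : (0 : ℂ) ∈ φ.target := h0 ▸ φ.map_source hp
    refine inter_mem (φ.open_target.mem_nhds h0t) ?_
    have hc := φ.continuousAt_symm h0t
    have : φ.symm 0 = p := by rw [← h0, φ.left_inv hp]
    exact hc.preimage_mem_nhds (by rwa [this])
  have hnhds' : (fun z : ℂ => ζ * z) ⁻¹' (φ.target ∩ φ.symm ⁻¹' N) ∈ 𝓝 (0 : ℂ) := by
    have : ContinuousAt (fun z : ℂ => ζ * z) 0 := by fun_prop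
    exact this.preimage_mem_nhds (by simpa using hnhds)
  have hex : ∃ᶠ z in 𝓝[≠] (0 : ℂ), z ∈ φ.target ∩ φ.symm ⁻¹' N ∩
      (fun z : ℂ => ζ * z) ⁻¹' (φ.target ∩ φ.symm ⁻¹' N) :=
    Eventually.frequently (mem_nhdsWithin_of_mem_nhds (inter_mem hnhds hnhds'))
  obtain ⟨z, ⟨hz1, hz2⟩, hz0⟩ := (hex.and_eventually self_mem_nhdsWithin).exists
  have e1 := hφ _ (φ.map_target hz1.1)
  have e2 := hφ _ (φ.map_target hz2.1)
  rw [φ.right_inv hz1.1] at e1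
  rw [φ.right_inv hz2.1, mul_pow, hζ.pow_eq_one, one_mul] at e2
  have := hinj hz2.2 hz1.2 (e2.trans e1.symm)
  have h3 := φ.symm.injOn (by simpa using hz2.1) (by simpa using hz1.1) this
  have hz0' : z ≠ 0 := hz0
  have hζ1 : ζ = 1 := mul_right_cancel₀ hz0' (by simpa using h3)
  rw [hζ1] at hζ
  have := hζ.unique IsPrimitiveRoot.one
  omega

/-! ### Straight segments -/

lemma isPreconnected_Ioo_unitInterval (a b : I) : IsPreconnected (Ioo a b) := by
  have : (Subtype.val '' Ioo a b : Set ℝ) = Ioo (a : ℝ) b := by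
    ext x
    constructor
    · rintro ⟨y, hy, rfl⟩; exact ⟨hy.1, hy.2⟩
    · intro hx
      exact ⟨⟨x, a.2.1.trans hx.1.le, hx.2.le.trans b.2.2⟩, ⟨hx.1, hx.2⟩, rfl⟩
  exact (Topology.IsInducing.subtypeVal.isPreconnected_image).1 (this ▸ isPreconnected_Ioo)

lemma dense_Ioo_unitInterval : Dense (Ioo (0 : I) 1) := by
  intro x
  rw [closure_Ioo (zero_ne_one)]
  exact ⟨x.2.1, x.2.2⟩

lemma IsSegment.eventually_eq_of_isRegular {c₁ c₂ : C(I, S)} {v : ℂ} (h₁ : S.IsSegment c₁ v)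
    (h₂ : S.IsSegment c₂ v) {t : I} (ht : c₁ t = c₂ t) (hr : S.IsRegular (c₁ t)) :
    ∀ᶠ s in 𝓝 t, c₁ s = c₂ s := by
  obtain ⟨N, hN, hinj⟩ := hr.exists_injOn
  filter_upwards [h₁.straight t, h₂.straight t, c₁.continuous.continuousAt hN,
    c₂.continuous.continuousAt (ht ▸ hN)] with s e₁ e₂ m₁ m₂
  exact hinj m₁ m₂ (by rw [e₁, ht, e₂])

/-- Unique continuation of segments. -/
lemma IsSegment.eq_of_apply_eq {c₁ c₂ : C(I, S)} {v : ℂ} (h₁ : S.IsSegment c₁ v)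
    (h₂ : S.IsSegment c₂ v) {t₀ : I} (h0 : 0 < t₀) (h1 : t₀ < 1) (ht : c₁ t₀ = c₂ t₀) :
    c₁ = c₂ := by
  have key : EqOn (c₁ : I → S) c₂ (Ioo 0 1) := by
    intro t htm
    have : (c₁ t₀ = c₂ t₀) = (c₁ t = c₂ t) := by
      refine eq_of_eventually_eq_of_isPreconnected (u := fun t => (c₁ t = c₂ t))
        (isPreconnected_Ioo_unitInterval 0 1) ?_ ⟨h0, h1⟩ htm
      intro x hx
      by_cases hxe : c₁ x = c₂ x
      · filter_upwards [mem_nhdsWithin_of_mem_nhds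
          (h₁.eventually_eq_of_isRegular h₂ hxe (h₁.regular x hx.1 hx.2))] with y hy
        exact propext ⟨fun _ => hxe, fun _ => hy⟩
      · have : {y : I | c₁ y ≠ c₂ y} ∈ 𝓝 x :=
          (isOpen_ne_fun c₁.continuous c₂.continuous).mem_nhds hxe
        filter_upwards [mem_nhdsWithin_of_mem_nhds this] with y hy
        exact propext ⟨fun h => absurd h hy, fun h => absurd h hxe⟩
    exact this ▸ ht
  exact DFunLike.coe_injective
    (Continuous.ext_on dense_Ioo_unitInterval c₁.continuous c₂.continuous key)

lemma exists_mem_Ioo_of_eventually {P : I → Prop} (h : ∀ᶠ s in 𝓝 (0 : I), P s) :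
    ∃ s : I, 0 < s ∧ s < 1 ∧ P s := by
  have : (0 : I) ∈ closure (Ioo (0 : I) 1) := dense_Ioo_unitInterval 0
  obtain ⟨s, hs⟩ := ((mem_closure_iff_frequently.1 this).and_eventually h).exists
  exact ⟨s, hs.1.1, hs.1.2, hs.2⟩

lemma IsSegment.eq_of_eventually_eq {c₁ c₂ : C(I, S)} {v : ℂ} (h₁ : S.IsSegment c₁ v)
    (h₂ : S.IsSegment c₂ v) (h : ∀ᶠ s in 𝓝 (0 : I), c₁ s = c₂ s) : c₁ = c₂ := by
  obtain ⟨s, h0, h1, hs⟩ := exists_mem_Ioo_of_eventually h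
  exact h₁.eq_of_apply_eq h₂ h0 h1 hs

lemma IsSegment.eq_of_start_isRegular {c₁ c₂ : C(I, S)} {v : ℂ} (h₁ : S.IsSegment c₁ v)
    (h₂ : S.IsSegment c₂ v) (h : c₁ 0 = c₂ 0) (hr : S.IsRegular (c₁ 0)) : c₁ = c₂ :=
  h₁.eq_of_eventually_eq h₂ (h₁.eventually_eq_of_isRegular h₂ h hr)

/-! ### The twin on a given side is unique -/

lemma isPreconnected_upperHalfDisc_diff (r : ℝ) :
    IsPreconnected (({z : ℂ | 0 ≤ z.im} ∩ Metric.ball 0 r) \ {0}) := by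
  have hA : IsPreconnected ({z : ℂ | 0 < z.im} ∩ Metric.ball 0 r) :=
    ((convex_halfSpace_im_gt 0).inter (convex_ball 0 r)).isPreconnected
  refine hA.subset_closure ?_ ?_
  · rintro z ⟨hz, hr⟩
    exact ⟨⟨le_of_lt (show 0 < z.im from hz), hr⟩, by rintro rfl; simp at hz⟩
  · rintro z ⟨⟨hz, hr⟩, -⟩
    have hcont : ContinuousWithinAt (fun e : ℝ => z + e * Complex.I) (Ioi 0) 0 := by fun_prop
    have h0 : (fun e : ℝ => z + e * Complex.I) 0 = z := by simp
    have hlim : Tendsto (fun e : ℝ => z + e * Complex.I) (𝓝[>] 0) (𝓝 z) := by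
      simpa using hcont.tendsto
    refine mem_closure_of_frequently_of_tendsto ?_ hlim
    refine Eventually.frequently ?_
    have : Metric.ball (0 : ℂ) r ∈ 𝓝 ((fun e : ℝ => z + e * Complex.I) 0) := by
      rw [h0]; exact Metric.isOpen_ball.mem_nhds hr
    filter_upwards [hcont this, self_mem_nhdsWithin] with e he he0
    have hz' : 0 ≤ z.im := hz
    have he0' : 0 < e := he0
    exact ⟨by simp; linarith, he⟩

lemma isPreconnected_lowerHalfDisc_diff (r : ℝ) :
    IsPreconnected (({z : ℂ | z.im ≤ 0} ∩ Metric.ball 0 r) \ {0}) := by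
  have := (isPreconnected_upperHalfDisc_diff r).image (fun z => -z) (by fun_prop)
  convert! this using 1
  ext z
  simp only [Set.mem_sdiff, mem_inter_iff, mem_ofPred_eq, mem_singleton_iff, mem_image]
  constructor
  · rintro ⟨⟨h1, h2⟩, h3⟩
    exact ⟨-z, ⟨⟨by simpa using h1, by simpa using h2⟩, by simpa using h3⟩, by simp⟩
  · rintro ⟨w, ⟨⟨h1, h2⟩, h3⟩, rfl⟩
    exact ⟨⟨by simpa using h1, by simpa using h2⟩, by simpa using h3⟩

/-- The half-disc at the end of `γ` determines the direction in which the twin starts: two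
half-discs are `k`-th roots of the same function that agree along `γ`. -/
lemma HalfDiscAt.eq_of_isSegment {H : Set ℂ}
    (hH : ∀ r, IsPreconnected ((H ∩ Metric.ball 0 r) \ {0})) (hreal : ∀ x : ℝ, (x : ℂ) ∈ H)
    {γ η₁ η₂ : C(I, S)} {v : ℂ} (h₁ : S.HalfDiscAt H γ η₁) (h₂ : S.HalfDiscAt H γ η₂)
    (s₁ : S.IsSegment η₁ v) (s₂ : S.IsSegment η₂ v) : η₁ = η₂ := by
  obtain ⟨r₁, hr₁, f₁, c₁, d₁, e₁⟩ := h₁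
  obtain ⟨r₂, hr₂, f₂, c₂, d₂, e₂⟩ := h₂
  obtain ⟨k, hk, φ, hp, h0, hφ⟩ := S.exists_chart (γ 1)
  have f10 : f₁ 0 = γ 1 := by simpa using (e₁ 0 (by simpa using hr₁)).2
  have f20 : f₂ 0 = γ 1 := by simpa using (e₂ 0 (by simpa using hr₂)).2
  have h0H : (0 : ℂ) ∈ H := by simpa using hreal 0
  have m₁ : ∀ᶠ z in 𝓝[H ∩ Metric.ball 0 r₁] (0 : ℂ), f₁ z ∈ φ.source :=
    c₁ 0 ⟨h0H, by simpa using hr₁⟩ (f10 ▸ φ.open_source.mem_nhds hp)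
  have m₂ : ∀ᶠ z in 𝓝[H ∩ Metric.ball 0 r₂] (0 : ℂ), f₂ z ∈ φ.source :=
    c₂ 0 ⟨h0H, by simpa using hr₂⟩ (f20 ▸ φ.open_source.mem_nhds hp)
  obtain ⟨ε₁, hε₁, m₁⟩ := Metric.mem_nhdsWithin_iff.1 m₁
  obtain ⟨ε₂, hε₂, m₂⟩ := Metric.mem_nhdsWithin_iff.1 m₂
  obtain ⟨r, hr, hlt⟩ : ∃ r : ℝ, 0 < r ∧ (r ≤ r₁ ∧ r ≤ r₂ ∧ r ≤ ε₁ ∧ r ≤ ε₂ ∧ r ≤ 1) :=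
    ⟨min (min (min r₁ r₂) (min ε₁ ε₂)) 1, by positivity, by simp⟩
  obtain ⟨l1, l2, l3, l4, l5⟩ := hlt
  set D := (H ∩ Metric.ball (0 : ℂ) r) \ {0} with hD
  have sub : ∀ {ρ}, r ≤ ρ → D ⊆ H ∩ Metric.ball 0 ρ := fun h z hz =>
    ⟨hz.1.1, Metric.ball_subset_ball h hz.1.2⟩
  have n₁ : ∀ z ∈ D, f₁ z ∈ φ.source := fun z hz => m₁ ⟨(sub l3 hz).2, sub l1 hz⟩
  have n₂ : ∀ z ∈ D, f₂ z ∈ φ.source := fun z hz => m₂ ⟨(sub l4 hz).2, sub l2 hz⟩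
  have p₁ : ∀ z ∈ D, φ (f₁ z) ^ k = z := fun z hz => by
    rw [← hφ _ (n₁ z hz)]; exact d₁ z (sub l1 hz)
  have p₂ : ∀ z ∈ D, φ (f₂ z) ^ k = z := fun z hz => by
    rw [← hφ _ (n₂ z hz)]; exact d₂ z (sub l2 hz)
  have hrr : ((r / 2 : ℝ) : ℝ) < r := by linarith
  set τ : I := ⟨r / 2, by positivity, by linarith⟩ with hτ
  have hτD : -((τ : ℝ) : ℂ) ∈ D := by
    refine ⟨⟨by simpa using hreal (-τ), ?_⟩, ?_⟩
    · simp [hτ, abs_of_pos hr, hrr]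
    · simp [hτ, hr.ne']
  have hconn := eqOn_of_pow_eq (hH r) (u := fun z => φ (f₁ z)) (v := fun z => φ (f₂ z))
    (φ.continuousOn.comp (c₁.mono (sub l1)) n₁) (φ.continuousOn.comp (c₂.mono (sub l2)) n₂) hk
    (fun z hz => (p₁ z hz).trans (p₂ z hz).symm)
    (fun z hz h => hz.2 (by
      rw [mem_singleton_iff, ← p₂ z hz]
      simp only [h]; exact zero_pow (by omega))) hτD
    (by
      have a₁ := (e₁ τ (hrr.trans_le l1)).2
      have a₂ := (e₂ τ (hrr.trans_le l2)).2
      simp only [a₁, a₂])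
  refine s₁.eq_of_apply_eq s₂ (t₀ := τ) (Subtype.mk_lt_mk.2 (by positivity))
    (Subtype.mk_lt_mk.2 (by linarith)) ?_
  have hτD' : ((τ : ℝ) : ℂ) ∈ D := by
    refine ⟨⟨hreal τ, ?_⟩, ?_⟩
    · simp [hτ, abs_of_pos hr, hrr]
    · simp [hτ, hr.ne']
  have := φ.injOn (n₁ _ hτD') (n₂ _ hτD') (hconn hτD')
  rw [← (e₁ τ (hrr.trans_le l1)).1, ← (e₂ τ (hrr.trans_le l2)).1, this]

end

section

/-! ### Transport along translation isomorphisms -/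

/-- The homeomorphism `e` reads as a translation in local charts. -/
def IsTranslationMap {S T : TranslationSurface} (e : S ≃ₜ T) : Prop :=
  ∀ p, ∀ᶠ q in 𝓝 p, T.dev (e p) (e q) = S.dev p q

variable {S T U : TranslationSurface}

lemma IsTranslationMap.symm {e : S ≃ₜ T} (he : IsTranslationMap e) : IsTranslationMap e.symm := by
  intro p
  have h := (e.symm.continuous.tendsto p).eventually (he (e.symm p))
  simpa [eq_comm] using h

lemma HasConeAngle.map {e : S ≃ₜ T} (he : IsTranslationMap e) {p : S} {k : ℕ}
    (h : S.HasConeAngle p k) : T.HasConeAngle (e p) k := by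
  obtain ⟨hk, φ, hp, h0, hφ⟩ := h
  obtain ⟨N, hN, hNo, hpN⟩ := mem_nhds_iff.1 (he p)
  refine ⟨hk, (e.symm.toOpenPartialHomeomorph.trans φ).restrOpen (e.symm ⁻¹' N)
    (hNo.preimage e.symm.continuous), ?_, by simpa using h0, ?_⟩
  · simpa using ⟨hp, hpN⟩
  · intro q hq
    simp only [OpenPartialHomeomorph.restrOpen_source, OpenPartialHomeomorph.trans_source,
      Homeomorph.toOpenPartialHomeomorph_source, univ_inter, mem_inter_iff, mem_preimage] at hq
    have h1 := hN hq.2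
    have h2 := hφ (e.symm q) hq.1
    simp only [Set.mem_ofPred_eq, e.apply_symm_apply] at h1
    rw [h1, h2]
    simp

lemma IsTranslationMap.eventually_dev_eq_comp {e : S ≃ₜ T} (he : IsTranslationMap e) (c : C(I, S))
    (s : I) : ∀ᶠ t in 𝓝 s, T.dev (e (c s)) (e (c t)) = S.dev (c s) (c t) :=
  (c.continuous.tendsto s).eventually (he (c s))

lemma IsSegment.map {e : S ≃ₜ T} (he : IsTranslationMap e) {c : C(I, S)} {v : ℂ}
    (h : S.IsSegment c v) : T.IsSegment ((e : C(S, T)).comp c) v where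
  ne_zero := h.ne_zero
  straight s := by
    filter_upwards [h.straight s, he.eventually_dev_eq_comp c s] with t h1 h2
    simpa [h1] using h2
  regular t h0 h1 := (h.regular t h0 h1).map he

lemma IsSingular.map {e : S ≃ₜ T} (he : IsTranslationMap e) {p : S} (h : S.IsSingular p) :
    T.IsSingular (e p) := by
  obtain ⟨k, hk, h⟩ := h
  exact ⟨k, hk, h.map he⟩

lemma IsUnitHorizontalSaddle.map {e : S ≃ₜ T} (he : IsTranslationMap e) {γ : C(I, S)}
    (h : S.IsUnitHorizontalSaddle γ) : T.IsUnitHorizontalSaddle ((e : C(S, T)).comp γ) :=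
  ⟨h.1.map he, by simpa using h.2.1, h.2.2.map he⟩

lemma HalfDiscAt.map {e : S ≃ₜ T} (he : IsTranslationMap e) {H : Set ℂ} (h0H : (0 : ℂ) ∈ H)
    {γ η : C(I, S)} (h : S.HalfDiscAt H γ η) :
    T.HalfDiscAt H ((e : C(S, T)).comp γ) ((e : C(S, T)).comp η) := by
  obtain ⟨r, hr, f, hf, hd, hfr⟩ := h
  have f0 : f 0 = γ 1 := by simpa using (hfr 0 (by simpa using hr)).2
  have hev : ∀ᶠ z in 𝓝[H ∩ Metric.ball 0 r] (0 : ℂ),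
      T.dev (e (γ 1)) (e (f z)) = S.dev (γ 1) (f z) := by
    have := hf 0 ⟨h0H, by simpa using hr⟩
    rw [ContinuousWithinAt, f0] at this
    exact this.eventually (he (γ 1))
  obtain ⟨ε, hε, hev⟩ := Metric.mem_nhdsWithin_iff.1 hev
  have hsub : ∀ z ∈ H ∩ Metric.ball (0 : ℂ) (min r ε), z ∈ H ∩ Metric.ball (0 : ℂ) r ∧
      z ∈ Metric.ball (0 : ℂ) ε := fun z hz =>
    ⟨⟨hz.1, Metric.ball_subset_ball (min_le_left _ _) hz.2⟩,
      Metric.ball_subset_ball (min_le_right _ _) hz.2⟩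
  refine ⟨min r ε, lt_min hr hε, e ∘ f, e.continuous.comp_continuousOn
    (hf.mono fun z hz => (hsub z hz).1), fun z hz => ?_, fun t ht => ?_⟩
  · have := hev ⟨(hsub z hz).2, (hsub z hz).1⟩
    simp only [Set.mem_ofPred_eq] at this
    simpa [hd z (hsub z hz).1] using this
  · obtain ⟨h1, h2⟩ := hfr t (ht.trans_le (min_le_left _ _))
    simp only [Function.comp_apply, h1, h2]
    exact ⟨rfl, rfl⟩

lemma IsTranslationMap.tendsto_leftSide {e : S ≃ₜ T} (he : IsTranslationMap e) (c : C(I, S)) (v : ℂ)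
    (t : I) : Tendsto e.symm (T.leftSide ((e : C(S, T)).comp c) v t) (S.leftSide c v t) := by
  have h1 : Tendsto e.symm (𝓝 (e (c t))) (𝓝 (c t)) := by
    simpa using e.symm.continuous.tendsto (e (c t))
  refine tendsto_inf.2 ⟨h1.mono_left inf_le_left, tendsto_principal.2 ?_⟩
  have h2 := he.symm (e (c t))
  filter_upwards [(h2.filter_mono inf_le_left :
    ∀ᶠ q in 𝓝 (e (c t)) ⊓ 𝓟 {q | 0 < (T.dev (e (c t)) q / v).im}, _),
    mem_inf_of_right (mem_principal_self _)] with q hq hq'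
  simp only [e.symm_apply_apply] at hq
  rw [hq]
  exact hq'

lemma IsTranslationMap.tendsto_rightSide {e : S ≃ₜ T} (he : IsTranslationMap e) (c : C(I, S))
    (v : ℂ) (t : I) :
    Tendsto e.symm (T.rightSide ((e : C(S, T)).comp c) v t) (S.rightSide c v t) := by
  have h1 : Tendsto e.symm (𝓝 (e (c t))) (𝓝 (c t)) := by
    simpa using e.symm.continuous.tendsto (e (c t))
  refine tendsto_inf.2 ⟨h1.mono_left inf_le_left, tendsto_principal.2 ?_⟩
  have h2 := he.symm (e (c t))
  filter_upwards [(h2.filter_mono inf_le_left :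
    ∀ᶠ q in 𝓝 (e (c t)) ⊓ 𝓟 {q | (T.dev (e (c t)) q / v).im < 0}, _),
    mem_inf_of_right (mem_principal_self _)] with q hq hq'
  simp only [e.symm_apply_apply] at hq
  rw [hq]
  exact hq'

/-- A surgery on `S` is also a surgery on any surface isomorphic to `S`, along the image cuts. -/
lemma IsSurgery.map {e : S ≃ₜ T} (he : IsTranslationMap e) {γ η : C(I, S)} {v : ℂ}
    (h : S.IsSurgery U γ η v) :
    T.IsSurgery U ((e : C(S, T)).comp γ) ((e : C(S, T)).comp η) v := by
  obtain ⟨γ', η', hγ', hη', h, hs, ht, hd, hlim⟩ := h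
  have hsrc : (e.symm.toOpenPartialHomeomorph.trans h).source = e.symm ⁻¹' h.source := by
    simp
  refine ⟨γ', η', hγ', hη', e.symm.toOpenPartialHomeomorph.trans h, ?_, ?_, ?_, ?_⟩
  · rw [hsrc, hs, preimage_compl, preimage_union]
    have : ∀ c : C(I, S), e.symm ⁻¹' range c = range ((e : C(S, T)).comp c) := by
      intro c
      ext x
      simp only [mem_preimage, mem_range, ContinuousMap.comp_apply]
      exact exists_congr fun t => e.toEquiv.eq_symm_apply
    rw [this, this]
  · rw [← ht]
    simp
  · intro x hx
    rw [hsrc] at hx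
    filter_upwards [he.symm x, (e.symm.continuous.tendsto x).eventually (hd (e.symm x) hx)]
      with y h1 h2
    simpa [h1] using h2
  · intro t h0 h1
    obtain ⟨l1, l2, l3, l4⟩ := hlim t h0 h1
    exact ⟨l1.comp (he.tendsto_leftSide γ v t), l2.comp (he.tendsto_rightSide η v t),
      l3.comp (he.tendsto_leftSide η v t), l4.comp (he.tendsto_rightSide γ v t)⟩

end

/-! ### Extending a homeomorphism over finitely many points -/

/-- Each point has arbitrarily small neighbourhoods that stay connected when the point is
removed. -/
def HasPuncturedNhds (X : Type*) [TopologicalSpace X] : Prop :=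
  ∀ x : X, ∀ U ∈ 𝓝 x, ∃ V ∈ 𝓝 x, V ⊆ U ∧ IsPreconnected (V \ {x})

lemma isPreconnected_ball_diff_zero (ε : ℝ) : IsPreconnected (Metric.ball (0 : ℂ) ε \ {0}) := by
  have : Metric.ball (0 : ℂ) ε \ {0} =
      (fun p : ℝ × ℝ => (p.1 : ℂ) * Complex.exp (p.2 * Complex.I)) '' (Ioo 0 ε ×ˢ univ) := by
    ext z
    constructor
    · rintro ⟨hz, hz0⟩
      refine ⟨(‖z‖, z.arg), ⟨⟨norm_pos_iff.2 hz0, by simpa using hz⟩, mem_univ _⟩, ?_⟩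
      simp
    · rintro ⟨⟨r, θ⟩, ⟨⟨h0, h1⟩, -⟩, rfl⟩
      refine ⟨?_, ?_⟩
      · simpa [Complex.norm_exp_ofReal_mul_I, abs_of_pos h0] using h1
      · simp [h0.ne']
  rw [this]
  exact (isPreconnected_Ioo.prod isPreconnected_univ).image _ (by fun_prop)

lemma hasPuncturedNhds (S : TranslationSurface) : HasPuncturedNhds S := by
  intro x U hU
  obtain ⟨k, hk, φ, hp, h0, hφ⟩ := S.exists_chart x
  have h0t : (0 : ℂ) ∈ φ.target := h0 ▸ φ.map_source hp
  have hx : φ.symm 0 = x := by rw [← h0, φ.left_inv hp]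
  have hn : φ.target ∩ φ.symm ⁻¹' U ∈ 𝓝 (0 : ℂ) :=
    inter_mem (φ.open_target.mem_nhds h0t)
      ((φ.continuousAt_symm h0t).preimage_mem_nhds (by rwa [hx]))
  obtain ⟨ε, hε, hsub⟩ := Metric.mem_nhds_iff.1 hn
  have himg : φ.symm '' Metric.ball 0 ε \ {x} = φ.symm '' (Metric.ball 0 ε \ {0}) := by
    ext y
    constructor
    · rintro ⟨⟨z, hz, rfl⟩, hy⟩
      exact ⟨z, ⟨hz, fun h => hy (by rw [mem_singleton_iff.1 h, hx]; rfl)⟩, rfl⟩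
    · rintro ⟨z, ⟨hz, hz0⟩, rfl⟩
      refine ⟨⟨z, hz, rfl⟩, fun h => hz0 ?_⟩
      rw [mem_singleton_iff, ← hx] at h
      exact φ.symm.injOn (hsub hz).1 h0t h
  refine ⟨φ.symm '' Metric.ball 0 ε, ?_, ?_, ?_⟩
  · have := φ.symm.image_mem_nhds (x := 0) h0t (Metric.ball_mem_nhds 0 hε)
    rwa [hx] at this
  · rintro _ ⟨z, hz, rfl⟩
    exact (hsub hz).2
  · rw [himg]
    exact (isPreconnected_ball_diff_zero ε).image _
      (φ.continuousOn_symm.mono fun z hz => (hsub hz.1).1)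

/-- The limit of `p` exists at an isolated exceptional point `x`, because its cluster points form a
finite set and punctured neighbourhoods of `x` are connected. -/
lemma exists_tendsto_of_finite {X Y : Type*} [TopologicalSpace X]
    [TopologicalSpace Y] [CompactSpace Y] [T2Space Y] (hX : HasPuncturedNhds X) {D : Set X}
    (hD : Dense D) {F : Set X} (hF : F.Finite) (hFD : Disjoint F D) {p : X → Y}
    (hlim : ∀ x ∉ F, ∃ y, Tendsto p (𝓝[D] x) (𝓝 y)) (hcont : ContinuousOn p D)
    {F' : Set Y} (hF' : F'.Finite) {x : X} (hx : x ∈ F)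
    (hcl : ∀ y, MapClusterPt y (𝓝[D] x) p → y ∈ F') [T1Space X] :
    ∃ y, Tendsto p (𝓝[D] x) (𝓝 y) := by
  have hne : (𝓝[D] x).NeBot := mem_closure_iff_nhdsWithin_neBot.1 (hD x)
  obtain ⟨y₁, -, hy₁⟩ := isCompact_univ (X := Y) (f := map p (𝓝[D] x)) (by simp)
  refine ⟨y₁, isCompact_univ.le_nhds_of_unique_clusterPt (by simp) fun y₂ _ hy₂ => ?_⟩
  by_contra hne12
  obtain ⟨g, hg0, hg1, -⟩ := exists_continuous_zero_one_of_isClosed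
    (isClosed_singleton (x := y₁)) ((hF'.subset (sdiff_subset (s := F') (t := {y₁}))).isClosed)
    (by simp)
  -- near `x`, the values of `g ∘ p` stay away from `[1/3, 2/3]`
  have hout : ∀ᶠ z in 𝓝[D] x, g (p z) ∉ Icc (1 / 3 : ℝ) (2 / 3) := by
    by_contra hcon
    rw [not_eventually] at hcon
    have hnb : (map p (𝓝[D] x) ⊓ 𝓟 (g ⁻¹' Icc (1 / 3 : ℝ) (2 / 3))).NeBot := by
      rw [← frequently_mem_iff_neBot, frequently_map]
      refine hcon.mono fun z hz => ?_
      simpa using hz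
    have hK : IsCompact (g ⁻¹' Icc (1 / 3 : ℝ) (2 / 3)) :=
      (isClosed_Icc.preimage g.continuous).isCompact
    obtain ⟨y, hyK, hy⟩ := hK (inf_le_right : map p (𝓝[D] x) ⊓ _ ≤ _)
    have hyF := hcl y (hy.mono inf_le_left)
    by_cases hyy : y = y₁
    · have : g y = 0 := hg0 hyy
      rw [mem_preimage, this] at hyK
      norm_num at hyK
    · have : g y = 1 := hg1 ⟨hyF, hyy⟩
      rw [mem_preimage, this] at hyK
      norm_num at hyK
  obtain ⟨N, hN, hNsub⟩ := mem_nhdsWithin_iff_exists_mem_nhds_inter.1 hout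
  obtain ⟨N', hN'N, hN'o, hxN'⟩ := mem_nhds_iff.1 hN
  have hFx : (F \ {x})ᶜ ∈ 𝓝 x :=
    (hF.subset sdiff_subset).isClosed.isOpen_compl.mem_nhds (by simp)
  obtain ⟨V, hV, hVsub, hVc⟩ := hX x _ (inter_mem (hN'o.mem_nhds hxN') hFx)
  have hVF : ∀ z ∈ V \ {x}, z ∉ F := fun z hz hzF => (hVsub hz.1).2 ⟨hzF, hz.2⟩
  set q := extendFrom D p with hq
  have hqc : ContinuousOn q (V \ {x}) :=
    continuousOn_extendFrom (fun z _ => hD z) fun z hz => hlim z (hVF z hz)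
  have hqout : ∀ z ∈ V \ {x}, g (q z) ∉ Ioo (1 / 3 : ℝ) (2 / 3) := by
    intro z hz
    have hnz : (𝓝[D] z).NeBot := mem_closure_iff_nhdsWithin_neBot.1 (hD z)
    have ht := (g.continuous.tendsto _).comp (tendsto_extendFrom (hlim z (hVF z hz)))
    refine (isOpen_Ioo.isClosed_compl.mem_of_tendsto ht ?_ : g (q z) ∈ (Ioo (1 / 3 : ℝ) (2 / 3))ᶜ)
    filter_upwards [mem_nhdsWithin_of_mem_nhds (hN'o.mem_nhds (hVsub hz.1).1),
      self_mem_nhdsWithin] with w hw hwD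
    intro hmem
    exact hNsub ⟨hN'N hw, hwD⟩ ⟨hmem.1.le, hmem.2.le⟩
  have hpq : ∀ z ∈ D, q z = p z := fun z hz =>
    extendFrom_eq (hD z) (hcont z hz)
  have hpick : ∀ y : Y, MapClusterPt y (𝓝[D] x) p → ∀ W ∈ 𝓝 y, ∃ z ∈ V \ {x}, q z ∈ W := by
    intro y hy W hW
    obtain ⟨z, hz1, hz2, hz3⟩ := ((hy.frequently hW).and_eventually
      (Eventually.and (mem_nhdsWithin_of_mem_nhds hV) self_mem_nhdsWithin)).exists
    refine ⟨z, ⟨hz2, fun h => ?_⟩, by rw [hpq z hz3]; exact hz1⟩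
    exact disjoint_left.1 hFD hx ((mem_singleton_iff.1 h) ▸ hz3)
  obtain ⟨z₁, hz₁, hgz₁⟩ := hpick y₁ hy₁ (g ⁻¹' Iio (1 / 2 : ℝ))
    (g.continuous.continuousAt.preimage_mem_nhds (Iio_mem_nhds (by
      have : g y₁ = 0 := hg0 rfl
      rw [this]; norm_num)))
  obtain ⟨z₂, hz₂, hgz₂⟩ := hpick y₂ hy₂ (g ⁻¹' Ioi (1 / 2 : ℝ))
    (g.continuous.continuousAt.preimage_mem_nhds (Ioi_mem_nhds (by
      have : g y₂ = 1 := hg1 ⟨hcl y₂ hy₂, hne12⟩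
      rw [this]; norm_num)))
  have hmem : (1 / 2 : ℝ) ∈ (fun z => g (q z)) '' (V \ {x}) :=
    hVc.intermediate_value hz₁ hz₂ (g.continuous.comp_continuousOn hqc)
      ⟨le_of_lt hgz₁, le_of_lt hgz₂⟩
  obtain ⟨z, hz, hgz⟩ := hmem
  refine hqout z hz ?_
  simp only at hgz
  rw [hgz]
  norm_num

lemma mem_of_mapClusterPt {X Y : Type*} [TopologicalSpace X] [TopologicalSpace Y] [T2Space X]
    (p : OpenPartialHomeomorph X Y) {F : Set X} {F' : Set Y}
    (hlim' : ∀ y ∉ F', ∃ x ∉ F, Tendsto p.symm (𝓝[p.target] y) (𝓝 x)) {x : X} (hx : x ∈ F) {y : Y}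
    (hy : MapClusterPt y (𝓝[p.source] x) p) : y ∈ F' := by
  by_contra hyF
  obtain ⟨x', hx', hx't⟩ := hlim' y hyF
  have : x' ≠ x := fun h => hx' (h ▸ hx)
  obtain ⟨U, U', hU, hU', hd⟩ := t2_separation_nhds this
  have h1 := mem_nhdsWithin_iff_exists_mem_nhds_inter.1 (hx't hU)
  obtain ⟨W, hW, hWs⟩ := h1
  obtain ⟨z, hz1, hz2, hz3⟩ := ((hy.frequently hW).and_eventually
    (Eventually.and (mem_nhdsWithin_of_mem_nhds hU') self_mem_nhdsWithin)).exists
  have := hWs ⟨hz1, p.map_source hz3⟩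
  rw [mem_preimage, p.left_inv hz3] at this
  exact disjoint_left.1 hd this hz2

/-- A homeomorphism between dense open sets which extends continuously, in both directions, away
from finitely many points, extends to a homeomorphism. -/
lemma exists_homeomorph_extension {X Y : Type*} [TopologicalSpace X] [TopologicalSpace Y]
    [CompactSpace X] [CompactSpace Y] [T2Space X] [T2Space Y] (hX : HasPuncturedNhds X)
    (hY : HasPuncturedNhds Y) (p : OpenPartialHomeomorph X Y) (hs : Dense p.source)
    (ht : Dense p.target) {F : Set X} {F' : Set Y} (hF : F.Finite) (hF' : F'.Finite)
    (hFs : Disjoint F p.source) (hFt : Disjoint F' p.target)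
    (hlim : ∀ x ∉ F, ∃ y ∉ F', Tendsto p (𝓝[p.source] x) (𝓝 y))
    (hlim' : ∀ y ∉ F', ∃ x ∉ F, Tendsto p.symm (𝓝[p.target] y) (𝓝 x)) :
    ∃ f : X ≃ₜ Y, (∀ x ∈ p.source, f x = p x) ∧
      ∀ x y, Tendsto p (𝓝[p.source] x) (𝓝 y) → f x = y := by
  have L : ∀ x, ∃ y, Tendsto p (𝓝[p.source] x) (𝓝 y) := by
    intro x
    by_cases hx : x ∈ F
    · exact exists_tendsto_of_finite hX hs hF hFs (fun z hz => (hlim z hz).imp fun _ h => h.2)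
        p.continuousOn hF' hx (fun _ => mem_of_mapClusterPt p hlim' hx)
    · exact (hlim x hx).imp fun _ h => h.2
  have L' : ∀ y, ∃ x, Tendsto p.symm (𝓝[p.target] y) (𝓝 x) := by
    intro x
    by_cases hx : x ∈ F'
    · exact exists_tendsto_of_finite hY ht hF' hFt (fun z hz => (hlim' z hz).imp fun _ h => h.2)
        p.continuousOn_symm hF hx (fun _ => mem_of_mapClusterPt p.symm hlim hx)
    · exact (hlim' x hx).imp fun _ h => h.2
  have c1 := continuous_extendFrom hs L
  have c2 := continuous_extendFrom ht L'
  have e1 : ∀ x ∈ p.source, extendFrom p.source p x = p x := fun x hx =>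
    extendFrom_eq (hs x) (p.continuousOn x hx)
  have e2 : ∀ y ∈ p.target, extendFrom p.target p.symm y = p.symm y := fun x hx =>
    extendFrom_eq (ht x) (p.continuousOn_symm x hx)
  refine ⟨⟨⟨extendFrom p.source p, extendFrom p.target p.symm, fun x => ?_, fun y => ?_⟩, c1, c2⟩,
    e1, fun x y hxy => extendFrom_eq (hs x) hxy⟩
  · refine congrFun (Continuous.ext_on hs (c2.comp c1) continuous_id fun x hx => ?_) x
    simp [e1 x hx, e2 _ (p.map_source hx), p.left_inv hx]
  · refine congrFun (Continuous.ext_on ht (c1.comp c2) continuous_id fun x hx => ?_) y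
    simp [e2 x hx, e1 _ (p.map_target hx), p.right_inv hx]

section

/-! ### The result of a surgery is determined by the cuts -/

/-- The open half-plane on the left of the vector `v`. -/
def leftHalf (v : ℂ) : Set ℂ := {z | 0 < (z / v).im}

lemma convex_leftHalf (v : ℂ) : Convex ℝ (leftHalf v) := by
  intro z hz w hw a b ha hb hab
  have hz' : 0 < (z / v).im := hz
  have hw' : 0 < (w / v).im := hw
  have : ((a • z + b • w) / v) = (a : ℂ) * (z / v) + (b : ℂ) * (w / v) := by
    simp only [Complex.real_smul]; ring
  show 0 < ((a • z + b • w) / v).im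
  rw [this]
  simp only [Complex.add_im, Complex.im_ofReal_mul]
  rcases ha.eq_or_lt with rfl | ha
  · have : b = 1 := by linarith
    subst this; linarith
  · have := mul_pos ha hz'
    have := mul_nonneg hb hw'.le
    linarith

lemma zero_mem_closure_leftHalf {v : ℂ} (hv : v ≠ 0) : (0 : ℂ) ∈ closure (leftHalf v) := by
  have hlim : Tendsto (fun e : ℝ => (e : ℂ) * (Complex.I * v)) (𝓝[>] 0) (𝓝 0) := by
    have : ContinuousWithinAt (fun e : ℝ => (e : ℂ) * (Complex.I * v)) (Ioi 0) 0 := by fun_prop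
    simpa using this.tendsto
  refine mem_closure_of_tendsto hlim ?_
  filter_upwards [self_mem_nhdsWithin] with e he
  have he' : 0 < e := he
  show 0 < ((e : ℂ) * (Complex.I * v) / v).im
  rw [show (e : ℂ) * (Complex.I * v) / v = e * Complex.I by field_simp]
  simpa using he'

variable {S T T₁ T₂ : TranslationSurface}

/-- The germ at `p` of the half-plane on the left of the vector `v`. -/
def leftGerm (S : TranslationSurface) (p : S) (v : ℂ) : Filter S :=
  𝓝 p ⊓ 𝓟 {q | S.dev p q ∈ leftHalf v}

lemma leftSide_eq_leftGerm (c : C(I, S)) (v : ℂ) (t : I) :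
    S.leftSide c v t = S.leftGerm (c t) v := rfl

lemma rightSide_eq_leftGerm (c : C(I, S)) (v : ℂ) (t : I) :
    S.rightSide c v t = S.leftGerm (c t) (-v) := by
  simp [rightSide, leftGerm, leftHalf, div_neg]

lemma IsRegular.leftGerm_neBot {p : S} (hp : S.IsRegular p) {v : ℂ} (hv : v ≠ 0) :
    (S.leftGerm p v).NeBot := by
  obtain ⟨-, φ, hps, h0, hφ⟩ := hp
  rw [leftGerm, ← frequently_mem_iff_neBot]
  have h0t : (0 : ℂ) ∈ φ.target := h0 ▸ φ.map_source hps
  have h1 : ∃ᶠ z in 𝓝 (0 : ℂ), z ∈ leftHalf v :=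
    mem_closure_iff_frequently.1 (zero_mem_closure_leftHalf hv)
  have h2 : Tendsto φ.symm (𝓝 0) (𝓝 p) := by
    have := φ.continuousAt_symm h0t
    rwa [ContinuousAt, ← h0, φ.left_inv hps, h0] at this
  refine h2.frequently ((h1.and_eventually (φ.open_target.mem_nhds h0t)).mono ?_)
  rintro z ⟨hz, hzt⟩
  show S.dev p (φ.symm z) ∈ leftHalf v
  rw [hφ _ (φ.map_target hzt), φ.right_inv hzt, pow_one]
  exact hz

/-- A local translation `h` defined on a half-disc centred at the regular point `p` reads, in
developing coordinates, as the identity, if the developing coordinates of the image are centred at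
the limit of `h` at `p`. -/
lemma eventually_dev_eq_of_tendsto_leftGerm {h : OpenPartialHomeomorph S T}
    (hdev : ∀ x ∈ h.source, ∀ᶠ y in 𝓝 x, T.dev (h x) (h y) = S.dev x y) {p : S} {q : T} {v : ℂ}
    (hv : v ≠ 0) (hp : S.IsRegular p) (hlim : Tendsto h (S.leftGerm p v) (𝓝 q))
    (hsrc : ∀ᶠ x in 𝓝 p, S.dev p x ∈ leftHalf v → x ∈ h.source) :
    ∀ᶠ x in 𝓝 p, S.dev p x ∈ leftHalf v → T.dev q (h x) = S.dev p x := by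
  obtain ⟨-, φ, hps, h0, hφ⟩ := hp
  simp only [pow_one] at hφ
  have h0t : (0 : ℂ) ∈ φ.target := h0 ▸ φ.map_source hps
  have hsymm : Tendsto φ.symm (𝓝 0) (𝓝 p) := by
    have := φ.continuousAt_symm h0t
    rwa [ContinuousAt, ← h0, φ.left_inv hps, h0] at this
  have hgood : ∀ᶠ x in 𝓝 p, S.dev p x ∈ leftHalf v →
      (∀ᶠ r in 𝓝 (h x), T.dev (h x) r = T.dev q r - T.dev q (h x)) := by
    have := hlim.eventually (T.dev_translation q)
    rwa [leftGerm, eventually_inf_principal] at this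
  have hall := hsymm.eventually
    ((hgood.and (hsrc.and (S.dev_translation p))).and (φ.open_source.mem_nhds hps))
  obtain ⟨ε, hε, hball⟩ := Metric.mem_nhds_iff.1 (inter_mem hall (φ.open_target.mem_nhds h0t))
  set A := leftHalf v ∩ Metric.ball (0 : ℂ) ε with hA
  have hAc : IsPreconnected A := ((convex_leftHalf v).inter (convex_ball 0 ε)).isPreconnected
  have hdz : ∀ z ∈ Metric.ball (0 : ℂ) ε, S.dev p (φ.symm z) = z := fun z hz => by
    rw [hφ _ (hball hz).1.2, φ.right_inv (hball hz).2]
  have hlc : ∀ z ∈ A, ∀ᶠ w in 𝓝[A] z,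
      T.dev q (h (φ.symm w)) - w = T.dev q (h (φ.symm z)) - z := by
    intro z hz
    obtain ⟨⟨⟨hz1, hz2, hz3⟩, hz4⟩, hz5⟩ := hball hz.2
    have hzl : S.dev p (φ.symm z) ∈ leftHalf v := by rw [hdz z hz.2]; exact hz.1
    have hc : Tendsto φ.symm (𝓝[A] z) (𝓝 (φ.symm z)) :=
      (φ.continuousAt_symm hz5).tendsto.mono_left nhdsWithin_le_nhds
    have hch : Tendsto h (𝓝 (φ.symm z)) (𝓝 (h (φ.symm z))) := h.continuousAt (hz2 hzl)
    filter_upwards [hc.eventually (hdev _ (hz2 hzl)), hc.eventually hz3,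
      (hch.comp hc).eventually (hz1 hzl), self_mem_nhdsWithin] with w e1 e2 e3 hw
    simp only [Function.comp_apply] at e3
    rw [hdz w hw.2, hdz z hz.2] at e2
    rw [e1, e2] at e3
    linear_combination -e3
  have hne : (𝓝[A] (0 : ℂ)).NeBot := by
    rw [hA, nhdsWithin_inter_of_mem' (mem_nhdsWithin_of_mem_nhds (Metric.ball_mem_nhds _ hε))]
    exact mem_closure_iff_nhdsWithin_neBot.1 (zero_mem_closure_leftHalf hv)
  have hzero : ∀ z ∈ A, T.dev q (h (φ.symm z)) - z = 0 := by
    intro z hz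
    have ht : Tendsto (fun w => T.dev q (h (φ.symm w)) - w) (𝓝[A] 0) (𝓝 0) := by
      have l1 : Tendsto φ.symm (𝓝[A] 0) (S.leftGerm p v) := by
        refine tendsto_inf.2 ⟨hsymm.mono_left nhdsWithin_le_nhds, tendsto_principal.2 ?_⟩
        filter_upwards [self_mem_nhdsWithin] with w hw
        show S.dev p (φ.symm w) ∈ leftHalf v
        rw [hdz w hw.2]; exact hw.1
      have l2 := (tendsto_dev q).comp (hlim.comp l1)
      simpa using l2.sub (tendsto_id.mono_left (nhdsWithin_le_nhds (s := A)))
    refine tendsto_nhds_unique (tendsto_const_nhds.congr' ?_) ht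
    filter_upwards [self_mem_nhdsWithin] with w hw
    exact eq_of_eventually_eq_of_isPreconnected hAc hlc hz hw
  have hφ0 : ∀ᶠ x in 𝓝 p, φ x ∈ Metric.ball (0 : ℂ) ε := by
    have := φ.continuousAt hps
    rw [ContinuousAt, h0] at this
    exact this (Metric.ball_mem_nhds _ hε)
  filter_upwards [hφ0, φ.open_source.mem_nhds hps] with x hx hxs hxl
  have hdx := hφ x hxs
  have := hzero (φ x) ⟨hdx ▸ hxl, hx⟩
  rw [φ.left_inv hxs] at this
  rw [hdx]
  exact sub_eq_zero.1 this

lemma eventually_exists_of_tendsto_leftGerm {h : OpenPartialHomeomorph S T}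
    (hdev : ∀ x ∈ h.source, ∀ᶠ y in 𝓝 x, T.dev (h x) (h y) = S.dev x y) {p : S} {q : T} {v : ℂ}
    (hv : v ≠ 0) (hp : S.IsRegular p) (hq : T.IsRegular q)
    (hlim : Tendsto h (S.leftGerm p v) (𝓝 q))
    (hsrc : ∀ᶠ x in 𝓝 p, S.dev p x ∈ leftHalf v → x ∈ h.source) {W : Set S} (hW : W ∈ 𝓝 p) :
    ∀ᶠ y in 𝓝 q, T.dev q y ∈ leftHalf v →
      ∃ x ∈ W, x ∈ h.source ∧ S.dev p x = T.dev q y ∧ h x = y := by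
  obtain ⟨N, hN, hinj⟩ := hq.exists_injOn
  have hd := eventually_dev_eq_of_tendsto_leftGerm hdev hv hp hlim hsrc
  have hNx : ∀ᶠ x in 𝓝 p, S.dev p x ∈ leftHalf v → h x ∈ N := by
    have := hlim.eventually (hN : ∀ᶠ y in 𝓝 q, y ∈ N)
    rwa [leftGerm, eventually_inf_principal] at this
  obtain ⟨-, φ, hps, h0, hφ⟩ := hp
  simp only [pow_one] at hφ
  have h0t : (0 : ℂ) ∈ φ.target := h0 ▸ φ.map_source hps
  have hsymm : Tendsto φ.symm (𝓝 0) (𝓝 p) := by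
    have := φ.continuousAt_symm h0t
    rwa [ContinuousAt, ← h0, φ.left_inv hps, h0] at this
  have hall := ((tendsto_dev q).eventually (φ.open_target.mem_nhds h0t)).and
    ((hsymm.comp (tendsto_dev q)).eventually
    ((hd.and (hsrc.and hNx)).and (Eventually.and (φ.open_source.mem_nhds hps) hW)))
  filter_upwards [hall, hN] with y hy hyN hyl
  obtain ⟨hy0, ⟨hy1, hy2, hy3⟩, hy4, hy5⟩ := hy
  simp only [Function.comp_apply] at hy1 hy2 hy3 hy4 hy5
  have hdy : S.dev p (φ.symm (T.dev q y)) = T.dev q y := by rw [hφ _ hy4, φ.right_inv hy0]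
  rw [hdy] at hy1 hy2 hy3
  exact ⟨_, hy5, hy2 hyl, hdy, hinj (hy3 hyl) hyN (hy1 hyl)⟩

lemma IsSegment.eventually_mem_range {c : C(I, S)} {v : ℂ} (hc : S.IsSegment c v) {t : I}
    (h0 : 0 < t) (h1 : t < 1) :
    ∀ᶠ y in 𝓝 (c t), (S.dev (c t) y / v).im = 0 → y ∈ range c := by
  obtain ⟨N, hN, hinj⟩ := (hc.regular t h0 h1).exists_injOn
  have hev : ∀ᶠ s in 𝓝 t, S.dev (c t) (c s) = (((s : ℝ) - (t : ℝ) : ℝ) : ℂ) * v ∧ c s ∈ N :=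
    (hc.straight t).and (c.continuous.continuousAt hN)
  have hproj : Tendsto (fun x : ℝ => projIcc (0 : ℝ) 1 zero_le_one ((t : ℝ) + x)) (𝓝 0) (𝓝 t) := by
    have : Continuous (fun x : ℝ => projIcc (0 : ℝ) 1 zero_le_one ((t : ℝ) + x)) :=
      continuous_projIcc.comp (by fun_prop)
    simpa using this.tendsto 0
  have hre : Tendsto (fun y => (S.dev (c t) y / v).re) (𝓝 (c t)) (𝓝 0) := by
    have : Tendsto (fun z : ℂ => (z / v).re) (𝓝 0) (𝓝 0) := by
      have : Continuous fun z : ℂ => (z / v).re := by fun_prop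
      simpa using this.tendsto 0
    exact this.comp (tendsto_dev (c t))
  have hin : ∀ᶠ x in 𝓝 (0 : ℝ), (t : ℝ) + x ∈ Icc (0 : ℝ) 1 := by
    have : ContinuousAt (fun x : ℝ => (t : ℝ) + x) 0 := by fun_prop
    exact this.preimage_mem_nhds (Icc_mem_nhds (by simpa using h0) (by simpa using h1))
  filter_upwards [hre.eventually (hproj.eventually hev), hre.eventually hin, hN]
    with y hy hyin hyN him
  rw [projIcc_of_mem _ hyin] at hy
  refine ⟨_, hinj hy.2 hyN ?_⟩
  rw [hy.1]
  have : S.dev (c t) y / v = ((S.dev (c t) y / v).re : ℂ) := by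
    apply Complex.ext <;> simp [him]
  have hv := hc.ne_zero
  rw [div_eq_iff hv] at this
  simpa using this.symm

/-- Across an interior point of a new segment, one of whose sides comes from `pu` and the other one
from `pl`, the identification of two surgered surfaces is continuous and is a translation. -/
lemma eventually_symm_of_sides {h₁ : OpenPartialHomeomorph S T₁} {h₂ : OpenPartialHomeomorph S T₂}
    (hdev₁ : ∀ x ∈ h₁.source, ∀ᶠ y in 𝓝 x, T₁.dev (h₁ x) (h₁ y) = S.dev x y)
    (hdev₂ : ∀ x ∈ h₂.source, ∀ᶠ y in 𝓝 x, T₂.dev (h₂ x) (h₂ y) = S.dev x y)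
    (hs : h₁.source = h₂.source) {pu pl : S} {v : ℂ} (hpu : S.IsRegular pu)
    (hpl : S.IsRegular pl) (hsrcu : ∀ᶠ x in 𝓝 pu, S.dev pu x ∈ leftHalf v → x ∈ h₁.source)
    (hsrcl : ∀ᶠ x in 𝓝 pl, S.dev pl x ∈ leftHalf (-v) → x ∈ h₁.source)
    {γ : C(I, T₁)} (hγ : T₁.IsSegment γ v) {t : I} (h0 : 0 < t) (h1 : t < 1) {q : T₂}
    (lu : Tendsto h₁ (S.leftGerm pu v) (𝓝 (γ t))) (ll : Tendsto h₁ (S.leftGerm pl (-v)) (𝓝 (γ t)))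
    (lu' : Tendsto h₂ (S.leftGerm pu v) (𝓝 q)) (ll' : Tendsto h₂ (S.leftGerm pl (-v)) (𝓝 q))
    {V : Set T₂} (hV : V ∈ 𝓝 q) :
    ∀ᶠ y in 𝓝 (γ t), y ∉ range γ →
      h₂ (h₁.symm y) ∈ V ∧ T₂.dev q (h₂ (h₁.symm y)) = T₁.dev (γ t) y := by
  have hv := hγ.ne_zero
  have hr := hγ.regular t h0 h1
  have key : ∀ (p : S) (w : ℂ), w ≠ 0 → S.IsRegular p →
      (∀ᶠ x in 𝓝 p, S.dev p x ∈ leftHalf w → x ∈ h₁.source) →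
      Tendsto h₁ (S.leftGerm p w) (𝓝 (γ t)) → Tendsto h₂ (S.leftGerm p w) (𝓝 q) →
      ∀ᶠ y in 𝓝 (γ t), T₁.dev (γ t) y ∈ leftHalf w →
        h₂ (h₁.symm y) ∈ V ∧ T₂.dev q (h₂ (h₁.symm y)) = T₁.dev (γ t) y := by
    intro p w hw hp hsrc l l'
    have hVp : ∀ᶠ x in 𝓝 p, S.dev p x ∈ leftHalf w → h₂ x ∈ V := by
      have := l'.eventually (hV : ∀ᶠ y in 𝓝 q, y ∈ V)
      rwa [leftGerm, eventually_inf_principal] at this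
    have hd := eventually_dev_eq_of_tendsto_leftGerm hdev₂ hw hp l' (hs ▸ hsrc)
    filter_upwards [eventually_exists_of_tendsto_leftGerm hdev₁ hw hp hr l hsrc (hVp.and hd)]
      with y hy hyl
    obtain ⟨x, ⟨hx1, hx2⟩, hxs, hxd, rfl⟩ := hy hyl
    rw [h₁.left_inv hxs]
    rw [hxd] at hx1 hx2
    exact ⟨hx1 hyl, hx2 hyl⟩
  filter_upwards [key pu v hv hpu hsrcu lu lu', key pl (-v) (neg_ne_zero.2 hv) hpl hsrcl ll ll',
    hγ.eventually_mem_range h0 h1] with y e1 e2 e3 hy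
  rcases lt_trichotomy (T₁.dev (γ t) y / v).im 0 with hlt | heq | hgt
  · exact e2 (by simpa [leftHalf, div_neg] using hlt)
  · exact absurd (e3 heq) hy
  · exact e1 hgt

/-- The segments `γ` and `η` are embedded and disjoint, apart from their end points. -/
def IsSimpleCut (S : TranslationSurface) (γ η : C(I, S)) : Prop :=
  ∀ t : I, 0 < t → t < 1 → (∀ s, γ s = γ t → s = t) ∧ (∀ s, η s = η t → s = t) ∧
    (∀ s, η s ≠ γ t) ∧ ∀ s, γ s ≠ η t

lemma IsSimpleCut.symm {γ η : C(I, S)} (h : S.IsSimpleCut γ η) : S.IsSimpleCut η γ :=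
  fun t h0 h1 => ⟨(h t h0 h1).2.1, (h t h0 h1).1, (h t h0 h1).2.2.2, (h t h0 h1).2.2.1⟩

lemma IsSimpleCut.eventually_notMem {γ η : C(I, S)} {v : ℂ} (h : S.IsSimpleCut γ η)
    (hγ : S.IsSegment γ v) {t : I} (h0 : 0 < t) (h1 : t < 1) :
    ∀ᶠ x in 𝓝 (γ t), (S.dev (γ t) x / v).im ≠ 0 → x ∉ range γ ∪ range η := by
  have e1 : ∀ᶠ x in 𝓝 (γ t), ∀ s ∈ γ ⁻¹' {x}, (S.dev (γ t) (γ s) / v).im = 0 := by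
    refine γ.continuous.isClosedMap.eventually_nhds_fiber
      (p := fun s => (S.dev (γ t) (γ s) / v).im = 0) (γ t) fun s hs => ?_
    obtain rfl := (h t h0 h1).1 s hs
    filter_upwards [hγ.straight s] with r hr
    rw [hr, mul_div_cancel_right₀ _ hγ.ne_zero, Complex.ofReal_im]
  have e2 : ∀ᶠ x in 𝓝 (γ t), ∀ s ∈ η ⁻¹' {x}, False :=
    η.continuous.isClosedMap.eventually_nhds_fiber
      (p := fun _ => False) (γ t) fun s hs => absurd hs ((h t h0 h1).2.2.1 s)
  filter_upwards [e1, e2] with x hx1 hx2 him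
  rintro (⟨s, rfl⟩ | ⟨s, rfl⟩)
  · exact him (hx1 s rfl)
  · exact hx2 s rfl

end

section

/-- The surface `T` is obtained by surgery from `S` along `γ` and `η`, the new segments being `γ'`
and `η'`, and `h` being the identification of the complements. -/
structure SurgeryData (S T : TranslationSurface) (γ η : C(I, S)) (v : ℂ) (γ' η' : C(I, T))
    (h : OpenPartialHomeomorph S T) : Prop where
  seg : T.IsSegment γ' v
  seg' : T.IsSegment η' v
  source : h.source = (range γ ∪ range η)ᶜ
  target : h.target = (range γ' ∪ range η')ᶜ
  dev : ∀ x ∈ h.source, ∀ᶠ y in 𝓝 x, T.dev (h x) (h y) = S.dev x y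
  lim : ∀ t : I, 0 < t → t < 1 →
    Tendsto h (S.leftSide γ v t) (𝓝 (γ' t)) ∧ Tendsto h (S.rightSide η v t) (𝓝 (γ' t)) ∧
    Tendsto h (S.leftSide η v t) (𝓝 (η' t)) ∧ Tendsto h (S.rightSide γ v t) (𝓝 (η' t))

variable {S T T₁ T₂ : TranslationSurface} {γ η : C(I, S)} {v : ℂ}

lemma IsSurgery.exists_data (h : S.IsSurgery T γ η v) :
    ∃ γ' η' h, SurgeryData S T γ η v γ' η' h := by
  obtain ⟨γ', η', h1, h2, h, h3, h4, h5, h6⟩ := h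
  exact ⟨γ', η', h, h1, h2, h3, h4, h5, h6⟩

lemma SurgeryData.swap {γ' η' : C(I, T)} {h : OpenPartialHomeomorph S T}
    (d : SurgeryData S T γ η v γ' η' h) : SurgeryData S T η γ v η' γ' h where
  seg := d.seg'
  seg' := d.seg
  source := by rw [d.source, union_comm]
  target := by rw [d.target, union_comm]
  dev := d.dev
  lim t h0 h1 := ⟨(d.lim t h0 h1).2.2.1, (d.lim t h0 h1).2.2.2, (d.lim t h0 h1).1,
    (d.lim t h0 h1).2.1⟩

variable {γ₁ η₁ : C(I, T₁)} {γ₂ η₂ : C(I, T₂)} {h₁ : OpenPartialHomeomorph S T₁}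
  {h₂ : OpenPartialHomeomorph S T₂}

lemma IsSimpleCut.eventually_mem_source (hcut : S.IsSimpleCut γ η) (hγ : S.IsSegment γ v)
    (d : SurgeryData S T γ η v γ₃ η₃ h) {t : I} (h0 : 0 < t) (h1 : t < 1) {w : ℂ}
    (hw : w = v ∨ w = -v) :
    ∀ᶠ x in 𝓝 (γ t), S.dev (γ t) x ∈ leftHalf w → x ∈ h.source := by
  filter_upwards [hcut.eventually_notMem hγ h0 h1] with x hx hxl
  rw [d.source]
  refine hx fun h => ?_
  rcases hw with rfl | rfl
  · exact absurd h (ne_of_gt hxl)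
  · have : 0 < (S.dev (γ t) x / (-v)).im := hxl
    rw [div_neg, Complex.neg_im, h] at this
    simp at this

/-- The identification of the complements of the cuts extends continuously, as a translation, over
an interior point of the first new segment: both sides of `γ₁` are mapped to the corresponding sides of
`γ₂`. -/
lemma SurgeryData.eventually_symm (d₁ : SurgeryData S T₁ γ η v γ₁ η₁ h₁)
    (d₂ : SurgeryData S T₂ γ η v γ₂ η₂ h₂) (hcut : S.IsSimpleCut γ η) (hγ : S.IsSegment γ v)
    (hη : S.IsSegment η v) {t : I} (h0 : 0 < t) (h1 : t < 1) {V : Set T₂} (hV : V ∈ 𝓝 (γ₂ t)) :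
    ∀ᶠ y in 𝓝 (γ₁ t), y ∈ h₁.target →
      h₂ (h₁.symm y) ∈ V ∧ T₂.dev (γ₂ t) (h₂ (h₁.symm y)) = T₁.dev (γ₁ t) y := by
  obtain ⟨l1, l2, -, -⟩ := d₁.lim t h0 h1
  obtain ⟨l1', l2', -, -⟩ := d₂.lim t h0 h1
  rw [leftSide_eq_leftGerm] at l1 l1'
  rw [rightSide_eq_leftGerm] at l2 l2'
  filter_upwards [eventually_symm_of_sides d₁.dev d₂.dev (d₁.source.trans d₂.source.symm)
    (hγ.regular t h0 h1) (hη.regular t h0 h1) (hcut.eventually_mem_source hγ d₁ h0 h1 (Or.inl rfl))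
    (hcut.symm.eventually_mem_source hη d₁.swap h0 h1 (Or.inr rfl)) d₁.seg h0 h1 l1 l2 l1' l2' hV]
    with y hy hyt
  refine hy fun hr => ?_
  rw [d₁.target] at hyt
  exact hyt (Or.inl hr)

lemma SurgeryData.mem_closure_target (d : SurgeryData S T₁ γ η v γ₁ η₁ h₁)
    (hcut : S.IsSimpleCut γ η) (hγ : S.IsSegment γ v) (t : I) : γ₁ t ∈ closure h₁.target := by
  have key : ∀ t : I, t ∈ Ioo (0 : I) 1 → γ₁ t ∈ closure h₁.target := by
    rintro t ⟨h0, h1⟩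
    obtain ⟨l1, -, -, -⟩ := d.lim t h0 h1
    rw [leftSide_eq_leftGerm] at l1
    have := (hγ.regular t h0 h1).leftGerm_neBot hγ.ne_zero
    refine mem_closure_of_tendsto l1 ?_
    rw [leftGerm, eventually_inf_principal]
    filter_upwards [hcut.eventually_mem_source hγ d h0 h1 (Or.inl rfl)] with x hx hxl
    exact h₁.map_source (hx hxl)
  have hsub : closure (Ioo (0 : I) 1) ⊆ γ₁ ⁻¹' closure h₁.target :=
    closure_minimal key (isClosed_closure.preimage γ₁.continuous)
  exact hsub (dense_Ioo_unitInterval t)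

lemma SurgeryData.dense_target (d : SurgeryData S T₁ γ η v γ₁ η₁ h₁)
    (hcut : S.IsSimpleCut γ η) (hγ : S.IsSegment γ v) (hη : S.IsSegment η v) :
    Dense h₁.target := by
  intro x
  by_cases hx : x ∈ h₁.target
  · exact subset_closure hx
  · rw [d.target, notMem_compl_iff] at hx
    rcases hx with ⟨t, rfl⟩ | ⟨t, rfl⟩
    · exact d.mem_closure_target hcut hγ t
    · exact d.swap.mem_closure_target hcut.symm hη t

/-- The points that lie neither in the domain `D` of the surgery identification nor in the interior
of one of the segments. -/
def exceptional (γ η : C(I, T)) (D : Set T) : Set T :=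
  (D ∪ (γ '' Ioo 0 1 ∪ η '' Ioo 0 1))ᶜ

lemma finite_exceptional {γ η : C(I, T)} {D : Set T} (hD : D = (range γ ∪ range η)ᶜ) :
    (exceptional γ η D).Finite := by
  refine (Set.toFinite ({γ 0, γ 1, η 0, η 1} : Set T)).subset fun x hx => ?_
  simp only [exceptional, mem_compl_iff, mem_union, not_or] at hx
  obtain ⟨h1, h2, h3⟩ := hx
  rw [hD, notMem_compl_iff] at h1
  have hend : ∀ t : I, t ∉ Ioo (0 : I) 1 → t = 0 ∨ t = 1 := by
    intro t ht
    rcases (bot_le : (0 : I) ≤ t).eq_or_lt with h | h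
    · exact Or.inl h.symm
    · rcases (le_top : t ≤ (1 : I)).eq_or_lt with h' | h'
      · exact Or.inr h'
      · exact absurd ⟨h, h'⟩ ht
  rcases h1 with ⟨t, rfl⟩ | ⟨t, rfl⟩
  · rcases hend t fun h => h2 ⟨t, h, rfl⟩ with rfl | rfl <;> simp
  · rcases hend t fun h => h3 ⟨t, h, rfl⟩ with rfl | rfl <;> simp

/-- Away from the exceptional points, the identification of the complements of the cuts in two
surgered surfaces has limits. -/
lemma SurgeryData.exists_tendsto (d₁ : SurgeryData S T₁ γ η v γ₁ η₁ h₁)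
    (d₂ : SurgeryData S T₂ γ η v γ₂ η₂ h₂) (hcut : S.IsSimpleCut γ η) (hγ : S.IsSegment γ v)
    (hη : S.IsSegment η v) {x : T₁} (hx : x ∉ exceptional γ₁ η₁ h₁.target) :
    ∃ y ∉ exceptional γ₂ η₂ h₂.target, Tendsto (fun x => h₂ (h₁.symm x)) (𝓝[h₁.target] x) (𝓝 y) := by
  have hs : h₁.source = h₂.source := d₁.source.trans d₂.source.symm
  rw [exceptional, notMem_compl_iff] at hx
  rcases hx with hx | ⟨t, ht, rfl⟩ | ⟨t, ht, rfl⟩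
  · have hm : h₁.symm x ∈ h₂.source := hs ▸ h₁.map_target hx
    refine ⟨h₂ (h₁.symm x), not_not.2 (Or.inl (h₂.map_source hm)), ?_⟩
    exact ((h₂.continuousAt hm).tendsto.comp (h₁.continuousAt_symm hx)).mono_left
      nhdsWithin_le_nhds
  · refine ⟨γ₂ t, not_not.2 (Or.inr (Or.inl ⟨t, ht, rfl⟩)), fun V hV => ?_⟩
    rw [mem_map, mem_nhdsWithin_iff_eventually]
    filter_upwards [d₁.eventually_symm d₂ hcut hγ hη ht.1 ht.2 hV] with y hy hyt
    exact (hy hyt).1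
  · refine ⟨η₂ t, not_not.2 (Or.inr (Or.inr ⟨t, ht, rfl⟩)), fun V hV => ?_⟩
    rw [mem_map, mem_nhdsWithin_iff_eventually]
    filter_upwards [d₁.swap.eventually_symm d₂.swap hcut.symm hη hγ ht.1 ht.2 hV] with y hy hyt
    exact (hy hyt).1

/-- A homeomorphism that reads as a translation on a dense set near a point does so near this point,
because developing maps are continuous. -/
lemma eventually_eq_of_dense {f : T₁ ≃ₜ T₂} {D : Set T₁} (hD : Dense D) {x : T₁}
    (h : ∀ᶠ y in 𝓝 x, y ∈ D → T₂.dev (f x) (f y) = T₁.dev x y) :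
    ∀ᶠ y in 𝓝 x, T₂.dev (f x) (f y) = T₁.dev x y := by
  have hc := (f.continuous.tendsto x).eventually (eventually_continuousAt_dev (f x))
  obtain ⟨N, hN, hNo, hxN⟩ := mem_nhds_iff.1 (h.and (hc.and (eventually_continuousAt_dev x)))
  filter_upwards [hNo.mem_nhds hxN] with y hy
  obtain ⟨-, c1, c2⟩ := hN hy
  have hne : (𝓝[D] y).NeBot := mem_closure_iff_nhdsWithin_neBot.1 (hD y)
  have c3 : ContinuousAt (fun z => T₂.dev (f x) (f z)) y :=
    ContinuousAt.comp c1 f.continuous.continuousAt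
  refine tendsto_nhds_unique (c3.tendsto.mono_left (nhdsWithin_le_nhds (s := D)))
    ((c2.tendsto.mono_left nhdsWithin_le_nhds).congr' ?_)
  filter_upwards [self_mem_nhdsWithin, mem_nhdsWithin_of_mem_nhds (hNo.mem_nhds hy)] with z hz hzN
  exact ((hN hzN).1 hz).symm

/-- A homeomorphism which is a translation away from a finite set is a translation. -/
lemma isTranslationMap_of_finite {f : T₁ ≃ₜ T₂} {F : Set T₁} (hF : F.Finite)
    {D : Set T₁} (hD : Dense D) (hFD : Disjoint F D)
    (h : ∀ x ∉ F, ∀ᶠ y in 𝓝 x, T₂.dev (f x) (f y) = T₁.dev x y) : IsTranslationMap f := by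
  intro x
  by_cases hx : x ∈ F
  swap
  · exact h x hx
  have hFx : (F \ {x})ᶜ ∈ 𝓝 x :=
    (hF.subset sdiff_subset).isClosed.isOpen_compl.mem_nhds (by simp)
  have hc := (f.continuous.tendsto x).eventually (T₂.dev_translation (f x))
  obtain ⟨V, hV, hVsub, hVc⟩ := hasPuncturedNhds T₁ x _
    (inter_mem (hc.and (T₁.dev_translation x)) hFx)
  have hlc : ∀ y ∈ V \ {x}, ∀ᶠ z in 𝓝[V \ {x}] y,
      T₂.dev (f x) (f z) - T₁.dev x z = T₂.dev (f x) (f y) - T₁.dev x y := by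
    intro y hy
    obtain ⟨⟨e1, e2⟩, hyF⟩ := hVsub hy.1
    have hyF' : y ∉ F := fun h => hyF ⟨h, hy.2⟩
    refine mem_nhdsWithin_of_mem_nhds ?_
    filter_upwards [(f.continuous.tendsto y).eventually e1, e2, h y hyF'] with z z1 z2 z3
    rw [z1, z2] at z3
    linear_combination z3
  have hne : (𝓝[V \ {x}] x).NeBot := by
    have h1 : (𝓝[D] x).NeBot := mem_closure_iff_nhdsWithin_neBot.1 (hD x)
    have h2 : 𝓝[D] x ≤ 𝓝[V \ {x}] x := by
      refine le_inf nhdsWithin_le_nhds (le_principal_iff.2 ?_)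
      filter_upwards [mem_nhdsWithin_of_mem_nhds hV, self_mem_nhdsWithin] with z hz hzD
      exact ⟨hz, fun h => disjoint_left.1 hFD hx ((mem_singleton_iff.1 h) ▸ hzD)⟩
    exact h1.mono h2
  have hlim : Tendsto (fun z => T₂.dev (f x) (f z) - T₁.dev x z) (𝓝[V \ {x}] x) (𝓝 0) := by
    have := ((tendsto_dev (f x)).comp (f.continuous.tendsto x)).sub (tendsto_dev x)
    simpa using this.mono_left nhdsWithin_le_nhds
  filter_upwards [hV] with y hy
  by_cases hyx : y = x
  · simp [hyx]
  refine sub_eq_zero.1 (tendsto_nhds_unique (tendsto_const_nhds.congr' ?_) hlim)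
  filter_upwards [self_mem_nhdsWithin] with z hz
  exact eq_of_eventually_eq_of_isPreconnected hVc hlc ⟨hy, hyx⟩ hz

/-- Up to isomorphism, there is only one way of performing a surgery along given segments. -/
theorem IsSurgery.isomorphic (d₁ : S.IsSurgery T₁ γ η v) (d₂ : S.IsSurgery T₂ γ η v)
    (hcut : S.IsSimpleCut γ η) (hγ : S.IsSegment γ v) (hη : S.IsSegment η v) :
    T₁.Isomorphic T₂ := by
  obtain ⟨γ₁, η₁, h₁, d₁⟩ := d₁.exists_data
  obtain ⟨γ₂, η₂, h₂, d₂⟩ := d₂.exists_data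
  have hs : h₁.source = h₂.source := d₁.source.trans d₂.source.symm
  set p := h₁.symm.trans h₂ with hp
  have hps : p.source = h₁.target := by
    rw [hp, OpenPartialHomeomorph.trans_source, ← hs]
    exact inter_eq_left.2 fun x hx => h₁.map_target hx
  have hpt : p.target = h₂.target := by
    rw [hp, OpenPartialHomeomorph.trans_target]
    refine inter_eq_left.2 fun x hx => ?_
    show h₂.symm x ∈ h₁.source
    exact hs ▸ h₂.map_target hx
  have hdense := d₁.dense_target hcut hγ hη
  have hfin := finite_exceptional d₁.target
  have hdisj : Disjoint (exceptional γ₁ η₁ h₁.target) h₁.target :=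
    disjoint_left.2 fun x hx h => hx (Or.inl h)
  obtain ⟨f, hf1, hf2⟩ := exists_homeomorph_extension (hasPuncturedNhds T₁) (hasPuncturedNhds T₂) p
    (hps ▸ hdense) (hpt ▸ d₂.dense_target hcut hγ hη) hfin
    (finite_exceptional d₂.target) (hps ▸ hdisj)
    (hpt ▸ disjoint_left.2 fun x hx h => hx (Or.inl h))
    (fun x hx => hps ▸ d₁.exists_tendsto d₂ hcut hγ hη hx)
    (fun x hx => hpt ▸ d₂.exists_tendsto d₁ hcut hγ hη hx)
  rw [hps] at hf1 hf2
  have hcutdev : ∀ {γ η : C(I, S)} {γ₁ η₁ : C(I, T₁)} {γ₂ η₂ : C(I, T₂)},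
      SurgeryData S T₁ γ η v γ₁ η₁ h₁ → SurgeryData S T₂ γ η v γ₂ η₂ h₂ → S.IsSimpleCut γ η →
      S.IsSegment γ v → S.IsSegment η v → ∀ t ∈ Ioo (0 : I) 1,
      ∀ᶠ y in 𝓝 (γ₁ t), T₂.dev (f (γ₁ t)) (f y) = T₁.dev (γ₁ t) y := by
    intro γ η γ₁ η₁ γ₂ η₂ d₁ d₂ hcut hγ hη t ht
    have hft : f (γ₁ t) = γ₂ t := by
      refine hf2 _ _ fun V hV => ?_
      rw [mem_map, mem_nhdsWithin_iff_eventually]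
      filter_upwards [d₁.eventually_symm d₂ hcut hγ hη ht.1 ht.2 hV] with y hy hyt
      exact (hy hyt).1
    refine eventually_eq_of_dense hdense ?_
    filter_upwards [d₁.eventually_symm d₂ hcut hγ hη ht.1 ht.2 univ_mem] with y hy hyt
    rw [hft, hf1 y hyt]
    exact (hy hyt).2
  refine ⟨f, isTranslationMap_of_finite hfin hdense hdisj fun x hx => ?_⟩
  rw [exceptional, notMem_compl_iff] at hx
  rcases hx with hx | ⟨t, ht, rfl⟩ | ⟨t, ht, rfl⟩
  · have hm : h₁.symm x ∈ h₁.source := h₁.map_target hx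
    filter_upwards [h₁.open_target.mem_nhds hx,
      (h₁.continuousAt_symm hx).eventually (d₁.dev _ hm),
      (h₁.continuousAt_symm hx).eventually (d₂.dev _ (hs ▸ hm))] with y hy e1 e2
    rw [h₁.right_inv hx, h₁.right_inv hy] at e1
    rw [hf1 x hx, hf1 y hy, e1]
    exact e2
  · exact hcutdev d₁ d₂ hcut hγ hη t ht
  · exact hcutdev d₁.swap d₂.swap hcut.symm hη hγ t ht

end

section

/-! ### Surfaces presented by planar pieces -/

/-- The space `X` is glued from the pieces `dom j ⊆ ℂ` by the maps `P j`: these are continuous, and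
a set is a neighbourhood of `x` as soon as its preimages are neighbourhoods of all points over `x`
(so `X` carries the quotient topology, and the maps `P j` are jointly surjective). -/
structure IsPresentation {ι X : Type*} [TopologicalSpace X] (dom : ι → Set ℂ) (P : ι → ℂ → X) :
    Prop where
  continuousOn : ∀ j, ContinuousOn (P j) (dom j)
  mem_nhds : ∀ x A, (∀ j, ∀ z ∈ dom j, P j z = x → ∀ᶠ z' in 𝓝[dom j] z, P j z' ∈ A) → A ∈ 𝓝 x

section Presentation

variable {ι X Y : Type*} [TopologicalSpace X] [TopologicalSpace Y] {dom : ι → Set ℂ}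
  {P : ι → ℂ → X} {Q : ι → ℂ → Y}

lemma IsPresentation.eventually (h : IsPresentation dom P) {x : X} {p : X → Prop}
    (hp : ∀ j, ∀ z ∈ dom j, P j z = x → ∀ᶠ z' in 𝓝[dom j] z, p (P j z')) : ∀ᶠ y in 𝓝 x, p y :=
  h.mem_nhds x {y | p y} hp

lemma IsPresentation.exists_eq (h : IsPresentation dom P) (x : X) :
    ∃ j, ∃ z ∈ dom j, P j z = x := by
  by_contra! hcon
  have := h.mem_nhds x ∅ fun j z hz hzx => absurd hzx (hcon j z hz)
  exact (mem_of_mem_nhds this).elim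

/-- Finitely many compact pieces that cover a Hausdorff space present it: the map from their
disjoint union is closed. -/
lemma IsPresentation.of_isCompact [Finite ι] [T2Space X] (hc : ∀ j, IsCompact (dom j))
    (hP : ∀ j, ContinuousOn (P j) (dom j)) (hs : ∀ x, ∃ j, ∃ z ∈ dom j, P j z = x) :
    IsPresentation dom P := by
  refine ⟨hP, fun x A hA => ?_⟩
  have : ∀ j, CompactSpace (dom j) := fun j => isCompact_iff_compactSpace.1 (hc j)
  let f : (Σ j, dom j) → X := fun y => P y.1 y.2
  have hf : Continuous f := continuous_sigma fun j => (hP j).domRestrict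
  have h1 : ∀ᶠ y in 𝓝 x, ∀ w ∈ f ⁻¹' {y}, f w ∈ A := by
    refine hf.isClosedMap.eventually_nhds_fiber (p := fun w => f w ∈ A) x ?_
    rintro ⟨j, z, hz⟩ hx
    have := hA j z hz hx
    rw [Sigma.nhds_mk, eventually_map]
    rw [← map_nhds_subtype_val ⟨z, hz⟩, eventually_map] at this
    exact this
  filter_upwards [h1] with y hy
  obtain ⟨j, z, hz, rfl⟩ := hs y
  exact hy ⟨j, z, hz⟩ rfl

lemma IsPresentation.mono {dom' : ι → Set ℂ} (h : IsPresentation dom P)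
    (hsub : ∀ j, dom j ⊆ dom' j) (hP : ∀ j, ContinuousOn (P j) (dom' j)) :
    IsPresentation dom' P :=
  ⟨hP, fun x A hA => h.mem_nhds x A fun j z hz hx =>
    (hA j z (hsub j hz) hx).filter_mono (nhdsWithin_mono _ (hsub j))⟩

/-- The map `X → Y` that lifts the identity of the pieces, wherever this makes sense. -/
def IsPresentation.lift (h : IsPresentation dom P) (Q : ι → ℂ → Y) (x : X) : Y :=
  Q (h.exists_eq x).choose (h.exists_eq x).choose_spec.choose

lemma IsPresentation.lift_eq {Z : Type*} {R : ι → ℂ → Z} (h : IsPresentation dom P) {x : X} {y : Z}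
    (hxy : ∀ j, ∀ z ∈ dom j, P j z = x → R j z = y) : h.lift R x = y :=
  hxy _ _ (h.exists_eq x).choose_spec.choose_spec.1 (h.exists_eq x).choose_spec.choose_spec.2

lemma IsPresentation.lift_apply {Z : Type*} {R : ι → ℂ → Z} (h : IsPresentation dom P)
    {i : ι} {z : ℂ} (hrel : ∀ j, ∀ w ∈ dom j, P i z = P j w → R i z = R j w) :
    h.lift R (P i z) = R i z :=
  h.lift_eq fun j w hw hjw => (hrel j w hw hjw.symm).symm

lemma IsPresentation.continuousAt_lift (h : IsPresentation dom P)
    (hQ : ∀ j, ContinuousOn (Q j) (dom j)) {x : X}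
    (hrel : ∀ᶠ x' in 𝓝 x, ∀ i j, ∀ z ∈ dom i, ∀ w ∈ dom j, P i z = x' → P j w = x' →
      Q i z = Q j w) : ContinuousAt (h.lift Q) x := by
  intro V hV
  refine h.mem_nhds x _ fun j z hz hzx => ?_
  have hx : h.lift Q x = Q j z := by
    rw [← hzx]
    exact h.lift_apply fun i w hw hiw =>
      hrel.self_of_nhds j i z hz w hw hzx (hiw.symm.trans hzx)
  rw [hx] at hV
  have hc : Tendsto (P j) (𝓝[dom j] z) (𝓝 x) := hzx ▸ h.continuousOn j z hz
  filter_upwards [hQ j z hz hV, hc.eventually hrel, self_mem_nhdsWithin] with w hw hr hwd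
  rw [mem_preimage, h.lift_apply fun i u hu hiu => hr j i w hwd u hu rfl hiu.symm]
  exact hw

lemma IsPresentation.exists_homeomorph (h : IsPresentation dom P) (h' : IsPresentation dom Q)
    (hrel : ∀ i j, ∀ z ∈ dom i, ∀ w ∈ dom j, P i z = P j w ↔ Q i z = Q j w) :
    ∃ f : X ≃ₜ Y, ∀ j, ∀ z ∈ dom j, f (P j z) = Q j z := by
  have e1 : ∀ j, ∀ z ∈ dom j, h.lift Q (P j z) = Q j z := fun j z hz =>
    h.lift_apply fun i w hw => (hrel j i z hz w hw).1
  have e2 : ∀ j, ∀ z ∈ dom j, h'.lift P (Q j z) = P j z := fun j z hz =>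
    h'.lift_apply fun i w hw => (hrel j i z hz w hw).2
  refine ⟨⟨⟨h.lift Q, h'.lift P, fun x => ?_, fun y => ?_⟩, ?_, ?_⟩, e1⟩
  · obtain ⟨j, z, hz, rfl⟩ := h.exists_eq x
    rw [e1 j z hz, e2 j z hz]
  · obtain ⟨j, z, hz, rfl⟩ := h'.exists_eq y
    rw [e2 j z hz, e1 j z hz]
  · exact continuous_iff_continuousAt.2 fun x => h.continuousAt_lift h'.continuousOn
      (Eventually.of_forall fun x' i j z hz w hw hz' hw' =>
        (hrel i j z hz w hw).1 (hz'.trans hw'.symm))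
  · exact continuous_iff_continuousAt.2 fun x => h'.continuousAt_lift h.continuousOn
      (Eventually.of_forall fun x' i j z hz w hw hz' hw' =>
        (hrel i j z hz w hw).2 (hz'.trans hw'.symm))

end Presentation

variable {S T : TranslationSurface} {ι : Type*} {dom : ι → Set ℂ} {P : ι → ℂ → S}
  {Q : ι → ℂ → T}

/-- The functions `δ j` are developing maps on the pieces `dom j`. -/
def Develops (S : TranslationSurface) (dom : ι → Set ℂ) (P : ι → ℂ → S) (δ : ι → ℂ → ℂ) : Prop :=
  ∀ j, ∀ z ∈ dom j, ∀ᶠ z' in 𝓝[dom j] z, S.dev (P j z) (P j z') = δ j z' - δ j z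

/-- Two surfaces presented by the same pieces, with the same identifications and the same developing
maps, are isomorphic. -/
theorem isomorphic_of_presentations (h : IsPresentation dom P) (h' : IsPresentation dom Q)
    (hrel : ∀ i j, ∀ z ∈ dom i, ∀ w ∈ dom j, P i z = P j w ↔ Q i z = Q j w) {δ : ι → ℂ → ℂ}
    (d : Develops S dom P δ) (d' : Develops T dom Q δ) : S.Isomorphic T := by
  obtain ⟨f, hf⟩ := h.exists_homeomorph h' hrel
  refine ⟨f, fun p => h.eventually fun j z hz hzp => ?_⟩
  subst hzp
  filter_upwards [d j z hz, d' j z hz, self_mem_nhdsWithin] with w e1 e2 hw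
  rw [hf j z hz, hf j w hw, e1, e2]

/-- If the difference of the forms `f^* ω_T` and `ω_S` is the differential of a function `G`, then
`S` and `T` have the same absolute periods. -/
theorem sameAbsolutePeriods_of_exact (f : S ≃ₜ T) {G : S → ℂ} (hG : Continuous G)
    (h : ∀ p, ∀ᶠ q in 𝓝 p, T.dev (f p) (f q) = S.dev p q + (G q - G p)) :
    S.SameAbsolutePeriods T := by
  refine ⟨f, fun γ hγ z => ⟨?_, ?_⟩⟩
  · rintro ⟨F, F0, F1, hF⟩
    refine ⟨⟨fun t => F t + (G (γ t) - G (γ 0)), by fun_prop⟩, by simp [F0], by simp [F1, hγ],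
      fun s => ?_⟩
    filter_upwards [hF s, (γ.continuous.tendsto s).eventually (h (γ s))] with t e1 e2
    simp only [ContinuousMap.comp_apply, ContinuousMap.coe_mk]
    rw [e2, e1]; ring
  · rintro ⟨F, F0, F1, hF⟩
    refine ⟨⟨fun t => F t - (G (γ t) - G (γ 0)), by fun_prop⟩, by simp [F0], by simp [F1, hγ],
      fun s => ?_⟩
    filter_upwards [hF s, (γ.continuous.tendsto s).eventually (h (γ s))] with t e1 e2
    simp only [ContinuousMap.comp_apply, ContinuousMap.coe_coe] at e1
    simp only [ContinuousMap.coe_mk]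
    rw [e2] at e1
    linear_combination e1

/-- Two surfaces presented by the same pieces with the same identifications have the same absolute
periods as soon as the differences of the developing maps of the pieces are compatible with the
identifications: they then form a single-valued function, whose integral over a loop vanishes. -/
theorem sameAbsolutePeriods_of_presentations (h : IsPresentation dom P)
    (h' : IsPresentation dom Q)
    (hrel : ∀ i j, ∀ z ∈ dom i, ∀ w ∈ dom j, P i z = P j w ↔ Q i z = Q j w) {δ δ' : ι → ℂ → ℂ}
    (d : Develops S dom P δ) (d' : Develops T dom Q δ')
    (hδ : ∀ j, ContinuousOn (fun z => δ' j z - δ j z) (dom j))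
    (hG : ∀ i j, ∀ z ∈ dom i, ∀ w ∈ dom j, P i z = P j w → δ' i z - δ i z = δ' j w - δ j w) :
    S.SameAbsolutePeriods T := by
  obtain ⟨f, hf⟩ := h.exists_homeomorph h' hrel
  have hGe : ∀ j, ∀ z ∈ dom j, h.lift (fun j z => δ' j z - δ j z) (P j z) = δ' j z - δ j z :=
    fun j z hz => h.lift_apply fun i w hw hjw => hG j i z hz w hw hjw
  refine sameAbsolutePeriods_of_exact f (G := h.lift fun j z => δ' j z - δ j z)
    (continuous_iff_continuousAt.2 fun x => h.continuousAt_lift hδ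
      (Eventually.of_forall fun x' i j z hz w hw hz' hw' =>
        hG i j z hz w hw (hz'.trans hw'.symm))) fun p => h.eventually fun j z hz hzp => ?_
  subst hzp
  filter_upwards [d j z hz, d' j z hz, self_mem_nhdsWithin] with w e1 e2 hw
  rw [hf j z hz, hf j w hw, e1, e2, hGe j z hz, hGe j w hw]
  ring

lemma SameAbsolutePeriods.refl (S : TranslationSurface) : S.SameAbsolutePeriods S :=
  sameAbsolutePeriods_of_exact (Homeomorph.refl S) (G := fun _ => 0) continuous_const
    fun p => Eventually.of_forall fun q => by simp

lemma SameAbsolutePeriods.symm (h : S.SameAbsolutePeriods T) : T.SameAbsolutePeriods S := by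
  obtain ⟨f, hf⟩ := h
  refine ⟨f.symm, fun γ hγ z => ?_⟩
  rw [hf _ (by simp [hγ])]
  have : (f : C(S, T)).comp ((f.symm : C(T, S)).comp γ) = γ := by ext t; simp
  rw [this]

lemma SameAbsolutePeriods.trans {U : TranslationSurface} (h : S.SameAbsolutePeriods T)
    (h' : T.SameAbsolutePeriods U) : S.SameAbsolutePeriods U := by
  obtain ⟨f, hf⟩ := h
  obtain ⟨g, hg⟩ := h'
  refine ⟨f.trans g, fun γ hγ z => ?_⟩
  rw [hf γ hγ, hg _ (by simp [hγ])]
  rfl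

/-! ### Surgeries of surfaces presented by the same pieces -/

/-- If `S` and `T` are glued from the same pieces, and the gluings differ only along the cuts, where
they differ as in a surgery, then `T` is the result of a surgery on `S`. -/
theorem isSurgery_of_presentations (h : IsPresentation dom P) (h' : IsPresentation dom Q)
    (d : Develops S dom P (fun _ z => z)) (d' : Develops T dom Q (fun _ z => z))
    {γ η : C(I, S)} {γ' η' : C(I, T)} {v : ℂ} (hγ : S.IsSegment γ v) (hη : S.IsSegment η v)
    (hsimple : S.IsSimpleCut γ η) (hγ' : T.IsSegment γ' v) (hη' : T.IsSegment η' v)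
    (hcut : ∀ j, ∀ z ∈ dom j, P j z ∈ range γ ∪ range η ↔ Q j z ∈ range γ' ∪ range η')
    (hrel : ∀ i j, ∀ z ∈ dom i, ∀ w ∈ dom j, P i z ∉ range γ ∪ range η →
      (P i z = P j w ↔ Q i z = Q j w))
    (hsideγ : ∀ t : I, 0 < t → t < 1 → ∀ j, ∀ z ∈ dom j, P j z = γ t →
      (Q j z = γ' t ∧ ∀ w ∈ dom j, 0 ≤ ((w - z) / v).im) ∨
      (Q j z = η' t ∧ ∀ w ∈ dom j, ((w - z) / v).im ≤ 0))
    (hsideη : ∀ t : I, 0 < t → t < 1 → ∀ j, ∀ z ∈ dom j, P j z = η t →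
      (Q j z = η' t ∧ ∀ w ∈ dom j, 0 ≤ ((w - z) / v).im) ∨
      (Q j z = γ' t ∧ ∀ w ∈ dom j, ((w - z) / v).im ≤ 0)) :
    S.IsSurgery T γ η v := by
  set A := range γ ∪ range η with hA
  set B := range γ' ∪ range η' with hB
  have hAc : IsClosed A :=
    (isCompact_range γ.continuous).isClosed.union (isCompact_range η.continuous).isClosed
  have hBc : IsClosed B :=
    (isCompact_range γ'.continuous).isClosed.union (isCompact_range η'.continuous).isClosed
  have e1 : ∀ j, ∀ z ∈ dom j, P j z ∉ A → h.lift Q (P j z) = Q j z := fun j z hz hzA =>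
    h.lift_apply fun i w hw => (hrel j i z hz w hw hzA).1
  have e2 : ∀ j, ∀ z ∈ dom j, P j z ∉ A → h'.lift P (Q j z) = P j z := fun j z hz hzA =>
    h'.lift_apply fun i w hw => (hrel j i z hz w hw hzA).2
  let p : OpenPartialHomeomorph S T :=
    { toFun := h.lift Q
      invFun := h'.lift P
      source := Aᶜ
      target := Bᶜ
      map_source' := fun x hx => by
        obtain ⟨j, z, hz, rfl⟩ := h.exists_eq x
        rw [e1 j z hz hx]
        exact fun hq => hx ((hcut j z hz).2 hq)
      map_target' := fun y hy => by
        obtain ⟨j, z, hz, rfl⟩ := h'.exists_eq y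
        have hz' : P j z ∉ A := fun hq => hy ((hcut j z hz).1 hq)
        rw [e2 j z hz hz']
        exact hz'
      left_inv' := fun x hx => by
        obtain ⟨j, z, hz, rfl⟩ := h.exists_eq x
        rw [e1 j z hz hx, e2 j z hz hx]
      right_inv' := fun y hy => by
        obtain ⟨j, z, hz, rfl⟩ := h'.exists_eq y
        have hz' : P j z ∉ A := fun hq => hy ((hcut j z hz).1 hq)
        rw [e2 j z hz hz', e1 j z hz hz']
      open_source := hAc.isOpen_compl
      open_target := hBc.isOpen_compl
      continuousOn_toFun := fun x hx => by
        refine (h.continuousAt_lift h'.continuousOn ?_).continuousWithinAt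
        filter_upwards [hAc.isOpen_compl.mem_nhds hx] with x' hx' i j z hz w hw hz' hw'
        exact (hrel i j z hz w hw (hz' ▸ hx')).1 (hz'.trans hw'.symm)
      continuousOn_invFun := fun x hx => by
        refine (h'.continuousAt_lift h.continuousOn ?_).continuousWithinAt
        filter_upwards [hBc.isOpen_compl.mem_nhds hx] with x' hx' i j z hz w hw hz' hw'
        refine (hrel i j z hz w hw fun hq => ?_).2 (hz'.trans hw'.symm)
        exact hx' (hz' ▸ (hcut i z hz).1 hq) }
  -- the preimages of a point of a cut lie on the sides of the cut
  have side : ∀ (c : C(I, S)) (t : I) (q : T) (w : ℂ), (∀ᶠ x in 𝓝 (c t),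
      S.dev (c t) x ∈ leftHalf w → x ∈ p.source) →
      (∀ j, ∀ z ∈ dom j, P j z = c t → Q j z = q ∨ ∀ w' ∈ dom j, ((w' - z) / w).im ≤ 0) →
      Tendsto p (S.leftGerm (c t) w) (𝓝 q) := by
    intro c t q w hsrc hs V hV
    rw [mem_map, leftGerm, mem_inf_principal]
    refine h.mem_nhds _ _ fun j z hz hzt => ?_
    have hc : Tendsto (P j) (𝓝[dom j] z) (𝓝 (c t)) := hzt ▸ h.continuousOn j z hz
    rcases hs j z hz hzt with hq | hq
    · filter_upwards [d j z hz, hc.eventually hsrc, self_mem_nhdsWithin,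
        h'.continuousOn j z hz (hq ▸ hV)] with z' hd hs' hz' hV' hl
      show h.lift Q (P j z') ∈ V
      rw [e1 j z' hz' (hs' hl)]
      exact hV'
    · filter_upwards [d j z hz, self_mem_nhdsWithin] with z' hd hz' hl
      have hl' : 0 < ((z' - z) / w).im := by rw [← hd, hzt]; exact hl
      exact absurd (hq z' hz') (not_le.2 hl')
  have src : ∀ (c : C(I, S)) (t : I), (∀ᶠ x in 𝓝 (c t), (S.dev (c t) x / v).im ≠ 0 →
      x ∉ range γ ∪ range η) → ∀ w, w = v ∨ w = -v →
      ∀ᶠ x in 𝓝 (c t), S.dev (c t) x ∈ leftHalf w → x ∈ p.source := by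
    intro c t hct w hw
    filter_upwards [hct] with x hx hxl
    refine hx fun h => ?_
    rcases hw with rfl | rfl
    · exact absurd h (ne_of_gt hxl)
    · have : 0 < (S.dev (c t) x / (-v)).im := hxl
      rw [div_neg, Complex.neg_im, h] at this
      simp at this
  have neg : ∀ z : ℂ, (z / -v).im = -(z / v).im := fun z => by rw [div_neg, Complex.neg_im]
  refine ⟨γ', η', hγ', hη', p, rfl, rfl, fun x hx => ?_, fun t h0 h1 => ?_⟩
  · refine h.eventually fun j z hz hzx => ?_
    subst hzx
    have hc := h.continuousOn j z hz
    filter_upwards [d j z hz, d' j z hz, self_mem_nhdsWithin,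
      hc.eventually (hAc.isOpen_compl.mem_nhds hx)] with w q1 q2 hw hwA
    show T.dev (h.lift Q (P j z)) (h.lift Q (P j w)) = _
    rw [e1 j z hz hx, e1 j w hw hwA, q1, q2]
  · have sγ := src γ t (hsimple.eventually_notMem hγ h0 h1)
    have sη := src η t (by
      simpa only [union_comm] using hsimple.symm.eventually_notMem hη h0 h1)
    simp only [leftSide_eq_leftGerm, rightSide_eq_leftGerm]
    refine ⟨side γ t _ v (sγ v (Or.inl rfl)) fun j z hz hzt => ?_,
      side η t _ (-v) (sη _ (Or.inr rfl)) fun j z hz hzt => ?_,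
      side η t _ v (sη v (Or.inl rfl)) fun j z hz hzt => ?_,
      side γ t _ (-v) (sγ _ (Or.inr rfl)) fun j z hz hzt => ?_⟩
    · exact (hsideγ t h0 h1 j z hz hzt).imp And.left And.right
    · refine (hsideη t h0 h1 j z hz hzt).symm.imp And.left fun h w hw => ?_
      rw [neg]; linarith [h.2 w hw]
    · exact (hsideη t h0 h1 j z hz hzt).imp And.left And.right
    · refine (hsideγ t h0 h1 j z hz hzt).symm.imp And.left fun h w hw => ?_
      rw [neg]; linarith [h.2 w hw]

end

/-! ### A model glued from two cylinders -/

/-- The length `1 + √2` of the two long horizontal saddle connections. -/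
def longLen : ℝ := 1 + √2

lemma two_lt_longLen : 2 < longLen := by
  have : 1 < √2 := by rw [Real.lt_sqrt] <;> norm_num
  unfold longLen; linarith

lemma longLen_pos : 0 < longLen := by linarith [two_lt_longLen]

/-- The circumferences of the two cylinders. -/
def circ : Fin 2 → ℝ := ![longLen, 1 + longLen]

/-- The lengths of the three horizontal edges. -/
def len : Fin 3 → ℝ := ![1, longLen, longLen]

/-- The cylinder above an edge. -/
def upBand : Fin 3 → Fin 2 := ![1, 0, 1]

/-- The position of the start of an edge on the bottom of the cylinder above it. -/
def upPos : Fin 3 → ℝ := ![0, 0, 1]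

/-- The cylinder below an edge. -/
def loBand : Fin 3 → Fin 2 := ![1, 1, 0]

/-- The position of the start of an edge on the top of the cylinder below it, measured from a
marked point of the top. -/
def loPos : Fin 3 → ℝ := ![0, 1, 0]

lemma circ_pos (j : Fin 2) : 0 < circ j := by
  have := longLen_pos
  fin_cases j <;> simp [circ] <;> linarith

lemma len_pos (e : Fin 3) : 0 < len e := by
  have := longLen_pos
  fin_cases e <;> simp [len] <;> linarith

/-- `ex x = e^{2πix}`. -/
def ex (x : ℝ) : ℂ := Complex.exp (2 * Real.pi * Complex.I * x)

lemma ex_eq_ex_iff {x y : ℝ} : ex x = ex y ↔ ∃ k : ℤ, x = y + k := by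
  unfold ex
  rw [Complex.exp_eq_exp_iff_exists_int]
  refine exists_congr fun k => ?_
  have hpi : (2 * Real.pi * Complex.I : ℂ) ≠ 0 := by simp [Real.pi_ne_zero]
  rw [show (2 * Real.pi * Complex.I * y + k * (2 * Real.pi * Complex.I) : ℂ) =
    2 * Real.pi * Complex.I * (y + k) by ring, mul_right_inj' hpi]
  norm_cast

@[simp] lemma ex_zero : ex 0 = 1 := by simp [ex]
@[simp] lemma ex_one : ex 1 = 1 := by simp [ex, Complex.exp_two_pi_mul_I]
lemma ex_add_int (x : ℝ) (k : ℤ) : ex (x + k) = ex x := ex_eq_ex_iff.2 ⟨k, rfl⟩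
lemma continuous_ex : Continuous ex := by unfold ex; fun_prop
lemma norm_ex (x : ℝ) : ‖ex x‖ = 1 := by
  unfold ex
  rw [show (2 * Real.pi * Complex.I * x : ℂ) = ((2 * Real.pi * x : ℝ) : ℂ) * Complex.I by
    push_cast; ring]
  exact Complex.norm_exp_ofReal_mul_I _
lemma ex_ne_zero (x : ℝ) : ex x ≠ 0 := Complex.exp_ne_zero _

/-- The representative in `[0, 1 + L)` of a position on a boundary circle of the long cylinder. -/
def rep (x : ℝ) : ℝ := Int.fract (x / (1 + longLen)) * (1 + longLen)

lemma rep_eq {s : ℝ} (h0 : 0 ≤ s) (h1 : s < 1 + longLen) (k : ℤ) :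
    rep (s + k * (1 + longLen)) = s := by
  have hL := longLen_pos
  have : (s + k * (1 + longLen)) / (1 + longLen) = s / (1 + longLen) + k := by field_simp
  rw [rep, this, Int.fract_add_intCast, Int.fract_eq_self.2 ⟨by positivity, by
    rw [div_lt_one (by positivity)]; exact h1⟩]
  field_simp

lemma exists_eq_add (w : ℝ) (hw : 0 < w) (x : ℝ) :
    ∃ s, ∃ k : ℤ, 0 ≤ s ∧ s < w ∧ x = s + k * w := by
  refine ⟨Int.fract (x / w) * w, ⌊x / w⌋, by have := Int.fract_nonneg (x / w); positivity, ?_, ?_⟩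
  · have := Int.fract_lt_one (x / w)
    nlinarith
  · rw [← add_mul, Int.fract_add_floor]; field_simp

/-- The loop around the short edge on a boundary circle of the long cylinder. -/
def shortLoop (x : ℝ) : ℂ := ex (min (rep x) 1) - 1

/-- The loop around a long edge on a boundary circle of the long cylinder. -/
def longLoop (x : ℝ) : ℂ := ex ((max (rep x) 1 - 1) / longLen) - 1

lemma continuous_shortLoop : Continuous shortLoop := by
  have hL := longLen_pos
  have : Continuous fun y : ℝ => ex (min (Int.fract y * (1 + longLen)) 1) - 1 := by
    refine ContinuousOn.comp_fract''
      (f := fun y : ℝ => ex (min (y * (1 + longLen)) 1) - 1) ?_ ?_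
    · exact (continuous_ex.comp (by fun_prop)).sub continuous_const |>.continuousOn
    · simp [min_eq_right (by linarith : (1 : ℝ) ≤ 1 + longLen)]
  exact this.comp (continuous_id.div_const _)

lemma continuous_longLoop : Continuous longLoop := by
  have hL := longLen_pos
  have : Continuous fun y : ℝ => ex ((max (Int.fract y * (1 + longLen)) 1 - 1) / longLen) - 1 := by
    refine ContinuousOn.comp_fract''
      (f := fun y : ℝ => ex ((max (y * (1 + longLen)) 1 - 1) / longLen) - 1) ?_ ?_
    · exact (continuous_ex.comp (by fun_prop)).sub continuous_const |>.continuousOn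
    · simp [max_eq_left (by linarith : (1 : ℝ) ≤ 1 + longLen), div_self hL.ne']
  exact this.comp (continuous_id.div_const _)

lemma rep_add (x : ℝ) (k : ℤ) : rep (x + k * (1 + longLen)) = rep x := by
  have hL := longLen_pos
  have : (x + k * (1 + longLen)) / (1 + longLen) = x / (1 + longLen) + k := by field_simp
  rw [rep, rep, this, Int.fract_add_intCast]

lemma shortLoop_add (x : ℝ) (k : ℤ) : shortLoop (x + k * (1 + longLen)) = shortLoop x := by
  rw [shortLoop, shortLoop, rep_add]

lemma longLoop_add (x : ℝ) (k : ℤ) : longLoop (x + k * (1 + longLen)) = longLoop x := by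
  rw [longLoop, longLoop, rep_add]

lemma loops_short {s : ℝ} (h0 : 0 ≤ s) (h1 : s ≤ 1) : shortLoop s = ex s - 1 ∧ longLoop s = 0 := by
  have := rep_eq h0 (by linarith [longLen_pos]) 0
  simp only [Int.cast_zero, zero_mul, add_zero] at this
  simp [shortLoop, longLoop, this, h1]

lemma loops_long {s : ℝ} (h0 : 0 ≤ s) (h1 : s ≤ longLen) :
    shortLoop (1 + s) = 0 ∧ longLoop (1 + s) = ex (s / longLen) - 1 := by
  have hL := longLen_pos
  rcases h1.eq_or_lt with rfl | h1
  · have := rep_eq (s := 0) le_rfl (by linarith) 1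
    simp only [Int.cast_one, one_mul, zero_add] at this
    simp [shortLoop, longLoop, this, div_self hL.ne']
  · have := rep_eq (s := 1 + s) (by linarith) (by linarith) 0
    simp only [Int.cast_zero, zero_mul, add_zero] at this
    simp [shortLoop, longLoop, this, h0]

/-- The vector space in which the model is embedded. -/
abbrev Ambient : Type := (Fin 3 → ℂ) × (Fin 2 → ℂ) × (Fin 2 → ℝ)

/-- The embedding of the bottoms of the cylinders into the first factor of the ambient space, where
each horizontal edge is a circle through `0` in its own coordinate line. -/
def bot : Fin 2 → ℝ → Fin 3 → ℂ :=
  ![fun x => ![0, ex (x / longLen) - 1, 0], fun x => ![shortLoop x, 0, longLoop x]]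

/-- The embedding of the tops of the cylinders. -/
def top' : Fin 2 → ℝ → Fin 3 → ℂ :=
  ![fun x => ![0, 0, ex (x / longLen) - 1], fun x => ![shortLoop x, longLoop x, 0]]

/-- The map of the cylinder number `j` into the ambient space, in the coordinates
`x ∈ ℝ / circ j` and `s ∈ [0, 1]`. -/
def cyl (j : Fin 2) (x s : ℝ) : Ambient :=
  ((1 - s : ℂ) • bot j x + (s : ℂ) • top' j x,
    Pi.single j ((s * (1 - s) : ℝ) * ex (x / circ j)), Pi.single j (s ^ 2 * (1 - s)))

/-- The points of the edge number `e`. -/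
def edgePt (e : Fin 3) (s : ℝ) : Ambient := (Pi.single e (ex (s / len e) - 1), 0, 0)

lemma continuous_bot (j : Fin 2) : Continuous (bot j) := by
  have h1 := continuous_shortLoop
  have h2 := continuous_longLoop
  have h3 := continuous_ex
  refine continuous_pi fun e => ?_
  fin_cases j <;> fin_cases e <;> simp [bot] <;> fun_prop

lemma continuous_top' (j : Fin 2) : Continuous (top' j) := by
  have h1 := continuous_shortLoop
  have h2 := continuous_longLoop
  have h3 := continuous_ex
  refine continuous_pi fun e => ?_
  fin_cases j <;> fin_cases e <;> simp [top'] <;> fun_prop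

lemma continuous_cyl (j : Fin 2) : Continuous fun p : ℝ × ℝ => cyl j p.1 p.2 := by
  have h1 := continuous_bot j
  have h2 := continuous_top' j
  have h3 := continuous_ex
  refine Continuous.prodMk ?_ (Continuous.prodMk ?_ ?_)
  · fun_prop
  · exact (continuous_single j).comp (by fun_prop)
  · exact (continuous_single j).comp (by fun_prop)

lemma cyl_add (j : Fin 2) (x s : ℝ) (k : ℤ) : cyl j (x + k * circ j) s = cyl j x s := by
  have hc := (circ_pos j).ne'
  have hL := longLen_pos.ne'
  have e1 : (x + k * circ j) / circ j = x / circ j + k := by field_simp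
  have e2 : (x + k * longLen) / longLen = x / longLen + k := by field_simp
  have hb : bot j (x + k * circ j) = bot j x := by
    fin_cases j
    · simp [bot, circ, e2, ex_add_int]
    · simp [bot, circ, shortLoop_add, longLoop_add]
  have ht : top' j (x + k * circ j) = top' j x := by
    fin_cases j
    · simp [top', circ, e2, ex_add_int]
    · simp [top', circ, shortLoop_add, longLoop_add]
  rw [cyl, cyl, hb, ht, e1, ex_add_int]

lemma cyl_upper {e : Fin 3} {s : ℝ} (h0 : 0 ≤ s) (h1 : s ≤ len e) :
    cyl (upBand e) (upPos e + s) 0 = edgePt e s := by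
  have hb : bot (upBand e) (upPos e + s) = Pi.single e (ex (s / len e) - 1) := by
    ext i
    fin_cases e
    · obtain ⟨q1, q2⟩ := loops_short h0 (by simpa [len] using h1)
      fin_cases i <;> simp [bot, upBand, upPos, len, q1, q2]
    · fin_cases i <;> simp [bot, upBand, upPos, len]
    · obtain ⟨q1, q2⟩ := loops_long h0 (by simpa [len] using h1)
      fin_cases i <;> simp [bot, upBand, upPos, len, q1, q2]
  simp [cyl, edgePt, hb]

lemma cyl_lower {e : Fin 3} {s : ℝ} (h0 : 0 ≤ s) (h1 : s ≤ len e) :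
    cyl (loBand e) (loPos e + s) 1 = edgePt e s := by
  have hb : top' (loBand e) (loPos e + s) = Pi.single e (ex (s / len e) - 1) := by
    ext i
    fin_cases e
    · obtain ⟨q1, q2⟩ := loops_short h0 (by simpa [len] using h1)
      fin_cases i <;> simp [top', loBand, loPos, len, q1, q2]
    · obtain ⟨q1, q2⟩ := loops_long h0 (by simpa [len] using h1)
      fin_cases i <;> simp [top', loBand, loPos, len, q1, q2]
    · fin_cases i <;> simp [top', loBand, loPos, len]
  simp [cyl, edgePt, hb]

/-- Apart from the periodicity, an interior point of a cylinder is represented only once. -/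
lemma cyl_inj {i j : Fin 2} {x x' s s' : ℝ} (h0 : 0 < s) (h1 : s < 1) (h0' : 0 ≤ s') (h1' : s' ≤ 1)
    (h : cyl j x s = cyl i x' s') : i = j ∧ s' = s ∧ ∃ k : ℤ, x' = x + k * circ j := by
  have hs : 0 < s * (1 - s) := mul_pos h0 (by linarith)
  have e2 := congrArg (fun v : Ambient => v.2.1 j) h
  have e3 := congrArg (fun v : Ambient => v.2.2 j) h
  simp only [cyl, Pi.single_eq_same] at e2 e3
  have hij : i = j := by
    by_contra hne
    rw [Pi.single_eq_of_ne (Ne.symm hne)] at e2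
    rcases mul_eq_zero.1 e2 with h | h
    · exact hs.ne' (by exact_mod_cast h)
    · exact ex_ne_zero _ h
  subst hij
  simp only [Pi.single_eq_same] at e2 e3
  have hs' : 0 ≤ s' * (1 - s') := mul_nonneg h0' (by linarith)
  have en : s * (1 - s) = s' * (1 - s') := by
    have := congrArg norm e2
    rw [norm_mul, norm_mul, norm_ex, norm_ex, Complex.norm_real, Complex.norm_real, mul_one,
      mul_one, Real.norm_of_nonneg hs.le, Real.norm_of_nonneg hs'] at this
    exact this
  have hss : s' = s := by
    have : (s' - s) * (s * (1 - s)) = 0 := by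
      have e3' : s * (s * (1 - s)) = s' * (s' * (1 - s')) := by linarith
      rw [← en] at e3'
      linarith
    rcases mul_eq_zero.1 this with h | h
    · linarith
    · exact absurd h hs.ne'
  refine ⟨rfl, hss, ?_⟩
  subst hss
  have hex := mul_left_cancel₀ (by exact_mod_cast hs.ne') e2
  obtain ⟨k, hk⟩ := ex_eq_ex_iff.1 hex.symm
  refine ⟨k, ?_⟩
  have hc := (circ_pos i).ne'
  field_simp at hk
  linarith

lemma edgePt_zero (e : Fin 3) : edgePt e 0 = 0 := by simp [edgePt]
lemma edgePt_len (e : Fin 3) : edgePt e (len e) = 0 := by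
  simp [edgePt, div_self (len_pos e).ne']

lemma ex_sub_one_ne_zero {e : Fin 3} {s : ℝ} (h0 : 0 < s) (h1 : s < len e) :
    ex (s / len e) - 1 ≠ 0 := by
  intro h
  rw [sub_eq_zero, ← ex_zero] at h
  obtain ⟨k, hk⟩ := ex_eq_ex_iff.1 h
  have hl := len_pos e
  have e1 : 0 < s / len e := by positivity
  have e2 : s / len e < 1 := by rw [div_lt_one hl]; exact h1
  rw [hk, zero_add] at e1 e2
  have : (0 : ℤ) < k := by exact_mod_cast e1
  have : k < 1 := by exact_mod_cast e2
  omega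

/-- An interior point of an edge lies on no other edge, and occurs there only once. -/
lemma edgePt_inj {e e' : Fin 3} {s s' : ℝ} (h0 : 0 < s) (h1 : s < len e) (h0' : 0 ≤ s')
    (h1' : s' ≤ len e') (h : edgePt e s = edgePt e' s') : e' = e ∧ s' = s := by
  have e1 := congrArg (fun v : Ambient => v.1 e) h
  simp only [edgePt, Pi.single_eq_same] at e1
  have hne := ex_sub_one_ne_zero h0 h1
  have hee : e' = e := by
    by_contra hne'
    rw [Pi.single_eq_of_ne (Ne.symm hne')] at e1
    exact hne e1
  subst hee
  refine ⟨rfl, ?_⟩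
  rw [Pi.single_eq_same, sub_left_inj] at e1
  obtain ⟨k, hk⟩ := ex_eq_ex_iff.1 e1
  have hl := len_pos e'
  field_simp at hk
  have hk0 : k = 0 := by
    have a1 : (k : ℝ) < 1 := by
      by_contra hc; push Not at hc; nlinarith
    have a2 : (-1 : ℝ) < k := by
      by_contra hc; push Not at hc; nlinarith
    have : k < 1 := by exact_mod_cast a1
    have : -1 < k := by exact_mod_cast a2
    omega
  subst hk0
  simp at hk; linarith

lemma edgePt_ne_zero {e : Fin 3} {s : ℝ} (h0 : 0 < s) (h1 : s < len e) : edgePt e s ≠ 0 := by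
  intro h
  have := edgePt_inj h0 h1 le_rfl (len_pos e).le (h.trans (edgePt_zero e).symm)
  linarith [this.2]

lemma exists_upper (j : Fin 2) (x : ℝ) : ∃ e s, ∃ k : ℤ, upBand e = j ∧ 0 ≤ s ∧ s < len e ∧
    x = upPos e + s + k * circ j := by
  obtain ⟨s, k, h0, h1, rfl⟩ := exists_eq_add (circ j) (circ_pos j) x
  fin_cases j
  · exact ⟨1, s, k, rfl, h0, by simpa [len, circ] using h1, by simp [upPos]⟩
  · rcases lt_or_ge s 1 with h | h
    · exact ⟨0, s, k, rfl, h0, by simpa [len] using h, by simp [upPos]⟩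
    · refine ⟨2, s - 1, k, rfl, by linarith, ?_, by simp [upPos]⟩
      simp [circ] at h1
      simp [len]; linarith

lemma exists_lower (j : Fin 2) (x : ℝ) : ∃ e s, ∃ k : ℤ, loBand e = j ∧ 0 ≤ s ∧ s < len e ∧
    x = loPos e + s + k * circ j := by
  obtain ⟨s, k, h0, h1, rfl⟩ := exists_eq_add (circ j) (circ_pos j) x
  fin_cases j
  · exact ⟨2, s, k, rfl, h0, by simpa [len, circ] using h1, by simp [loPos]⟩
  · rcases lt_or_ge s 1 with h | h
    · exact ⟨0, s, k, rfl, h0, by simpa [len] using h, by simp [loPos]⟩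
    · refine ⟨1, s - 1, k, rfl, by linarith, ?_, by simp [loPos]⟩
      simp [circ] at h1
      simp [len]; linarith

/-- The topological space underlying all the surfaces `Oct n`: two cylinders, glued along the three
horizontal edges, as a subset of the ambient space. -/
def modelSet : Set Ambient := {v | ∃ j x s, 0 ≤ s ∧ s ≤ 1 ∧ v = cyl j x s}

/-- The model as a type. -/
abbrev Model : Type := modelSet

lemma modelSet_eq : modelSet = ⋃ j, (fun p : ℝ × ℝ => cyl j p.1 p.2) '' (Icc 0 (circ j) ×ˢ Icc 0 1) := by
  ext v
  simp only [modelSet, mem_iUnion]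
  constructor
  · rintro ⟨j, x, s, h0, h1, rfl⟩
    obtain ⟨y, k, hy0, hy1, rfl⟩ := exists_eq_add (circ j) (circ_pos j) x
    exact ⟨j, (y, s), ⟨⟨hy0, hy1.le⟩, h0, h1⟩, (cyl_add j y s k).symm⟩
  · rintro ⟨j, ⟨x, s⟩, ⟨-, h0, h1⟩, rfl⟩
    exact ⟨j, x, s, h0, h1, rfl⟩

lemma isCompact_modelSet : IsCompact modelSet := by
  rw [modelSet_eq]
  exact isCompact_iUnion fun j => (isCompact_Icc.prod isCompact_Icc).image (continuous_cyl j)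

lemma cyl_vertex (j : Fin 2) : cyl j 0 0 = 0 := by
  fin_cases j
  · have := cyl_upper (e := 1) le_rfl (len_pos 1).le
    simpa [upBand, upPos, edgePt_zero] using this
  · have := cyl_upper (e := 0) le_rfl (len_pos 0).le
    simpa [upBand, upPos, edgePt_zero] using this

lemma isConnected_modelSet : IsConnected modelSet := by
  rw [modelSet_eq]
  refine ⟨⟨0, mem_iUnion.2 ⟨0, (0, 0), ⟨⟨le_rfl, (circ_pos 0).le⟩, le_rfl, zero_le_one⟩,
    cyl_vertex 0⟩⟩, isPreconnected_iUnion ⟨0, mem_iInter.2 fun j => ⟨(0, 0), ⟨⟨le_rfl, (circ_pos j).le⟩, le_rfl,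
    zero_le_one⟩, cyl_vertex j⟩⟩ fun j => ?_⟩
  exact (isPreconnected_Icc.prod isPreconnected_Icc).image _ (continuous_cyl j).continuousOn

instance : CompactSpace Model := isCompact_iff_compactSpace.1 isCompact_modelSet

instance : ConnectedSpace Model := Subtype.connectedSpace isConnected_modelSet

section

/-! ### The strips that cover the model -/

/-- The points of the model in the coordinates of the cylinder number `j`. -/
def pt (j : Fin 2) (x s : ℝ) : Model :=
  ⟨cyl j x (projIcc 0 1 zero_le_one s), j, x, _, (projIcc 0 1 zero_le_one s).2.1,
    (projIcc 0 1 zero_le_one s).2.2, rfl⟩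

/-- The heights of the two cylinders. -/
def ht : Fin 2 → ℝ := ![1, √2 / 2]

/-- The horizontal displacement from the marked point of the bottom to the marked point of the top
of a cylinder, in the surface with twist parameter `t`. -/
def sh (t : ℝ) : Fin 2 → ℝ := ![t, 1 + √2 / 2 - t]

/-- The position of the marked point of the top of a cylinder. -/
def topPt (t : ℝ) (j : Fin 2) : ℂ := ⟨sh t j, ht j⟩

/-- The strip that covers a cylinder. -/
def strip (j : Fin 2) : Set ℂ := {z | 0 ≤ z.im ∧ z.im ≤ ht j}

/-- The covering of a cylinder by a strip, in the surface with twist parameter `t`. -/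
def P (t : ℝ) (j : Fin 2) (z : ℂ) : Model := pt j (z.re - z.im / ht j * sh t j) (z.im / ht j)

/-- The edge number `e`, parametrised by arc length on `[0, len e]`. -/
def E (e : Fin 3) (s : ℝ) : Model := pt (upBand e) (upPos e + s) 0

/-- The vertex of the model. -/
def vertex : Model := pt 0 0 0

/-- A point of an edge, on the bottom of the strip above it. -/
def upperPt (e : Fin 3) (s : ℝ) : ℂ := ((upPos e + s : ℝ) : ℂ)

/-- A point of an edge, on the top of the strip below it. -/
def lowerPt (t : ℝ) (e : Fin 3) (s : ℝ) : ℂ := topPt t (loBand e) + ((loPos e + s : ℝ) : ℂ)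

lemma lt_ht (j : Fin 2) : 7 / 10 < ht j := by
  have : 14 / 10 < √2 := by rw [Real.lt_sqrt] <;> norm_num
  fin_cases j <;> simp [ht] <;> linarith

lemma ht_pos (j : Fin 2) : 0 < ht j := by linarith [lt_ht j]

lemma continuous_pt (j : Fin 2) : Continuous fun p : ℝ × ℝ => pt j p.1 p.2 := by
  have h : Continuous fun p : ℝ × ℝ => (p.1, (projIcc (0 : ℝ) 1 zero_le_one p.2 : ℝ)) :=
    continuous_fst.prodMk
      (continuous_subtype_val.comp ((continuous_projIcc (h := zero_le_one)).comp continuous_snd))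
  exact Continuous.subtype_mk ((continuous_cyl j).comp h) _

lemma continuous_P (t : ℝ) (j : Fin 2) : Continuous (P t j) := by
  have h : Continuous fun z : ℂ => (z.re - z.im / ht j * sh t j, z.im / ht j) := by fun_prop
  have h2 := (continuous_pt j).comp h
  unfold Function.comp at h2
  exact h2

lemma continuous_E (e : Fin 3) : Continuous (E e) := by
  have h : Continuous fun s : ℝ => (upPos e + s, (0 : ℝ)) := by fun_prop
  have h2 := (continuous_pt (upBand e)).comp h
  unfold Function.comp at h2
  exact h2

lemma pt_val {j : Fin 2} {x s : ℝ} (h0 : 0 ≤ s) (h1 : s ≤ 1) : (pt j x s : Ambient) = cyl j x s := by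
  simp [pt, projIcc_of_mem zero_le_one (show s ∈ Icc (0 : ℝ) 1 from ⟨h0, h1⟩)]

lemma E_val {e : Fin 3} {s : ℝ} (h0 : 0 ≤ s) (h1 : s ≤ len e) : (E e s : Ambient) = edgePt e s := by
  rw [E, pt_val le_rfl zero_le_one, cyl_upper h0 h1]

lemma vertex_val : (vertex : Ambient) = 0 := by
  rw [vertex, pt_val le_rfl zero_le_one, cyl_vertex]

lemma E_zero (e : Fin 3) : E e 0 = vertex := by
  ext1; rw [E_val le_rfl (len_pos e).le, vertex_val, edgePt_zero]

lemma E_len (e : Fin 3) : E e (len e) = vertex := by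
  ext1; rw [E_val (len_pos e).le le_rfl, vertex_val, edgePt_len]

lemma E_ne_vertex {e : Fin 3} {s : ℝ} (h0 : 0 < s) (h1 : s < len e) : E e s ≠ vertex := fun h => by
  have := congrArg Subtype.val h
  rw [E_val h0.le h1.le, vertex_val] at this
  exact edgePt_ne_zero h0 h1 this

lemma E_inj {e e' : Fin 3} {s s' : ℝ} (h0 : 0 < s) (h1 : s < len e) (h0' : 0 ≤ s')
    (h1' : s' ≤ len e') (h : E e s = E e' s') : e' = e ∧ s' = s := by
  have := congrArg Subtype.val h
  rw [E_val h0.le h1.le, E_val h0' h1'] at this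
  exact edgePt_inj h0 h1 h0' h1' this

variable {t : ℝ} {j : Fin 2}

lemma P_add (t : ℝ) (j : Fin 2) (z : ℂ) (k : ℤ) : P t j (z + k * circ j) = P t j z := by
  have : (z + k * circ j).im = z.im := by simp
  have h2 : (z + k * circ j).re = z.re + k * circ j := by simp
  ext1
  rw [P, P, this, h2, pt, pt]
  simp only
  rw [show z.re + k * circ j - z.im / ht j * sh t j = z.re - z.im / ht j * sh t j + k * circ j by
    ring, cyl_add]

lemma P_upper {e : Fin 3} (s : ℝ) : P t (upBand e) (upperPt e s) = E e s := by
  simp [P, upperPt, E]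

lemma P_lower {e : Fin 3} {s : ℝ} (h0 : 0 ≤ s) (h1 : s ≤ len e) :
    P t (loBand e) (lowerPt t e s) = E e s := by
  have hh := (ht_pos (loBand e)).ne'
  ext1
  rw [E_val h0 h1, ← cyl_lower h0 h1, P, pt_val]
  · simp [lowerPt, topPt, div_self hh]
  · simp [lowerPt, topPt, div_self hh]
  · simp [lowerPt, topPt, div_self hh]

lemma P_val {z : ℂ} (hz : z ∈ strip j) :
    (P t j z : Ambient) = cyl j (z.re - z.im / ht j * sh t j) (z.im / ht j) := by
  have := ht_pos j
  exact pt_val (div_nonneg hz.1 this.le) (by rw [div_le_one this]; exact hz.2)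

lemma P_inj {i : Fin 2} {z w : ℂ} (h0 : 0 < z.im) (h1 : z.im < ht j) (hw : w ∈ strip i)
    (h : P t j z = P t i w) : i = j ∧ ∃ k : ℤ, w = z + k * circ j := by
  have hj := ht_pos j
  have hi := ht_pos i
  have := congrArg Subtype.val h
  rw [P_val ⟨h0.le, h1.le⟩, P_val hw] at this
  obtain ⟨rfl, hs, k, hk⟩ := cyl_inj (by positivity) (by rw [div_lt_one hj]; exact h1)
    (div_nonneg hw.1 hi.le) (by rw [div_le_one hi]; exact hw.2) this
  refine ⟨rfl, k, ?_⟩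
  have him : w.im = z.im := by field_simp at hs; exact hs
  apply Complex.ext
  · rw [him] at hk
    simp; linarith
  · simp [him]

lemma upperPt_mem (e : Fin 3) (s : ℝ) : upperPt e s ∈ strip (upBand e) := by
  simp [strip, upperPt, (ht_pos _).le]

lemma lowerPt_mem (t : ℝ) (e : Fin 3) (s : ℝ) : lowerPt t e s ∈ strip (loBand e) := by
  simp [strip, lowerPt, topPt, (ht_pos _).le]

lemma P_ne_E {z : ℂ} (h0 : 0 < z.im) (h1 : z.im < ht j) (e : Fin 3) (s : ℝ) : P t j z ≠ E e s := by
  intro h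
  rw [← P_upper (t := t)] at h
  obtain ⟨-, k, hk⟩ := P_inj h0 h1 (upperPt_mem e s) h
  have := congrArg Complex.im hk
  simp [upperPt] at this
  exact h0.ne this

lemma P_ne_vertex {z : ℂ} (h0 : 0 < z.im) (h1 : z.im < ht j) : P t j z ≠ vertex := by
  rw [← E_zero 0]; exact P_ne_E h0 h1 _ _

/-- A point of a strip is in its interior, or on its bottom, or on its top. -/
lemma strip_cases (t : ℝ) {z : ℂ} (hz : z ∈ strip j) : (0 < z.im ∧ z.im < ht j) ∨
    (∃ e s, ∃ k : ℤ, upBand e = j ∧ 0 ≤ s ∧ s < len e ∧ z = upperPt e s + k * circ j) ∨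
    (∃ e s, ∃ k : ℤ, loBand e = j ∧ 0 ≤ s ∧ s < len e ∧ z = lowerPt t e s + k * circ j) := by
  rcases hz.1.eq_or_lt with h0 | h0
  · obtain ⟨e, s, k, he, hs0, hs1, hx⟩ := exists_upper j z.re
    refine Or.inr (Or.inl ⟨e, s, k, he, hs0, hs1, Complex.ext ?_ ?_⟩)
    · simp [upperPt, hx]
    · simp [upperPt, ← h0]
  rcases hz.2.eq_or_lt with h1 | h1
  · obtain ⟨e, s, k, he, hs0, hs1, hx⟩ := exists_lower j (z.re - sh t j)
    refine Or.inr (Or.inr ⟨e, s, k, he, hs0, hs1, Complex.ext ?_ ?_⟩)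
    · subst he; simp [lowerPt, topPt]; linarith
    · subst he; simp [lowerPt, topPt, ← h1]
  · exact Or.inl ⟨h0, h1⟩

lemma P_upper_add {e : Fin 3} (s : ℝ) (k : ℤ) :
    P t (upBand e) (upperPt e s + k * circ (upBand e)) = E e s := by
  rw [P_add, P_upper]

lemma P_lower_add {e : Fin 3} {s : ℝ} (h0 : 0 ≤ s) (h1 : s ≤ len e) (k : ℤ) :
    P t (loBand e) (lowerPt t e s + k * circ (loBand e)) = E e s := by
  rw [P_add, P_lower h0 h1]

/-- A compact part of a strip that covers the cylinder. -/
def box (t : ℝ) (j : Fin 2) : Set ℂ :=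
  (fun p : ℝ × ℝ => (⟨p.1 + p.2 * sh t j, p.2 * ht j⟩ : ℂ)) '' (Icc 0 (circ j) ×ˢ Icc 0 1)

lemma isCompact_box (t : ℝ) (j : Fin 2) : IsCompact (box t j) := by
  refine (isCompact_Icc.prod isCompact_Icc).image ?_
  have : (fun p : ℝ × ℝ => (⟨p.1 + p.2 * sh t j, p.2 * ht j⟩ : ℂ)) =
      fun p => ((p.1 + p.2 * sh t j : ℝ) : ℂ) + ((p.2 * ht j : ℝ) : ℂ) * Complex.I := by
    ext1 p; apply Complex.ext <;> simp
  rw [this]; fun_prop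

lemma box_subset (t : ℝ) (j : Fin 2) : box t j ⊆ strip j := by
  rintro _ ⟨⟨x, s⟩, ⟨-, h0, h1⟩, rfl⟩
  have := ht_pos j
  exact ⟨mul_nonneg h0 this.le, mul_le_of_le_one_left this.le h1⟩

lemma isPresentation_box (t : ℝ) : IsPresentation (box t) (P t) := by
  refine IsPresentation.of_isCompact (isCompact_box t) (fun j => (continuous_P t j).continuousOn) ?_
  rintro ⟨v, hv⟩
  rw [modelSet_eq] at hv
  obtain ⟨j, ⟨x, s⟩, hp, hxs⟩ := mem_iUnion.1 hv
  simp only at hxs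
  refine ⟨j, ⟨x + s * sh t j, s * ht j⟩, ⟨(x, s), hp, rfl⟩, ?_⟩
  have hh := (ht_pos j).ne'
  ext1
  rw [P_val (box_subset t j ⟨(x, s), hp, rfl⟩)]
  simp [mul_div_assoc, div_self hh, hxs]

lemma isPresentation (t : ℝ) : IsPresentation strip (P t) :=
  (isPresentation_box t).mono (box_subset t) fun j => (continuous_P t j).continuousOn

lemma exists_P_eq (t : ℝ) (x : Model) : ∃ j, ∃ z ∈ strip j, P t j z = x :=
  (isPresentation t).exists_eq x

/-- A point of the model is in the interior of a cylinder, or in the interior of an edge, or the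
vertex. -/
lemma model_cases (t : ℝ) (x : Model) : (∃ j z, 0 < z.im ∧ z.im < ht j ∧ x = P t j z) ∨
    (∃ e s, 0 < s ∧ s < len e ∧ x = E e s) ∨ x = vertex := by
  obtain ⟨j, z, hz, rfl⟩ := exists_P_eq t x
  rcases strip_cases t hz with h | ⟨e, s, k, rfl, h0, h1, rfl⟩ | ⟨e, s, k, rfl, h0, h1, rfl⟩
  · exact Or.inl ⟨j, z, h.1, h.2, rfl⟩
  · rw [P_upper_add]
    rcases h0.eq_or_lt with rfl | h0
    · exact Or.inr (Or.inr (E_zero e))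
    · exact Or.inr (Or.inl ⟨e, s, h0, h1, rfl⟩)
  · rw [P_lower_add h0 h1.le]
    rcases h0.eq_or_lt with rfl | h0
    · exact Or.inr (Or.inr (E_zero e))
    · exact Or.inr (Or.inl ⟨e, s, h0, h1, rfl⟩)

/-- The points of the strips over a point of an edge. -/
lemma P_eq_E {z : ℂ} (hz : z ∈ strip j) {e : Fin 3} {s : ℝ} (h0 : 0 < s) (h1 : s < len e)
    (h : P t j z = E e s) : (∃ k : ℤ, upBand e = j ∧ z = upperPt e s + k * circ j) ∨
    (∃ k : ℤ, loBand e = j ∧ z = lowerPt t e s + k * circ j) := by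
  rcases strip_cases t hz with h' | ⟨e', s', k, rfl, h0', h1', rfl⟩ | ⟨e', s', k, rfl, h0', h1', rfl⟩
  · exact absurd h (P_ne_E h'.1 h'.2 _ _)
  · rw [P_upper_add] at h
    obtain ⟨rfl, rfl⟩ := E_inj h0 h1 h0' h1'.le h.symm
    exact Or.inl ⟨k, rfl, rfl⟩
  · rw [P_lower_add h0' h1'.le] at h
    obtain ⟨rfl, rfl⟩ := E_inj h0 h1 h0' h1'.le h.symm
    exact Or.inr ⟨k, rfl, rfl⟩

/-- The points of the strips over the vertex. -/
lemma P_eq_vertex {z : ℂ} (hz : z ∈ strip j) (h : P t j z = vertex) :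
    (∃ e, ∃ k : ℤ, upBand e = j ∧ z = upperPt e 0 + k * circ j) ∨
    (∃ e, ∃ k : ℤ, loBand e = j ∧ z = lowerPt t e 0 + k * circ j) := by
  rcases strip_cases t hz with h' | ⟨e', s', k, rfl, h0', h1', rfl⟩ | ⟨e', s', k, rfl, h0', h1', rfl⟩
  · exact absurd h (P_ne_vertex h'.1 h'.2)
  · rw [P_upper_add] at h
    rcases h0'.eq_or_lt with rfl | h0'
    · exact Or.inl ⟨e', k, rfl, rfl⟩
    · exact absurd h (E_ne_vertex h0' h1')
  · rw [P_lower_add h0' h1'.le] at h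
    rcases h0'.eq_or_lt with rfl | h0'
    · exact Or.inr ⟨e', k, rfl, rfl⟩
    · exact absurd h (E_ne_vertex h0' h1')

end

/-! ### Charts at cone points -/

/-- The closed upper half-disc of radius `r`. -/
def halfDisc (r : ℝ) : Set ℂ := {z | 0 ≤ z.im} ∩ Metric.closedBall 0 r

lemma isCompact_halfDisc (r : ℝ) : IsCompact (halfDisc r) :=
  (isCompact_closedBall (0 : ℂ) r).inter_left (isClosed_le continuous_const Complex.continuous_im)

/-- The branch of the `k`-th root on the closed upper half-plane that is positive on the positive
reals. -/
def root (k : ℕ) (z : ℂ) : ℂ := z ^ ((k : ℂ)⁻¹)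

/-- The rotation by the angle `π / k`. -/
def rot (k : ℕ) : ℂ := Complex.exp (2 * Real.pi * Complex.I / (2 * k : ℕ))

lemma isPrimitiveRoot_rot {k : ℕ} (hk : 1 ≤ k) : IsPrimitiveRoot (rot k) (2 * k) :=
  Complex.isPrimitiveRoot_exp _ (by omega)

lemma root_pow {k : ℕ} (hk : 1 ≤ k) (z : ℂ) : root k z ^ k = z :=
  Complex.cpow_nat_inv_pow z (by omega)

lemma rot_pow {k : ℕ} (hk : 1 ≤ k) : rot k ^ k = -1 := by
  have hk' : (k : ℂ) ≠ 0 := by exact_mod_cast (by omega : k ≠ 0)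
  rw [rot, ← Complex.exp_nat_mul, ← Complex.exp_pi_mul_I]
  congr 1
  push_cast
  field_simp

lemma root_neg {k : ℕ} {s : ℝ} (hs : 0 ≤ s) (hk : 1 ≤ k) :
    root k (-(s : ℂ)) = rot k * root k s := by
  have hk' : (k : ℂ) ≠ 0 := by exact_mod_cast (by omega : k ≠ 0)
  have := Complex.ofReal_cpow_of_nonpos (x := -s) (by linarith) ((k : ℂ)⁻¹)
  rw [Complex.ofReal_neg, neg_neg] at this
  rw [root, this, root, rot, mul_comm]
  congr 2
  push_cast
  field_simp

lemma continuousOn_root {k : ℕ} (hk : 1 ≤ k) : ContinuousOn (root k) {z : ℂ | 0 ≤ z.im} := by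
  intro z hz
  have hk0 : (0 : ℝ) < ((k : ℂ)⁻¹).re := by
    rw [← Complex.ofReal_natCast, ← Complex.ofReal_inv, Complex.ofReal_re]
    exact inv_pos.2 (by exact_mod_cast hk)
  by_cases h0 : z = 0
  · subst h0
    have : ContinuousAt (root k) 0 := by
      have h1 : root k 0 = 0 := Complex.zero_cpow (by intro h; rw [h] at hk0; simp at hk0)
      have h2 : ∀ w, ‖root k w‖ ^ k = ‖w‖ := fun w => by rw [← norm_pow, root_pow hk]
      rw [ContinuousAt, h1, tendsto_zero_iff_norm_tendsto_zero]
      refine Metric.tendsto_nhds.2 fun ε hε => ?_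
      have : ∀ᶠ w : ℂ in 𝓝 0, ‖w‖ < ε ^ k := by
        have := Metric.ball_mem_nhds (0 : ℂ) (pow_pos hε k)
        filter_upwards [this] with w hw
        simpa using hw
      filter_upwards [this] with w hw
      rw [← h2] at hw
      simpa using lt_of_pow_lt_pow_left₀ k hε.le hw
    exact this.continuousWithinAt
  · have hlog : ContinuousWithinAt Complex.log {z : ℂ | 0 ≤ z.im} z := by
      by_cases hs : z ∈ Complex.slitPlane
      · exact (continuousAt_clog hs).continuousWithinAt
      · rw [Complex.mem_slitPlane_iff] at hs
        push Not at hs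
        have hre : z.re < 0 := lt_of_le_of_ne hs.1 fun h => h0 (Complex.ext h hs.2)
        exact Complex.continuousWithinAt_log_of_re_neg_of_im_zero hre hs.2
    have : ContinuousWithinAt (fun w => Complex.exp (Complex.log w * (k : ℂ)⁻¹))
        {z : ℂ | 0 ≤ z.im} z := (hlog.mul continuousWithinAt_const).cexp
    refine this.congr_of_eventuallyEq ?_ (Complex.cpow_def_of_ne_zero h0 _)
    filter_upwards [nhdsWithin_le_nhds (isOpen_ne.mem_nhds h0)] with w hw
    exact Complex.cpow_def_of_ne_zero hw _

/-- A homeomorphism of a subspace with a closed disc restricts to a chart. -/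
lemma exists_chart_of_homeomorph {X : Type*} [TopologicalSpace X] {K : Set X} {R : ℝ}
    (f : K ≃ₜ Metric.closedBall (0 : ℂ) R) {x : X} (hx : K ∈ 𝓝 x)
    (hfx : ‖(f ⟨x, mem_of_mem_nhds hx⟩ : ℂ)‖ < R) :
    ∃ φ : OpenPartialHomeomorph X ℂ, x ∈ φ.source ∧
      ∀ y (hy : y ∈ K), φ y = f ⟨y, hy⟩ := by
  classical
  let F : X → ℂ := fun y => if h : y ∈ K then f ⟨y, h⟩ else 0
  let G : ℂ → X := fun w => if h : w ∈ Metric.closedBall (0 : ℂ) R then f.symm ⟨w, h⟩ else x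
  have hF : ∀ y (hy : y ∈ K), F y = f ⟨y, hy⟩ := fun y hy => dif_pos hy
  have hG : ∀ w (hw : w ∈ Metric.closedBall (0 : ℂ) R), G w = f.symm ⟨w, hw⟩ :=
    fun w hw => dif_pos hw
  have cF : ContinuousOn F K := by
    rw [continuousOn_iff_continuous_domRestrict]
    have : K.domRestrict F = fun y => (f y : ℂ) := by ext y; exact hF _ y.2
    rw [this]
    exact continuous_subtype_val.comp f.continuous
  have cG : ContinuousOn G (Metric.closedBall 0 R) := by
    rw [continuousOn_iff_continuous_domRestrict]
    have : (Metric.closedBall (0 : ℂ) R).domRestrict G = fun y => (f.symm y : X) := by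
      ext y; exact hG _ y.2
    rw [this]
    exact continuous_subtype_val.comp f.symm.continuous
  have hsub : Metric.ball (0 : ℂ) R ⊆ Metric.closedBall 0 R := Metric.ball_subset_closedBall
  have gF : ∀ y ∈ K, G (F y) = y := fun y hy => by
    rw [hF y hy, hG _ (f ⟨y, hy⟩).2]; simp
  have fG : ∀ w ∈ Metric.closedBall (0 : ℂ) R, F (G w) = w := fun w hw => by
    rw [hG w hw, hF _ (f.symm ⟨w, hw⟩).2]; simp
  let φ : OpenPartialHomeomorph X ℂ :=
    { toFun := F
      invFun := G
      source := interior K ∩ F ⁻¹' Metric.ball 0 R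
      target := Metric.ball 0 R ∩ G ⁻¹' interior K
      map_source' := fun y hy => ⟨hy.2, by
        rw [mem_preimage, gF y (interior_subset hy.1)]; exact hy.1⟩
      map_target' := fun w hw => ⟨hw.2, by
        rw [mem_preimage, fG w (hsub hw.1)]; exact hw.1⟩
      left_inv' := fun y hy => gF y (interior_subset hy.1)
      right_inv' := fun w hw => fG w (hsub hw.1)
      open_source := (cF.mono interior_subset).isOpen_inter_preimage isOpen_interior
        Metric.isOpen_ball
      open_target := (cG.mono hsub).isOpen_inter_preimage Metric.isOpen_ball isOpen_interior
      continuousOn_toFun := cF.mono fun y hy => interior_subset hy.1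
      continuousOn_invFun := cG.mono fun w hw => hsub hw.1 }
  exact ⟨φ, ⟨mem_interior_iff_mem_nhds.2 hx, by
    simp only [mem_preimage, mem_ball_zero_iff, hF x (mem_of_mem_nhds hx), hfx]⟩, hF⟩

/-- The points of a closed half-disc other than the centre and the points of the negative real
radius. -/
def halfOpen (r : ℝ) : Set ℂ := {z ∈ halfDisc r | z ≠ 0 ∧ ¬ (z.im = 0 ∧ z.re < 0)}

lemma zero_mem_halfDisc {r : ℝ} (hr : 0 ≤ r) : (0 : ℂ) ∈ halfDisc r := by
  simp [halfDisc, hr]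

lemma halfDisc_cases {r : ℝ} {z : ℂ} (hz : z ∈ halfDisc r) :
    z = 0 ∨ z ∈ halfOpen r ∨ ∃ s : ℝ, 0 < s ∧ s ≤ r ∧ z = -(s : ℂ) ∧ (s : ℂ) ∈ halfOpen r := by
  by_cases h0 : z = 0
  · exact Or.inl h0
  by_cases h1 : z.im = 0 ∧ z.re < 0
  · have hz' : z = -((-z.re : ℝ) : ℂ) := Complex.ext (by simp) (by simp [h1.1])
    have hn : -z.re ≤ r := by
      have := hz.2
      rw [mem_closedBall_zero_iff, hz', norm_neg, Complex.norm_real,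
        Real.norm_of_nonneg (by linarith [h1.2])] at this
      exact this
    refine Or.inr (Or.inr ⟨-z.re, by linarith [h1.2], hn, hz', ⟨⟨by simp, ?_⟩, ?_, ?_⟩⟩)
    · rw [mem_closedBall_zero_iff, Complex.norm_real, Real.norm_of_nonneg (by linarith [h1.2])]
      exact hn
    · simpa using h1.2.ne
    · simp [h1.2.le]
  · exact Or.inr (Or.inl ⟨hz, h0, h1⟩)

lemma eq_of_sign_mul_eq {r : ℝ} {z w : ℂ} (hz : z ∈ halfOpen r) (hw : w ∈ halfOpen r) {m n : ℕ}
    (h : (-1) ^ m * z = (-1) ^ n * w) : z = w ∧ ((-1 : ℂ) ^ m = (-1) ^ n) := by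
  have key : z ≠ -w := by
    intro h
    have e1 : z.im = -w.im := by simp [h]
    have e2 : z.re = -w.re := by simp [h]
    have h1 : 0 ≤ z.im := hz.1.1
    have h2 : 0 ≤ w.im := hw.1.1
    have h3 : z.im = 0 := by linarith
    have h4 : w.im = 0 := by linarith
    have h5 : 0 ≤ z.re := by by_contra hc; exact hz.2.2 ⟨h3, not_le.1 hc⟩
    have h6 : 0 ≤ w.re := by by_contra hc; exact hw.2.2 ⟨h4, not_le.1 hc⟩
    exact hz.2.1 (Complex.ext (by simp; linarith) h3)
  have key2 : -z ≠ w := fun h => key (by rw [← h, neg_neg])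
  rcases neg_one_pow_eq_or ℂ m with hm | hm <;> rcases neg_one_pow_eq_or ℂ n with hn | hn <;>
    simp [hm, hn] at h ⊢ <;> first | exact h | exact (key h).elim | exact (key2 h).elim

/-- A presentation of a chart at a cone point: if `2k` half-discs, cyclically glued along their
boundary radii, develop onto a neighbourhood of `x`, then a `k`-th root of the developing map
is a chart. -/
theorem exists_coneChart {ι X : Type*} [TopologicalSpace X] [T2Space X] {dom : ι → Set ℂ}
    {P : ι → ℂ → X} (h : IsPresentation dom P) {x : X} {k : ℕ} (hk : 1 ≤ k) {r : ℝ} (hr : 0 < r)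
    (d : ℕ → ℂ → X) (hd : ∀ m, ContinuousOn (d m) (halfDisc r)) (hd0 : ∀ m, d m 0 = x)
    (hsucc : ∀ m < 2 * k, ∀ s : ℝ, 0 ≤ s → s ≤ r → d m (-s) = d ((m + 1) % (2 * k)) s)
    (hdx : ∀ m < 2 * k, ∀ z ∈ halfOpen r, d m z ≠ x)
    (hinj : ∀ m < 2 * k, ∀ n < 2 * k, ∀ z ∈ halfOpen r, ∀ w ∈ halfOpen r, d m z = d n w →
      m = n ∧ z = w)
    (hx : ∀ j, ∀ z ∈ dom j, P j z = x → ∀ᶠ z' in 𝓝[dom j] z, ∃ m < 2 * k, ∃ w ∈ halfDisc r,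
      d m w = P j z' ∧ (-1) ^ m * w = z' - z) :
    ∃ φ : OpenPartialHomeomorph X ℂ, x ∈ φ.source ∧ φ x = 0 ∧ ∀ j, ∀ z ∈ dom j, P j z = x →
      ∀ᶠ z' in 𝓝[dom j] z, φ (P j z') ^ k = z' - z := by
  have hζ := isPrimitiveRoot_rot hk
  have hk0 : k ≠ 0 := by omega
  have root0 : root k 0 = 0 := pow_eq_zero_iff hk0 |>.1 (root_pow hk 0)
  have hrn : ∀ z, root k z = 0 → z = 0 := fun z hz => by rw [← root_pow hk z, hz, zero_pow hk0]
  have hrot : ‖rot k‖ = 1 := hζ.norm'_eq_one (by omega)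
  set ψ : ℕ → ℂ → ℂ := fun m z => rot k ^ m * root k z with hψ
  have ψpow : ∀ m z, ψ m z ^ k = (-1) ^ m * z := fun m z => by
    rw [hψ]; simp only
    rw [mul_pow, root_pow hk, ← pow_mul, mul_comm m k, pow_mul, rot_pow hk]
  have ψsucc : ∀ m, ∀ s : ℝ, 0 ≤ s → ψ m (-s) = ψ ((m + 1) % (2 * k)) s := fun m s hs => by
    rw [hψ]; simp only
    rw [root_neg hs hk, ← mul_assoc, ← pow_succ]
    congr 1
    conv_lhs => rw [← Nat.mod_add_div (m + 1) (2 * k)]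
    rw [pow_add, pow_mul (rot k) (2 * k), hζ.pow_eq_one, one_pow, mul_one]
  have ψinj : ∀ m < 2 * k, ∀ n < 2 * k, ∀ z ∈ halfOpen r, ∀ w ∈ halfOpen r, ψ m z = ψ n w →
      m = n ∧ z = w := by
    intro m hm n hn z hz w hw hmn
    have := congrArg (· ^ k) hmn
    simp only [ψpow] at this
    obtain ⟨rfl, -⟩ := eq_of_sign_mul_eq hz hw this
    have h1 := mul_right_cancel₀ (fun h => hz.2.1 (hrn z h)) hmn
    exact ⟨hζ.pow_inj hm hn h1, rfl⟩
  have ψ0 : ∀ m, ψ m 0 = 0 := fun m => by simp [hψ, root0]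
  have ψne : ∀ m z, z ≠ 0 → ψ m z ≠ 0 := fun m z hz h0 => by
    have := ψpow m z
    rw [h0, zero_pow hk0] at this
    rcases mul_eq_zero.1 this.symm with h | h
    · exact pow_ne_zero m (by norm_num) h
    · exact hz h
  -- The two families of half-discs are glued in the same way.
  have hkl : ∀ m < 2 * k, (m + 1) % (2 * k) < 2 * k := fun m _ => Nat.mod_lt _ (by omega)
  have norm1 : ∀ m < 2 * k, ∀ z ∈ halfDisc r, z ≠ 0 → ∃ n < 2 * k, ∃ w ∈ halfOpen r,
      d m z = d n w ∧ ψ m z = ψ n w := by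
    intro m hm z hz hz0
    rcases halfDisc_cases hz with h | h | ⟨s, hs0, hsr, rfl, hs⟩
    · exact absurd h hz0
    · exact ⟨m, hm, z, h, rfl, rfl⟩
    · exact ⟨_, hkl m hm, s, hs, hsucc m hm s hs0.le hsr, ψsucc m s hs0.le⟩
  have hker : ∀ m < 2 * k, ∀ n < 2 * k, ∀ z ∈ halfDisc r, ∀ w ∈ halfDisc r,
      (d m z = d n w ↔ ψ m z = ψ n w) := by
    intro m hm n hn z hz w hw
    by_cases hz0 : z = 0 <;> by_cases hw0 : w = 0
    · simp [hz0, hw0, hd0, ψ0]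
    · obtain ⟨n', hn', w', hw', e1, e2⟩ := norm1 n hn w hw hw0
      rw [e1, e2, hz0, hd0, ψ0]
      exact iff_of_false (hdx n' hn' w' hw').symm (ψne n' w' hw'.2.1).symm
    · obtain ⟨n', hn', w', hw', e1, e2⟩ := norm1 m hm z hz hz0
      rw [e1, e2, hw0, hd0, ψ0]
      exact iff_of_false (hdx n' hn' w' hw') (ψne n' w' hw'.2.1)
    · obtain ⟨m', hm', z', hz', e1, e2⟩ := norm1 m hm z hz hz0
      obtain ⟨n', hn', w', hw', e3, e4⟩ := norm1 n hn w hw hw0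
      rw [e1, e2, e3, e4]
      constructor
      · intro he
        obtain ⟨rfl, rfl⟩ := hinj m' hm' n' hn' z' hz' w' hw' he; rfl
      · intro he
        obtain ⟨rfl, rfl⟩ := ψinj m' hm' n' hn' z' hz' w' hw' he; rfl
  have : NeZero (2 * k) := ⟨by omega⟩
  set R : ℝ := r ^ ((k : ℝ)⁻¹) with hR
  have hR0 : 0 < R := Real.rpow_pos_of_pos hr _
  have hRk : R ^ k = r := Real.rpow_inv_natCast_pow hr.le hk0
  have ψR : ∀ m, ∀ z ∈ halfDisc r, ψ m z ∈ Metric.closedBall (0 : ℂ) R := by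
    intro m z hz
    rw [mem_closedBall_zero_iff]
    refine le_of_pow_le_pow_left₀ hk0 hR0.le ?_
    rw [← norm_pow, ψpow, hRk]
    simpa using hz.2
  have ψsurj : ∀ w ∈ Metric.closedBall (0 : ℂ) R, ∃ m < 2 * k, ∃ z ∈ halfDisc r, ψ m z = w := by
    intro w hw
    by_cases hw0 : w = 0
    · exact ⟨0, by omega, 0, zero_mem_halfDisc hr.le, by rw [ψ0, hw0]⟩
    have hwr : ‖w ^ k‖ ≤ r := by
      rw [norm_pow, ← hRk]
      exact pow_le_pow_left₀ (norm_nonneg _) (by simpa using hw) k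
    obtain ⟨z, hz, hz2⟩ : ∃ z ∈ halfDisc r, (w ^ k) ^ 2 = z ^ 2 := by
      rcases le_total 0 (w ^ k).im with hi | hi
      · exact ⟨w ^ k, ⟨hi, by simpa using hwr⟩, rfl⟩
      · exact ⟨-w ^ k, ⟨by simpa using hi, by simpa using hwr⟩, by ring⟩
    have hz0 : root k z ≠ 0 := fun h0 => by
      rw [hrn z h0] at hz2
      simp [hw0, hk0] at hz2
    obtain ⟨m, hm, hm2⟩ := hζ.eq_pow_of_pow_eq_one (ξ := w / root k z) (by
      rw [mul_comm, pow_mul, div_pow, div_pow, root_pow hk, hz2, div_self]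
      rw [← hz2]; exact pow_ne_zero _ (pow_ne_zero _ hw0))
    exact ⟨m, hm, z, hz, by rw [hψ]; simp only; rw [hm2]; field_simp⟩
  set K : Set X := ⋃ m : Fin (2 * k), d m '' halfDisc r with hK
  have hdK : ∀ m (_ : m < 2 * k) z (_ : z ∈ halfDisc r), d m z ∈ K := fun m hm z hz =>
    mem_iUnion.2 ⟨⟨m, hm⟩, z, hz, rfl⟩
  have hKx : K ∈ 𝓝 x := h.mem_nhds x K fun j z hz hzx => by
    filter_upwards [hx j z hz hzx] with z' ⟨m, hm, w, hw, e, _⟩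
    rw [← e]; exact hdK m hm w hw
  have hxK : x ∈ K := mem_of_mem_nhds hKx
  -- The gluing of the half-discs, as a subspace of `X` and as a disc.
  classical
  let D : Fin (2 * k) → ℂ → K := fun m z => if hz : z ∈ halfDisc r then ⟨d m z, hdK m m.2 z hz⟩
    else ⟨x, hxK⟩
  let Ψ : Fin (2 * k) → ℂ → Metric.closedBall (0 : ℂ) R := fun m z =>
    if hz : z ∈ halfDisc r then ⟨ψ m z, ψR m z hz⟩ else ⟨0, by simp [hR0.le]⟩
  have hD : ∀ m z, z ∈ halfDisc r → (D m z : X) = d m z := fun m z hz => by simp [D, hz]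
  have hΨ : ∀ m z, z ∈ halfDisc r → (Ψ m z : ℂ) = ψ m z := fun m z hz => by simp [Ψ, hz]
  have pD : IsPresentation (fun _ : Fin (2 * k) => halfDisc r) D := by
    refine .of_isCompact (fun _ => isCompact_halfDisc r) (fun m => ?_) ?_
    · rw [Topology.IsInducing.subtypeVal.continuousOn_iff]
      exact (hd m).congr fun z hz => (hD m z hz)
    · rintro ⟨y, hy⟩
      obtain ⟨m, z, hz, rfl⟩ := mem_iUnion.1 hy
      exact ⟨m, z, hz, Subtype.ext (hD m z hz)⟩
  have pΨ : IsPresentation (fun _ : Fin (2 * k) => halfDisc r) Ψ := by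
    refine .of_isCompact (fun _ => isCompact_halfDisc r) (fun m => ?_) ?_
    · rw [Topology.IsInducing.subtypeVal.continuousOn_iff]
      refine ContinuousOn.congr ?_ fun z hz => hΨ m z hz
      exact continuousOn_const.mul ((continuousOn_root hk).mono inter_subset_left)
    · rintro ⟨w, hw⟩
      obtain ⟨m, hm, z, hz, e⟩ := ψsurj w hw
      exact ⟨⟨m, hm⟩, z, hz, Subtype.ext ((hΨ _ z hz).trans e)⟩
  obtain ⟨f, hf⟩ := pD.exists_homeomorph pΨ fun m n z hz w hw => by
    rw [Subtype.ext_iff, Subtype.ext_iff, hD m z hz, hD n w hw, hΨ m z hz, hΨ n w hw]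
    exact hker m m.2 n n.2 z hz w hw
  have hf' : ∀ m (hm : m < 2 * k) z (hz : z ∈ halfDisc r),
      (f ⟨d m z, hdK m hm z hz⟩ : ℂ) = ψ m z := fun m hm z hz => by
    have e := hf ⟨m, hm⟩ z hz
    rw [show D ⟨m, hm⟩ z = ⟨d m z, hdK m hm z hz⟩ from Subtype.ext (hD _ z hz)] at e
    rw [e, hΨ _ z hz]
  have hfx : (f ⟨x, hxK⟩ : ℂ) = 0 := by
    have := hf' 0 (by omega) 0 (zero_mem_halfDisc hr.le)
    simp only [hd0, ψ0] at this
    exact this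
  obtain ⟨φ, hφx, hφ⟩ := exists_chart_of_homeomorph f hKx (by rw [hfx]; simpa using hR0)
  refine ⟨φ, hφx, by rw [hφ x hxK, hfx], fun j z hz hzx => ?_⟩
  filter_upwards [hx j z hz hzx] with z' ⟨m, hm, w, hw, e, e'⟩
  rw [← e, hφ _ (hdK m hm w hw), hf' m hm w hw, ψpow, e']

section

variable {t : ℝ} {j : Fin 2}

/-! ### The surface with twist parameter `t` -/

lemma one_lt_circ (j : Fin 2) : 2 < circ j := by
  have := two_lt_longLen
  fin_cases j <;> simp [circ] <;> linarith

lemma one_le_len (e : Fin 3) : 1 ≤ len e := by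
  have := two_lt_longLen
  fin_cases e <;> simp [len] <;> linarith

lemma eq_zero_of_abs_lt {k : ℤ} {x : ℝ} (hx : 0 < x) (h : |(k : ℝ) * x| < x) : k = 0 := by
  rw [abs_mul, abs_of_pos hx] at h
  have h1 : |(k : ℝ)| < 1 := by
    by_contra hc; push Not at hc; nlinarith
  rw [← Int.cast_abs] at h1
  exact Int.abs_lt_one_iff.1 (by exact_mod_cast h1)

lemma halfOpen_cases {r : ℝ} {z : ℂ} (hz : z ∈ halfOpen r) :
    0 < z.im ∨ ∃ s : ℝ, 0 < s ∧ s ≤ r ∧ z = s := by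
  have h1 : (0 : ℝ) ≤ z.im := hz.1.1
  rcases h1.eq_or_lt with h | h
  · refine Or.inr ⟨z.re, ?_, ?_, Complex.ext rfl h.symm⟩
    · by_contra hc
      rcases (not_lt.1 hc).eq_or_lt with h' | h'
      · exact hz.2.1 (Complex.ext h' h.symm)
      · exact hz.2.2 ⟨h.symm, h'⟩
    · exact (Complex.re_le_norm z).trans (by simpa using hz.1.2)
  · exact Or.inl h

lemma im_le_of_mem_halfDisc {r : ℝ} {z : ℂ} (hz : z ∈ halfDisc r) : z.im ≤ r :=
  (Complex.im_le_norm z).trans (by simpa using hz.2)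

lemma abs_re_le_of_mem_halfDisc {r : ℝ} {z : ℂ} (hz : z ∈ halfDisc r) : |z.re| ≤ r :=
  (Complex.abs_re_le_norm z).trans (by simpa using hz.2)

lemma eventually_sub_mem_closedBall {s : Set ℂ} (z : ℂ) {r : ℝ} (hr : 0 < r) :
    ∀ᶠ z' in 𝓝[s] z, z' ∈ s ∧ z' - z ∈ Metric.closedBall (0 : ℂ) r := by
  filter_upwards [self_mem_nhdsWithin, nhdsWithin_le_nhds (Metric.closedBall_mem_nhds z hr)]
    with z' h1 h2
  exact ⟨h1, by simpa [dist_eq_norm] using h2⟩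

/-- The conclusion of the construction of charts: near `x`, the developing map is the `k`-th power
of a chart. -/
def HasChart (t : ℝ) (x : Model) (k : ℕ) : Prop :=
  ∃ φ : OpenPartialHomeomorph Model ℂ, x ∈ φ.source ∧ φ x = 0 ∧ ∀ j, ∀ z ∈ strip j, P t j z = x →
    ∀ᶠ z' in 𝓝[strip j] z, φ (P t j z') ^ k = z' - z

lemma hasChart_interior {c : ℂ} (h0 : 0 < c.im) (h1 : c.im < ht j) : HasChart t (P t j c) 1 := by
  obtain ⟨r, hr, hr1, hr2, hr3⟩ : ∃ r : ℝ, 0 < r ∧ r < c.im ∧ r < ht j - c.im ∧ r ≤ 1 / 2 := by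
    refine ⟨min (min c.im (ht j - c.im)) 1 / 2, ?_, ?_, ?_, ?_⟩
    · have : 0 < min (min c.im (ht j - c.im)) 1 := by
        simp only [lt_min_iff]; exact ⟨⟨h0, by linarith⟩, one_pos⟩
      linarith
    · have := (min_le_left (min c.im (ht j - c.im)) 1).trans (min_le_left _ _)
      linarith
    · have := (min_le_left (min c.im (ht j - c.im)) 1).trans (min_le_right _ _)
      linarith
    · have := min_le_right (min c.im (ht j - c.im)) 1
      linarith
  have him : ∀ (m : ℕ), ∀ z ∈ halfDisc r, 0 < (c + (-1) ^ m * z).im ∧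
      (c + (-1) ^ m * z).im < ht j := by
    intro m z hz
    have e1 := im_le_of_mem_halfDisc hz
    have e2 : (0 : ℝ) ≤ z.im := hz.1
    rcases neg_one_pow_eq_or ℂ m with hm | hm <;> rw [hm] <;> simp <;> constructor <;> linarith
  have hre : ∀ (m : ℕ), ∀ z ∈ halfDisc r, |(c + (-1) ^ m * z).re - c.re| ≤ 1 / 2 := by
    intro m z hz
    have e1 := abs_re_le_of_mem_halfDisc hz
    rcases neg_one_pow_eq_or ℂ m with hm | hm <;> rw [hm] <;> simp <;> linarith
  have key : ∀ m n : ℕ, ∀ z ∈ halfDisc r, ∀ w ∈ halfDisc r,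
      P t j (c + (-1) ^ m * z) = P t j (c + (-1) ^ n * w) → (-1) ^ m * z = (-1) ^ n * w := by
    intro m n z hz w hw h
    obtain ⟨q1, q2⟩ := him m z hz
    obtain ⟨q3, q4⟩ := him n w hw
    obtain ⟨-, k, hk⟩ := P_inj q1 q2 ⟨q3.le, q4.le⟩ h
    have hk0 : k = 0 := by
      refine eq_zero_of_abs_lt (circ_pos j) ?_
      have e : (c + (-1) ^ n * w).re = (c + (-1) ^ m * z).re + k * circ j := by
        rw [hk, Complex.add_re _ (_ * _)]; simp
      have a1 := abs_le.1 (hre m z hz)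
      have a2 := abs_le.1 (hre n w hw)
      have := one_lt_circ j
      rw [abs_lt]; constructor <;> linarith [a1.1, a1.2, a2.1, a2.2]
    rw [hk0] at hk
    simp only [Int.cast_zero, zero_mul, add_zero] at hk
    exact (add_left_cancel hk).symm
  refine exists_coneChart (isPresentation t) le_rfl hr (fun m z => P t j (c + (-1) ^ m * z))
    (fun m => ((continuous_P t j).comp (by fun_prop)).continuousOn) (fun m => by simp) ?_ ?_ ?_ ?_
  · intro m hm s _ _
    interval_cases m <;> simp
  · intro m hm z hz h
    have := key m 0 z hz.1 0 (zero_mem_halfDisc hr.le) (by simpa using h)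
    simp at this
    exact hz.2.1 this
  · intro m hm n hn z hz w hw h
    obtain ⟨rfl, he⟩ := eq_of_sign_mul_eq hz hw (key m n z hz.1 w hw.1 h)
    refine ⟨?_, rfl⟩
    interval_cases m <;> interval_cases n <;> first | rfl | (norm_num at he)
  · intro i z hz h
    obtain ⟨rfl, k, hk⟩ := P_inj h0 h1 hz h.symm
    filter_upwards [eventually_sub_mem_closedBall z hr] with z' ⟨_, hz'⟩
    have e : z' = (c + (z' - z)) + k * circ i := by rw [hk]; ring
    rcases le_total 0 (z' - z).im with hi | hi
    · refine ⟨0, by norm_num, z' - z, ⟨hi, hz'⟩, ?_, by simp⟩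
      conv_rhs => rw [e, P_add]
      simp
    · refine ⟨1, by norm_num, -(z' - z), ⟨by simpa using hi, by simpa [norm_sub_rev] using hz'⟩, ?_,
        by simp⟩
      conv_rhs => rw [e, P_add]
      simp

lemma upperPt_add (e : Fin 3) (s x : ℝ) : upperPt e s + x = upperPt e (s + x) := by
  simp [upperPt]; ring

lemma lowerPt_add (t : ℝ) (e : Fin 3) (s x : ℝ) : lowerPt t e s + x = lowerPt t e (s + x) := by
  simp [lowerPt]; ring

lemma im_upperPt (e : Fin 3) (s : ℝ) : (upperPt e s).im = 0 := by simp [upperPt]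

lemma im_lowerPt (e : Fin 3) (s : ℝ) : (lowerPt t e s).im = ht (loBand e) := by
  simp [lowerPt, topPt]

lemma re_upperPt (e : Fin 3) (s : ℝ) : (upperPt e s).re = upPos e + s := by simp [upperPt]

lemma re_lowerPt (e : Fin 3) (s : ℝ) :
    (lowerPt t e s).re = sh t (loBand e) + (loPos e + s) := by
  simp [lowerPt, topPt]

/-- The strip that contains the half-disc number `m` at a point of an edge: above the edge `e` if
`m` is even, below it if `m` is odd. -/
def sideBand (m : ℕ) (e : Fin 3) : Fin 2 := if Even m then upBand e else loBand e

/-- The position in its strip of the centre of the half-disc number `m` at the point `s` of the edge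
`e`. -/
def sidePt (t : ℝ) (m : ℕ) (e : Fin 3) (s : ℝ) : ℂ :=
  if Even m then upperPt e s else lowerPt t e s

/-- The half-disc above (`m` even) or below (`m` odd) the point `s` of the edge `e`. -/
def sideDisc (t : ℝ) (m : ℕ) (e : Fin 3) (s : ℝ) (z : ℂ) : Model :=
  P t (sideBand m e) (sidePt t m e s + (-1) ^ m * z)

lemma continuous_sideDisc (m : ℕ) (e : Fin 3) (s : ℝ) : Continuous (sideDisc t m e s) := by
  have : Continuous fun z : ℂ => sidePt t m e s + (-1) ^ m * z := by fun_prop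
  exact (continuous_P t _).comp this

lemma sideDisc_real {m : ℕ} {e : Fin 3} {s x : ℝ} (h0 : 0 ≤ s + (-1) ^ m * x)
    (h1 : s + (-1) ^ m * x ≤ len e) : sideDisc t m e s x = E e (s + (-1) ^ m * x) := by
  rcases Nat.even_or_odd m with hm | hm
  · rw [hm.neg_one_pow, one_mul]
    rw [sideDisc, sideBand, sidePt, if_pos hm, if_pos hm, hm.neg_one_pow, one_mul, upperPt_add,
      P_upper]
  · have hm' := Nat.not_even_iff_odd.2 hm
    rw [hm.neg_one_pow] at h0 h1 ⊢
    rw [sideDisc, sideBand, sidePt, if_neg hm', if_neg hm', hm.neg_one_pow, neg_one_mul,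
      ← Complex.ofReal_neg, lowerPt_add, P_lower (by linarith) (by linarith), neg_one_mul]

lemma sideDisc_im {m : ℕ} {e : Fin 3} {s : ℝ} {z : ℂ} {r : ℝ} (hr : r < 7 / 10)
    (hz : z ∈ halfDisc r) (h0 : 0 < z.im) : 0 < (sidePt t m e s + (-1) ^ m * z).im ∧
      (sidePt t m e s + (-1) ^ m * z).im < ht (sideBand m e) := by
  have h1 := im_le_of_mem_halfDisc hz
  have h2 := lt_ht (sideBand m e)
  rcases Nat.even_or_odd m with hm | hm
  · rw [sidePt, if_pos hm, hm.neg_one_pow, one_mul, Complex.add_im, im_upperPt]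
    constructor <;> linarith
  · have hm' := Nat.not_even_iff_odd.2 hm
    rw [sidePt, if_neg hm', hm.neg_one_pow, neg_one_mul, Complex.add_im, im_lowerPt,
      Complex.neg_im, sideBand, if_neg hm'] at *
    constructor <;> linarith

/-- Two half-discs of a small radius at the points of the edges do not overlap. -/
lemma sideDisc_inj {m n : ℕ} {e e' : Fin 3} {s : ℝ} {z w : ℂ} {r : ℝ}
    (hr1 : r ≤ 1 / 4)
    (hz : z ∈ halfDisc r) (hw : w ∈ halfDisc r) (hz0 : 0 < z.im) (hw0 : 0 < w.im)
    (h : sideDisc t m e s z = sideDisc t n e' s w) : (Even m ↔ Even n) ∧ e = e' ∧ z = w := by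
  obtain ⟨q1, q2⟩ := sideDisc_im (t := t) (m := m) (e := e) (s := s) (by linarith) hz hz0
  obtain ⟨q3, q4⟩ := sideDisc_im (t := t) (m := n) (e := e') (s := s) (by linarith) hw hw0
  obtain ⟨hb, k, hk⟩ := P_inj q1 q2 ⟨q3.le, q4.le⟩ h
  have i1 := im_le_of_mem_halfDisc hz
  have i2 := im_le_of_mem_halfDisc hw
  have r1 := abs_le.1 (abs_re_le_of_mem_halfDisc hz)
  have r2 := abs_le.1 (abs_re_le_of_mem_halfDisc hw)
  have kim : ((k : ℂ) * (circ (sideBand m e) : ℂ)).im = 0 := by simp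
  have kre : ((k : ℂ) * (circ (sideBand m e) : ℂ)).re = k * circ (sideBand m e) := by simp
  have e1 := congrArg Complex.im hk
  have e2 := congrArg Complex.re hk
  have l1 := lt_ht (loBand e)
  have l2 := lt_ht (loBand e')
  have hL := two_lt_longLen
  rw [Complex.add_im, Complex.add_im, Complex.add_im, kim] at e1
  rw [Complex.add_re, Complex.add_re, Complex.add_re, kre] at e2
  have par : Even m ↔ Even n := by
    rcases Nat.even_or_odd m with hm | hm <;> rcases Nat.even_or_odd n with hn | hn
    · simp [hm, hn]
    · have hn' := Nat.not_even_iff_odd.2 hn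
      rw [sidePt, sidePt, if_pos hm, if_neg hn', im_upperPt, im_lowerPt, hm.neg_one_pow,
        hn.neg_one_pow] at e1
      simp at e1; linarith
    · have hm' := Nat.not_even_iff_odd.2 hm
      rw [sidePt, sidePt, if_pos hn, if_neg hm', im_upperPt, im_lowerPt, hm.neg_one_pow,
        hn.neg_one_pow] at e1
      simp at e1; linarith
    · simp [Nat.not_even_iff_odd.2 hm, Nat.not_even_iff_odd.2 hn]
  refine ⟨par, ?_⟩
  have hee : e = e' ∧ k = 0 := by
    rcases Nat.even_or_odd m with hm | hm
    · have hn := par.1 hm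
      rw [sideBand, sideBand, if_pos hm, if_pos hn] at hb
      rw [sidePt, sidePt, if_pos hm, if_pos hn, re_upperPt, re_upperPt, hm.neg_one_pow,
        hn.neg_one_pow, sideBand, if_pos hm] at e2
      simp only [one_mul] at e2
      have hk0 : k = 0 := by
        refine eq_zero_of_abs_lt (circ_pos (upBand e)) ?_
        rw [abs_lt]
        revert hb e2
        fin_cases e <;> fin_cases e' <;> simp [upBand, upPos, circ] <;> intros <;>
          constructor <;> linarith [r1.1, r1.2, r2.1, r2.2]
      refine ⟨?_, hk0⟩
      subst hk0
      revert hb e2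
      fin_cases e <;> fin_cases e' <;> simp [upBand, upPos, circ] <;>
        linarith [r1.1, r1.2, r2.1, r2.2]
    · have hm' := Nat.not_even_iff_odd.2 hm
      have hn' : ¬ Even n := fun hn => hm' (par.2 hn)
      have hn := Nat.not_even_iff_odd.1 hn'
      rw [sideBand, sideBand, if_neg hm', if_neg hn'] at hb
      rw [sidePt, sidePt, if_neg hm', if_neg hn', re_lowerPt, re_lowerPt, hm.neg_one_pow,
        hn.neg_one_pow, sideBand, if_neg hm', hb] at e2
      simp only [neg_one_mul, Complex.neg_re] at e2
      have hk0 : k = 0 := by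
        refine eq_zero_of_abs_lt (circ_pos (loBand e)) ?_
        rw [abs_lt]
        revert hb e2
        fin_cases e <;> fin_cases e' <;> simp [loBand, loPos, circ] <;> intros <;>
          constructor <;> linarith [r1.1, r1.2, r2.1, r2.2]
      refine ⟨?_, hk0⟩
      subst hk0
      revert hb e2
      fin_cases e <;> fin_cases e' <;> simp [loBand, loPos, circ] <;>
        linarith [r1.1, r1.2, r2.1, r2.2]
  obtain ⟨rfl, rfl⟩ := hee
  refine ⟨rfl, ?_⟩
  simp only [Int.cast_zero, zero_mul, add_zero] at hk
  rcases Nat.even_or_odd m with hm | hm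
  · have hn := par.1 hm
    rw [sidePt, sidePt, if_pos hm, if_pos hn, hm.neg_one_pow, hn.neg_one_pow] at hk
    simpa using hk.symm
  · have hm' := Nat.not_even_iff_odd.2 hm
    have hn' : ¬ Even n := fun hn => hm' (par.2 hn)
    rw [sidePt, sidePt, if_neg hm', if_neg hn', hm.neg_one_pow,
      (Nat.not_even_iff_odd.1 hn').neg_one_pow] at hk
    simpa using hk.symm

lemma sideDisc_ne_E {m : ℕ} {e e' : Fin 3} {s s' : ℝ} {z : ℂ} {r : ℝ} (hr : r < 7 / 10)
    (hz : z ∈ halfDisc r) (h0 : 0 < z.im) : sideDisc t m e s z ≠ E e' s' := by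
  obtain ⟨q1, q2⟩ := sideDisc_im (t := t) (m := m) (e := e) (s := s) hr hz h0
  exact P_ne_E q1 q2 _ _

lemma sideDisc_of_upper {e : Fin 3} {s : ℝ} {k : ℤ} {m : ℕ} (hm : Even m) {z z' : ℂ}
    (hz : z = upperPt e s + k * circ (upBand e)) :
    sideDisc t m e s (z' - z) = P t (upBand e) z' := by
  rw [sideDisc, sideBand, sidePt, if_pos hm, if_pos hm, hm.neg_one_pow, one_mul]
  rw [show upperPt e s + (z' - z) = z' + (-k : ℤ) * circ (upBand e) by rw [hz]; push_cast; ring,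
    P_add]

lemma sideDisc_of_lower {e : Fin 3} {s : ℝ} {k : ℤ} {m : ℕ} (hm : Odd m) {z z' : ℂ}
    (hz : z = lowerPt t e s + k * circ (loBand e)) :
    sideDisc t m e s (-(z' - z)) = P t (loBand e) z' := by
  have hm' := Nat.not_even_iff_odd.2 hm
  rw [sideDisc, sideBand, sidePt, if_neg hm', if_neg hm', hm.neg_one_pow]
  rw [show lowerPt t e s + -1 * -(z' - z) = z' + (-k : ℤ) * circ (loBand e) by
    rw [hz]; push_cast; ring, P_add]

lemma sub_mem_halfDisc_of_upper {e : Fin 3} {s : ℝ} {k : ℤ} {z z' : ℂ} {r : ℝ}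
    (hz : z = upperPt e s + k * circ (upBand e)) (hz' : z' ∈ strip (upBand e))
    (h : z' - z ∈ Metric.closedBall (0 : ℂ) r) : z' - z ∈ halfDisc r := by
  refine ⟨?_, h⟩
  have : z.im = 0 := by rw [hz]; simp [im_upperPt]
  simp only [mem_ofPred_eq, Complex.sub_im, this, sub_zero]
  exact hz'.1

lemma neg_sub_mem_halfDisc_of_lower {e : Fin 3} {s : ℝ} {k : ℤ} {z z' : ℂ} {r : ℝ}
    (hz : z = lowerPt t e s + k * circ (loBand e)) (hz' : z' ∈ strip (loBand e))
    (h : z' - z ∈ Metric.closedBall (0 : ℂ) r) : -(z' - z) ∈ halfDisc r := by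
  refine ⟨?_, by simpa [norm_sub_rev] using h⟩
  have : z.im = ht (loBand e) := by rw [hz]; simp [im_lowerPt]
  simp only [mem_ofPred_eq, Complex.neg_im, Complex.sub_im, this]
  linarith [hz'.2]

lemma hasChart_edge {e : Fin 3} {s : ℝ} (h0 : 0 < s) (h1 : s < len e) : HasChart t (E e s) 1 := by
  obtain ⟨r, hr, hr1, hr2, hr3⟩ : ∃ r : ℝ, 0 < r ∧ r < s ∧ r < len e - s ∧ r ≤ 1 / 4 := by
    refine ⟨min (min s (len e - s)) 1 / 4, ?_, ?_, ?_, ?_⟩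
    · have : 0 < min (min s (len e - s)) 1 := by
        simp only [lt_min_iff]; exact ⟨⟨h0, by linarith⟩, one_pos⟩
      linarith
    · have := (min_le_left (min s (len e - s)) 1).trans (min_le_left _ _)
      linarith
    · have := (min_le_left (min s (len e - s)) 1).trans (min_le_right _ _)
      linarith
    · have := min_le_right (min s (len e - s)) 1
      linarith
  have hreal : ∀ m : ℕ, ∀ x : ℝ, |x| ≤ r → 0 < s + (-1) ^ m * x ∧ s + (-1) ^ m * x < len e := by
    intro m x hx
    have := abs_le.1 hx
    rcases neg_one_pow_eq_or ℝ m with hm | hm <;> rw [hm] <;> constructor <;>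
      linarith [this.1, this.2]
  have hE : ∀ m : ℕ, ∀ x : ℝ, |x| ≤ r → sideDisc t m e s x = E e (s + (-1) ^ m * x) := by
    intro m x hx
    obtain ⟨q1, q2⟩ := hreal m x hx
    exact sideDisc_real q1.le q2.le
  have h00 : ∀ m, sideDisc t m e s 0 = E e s := fun m => by
    have := hE m 0 (by simpa using hr.le)
    simpa using this
  refine exists_coneChart (isPresentation t) le_rfl hr (fun m => sideDisc t m e s)
    (fun m => (continuous_sideDisc m e s).continuousOn) h00 ?_ ?_ ?_ ?_
  · intro m hm x hx hxr
    have e1 := hE m (-x) (by rwa [abs_neg, abs_of_nonneg hx])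
    have e2 := hE ((m + 1) % 2) x (by rwa [abs_of_nonneg hx])
    rw [Complex.ofReal_neg] at e1
    rw [e1, mul_one, e2]
    interval_cases m <;> simp
  · intro m hm z hz h
    rcases halfOpen_cases hz with hi | ⟨x, hx, hxr, rfl⟩
    · exact sideDisc_ne_E (by linarith) hz.1 hi h
    · have hxr' : |x| ≤ r := by rwa [abs_of_pos hx]
      obtain ⟨q1, q2⟩ := hreal m x hxr'
      rw [hE m x hxr'] at h
      have := (E_inj q1 q2 h0.le h1.le h).2
      rcases neg_one_pow_eq_or ℝ m with hm | hm <;> rw [hm] at this <;> linarith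
  · intro m hm n hn z hz w hw h
    rcases halfOpen_cases hz with hi | ⟨x, hx, hxr, rfl⟩ <;>
      rcases halfOpen_cases hw with hi' | ⟨y, hy, hyr, rfl⟩
    · obtain ⟨par, -, rfl⟩ := sideDisc_inj hr3 hz.1 hw.1 hi hi' h
      refine ⟨?_, rfl⟩
      interval_cases m <;> interval_cases n <;> simp at par ⊢
    · rw [hE n y (by rwa [abs_of_pos hy])] at h
      exact absurd h (sideDisc_ne_E (by linarith) hz.1 hi)
    · rw [hE m x (by rwa [abs_of_pos hx])] at h
      exact absurd h.symm (sideDisc_ne_E (by linarith) hw.1 hi')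
    · have hxr' : |x| ≤ r := by rwa [abs_of_pos hx]
      have hyr' : |y| ≤ r := by rwa [abs_of_pos hy]
      obtain ⟨q1, q2⟩ := hreal m x hxr'
      obtain ⟨q3, q4⟩ := hreal n y hyr'
      rw [hE m x hxr', hE n y hyr'] at h
      have := (E_inj q1 q2 q3.le q4.le h).2
      interval_cases m <;> interval_cases n <;> simp at this ⊢ <;> linarith
  · intro i z hz h
    rcases P_eq_E hz h0 h1 h with ⟨k, rfl, hk⟩ | ⟨k, rfl, hk⟩
    · filter_upwards [eventually_sub_mem_closedBall z hr] with z' ⟨hs, hz'⟩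
      exact ⟨0, by norm_num, z' - z, sub_mem_halfDisc_of_upper hk hs hz',
        sideDisc_of_upper (by simp) hk, by simp⟩
    · filter_upwards [eventually_sub_mem_closedBall z hr] with z' ⟨hs, hz'⟩
      exact ⟨1, by norm_num, -(z' - z), neg_sub_mem_halfDisc_of_lower hk hs hz',
        sideDisc_of_lower (by simp) hk, by simp⟩

/-- The six half-discs at the vertex, in their cyclic order, are above and below, alternately, the
starts of these edges. -/
def vertexEdge (m : ℕ) : Fin 3 := (![0, 2, 2, 1, 1, 0] : Fin 6 → Fin 3) (Fin.ofNat 6 m)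

/-- The edge whose end is, on the same side, at the start of the edge `vertexEdge m`. -/
def vertexPred (m : ℕ) : Fin 3 := (![2, 2, 0, 0, 1, 1] : Fin 6 → Fin 3) (Fin.ofNat 6 m)

lemma sideDisc_vertex_pos {m : ℕ} {x : ℝ} (h0 : 0 ≤ x) (h1 : x ≤ 1) :
    sideDisc t m (vertexEdge m) 0 ((((-1) ^ m * x : ℝ)) : ℂ) = E (vertexEdge m) x := by
  have e : (0 : ℝ) + (-1) ^ m * ((-1) ^ m * x) = x := by
    rw [← mul_assoc, ← mul_pow]; norm_num
  have := one_le_len (vertexEdge m)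
  rw [sideDisc_real (by rw [e]; exact h0) (by rw [e]; linarith), e]

lemma sideDisc_vertex_neg {m : ℕ} (hm : m < 6) {x : ℝ} (h0 : 0 ≤ x) (h1 : x ≤ 1) :
    sideDisc t m (vertexEdge m) 0 ((-((-1) ^ m * x) : ℝ) : ℂ) =
      E (vertexPred m) (len (vertexPred m) - x) := by
  have h2 := one_le_len (vertexPred m)
  have key : sidePt t m (vertexEdge m) 0 + (-1) ^ m * ((-((-1) ^ m * x) : ℝ) : ℂ) =
      sidePt t m (vertexPred m) (len (vertexPred m) - x) +
        (if (m = 0 ∨ m = 1 ∨ m = 4 ∨ m = 5) then (-1 : ℤ) else 0) * circ (sideBand m (vertexPred m))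
      ∧ sideBand m (vertexEdge m) = sideBand m (vertexPred m) := by
    interval_cases m <;>
      simp [sidePt, sideBand, vertexEdge, vertexPred, upperPt, lowerPt, topPt, upBand, loBand,
        upPos, loPos, len, circ, Fin.ofNat, Nat.even_iff] <;> ring
  rw [sideDisc, key.1, key.2, P_add]
  rcases Nat.even_or_odd m with hm | hm
  · rw [sideBand, sidePt, if_pos hm, if_pos hm, P_upper]
  · have hm' := Nat.not_even_iff_odd.2 hm
    rw [sideBand, sidePt, if_neg hm', if_neg hm', P_lower (by linarith) (by linarith)]

/-- The vertex has cone angle `6π`: the six half discs at the ends of the sides of the cylinders,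
consecutive ones sharing a radius, form a chart. -/
lemma hasChart_vertex : HasChart t vertex 3 := by
  have hpos : ∀ m < 6, ∀ x : ℝ, 0 ≤ x → x ≤ 1 / 4 → sideDisc t m (vertexEdge m) 0 x =
      if Even m then E (vertexEdge m) x else E (vertexPred m) (len (vertexPred m) - x) := by
    intro m hm x h0 h1
    split_ifs with he
    · have := sideDisc_vertex_pos (t := t) (m := m) h0 (by linarith)
      rwa [he.neg_one_pow, one_mul] at this
    · have := sideDisc_vertex_neg (t := t) hm h0 (by linarith)
      rwa [(Nat.not_even_iff_odd.1 he).neg_one_pow, neg_one_mul, neg_neg] at this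
  have hneg : ∀ m < 6, ∀ x : ℝ, 0 ≤ x → x ≤ 1 / 4 → sideDisc t m (vertexEdge m) 0 (-x) =
      if Even m then E (vertexPred m) (len (vertexPred m) - x) else E (vertexEdge m) x := by
    intro m hm x h0 h1
    split_ifs with he
    · have := sideDisc_vertex_neg (t := t) hm h0 (by linarith)
      rwa [he.neg_one_pow, one_mul, Complex.ofReal_neg] at this
    · have := sideDisc_vertex_pos (t := t) (m := m) h0 (by linarith)
      rwa [(Nat.not_even_iff_odd.1 he).neg_one_pow, neg_one_mul, Complex.ofReal_neg] at this
  have h00 : ∀ m, sideDisc t m (vertexEdge m) 0 0 = vertex := fun m => by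
    have := sideDisc_vertex_pos (t := t) (m := m) le_rfl zero_le_one
    rw [mul_zero, Complex.ofReal_zero, E_zero] at this
    exact this
  have hr : (0 : ℝ) < 1 / 4 := by norm_num
  refine exists_coneChart (isPresentation t) (by norm_num) hr
    (fun m => sideDisc t m (vertexEdge m) 0)
    (fun m => (continuous_sideDisc m _ 0).continuousOn) h00 ?_ ?_ ?_ ?_
  · intro m hm x hx hxr
    rw [hneg m hm x hx hxr, hpos _ (Nat.mod_lt _ (by norm_num)) x hx hxr]
    interval_cases m <;> simp [vertexEdge, vertexPred, Nat.even_iff, Fin.ofNat]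
  · intro m hm z hz h
    rcases halfOpen_cases hz with hi | ⟨x, hx, hxr, rfl⟩
    · rw [← E_zero 0] at h
      exact sideDisc_ne_E (by norm_num) hz.1 hi h
    · rw [hpos m hm x hx.le hxr] at h
      have h1 := one_le_len (vertexEdge m)
      have h2 := one_le_len (vertexPred m)
      split_ifs at h
      · exact E_ne_vertex hx (by linarith) h
      · exact E_ne_vertex (by linarith) (by linarith) h
  · intro m hm n hn z hz w hw h
    rcases halfOpen_cases hz with hi | ⟨x, hx, hxr, rfl⟩ <;>
      rcases halfOpen_cases hw with hi' | ⟨y, hy, hyr, rfl⟩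
    · obtain ⟨par, he, rfl⟩ := sideDisc_inj le_rfl hz.1 hw.1 hi hi' h
      refine ⟨?_, rfl⟩
      have : ∀ m < 6, ∀ n < 6, (Even m ↔ Even n) → vertexEdge m = vertexEdge n → m = n := by
        decide
      exact this m hm n hn par he
    · rw [hpos n hn y hy.le hyr] at h
      split_ifs at h <;> exact absurd h (sideDisc_ne_E (by norm_num) hz.1 hi)
    · rw [hpos m hm x hx.le hxr] at h
      split_ifs at h <;> exact absurd h.symm (sideDisc_ne_E (by norm_num) hw.1 hi')
    · rw [hpos m hm x hx.le hxr, hpos n hn y hy.le hyr] at h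
      have l1 := one_le_len (vertexEdge m)
      have l2 := one_le_len (vertexPred m)
      have l3 := one_le_len (vertexEdge n)
      have l4 := one_le_len (vertexPred n)
      split_ifs at h with hem hen hen
      · obtain ⟨q1, q2⟩ := E_inj hx (by linarith) hy.le (by linarith) h
        have : ∀ m < 6, ∀ n < 6, Even m → Even n → vertexEdge n = vertexEdge m → m = n := by
          decide
        exact ⟨this m hm n hn hem hen q1, by rw [q2]⟩
      · obtain ⟨q1, q2⟩ := E_inj hx (by linarith) (by linarith) (by linarith) h
        linarith
      · obtain ⟨q1, q2⟩ := E_inj (by linarith) (by linarith) hy.le (by linarith) h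
        linarith
      · obtain ⟨q1, q2⟩ := E_inj (by linarith) (by linarith) (by linarith) (by linarith) h
        have : ∀ m < 6, ∀ n < 6, ¬ Even m → ¬ Even n → vertexPred n = vertexPred m → m = n := by
          decide
        refine ⟨this m hm n hn hem hen q1, ?_⟩
        rw [q1] at q2
        rw [show x = y by linarith]
  · intro i z hz h
    rcases P_eq_vertex hz h with ⟨e, k, rfl, hk⟩ | ⟨e, k, rfl, hk⟩
    · obtain ⟨m, hm, hme, rfl⟩ : ∃ m < 6, Even m ∧ vertexEdge m = e := by
        clear hk hz h
        revert e; decide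
      filter_upwards [eventually_sub_mem_closedBall z hr] with z' ⟨hs, hz'⟩
      exact ⟨m, hm, z' - z, sub_mem_halfDisc_of_upper hk hs hz',
        sideDisc_of_upper hme hk, by simp [hme.neg_one_pow]⟩
    · obtain ⟨m, hm, hme, rfl⟩ : ∃ m < 6, Odd m ∧ vertexEdge m = e := by
        clear hk hz h
        revert e; decide
      filter_upwards [eventually_sub_mem_closedBall z hr] with z' ⟨hs, hz'⟩
      exact ⟨m, hm, -(z' - z), neg_sub_mem_halfDisc_of_lower hk hs hz',
        sideDisc_of_lower hme hk, by simp [hme.neg_one_pow]⟩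

lemma exists_hasChart (t : ℝ) (x : Model) :
    ∃ k, 1 ≤ k ∧ HasChart t x k ∧ (x = vertex → k = 3) ∧ (x ≠ vertex → k = 1) := by
  rcases model_cases t x with ⟨j, z, h0, h1, rfl⟩ | ⟨e, s, h0, h1, rfl⟩ | rfl
  · exact ⟨1, le_rfl, hasChart_interior h0 h1, fun h => absurd h (P_ne_vertex h0 h1), fun _ => rfl⟩
  · exact ⟨1, le_rfl, hasChart_edge h0 h1, fun h => absurd h (E_ne_vertex h0 h1), fun _ => rfl⟩
  · exact ⟨3, by norm_num, hasChart_vertex, fun _ => rfl, fun h => absurd rfl h⟩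

/-- The cone angle of a point of the model, divided by `2π`. -/
def mult (t : ℝ) (x : Model) : ℕ := (exists_hasChart t x).choose

lemma mult_spec (t : ℝ) (x : Model) : 1 ≤ mult t x ∧ HasChart t x (mult t x) ∧
    (x = vertex → mult t x = 3) ∧ (x ≠ vertex → mult t x = 1) := (exists_hasChart t x).choose_spec

/-- A chart at a point of the model. -/
def chart (t : ℝ) (x : Model) : OpenPartialHomeomorph Model ℂ := (mult_spec t x).2.1.choose

lemma chart_spec (t : ℝ) (x : Model) : x ∈ (chart t x).source ∧ chart t x x = 0 ∧
    ∀ j, ∀ z ∈ strip j, P t j z = x →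
      ∀ᶠ z' in 𝓝[strip j] z, chart t x (P t j z') ^ mult t x = z' - z :=
  (mult_spec t x).2.1.choose_spec

/-- The fibres of a presentation with compact pieces depend upper semicontinuously on the point. -/
lemma eventually_forall_mem_of_isCompact {ι X : Type*} [Finite ι] [TopologicalSpace X] [T2Space X]
    {dom : ι → Set ℂ} {P : ι → ℂ → X} (hc : ∀ j, IsCompact (dom j))
    (hP : ∀ j, ContinuousOn (P j) (dom j)) {x : X} {p : ι → ℂ → Prop}
    (hp : ∀ j, ∀ z ∈ dom j, P j z = x → ∀ᶠ z' in 𝓝[dom j] z, p j z') :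
    ∀ᶠ y in 𝓝 x, ∀ j, ∀ z ∈ dom j, P j z = y → p j z := by
  refine eventually_all.2 fun j => ?_
  set C : Set ℂ := dom j ∩ closure {z ∈ dom j | ¬ p j z} with hC
  have hCc : IsCompact C := (hc j).inter_right isClosed_closure
  have hcl : IsClosed (P j '' C) := (hCc.image_of_continuousOn
    ((hP j).mono inter_subset_left)).isClosed
  have hx : x ∉ P j '' C := by
    rintro ⟨z, ⟨hz, hzc⟩, rfl⟩
    have h1 := hp j z hz rfl
    rw [mem_closure_iff_frequently] at hzc
    rw [eventually_nhdsWithin_iff] at h1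
    exact hzc (h1.mono fun w hw hw' => hw'.2 (hw hw'.1))
  filter_upwards [hcl.isOpen_compl.mem_nhds hx] with y hy z hz hzy
  by_contra hcon
  exact hy ⟨z, ⟨hz, subset_closure ⟨hz, hcon⟩⟩, hzy⟩

/-- The translation surface glued from two horizontal cylinders, with twist parameter `t`: as `t`
grows by `1`, the gluing of the top of the cylinder number `0` with its bottom is turned by `1`, and
the gluing of the top of the cylinder number `1` is turned by `-1`. -/
def surf (t : ℝ) : TranslationSurface where
  carrier := Model
  dev x y := chart t x y ^ mult t x
  exists_chart x := ⟨mult t x, (mult_spec t x).1, chart t x, (chart_spec t x).1,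
    (chart_spec t x).2.1, fun _ _ => rfl⟩
  dev_translation x := by
    have key : ∀ᶠ q in 𝓝 x, ∀ j, ∀ z ∈ box t j, P t j z = q → ∀ᶠ z' in 𝓝[strip j] z,
        chart t x (P t j z') ^ mult t x - chart t x (P t j z) ^ mult t x = z' - z := by
      refine eventually_forall_mem_of_isCompact (isCompact_box t)
        (fun j => (continuous_P t j).continuousOn) fun j z hz hzx => ?_
      have h1 := (chart_spec t x).2.2 j z (box_subset t j hz) hzx
      have h2 := eventually_eventually_nhdsWithin.2 h1
      refine Eventually.filter_mono (nhdsWithin_mono _ (box_subset t j)) ?_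
      filter_upwards [h1, h2] with z' e1 e2
      filter_upwards [e2] with z'' e3
      rw [e1, e3]; ring
    filter_upwards [key] with q hq
    refine (isPresentation_box t).eventually fun j z hz hzq => ?_
    have h1 := hq j z hz hzq
    have h2 := (chart_spec t q).2.2 j z (box_subset t j hz) hzq
    refine Eventually.filter_mono (nhdsWithin_mono _ (box_subset t j)) ?_
    filter_upwards [h1, h2] with z' e1 e2
    rw [e2, ← e1, hzq]

lemma isPresentation_surf (t : ℝ) : IsPresentation (X := surf t) strip (P t) := isPresentation t

lemma develops_surf (t : ℝ) : Develops (surf t) strip (P t) (fun _ z => z) := fun j z hz =>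
  (chart_spec t (P t j z)).2.2 j z hz rfl

lemma hasConeAngle_surf (t : ℝ) (x : surf t) : (surf t).HasConeAngle x (mult t x) :=
  ⟨(mult_spec t x).1, chart t x, (chart_spec t x).1, (chart_spec t x).2.1, fun _ _ => rfl⟩

lemma hasConeAngle_vertex (t : ℝ) : (surf t).HasConeAngle vertex 3 := by
  have := hasConeAngle_surf t vertex
  rwa [(mult_spec t vertex).2.2.1 rfl] at this

lemma isRegular_surf {x : surf t} (hx : x ≠ vertex) : (surf t).IsRegular x := by
  have := hasConeAngle_surf t x
  rwa [(mult_spec t x).2.2.2 hx] at this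

lemma isSingular_surf_iff {x : surf t} : (surf t).IsSingular x ↔ x = vertex := by
  refine ⟨fun h => ?_, fun h => ⟨3, by norm_num, h ▸ hasConeAngle_vertex t⟩⟩
  by_contra hx
  exact h.not_isRegular (isRegular_surf hx)

end

section

variable {t : ℝ} {j : Fin 2}

/-! ### Horizontal segments and the short saddle connection -/

/-- The part of length `l` of the edge `e` that starts at the point `s₀`. -/
def seg (t : ℝ) (e : Fin 3) (s₀ l : ℝ) : C(I, surf t) :=
  ⟨fun s => E e (s₀ + s * l), (continuous_E e).comp (by fun_prop)⟩

@[simp] lemma seg_apply (e : Fin 3) (s₀ l : ℝ) (s : I) : seg t e s₀ l s = E e (s₀ + s * l) := rfl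

lemma seg_zero (t : ℝ) (e : Fin 3) (l : ℝ) : seg t e 0 l 0 = vertex := by
  have : E e (0 + ((0 : I) : ℝ) * l) = vertex := by simpa using E_zero e
  exact this

lemma seg_short_one (t : ℝ) : seg t 0 0 1 1 = vertex := by
  have : E 0 (0 + ((1 : I) : ℝ) * 1) = vertex := by simpa [len] using E_len 0
  exact this

/-- A path that is straight in the coordinates of a strip is straight. -/
lemma eventually_dev_of_strip {c : I → ℂ} (hc : Continuous c) (hs : ∀ s, c s ∈ strip j) (s : I) :
    ∀ᶠ s' in 𝓝 s, (surf t).dev (P t j (c s)) (P t j (c s')) = c s' - c s := by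
  have h1 := develops_surf t j (c s) (hs s)
  have h2 : Tendsto c (𝓝 s) (𝓝[strip j] (c s)) :=
    tendsto_nhdsWithin_iff.2 ⟨hc.continuousAt, Eventually.of_forall hs⟩
  exact h2.eventually h1

lemma isSegment_seg (t : ℝ) {e : Fin 3} {s₀ l : ℝ} (h0 : 0 ≤ s₀) (hl : 0 < l) (h1 : s₀ + l ≤ len e) :
    (surf t).IsSegment (seg t e s₀ l) l where
  ne_zero := by exact_mod_cast hl.ne'
  straight s := by
    have hc : Continuous fun s : I => upperPt e (s₀ + s * l) := by
      unfold upperPt; fun_prop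
    filter_upwards [eventually_dev_of_strip (t := t) hc (fun s => upperPt_mem e _) s] with s' h
    simp only [P_upper] at h
    rw [seg_apply, seg_apply, h]
    simp only [upperPt]
    push_cast
    ring
  regular s hs0 hs1 := by
    have hs0' : (0 : ℝ) < s := hs0
    have hs1' : (s : ℝ) < 1 := hs1
    exact isRegular_surf (E_ne_vertex (by positivity) (by nlinarith))

/-- A segment of length one that starts at the vertex runs along an edge: the three edges account
for the three horizontal directions to the right at a point of angle `6π`. -/
lemma eq_seg_of_isSegment {c : C(I, surf t)} (hc : (surf t).IsSegment c 1) (h0 : c 0 = vertex) :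
    ∃ e, c = seg t e 0 1 := by
  have hseg : ∀ e, (surf t).IsSegment (seg t e 0 1) 1 := fun e => by
    have := isSegment_seg t (e := e) le_rfl one_pos (by simpa using one_le_len e)
    simpa using this
  obtain ⟨-, φ, hφ, -, hφ3⟩ := hasConeAngle_vertex t
  have hsrc : ∀ c : C(I, surf t), c 0 = vertex → (surf t).IsSegment c 1 →
      ∀ᶠ s in 𝓝 (0 : I), c s ∈ φ.source ∧ φ (c s) ^ 3 = (s : ℝ) := by
    intro c h0 hc
    have h1 := hc.straight 0
    have h2 : ∀ᶠ s in 𝓝 (0 : I), c s ∈ φ.source :=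
      c.continuous.continuousAt.eventually_mem (φ.open_source.mem_nhds (by rwa [h0]))
    filter_upwards [h1, h2] with s e1 e2
    refine ⟨e2, ?_⟩
    rw [← hφ3 _ e2, ← h0, e1]
    simp
  have hE0 : ∀ e, seg t e 0 1 0 = vertex := fun e => seg_zero t e 1
  obtain ⟨s, hs0, hs1, ⟨m, e⟩, m0, m1, m2⟩ := exists_mem_Ioo_of_eventually
    ((hsrc c h0 hc).and ((hsrc _ (hE0 0) (hseg 0)).and
      ((hsrc _ (hE0 1) (hseg 1)).and (hsrc _ (hE0 2) (hseg 2)))))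
  have hs0' : (0 : ℝ) < s := hs0
  have hs1' : (s : ℝ) < 1 := hs1
  have hinj : ∀ {e e' : Fin 3}, e' ≠ e → seg t e 0 1 s ∈ φ.source → seg t e' 0 1 s ∈ φ.source →
      φ (seg t e 0 1 s) ≠ φ (seg t e' 0 1 s) := by
    intro e e' hne h1 h2 h
    have h3 := φ.injOn h1 h2 h
    simp only [seg_apply, zero_add, mul_one] at h3
    exact hne (E_inj hs0' (by linarith [one_le_len e]) hs0'.le (by linarith [one_le_len e']) h3).1
  suffices ∃ e, φ (c s) = φ (seg t e 0 1 s) by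
    obtain ⟨e, he⟩ := this
    refine ⟨e, hc.eq_of_apply_eq (hseg e) hs0 hs1 (φ.injOn m ?_ he)⟩
    fin_cases e
    exacts [m0.1, m1.1, m2.1]
  have n01 := hinj (e := 0) (e' := 1) (by decide) m0.1 m1.1
  have n02 := hinj (e := 0) (e' := 2) (by decide) m0.1 m2.1
  have n12 := hinj (e := 1) (e' := 2) (by decide) m1.1 m2.1
  by_contra! hcon
  -- A cubic equation has no four distinct roots.
  have f : ∀ {x y : ℂ}, x ≠ y → x ^ 3 = (s : ℝ) → y ^ 3 = (s : ℝ) → x ^ 2 + x * y + y ^ 2 = 0 := by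
    intro x y hxy hx hy
    have : (x - y) * (x ^ 2 + x * y + y ^ 2) = 0 := by linear_combination hx - hy
    exact (mul_eq_zero.1 this).resolve_left (sub_ne_zero.2 hxy)
  have g : ∀ {x y z : ℂ}, x ≠ y → x ≠ z → y ≠ z → x ^ 3 = (s : ℝ) → y ^ 3 = (s : ℝ) →
      z ^ 3 = (s : ℝ) → x + y + z = 0 := by
    intro x y z hxy hxz hyz hx hy hz
    have : (y - z) * (x + y + z) = 0 := by
      linear_combination f hxy hx hy - f hxz hx hz
    exact (mul_eq_zero.1 this).resolve_left (sub_ne_zero.2 hyz)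
  have g1 := g n01 n02 n12 m0.2 m1.2 m2.2
  have g2 := g n01 (hcon 0).symm (hcon 1).symm m0.2 m1.2 e
  exact hcon 2 (by linear_combination g2 - g1)

lemma isSegment_seg_one (t : ℝ) (e : Fin 3) : (surf t).IsSegment (seg t e 0 1) 1 := by
  have := isSegment_seg t (e := e) le_rfl one_pos (by simpa using one_le_len e)
  simpa using this

lemma isUnitHorizontalSaddle_seg (t : ℝ) : (surf t).IsUnitHorizontalSaddle (seg t 0 0 1) := by
  exact ⟨isSegment_seg_one t 0, (seg_zero t 0 1).trans (seg_short_one t).symm,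
    isSingular_surf_iff.2 (seg_zero t 0 1)⟩

lemma eq_of_isUnitHorizontalSaddle {γ : C(I, surf t)} (h : (surf t).IsUnitHorizontalSaddle γ) :
    γ = seg t 0 0 1 := by
  obtain ⟨hs, h01, hsing⟩ := h
  have h0 : γ 0 = vertex := isSingular_surf_iff.1 hsing
  obtain ⟨e, rfl⟩ := eq_seg_of_isSegment hs h0
  have h1 : E e 1 = vertex := by
    rw [h01, seg_apply] at h0
    simp only [Icc.coe_one, zero_add, mul_one] at h0
    exact h0
  have hL := two_lt_longLen
  fin_cases e
  · rfl
  · exact absurd h1 (E_ne_vertex one_pos (by simp [len]; linarith))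
  · exact absurd h1 (E_ne_vertex one_pos (by simp [len]; linarith))

theorem existsUnique_isUnitHorizontalSaddle (t : ℝ) :
    ∃! γ : C(I, surf t), (surf t).IsUnitHorizontalSaddle γ :=
  ⟨_, isUnitHorizontalSaddle_seg t, fun _ h => eq_of_isUnitHorizontalSaddle h⟩

lemma len_of_ne_zero {e : Fin 3} (he : e ≠ 0) : len e = longLen := by
  fin_cases e
  · exact absurd rfl he
  · simp [len]
  · simp [len]

lemma injective_seg {e : Fin 3} (he : e ≠ 0) : Function.Injective (seg t e 0 1) := by
  have hL := two_lt_longLen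
  have hl := len_of_ne_zero he
  have key : ∀ s s' : I, 0 < s → seg t e 0 1 s = seg t e 0 1 s' → s = s' := by
    intro s s' h0 h
    simp only [seg_apply, zero_add, mul_one] at h
    have h0' : (0 : ℝ) < s := h0
    exact Subtype.ext (E_inj h0' (by linarith [s.2.2]) s'.2.1 (by linarith [s'.2.2]) h).2.symm
  intro s s' h
  rcases em (s = 0) with h0 | h0
  · rcases em (s' = 0) with h1 | h1
    · rw [h0, h1]
    · exact (key s' s (unitInterval.pos_iff_ne_zero.2 h1) h.symm).symm
  · exact key s s' (unitInterval.pos_iff_ne_zero.2 h0) h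

lemma isTwin_seg {e : Fin 3} (he : e ≠ 0) : (surf t).IsTwin (seg t 0 0 1) (seg t e 0 1) 1 := by
  refine ⟨isSegment_seg_one t 0, isSegment_seg_one t e,
    (seg_zero t e 1).trans (seg_zero t 0 1).symm, fun h => he ?_⟩
  have h2 := congrArg (fun c : C(I, surf t) => c ⟨1 / 2, by norm_num, by norm_num⟩) h
  simp only [seg_apply, zero_add, mul_one] at h2
  have hL := two_lt_longLen
  exact (E_inj (by norm_num) (by simp [len]; norm_num) (by norm_num)
    (by rw [len_of_ne_zero he]; linarith) h2.symm).1

lemma isSimpleCut_seg {e : Fin 3} (he : e ≠ 0) :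
    (surf t).IsSimpleCut (seg t 0 0 1) (seg t e 0 1) := by
  have hlt : ∀ s : I, s < 1 → ∀ e, (s : ℝ) < len e := fun s hs e =>
    lt_of_lt_of_le (show (s : ℝ) < 1 from hs) (one_le_len e)
  have hle : ∀ s : I, ∀ e, (s : ℝ) ≤ len e := fun s e => s.2.2.trans (one_le_len e)
  intro s hs0 hs1
  simp only [seg_apply, zero_add, mul_one]
  have hs0' : (0 : ℝ) < s := hs0
  refine ⟨fun s' h => ?_, fun s' h => ?_, fun s' h => ?_, fun s' h => ?_⟩
  · exact Subtype.ext (E_inj hs0' (hlt s hs1 _) s'.2.1 (hle s' _) h.symm).2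
  · exact Subtype.ext (E_inj hs0' (hlt s hs1 _) s'.2.1 (hle s' _) h.symm).2
  · exact he (E_inj hs0' (hlt s hs1 _) s'.2.1 (hle s' _) h.symm).1
  · exact he (E_inj hs0' (hlt s hs1 _) s'.2.1 (hle s' _) h.symm).1.symm

lemma halfDiscAt_upper (t : ℝ) :
    (surf t).HalfDiscAt {z | 0 ≤ z.im} (seg t 0 0 1) (seg t 2 0 1) := by
  have h1 := develops_surf t (upBand 2) (upperPt 2 0) (upperPt_mem 2 0)
  obtain ⟨r, hr, h⟩ := Metric.mem_nhdsWithin_iff.1 h1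
  have hlt : (7 : ℝ) / 10 < ht (upBand 2) := lt_ht _
  have hP : P t (upBand 2) (upperPt 2 0) = vertex := by rw [P_upper, E_zero]
  refine ⟨min r (1 / 2), by positivity, fun z => P t (upBand 2) (upperPt 2 0 + z),
    ((continuous_P t _).comp (by fun_prop)).continuousOn, ?_, ?_⟩
  · rintro z ⟨hz, hzr⟩
    rw [mem_ball_zero_iff, lt_min_iff] at hzr
    have hi := (Complex.im_le_norm z).trans hzr.2.le
    have hz' : (0 : ℝ) ≤ z.im := hz
    have hs : upperPt 2 0 + z ∈ strip (upBand 2) := by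
      simp only [strip, mem_ofPred_eq, Complex.add_im, im_upperPt]
      constructor <;> linarith
    have := h ⟨show upperPt 2 0 + z ∈ Metric.ball (upperPt 2 0) r by simpa using hzr.1, hs⟩
    simp only [mem_ofPred_eq, add_sub_cancel_left] at this
    rw [seg_short_one, ← hP]
    exact this
  · intro s hs
    have hs1 : (s : ℝ) ≤ 1 := s.2.2
    have e1 := sideDisc_vertex_pos (t := t) (m := 2) s.2.1 hs1
    have e2 := sideDisc_vertex_neg (t := t) (m := 2) (by norm_num) s.2.1 hs1
    simp [sideDisc, sideBand, sidePt, vertexEdge, vertexPred, Fin.ofNat, len] at e1 e2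
    simp only [seg_apply, zero_add, mul_one, unitInterval.coe_symm_eq]
    exact ⟨e1, e2⟩

lemma halfDiscAt_lower (t : ℝ) :
    (surf t).HalfDiscAt {z | z.im ≤ 0} (seg t 0 0 1) (seg t 1 0 1) := by
  have h1 := develops_surf t (loBand 1) (lowerPt t 1 0) (lowerPt_mem t 1 0)
  obtain ⟨r, hr, h⟩ := Metric.mem_nhdsWithin_iff.1 h1
  have hlt : (7 : ℝ) / 10 < ht (loBand 1) := lt_ht _
  have hP : P t (loBand 1) (lowerPt t 1 0) = vertex := by
    rw [P_lower le_rfl (len_pos 1).le, E_zero]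
  refine ⟨min r (1 / 2), by positivity, fun z => P t (loBand 1) (lowerPt t 1 0 + z),
    ((continuous_P t _).comp (by fun_prop)).continuousOn, ?_, ?_⟩
  · rintro z ⟨hz, hzr⟩
    rw [mem_ball_zero_iff, lt_min_iff] at hzr
    have hi := (abs_le.1 ((Complex.abs_im_le_norm z).trans hzr.2.le)).1
    have hz' : z.im ≤ 0 := hz
    have hs : lowerPt t 1 0 + z ∈ strip (loBand 1) := by
      simp only [strip, mem_ofPred_eq, Complex.add_im, im_lowerPt]
      constructor <;> linarith
    have := h ⟨show lowerPt t 1 0 + z ∈ Metric.ball (lowerPt t 1 0) r by simpa using hzr.1, hs⟩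
    simp only [mem_ofPred_eq, add_sub_cancel_left] at this
    rw [seg_short_one, ← hP]
    exact this
  · intro s hs
    have hs1 : (s : ℝ) ≤ 1 := s.2.2
    have e1 := sideDisc_vertex_pos (t := t) (m := 3) s.2.1 hs1
    have e2 := sideDisc_vertex_neg (t := t) (m := 3) (by norm_num) s.2.1 hs1
    have hm : ¬ Even 3 := by decide
    have hm3 : (-1 : ℝ) ^ 3 = -1 ∧ (-1 : ℂ) ^ 3 = -1 := by norm_num
    simp [sideDisc, sideBand, sidePt, vertexEdge, vertexPred, Fin.ofNat, len, hm, hm3] at e1 e2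
    simp only [seg_apply, zero_add, mul_one, unitInterval.coe_symm_eq]
    exact ⟨e1, e2⟩

end

section

variable {t : ℝ} {j : Fin 2}

/-! ### The surgeries between the surfaces `surf t` -/

lemma add_ofReal_mem_strip {z : ℂ} (x : ℝ) (hz : z ∈ strip j) : z + x ∈ strip j := by
  simpa [strip] using hz

lemma tendsto_add_ofReal_strip (z : ℂ) (x : ℝ) :
    Tendsto (fun z' : ℂ => z' + x) (𝓝[strip j] z) (𝓝[strip j] (z + x)) := by
  refine tendsto_nhdsWithin_iff.2 ⟨?_, ?_⟩
  · exact ((by fun_prop : Continuous fun z' : ℂ => z' + x).tendsto z).mono_left nhdsWithin_le_nhds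
  · filter_upwards [self_mem_nhdsWithin] with z' hz'
    exact add_ofReal_mem_strip x hz'

/-- The covering of a cylinder by a strip, after a horizontal translation of the strip. -/
def shiftP (t : ℝ) (x : Fin 2 → ℝ) (j : Fin 2) (z : ℂ) : surf t := P t j (z + x j)

lemma isPresentation_shiftP (t : ℝ) (x : Fin 2 → ℝ) : IsPresentation strip (shiftP t x) := by
  refine ⟨fun j => ?_, fun y A hA => ?_⟩
  · have : Continuous fun z : ℂ => z + x j := by fun_prop
    exact ((continuous_P t j).comp this).continuousOn
  · refine (isPresentation_surf t).mem_nhds y A fun j z hz hzy => ?_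
    have h1 := hA j (z + ((-x j : ℝ) : ℂ)) (add_ofReal_mem_strip _ hz) (by simp [shiftP, hzy])
    have h2 := (tendsto_add_ofReal_strip z (-x j)).eventually h1
    filter_upwards [h2] with z' hz'
    simpa [shiftP] using hz'

lemma develops_shiftP (t : ℝ) (x : Fin 2 → ℝ) :
    Develops (surf t) strip (shiftP t x) (fun _ z => z) := by
  intro j z hz
  have h := develops_surf t j (z + x j) (add_ofReal_mem_strip _ hz)
  filter_upwards [(tendsto_add_ofReal_strip z (x j)).eventually h] with z' hz'
  simpa [shiftP] using hz'

lemma shiftP_add (t : ℝ) (x : Fin 2 → ℝ) (j : Fin 2) (z : ℂ) (k : ℤ) :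
    shiftP t x j (z + k * circ j) = shiftP t x j z := by
  rw [shiftP, shiftP, show z + k * circ j + x j = z + x j + k * circ j by ring, P_add]

lemma shiftP_eq_iff {t' : ℝ} {x : Fin 2 → ℝ} {i : Fin 2} {z w : ℂ} (h0 : 0 < z.im)
    (h1 : z.im < ht j) (hw : w ∈ strip i) : P t j z = P t i w ↔
      shiftP t' x j z = shiftP t' x i w := by
  constructor
  · intro h
    obtain ⟨rfl, k, rfl⟩ := P_inj h0 h1 hw h
    exact (shiftP_add _ _ _ _ _).symm
  · intro h
    obtain ⟨rfl, k, hk⟩ := P_inj (by simpa using h0) (by simpa using h1)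
      (add_ofReal_mem_strip _ hw) h
    rw [show w = z + k * circ i by linear_combination hk, P_add]

lemma mem_range_seg {t : ℝ} {e : Fin 3} {s₀ : ℝ} {y : surf t} : y ∈ range (seg t e s₀ 1) ↔
    ∃ s, 0 ≤ s ∧ s ≤ 1 ∧ y = E e (s₀ + s) := by
  constructor
  · rintro ⟨s, rfl⟩
    exact ⟨s, s.2.1, s.2.2, by rw [seg_apply, mul_one]⟩
  · rintro ⟨s, h0, h1, rfl⟩
    exact ⟨⟨s, h0, h1⟩, by rw [seg_apply, mul_one]⟩

lemma shiftP_of_upper {t' : ℝ} {x : Fin 2 → ℝ} (e e' : Fin 3) {s s' : ℝ} (k k' : ℤ)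
    (hb : upBand e' = upBand e)
    (h : upPos e + s + x (upBand e) = upPos e' + s' + k' * circ (upBand e)) :
    shiftP t' x (upBand e) (upperPt e s + k * circ (upBand e)) = E e' s' := by
  rw [shiftP_add, shiftP, ← P_upper_add (t := t') s' k', hb]
  congr 1
  apply Complex.ext
  · simp [re_upperPt]; linarith
  · simp [im_upperPt]

lemma shiftP_of_lower {t' : ℝ} {x : Fin 2 → ℝ} (e e' : Fin 3) {s s' : ℝ} (k k' : ℤ)
    (hb : loBand e' = loBand e) (h0 : 0 ≤ s') (h1 : s' ≤ len e')
    (h : sh t (loBand e) + (loPos e + s) + x (loBand e) =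
      sh t' (loBand e) + (loPos e' + s') + k' * circ (loBand e)) :
    shiftP t' x (loBand e) (lowerPt t e s + k * circ (loBand e)) = E e' s' := by
  rw [shiftP_add, shiftP, ← P_lower_add (t := t') h0 h1 k', hb]
  congr 1
  apply Complex.ext
  · simp [re_lowerPt, hb]; linarith
  · simp [im_lowerPt, hb]

/-- The common part of the two kinds of surgeries: the cuts are the short edge and the first part of
the edge `e`, and the remaining edge is `e'`. -/
lemma isSurgery_of_values {t' : ℝ} {x : Fin 2 → ℝ} {e e' : Fin 3} (he : e ≠ 0) (he' : e' ≠ 0)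
    (hne : e ≠ e') {γ' η' : C(I, surf t')} (hγ' : (surf t').IsSegment γ' 1)
    (hη' : (surf t').IsSegment η' 1)
    (hB : range γ' ∪ range η' = range (seg t' 0 0 1) ∪ range (seg t' e (longLen - 1) 1))
    (hval : ∀ j, ∀ z ∈ strip j, ¬ (0 < z.im ∧ z.im < ht j) →
      (P t j z ∈ range (seg t 0 0 1) ∪ range (seg t e 0 1) ∧
        shiftP t' x j z ∈ range (seg t' 0 0 1) ∪ range (seg t' e (longLen - 1) 1)) ∨
      (∃ s, 0 < s ∧ s < longLen ∧ P t j z = E e' s ∧ shiftP t' x j z = E e' s) ∨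
      (∃ s, 1 < s ∧ s < longLen ∧ P t j z = E e s ∧ shiftP t' x j z = E e (s - 1)))
    (hγu : ∀ s : I, ∀ k : ℤ, shiftP t' x (upBand 0) (upperPt 0 s + k * circ (upBand 0)) = γ' s)
    (hγl : ∀ s : I, ∀ k : ℤ, shiftP t' x (loBand 0) (lowerPt t 0 s + k * circ (loBand 0)) = η' s)
    (hηu : ∀ s : I, ∀ k : ℤ, shiftP t' x (upBand e) (upperPt e s + k * circ (upBand e)) = η' s)
    (hηl : ∀ s : I, ∀ k : ℤ, shiftP t' x (loBand e) (lowerPt t e s + k * circ (loBand e)) = γ' s) :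
    (surf t).IsSurgery (surf t') (seg t 0 0 1) (seg t e 0 1) 1 := by
  have hL := two_lt_longLen
  have hl := len_of_ne_zero he
  have hl' := len_of_ne_zero he'
  have hl0 : len 0 = 1 := rfl
  -- The points of the edges outside the cuts are not on the cuts, before and after the surgery.
  have nA : ∀ s, 0 < s → s < longLen → (E e' s : surf t) ∉ range (seg t 0 0 1) ∪ range (seg t e 0 1) := by
    rintro s h0 h1 (h | h) <;> obtain ⟨s', a0, a1, h⟩ := mem_range_seg.1 h <;> rw [zero_add] at h
    · exact he' (E_inj h0 (by linarith) a0 (by linarith) h).1.symm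
    · exact hne (E_inj h0 (by linarith) a0 (by linarith) h).1
  have nA' : ∀ s, 1 < s → s < longLen → (E e s : surf t) ∉ range (seg t 0 0 1) ∪ range (seg t e 0 1) := by
    rintro s h0 h1 (h | h) <;> obtain ⟨s', a0, a1, h⟩ := mem_range_seg.1 h <;> rw [zero_add] at h
    · exact he (E_inj (by linarith) (by linarith) a0 (by linarith) h).1.symm
    · linarith [(E_inj (by linarith) (by linarith) a0 (by linarith) h).2]
  have nB : ∀ s, 0 < s → s < longLen →
      (E e' s : surf t') ∉ range (seg t' 0 0 1) ∪ range (seg t' e (longLen - 1) 1) := by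
    rintro s h0 h1 (h | h) <;> obtain ⟨s', a0, a1, h⟩ := mem_range_seg.1 h
    · exact he' (E_inj h0 (by linarith) (by linarith) (by linarith) h).1.symm
    · exact hne (E_inj h0 (by linarith) (by linarith) (by linarith) h).1
  have nB' : ∀ s, 1 < s → s < longLen →
      (E e (s - 1) : surf t') ∉ range (seg t' 0 0 1) ∪ range (seg t' e (longLen - 1) 1) := by
    rintro s h0 h1 (h | h) <;> obtain ⟨s', a0, a1, h⟩ := mem_range_seg.1 h
    · exact he (E_inj (by linarith) (by linarith) (by linarith) (by linarith) h).1.symm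
    · linarith [(E_inj (by linarith) (by linarith) (by linarith) (by linarith) h).2]
  have iA : ∀ j (z : ℂ), 0 < z.im → z.im < ht j →
      (P t j z : surf t) ∉ range (seg t 0 0 1) ∪ range (seg t e 0 1) := by
    rintro j z h0 h1 (h | h) <;> obtain ⟨s', -, -, h⟩ := mem_range_seg.1 h <;>
      exact P_ne_E h0 h1 _ _ h
  have iS : ∀ j (z : ℂ), 0 < z.im → z.im < ht j → ∀ e s, shiftP t' x j z ≠ E e s :=
    fun j z h0 h1 e s => P_ne_E (by simpa using h0) (by simpa using h1) _ _
  have iB : ∀ j (z : ℂ), 0 < z.im → z.im < ht j →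
      shiftP t' x j z ∉ range (seg t' 0 0 1) ∪ range (seg t' e (longLen - 1) 1) := by
    rintro j z h0 h1 (h | h) <;> obtain ⟨s', -, -, h⟩ := mem_range_seg.1 h <;>
      exact iS j z h0 h1 _ _ h
  have hcut : ∀ j, ∀ z ∈ strip j, (P t j z : surf t) ∈ range (seg t 0 0 1) ∪ range (seg t e 0 1) ↔
      shiftP t' x j z ∈ range (seg t' 0 0 1) ∪ range (seg t' e (longLen - 1) 1) := by
    intro j z hz
    by_cases hi : 0 < z.im ∧ z.im < ht j
    · exact iff_of_false (iA j z hi.1 hi.2) (iB j z hi.1 hi.2)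
    · rcases hval j z hz hi with ⟨h1, h2⟩ | ⟨s, h0, h1, h2, h3⟩ | ⟨s, h0, h1, h2, h3⟩
      · exact iff_of_true h1 h2
      · rw [h2, h3]; exact iff_of_false (nA s h0 h1) (nB s h0 h1)
      · rw [h2, h3]; exact iff_of_false (nA' s h0 h1) (nB' s h0 h1)
  refine isSurgery_of_presentations (isPresentation_surf t) (isPresentation_shiftP t' x)
    (develops_surf t) (develops_shiftP t' x) (isSegment_seg_one t 0) (isSegment_seg_one t e)
    (isSimpleCut_seg he) hγ' hη' (by rw [hB]; exact hcut) ?_ ?_ ?_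
  · intro i j z hz w hw hzA
    by_cases hi : 0 < z.im ∧ z.im < ht i
    · exact shiftP_eq_iff hi.1 hi.2 hw
    by_cases hi' : 0 < w.im ∧ w.im < ht j
    · have := shiftP_eq_iff (t := t) (t' := t') (x := x) hi'.1 hi'.2 hz
      exact ⟨fun h => (this.1 h.symm).symm, fun h => (this.2 h.symm).symm⟩
    rcases hval i z hz hi with ⟨h1, -⟩ | ⟨s, h0, h1, h2, h3⟩ | ⟨s, h0, h1, h2, h3⟩
    · exact absurd h1 hzA
    · rcases hval j w hw hi' with ⟨k1, k2⟩ | ⟨s', k0, k1, k2, k3⟩ | ⟨s', k0, k1, k2, k3⟩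
      · refine iff_of_false (fun h => hzA ?_) fun h => nB s h0 h1 ?_
        · rw [h]; exact k1
        · rw [← h3, h]; exact k2
      · rw [h2, h3, k2, k3]; exact Iff.rfl
      · rw [h2, h3, k2, k3]
        refine iff_of_false (fun h => hne ?_) fun h => hne ?_
        · exact (E_inj h0 (by linarith) (by linarith) (by linarith) h).1
        · exact (E_inj h0 (by linarith) (by linarith) (by linarith) h).1
    · rcases hval j w hw hi' with ⟨k1, k2⟩ | ⟨s', k0, k1, k2, k3⟩ | ⟨s', k0, k1, k2, k3⟩
      · refine iff_of_false (fun h => hzA ?_) fun h => nB' s h0 h1 ?_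
        · rw [h]; exact k1
        · rw [← h3, h]; exact k2
      · rw [h2, h3, k2, k3]
        refine iff_of_false (fun h => hne ?_) fun h => hne ?_
        · exact (E_inj (by linarith) (by linarith) k0.le (by linarith) h).1.symm
        · exact (E_inj (by linarith) (by linarith) k0.le (by linarith) h).1.symm
      · rw [h2, h3, k2, k3]
        constructor
        · intro h
          rw [(E_inj (by linarith) (by linarith) (by linarith) (by linarith) h).2]
        · intro h
          have := (E_inj (by linarith) (by linarith) (by linarith) (by linarith) h).2
          rw [show s' = s by linarith]
  all_goals
    intro s hs0 hs1 j z hz h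
    have hs0' : (0 : ℝ) < s := hs0
    have hs1' : (s : ℝ) < 1 := hs1
    simp only [seg_apply, zero_add, mul_one] at h
    rcases P_eq_E hz hs0' (by linarith [one_le_len 0, one_le_len e]) h with
      ⟨k, rfl, hk⟩ | ⟨k, hj, hk⟩
    · refine Or.inl ⟨by rw [hk]; first | exact hγu s k | exact hηu s k, fun w hw => ?_⟩
      have : z.im = 0 := by rw [hk]; simp [im_upperPt]
      rw [div_one, Complex.sub_im, this]
      linarith [hw.1]
    · have : z.im = ht j := by rw [hk, ← hj]; simp [im_lowerPt]
      subst hj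
      refine Or.inr ⟨by rw [hk]; first | exact hγl s k | exact hηl s k, fun w hw => ?_⟩
      rw [div_one, Complex.sub_im, this]
      linarith [hw.2]

/-- The cuts are the short edge and the beginning of the edge `2`; the second cylinder is displaced
by one. The new segments are the end of the edge `2` and the short edge. -/
theorem isLeftSurgery_surf (t : ℝ) : (surf t).IsLeftSurgery (surf (t + 1)) := by
  have hL := two_lt_longLen
  refine ⟨seg t 0 0 1, seg t 2 0 1, isUnitHorizontalSaddle_seg t, isTwin_seg (by decide),
    injective_seg (by decide), halfDiscAt_upper t, ?_⟩
  have h2 : (surf (t + 1)).IsSegment (seg (t + 1) 2 (longLen - 1) 1) 1 := by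
    have := isSegment_seg (t + 1) (e := 2) (s₀ := longLen - 1) (by linarith) one_pos (by simp [len])
    simpa using this
  have ua : ∀ (s : ℝ) (k : ℤ), shiftP (t + 1) ![0, -1] 1 (upperPt 0 s + k * circ 1) =
      E 2 (longLen - 1 + s) := fun s k =>
    shiftP_of_upper 0 2 k (-1) rfl (by simp [upPos, upBand, circ]; ring)
  have uc : ∀ (s : ℝ) (k : ℤ), shiftP (t + 1) ![0, -1] 1 (upperPt 2 s + k * circ 1) = E 0 s :=
    fun s k => shiftP_of_upper 2 0 k 0 rfl (by simp [upPos, upBand])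
  have uc' : ∀ (s : ℝ) (k : ℤ), shiftP (t + 1) ![0, -1] 1 (upperPt 2 s + k * circ 1) =
      E 2 (s - 1) :=
    fun s k => shiftP_of_upper 2 2 k 0 rfl (by simp [upPos, upBand])
  have ub : ∀ (s : ℝ) (k : ℤ), shiftP (t + 1) ![0, -1] 0 (upperPt 1 s + k * circ 0) = E 1 s :=
    fun s k => shiftP_of_upper 1 1 k 0 rfl (by simp [upPos, upBand])
  have la : ∀ (s : ℝ) (k : ℤ), 0 ≤ s → s ≤ 1 →
      shiftP (t + 1) ![0, -1] 1 (lowerPt t 0 s + k * circ 1) = E 0 s := fun s k h0 h1 =>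
    shiftP_of_lower 0 0 k 0 rfl h0 (by simpa [len] using h1) (by simp [loPos, loBand, sh]; ring)
  have lb : ∀ (s : ℝ) (k : ℤ), 0 ≤ s → s ≤ longLen →
      shiftP (t + 1) ![0, -1] 1 (lowerPt t 1 s + k * circ 1) = E 1 s := fun s k h0 h1 =>
    shiftP_of_lower 1 1 k 0 rfl h0 (by simpa [len] using h1) (by simp [loPos, loBand, sh]; ring)
  have lc : ∀ (s : ℝ) (k : ℤ), 0 ≤ s → s ≤ 1 →
      shiftP (t + 1) ![0, -1] 0 (lowerPt t 2 s + k * circ 0) = E 2 (longLen - 1 + s) :=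
    fun s k h0 h1 => shiftP_of_lower 2 2 k (-1) rfl (by linarith) (by simp [len]; linarith)
      (by simp [loPos, loBand, sh, circ]; ring)
  have lc' : ∀ (s : ℝ) (k : ℤ), 1 ≤ s → s ≤ longLen →
      shiftP (t + 1) ![0, -1] 0 (lowerPt t 2 s + k * circ 0) = E 2 (s - 1) :=
    fun s k h0 h1 => shiftP_of_lower 2 2 k 0 rfl (by linarith) (by simp [len]; linarith)
      (by simp [loPos, loBand, sh])
  refine isSurgery_of_values (e' := 1) (x := ![0, -1]) (γ' := seg (t + 1) 2 (longLen - 1) 1)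
    (η' := seg (t + 1) 0 0 1) (by decide) (by decide) (by decide) h2 (isSegment_seg_one _ 0)
    (union_comm _ _) ?_ ?_ ?_ ?_ ?_
  · intro j z hz hi
    have m1 : ∀ s, 0 ≤ s → s ≤ 1 → (E 0 s : surf (t + 1)) ∈
        range (seg (t + 1) 0 0 1) ∪ range (seg (t + 1) 2 (longLen - 1) 1) := fun s h0 h1 =>
      Or.inl (mem_range_seg.2 ⟨s, h0, h1, by rw [zero_add]⟩)
    have m2 : ∀ s, 0 ≤ s → s ≤ 1 → (E 2 (longLen - 1 + s) : surf (t + 1)) ∈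
        range (seg (t + 1) 0 0 1) ∪ range (seg (t + 1) 2 (longLen - 1) 1) := fun s h0 h1 =>
      Or.inr (mem_range_seg.2 ⟨s, h0, h1, rfl⟩)
    have m3 : ∀ s, 0 ≤ s → s ≤ 1 → (E 0 s : surf t) ∈
        range (seg t 0 0 1) ∪ range (seg t 2 0 1) := fun s h0 h1 =>
      Or.inl (mem_range_seg.2 ⟨s, h0, h1, by rw [zero_add]⟩)
    have m4 : ∀ s, 0 ≤ s → s ≤ 1 → (E 2 s : surf t) ∈
        range (seg t 0 0 1) ∪ range (seg t 2 0 1) := fun s h0 h1 =>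
      Or.inr (mem_range_seg.2 ⟨s, h0, h1, by rw [zero_add]⟩)
    have mv : ∀ e, (E e 0 : surf (t + 1)) ∈
        range (seg (t + 1) 0 0 1) ∪ range (seg (t + 1) 2 (longLen - 1) 1) := fun e => by
      have := m1 0 le_rfl zero_le_one
      rw [E_zero] at this ⊢
      exact this
    have mv' : ∀ e, (E e 0 : surf t) ∈
        range (seg t 0 0 1) ∪ range (seg t 2 0 1) := fun e => by
      have := m3 0 le_rfl zero_le_one
      rw [E_zero] at this ⊢
      exact this
    rcases strip_cases t hz with h | ⟨e, s, k, rfl, h0, h1, rfl⟩ | ⟨e, s, k, rfl, h0, h1, rfl⟩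
    · exact absurd h hi
    · rw [P_upper_add]
      fin_cases e
      · exact Or.inl ⟨m3 s h0 h1.le, mem_of_eq_of_mem (ua s k) (m2 s h0 h1.le)⟩
      · rcases h0.eq_or_lt with rfl | h0
        · exact Or.inl ⟨mv' 1, mem_of_eq_of_mem (ub 0 k) (mv 1)⟩
        · exact Or.inr (Or.inl ⟨s, h0, h1, rfl, ub s k⟩)
      · rcases le_or_gt s 1 with hs | hs
        · exact Or.inl ⟨m4 s h0 hs, mem_of_eq_of_mem (uc s k) (m1 s h0 hs)⟩
        · exact Or.inr (Or.inr ⟨s, hs, h1, rfl, uc' s k⟩)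
    · rw [P_lower_add h0 h1.le]
      fin_cases e
      · exact Or.inl ⟨m3 s h0 h1.le, mem_of_eq_of_mem (la s k h0 h1.le) (m1 s h0 h1.le)⟩
      · rcases h0.eq_or_lt with rfl | h0
        · exact Or.inl ⟨mv' 1, mem_of_eq_of_mem (lb 0 k h0 h1.le) (mv 1)⟩
        · exact Or.inr (Or.inl ⟨s, h0, h1, rfl, lb s k h0.le h1.le⟩)
      · rcases le_or_gt s 1 with hs | hs
        · exact Or.inl ⟨m4 s h0 hs, mem_of_eq_of_mem (lc s k h0 hs) (m2 s h0 hs)⟩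
        · exact Or.inr (Or.inr ⟨s, hs, h1, rfl, lc' s k hs.le h1.le⟩)
  · intro s k; rw [seg_apply, mul_one]; exact ua s k
  · intro s k; rw [seg_apply, mul_one, zero_add]; exact la s k s.2.1 s.2.2
  · intro s k; rw [seg_apply, mul_one, zero_add]; exact uc s k
  · intro s k; rw [seg_apply, mul_one]; exact lc s k s.2.1 s.2.2

/-- The cuts are the short edge and the beginning of the edge `1`; the first cylinder is displaced
by one. The new segments are the end of the edge `1` and the short edge. -/
theorem isRightSurgery_surf (t : ℝ) : (surf t).IsRightSurgery (surf (t - 1)) := by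
  have hL := two_lt_longLen
  refine ⟨seg t 0 0 1, seg t 1 0 1, isUnitHorizontalSaddle_seg t, isTwin_seg (by decide),
    injective_seg (by decide), halfDiscAt_lower t, ?_⟩
  have h2 : (surf (t - 1)).IsSegment (seg (t - 1) 1 (longLen - 1) 1) 1 := by
    have := isSegment_seg (t - 1) (e := 1) (s₀ := longLen - 1) (by linarith) one_pos (by simp [len])
    simpa using this
  have la : ∀ (s : ℝ) (k : ℤ), 0 ≤ s → s ≤ 1 →
      shiftP (t - 1) ![-1, 0] 1 (lowerPt t 0 s + k * circ 1) = E 1 (longLen - 1 + s) :=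
    fun s k h0 h1 => shiftP_of_lower 0 1 k (-1) rfl (by linarith) (by simp [len]; linarith)
      (by simp [loPos, loBand, sh, circ]; ring)
  have lb : ∀ (s : ℝ) (k : ℤ), 0 ≤ s → s ≤ 1 →
      shiftP (t - 1) ![-1, 0] 1 (lowerPt t 1 s + k * circ 1) = E 0 s := fun s k h0 h1 =>
    shiftP_of_lower 1 0 k 0 rfl h0 (by simpa [len] using h1) (by simp [loPos, loBand, sh]; ring)
  have lb' : ∀ (s : ℝ) (k : ℤ), 1 ≤ s → s ≤ longLen →
      shiftP (t - 1) ![-1, 0] 1 (lowerPt t 1 s + k * circ 1) = E 1 (s - 1) := fun s k h0 h1 =>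
    shiftP_of_lower 1 1 k 0 rfl (by linarith) (by simp [len]; linarith)
      (by simp [loPos, loBand, sh]; ring)
  have lc : ∀ (s : ℝ) (k : ℤ), 0 ≤ s → s ≤ longLen →
      shiftP (t - 1) ![-1, 0] 0 (lowerPt t 2 s + k * circ 0) = E 2 s := fun s k h0 h1 =>
    shiftP_of_lower 2 2 k 0 rfl h0 (by simpa [len] using h1) (by simp [loPos, loBand, sh]; ring)
  have ua : ∀ (s : ℝ) (k : ℤ), shiftP (t - 1) ![-1, 0] 1 (upperPt 0 s + k * circ 1) = E 0 s :=
    fun s k => shiftP_of_upper 0 0 k 0 rfl (by simp [upPos, upBand])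
  have uc : ∀ (s : ℝ) (k : ℤ), shiftP (t - 1) ![-1, 0] 1 (upperPt 2 s + k * circ 1) = E 2 s :=
    fun s k => shiftP_of_upper 2 2 k 0 rfl (by simp [upPos, upBand])
  have ub : ∀ (s : ℝ) (k : ℤ), shiftP (t - 1) ![-1, 0] 0 (upperPt 1 s + k * circ 0) =
      E 1 (longLen - 1 + s) :=
    fun s k => shiftP_of_upper 1 1 k (-1) rfl (by simp [upPos, upBand, circ]; ring)
  have ub' : ∀ (s : ℝ) (k : ℤ), shiftP (t - 1) ![-1, 0] 0 (upperPt 1 s + k * circ 0) =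
      E 1 (s - 1) :=
    fun s k => shiftP_of_upper 1 1 k 0 rfl (by simp [upPos, upBand]; ring)
  refine isSurgery_of_values (e' := 2) (x := ![-1, 0]) (γ' := seg (t - 1) 0 0 1)
    (η' := seg (t - 1) 1 (longLen - 1) 1) (by decide) (by decide) (by decide)
    (isSegment_seg_one _ 0) h2 rfl ?_ ?_ ?_ ?_ ?_
  · intro j z hz hi
    have m1 : ∀ s, 0 ≤ s → s ≤ 1 → (E 0 s : surf (t - 1)) ∈
        range (seg (t - 1) 0 0 1) ∪ range (seg (t - 1) 1 (longLen - 1) 1) := fun s h0 h1 =>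
      Or.inl (mem_range_seg.2 ⟨s, h0, h1, by rw [zero_add]⟩)
    have m2 : ∀ s, 0 ≤ s → s ≤ 1 → (E 1 (longLen - 1 + s) : surf (t - 1)) ∈
        range (seg (t - 1) 0 0 1) ∪ range (seg (t - 1) 1 (longLen - 1) 1) := fun s h0 h1 =>
      Or.inr (mem_range_seg.2 ⟨s, h0, h1, rfl⟩)
    have m3 : ∀ s, 0 ≤ s → s ≤ 1 → (E 0 s : surf t) ∈
        range (seg t 0 0 1) ∪ range (seg t 1 0 1) := fun s h0 h1 =>
      Or.inl (mem_range_seg.2 ⟨s, h0, h1, by rw [zero_add]⟩)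
    have m4 : ∀ s, 0 ≤ s → s ≤ 1 → (E 1 s : surf t) ∈
        range (seg t 0 0 1) ∪ range (seg t 1 0 1) := fun s h0 h1 =>
      Or.inr (mem_range_seg.2 ⟨s, h0, h1, by rw [zero_add]⟩)
    have mv : ∀ e, (E e 0 : surf (t - 1)) ∈
        range (seg (t - 1) 0 0 1) ∪ range (seg (t - 1) 1 (longLen - 1) 1) := fun e => by
      have := m1 0 le_rfl zero_le_one
      rw [E_zero] at this ⊢
      exact this
    have mv' : ∀ e, (E e 0 : surf t) ∈
        range (seg t 0 0 1) ∪ range (seg t 1 0 1) := fun e => by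
      have := m3 0 le_rfl zero_le_one
      rw [E_zero] at this ⊢
      exact this
    rcases strip_cases t hz with h | ⟨e, s, k, rfl, h0, h1, rfl⟩ | ⟨e, s, k, rfl, h0, h1, rfl⟩
    · exact absurd h hi
    · rw [P_upper_add]
      fin_cases e
      · exact Or.inl ⟨m3 s h0 h1.le, mem_of_eq_of_mem (ua s k) (m1 s h0 h1.le)⟩
      · rcases le_or_gt s 1 with hs | hs
        · exact Or.inl ⟨m4 s h0 hs, mem_of_eq_of_mem (ub s k) (m2 s h0 hs)⟩
        · exact Or.inr (Or.inr ⟨s, hs, h1, rfl, ub' s k⟩)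
      · rcases h0.eq_or_lt with rfl | h0
        · exact Or.inl ⟨mv' 2, mem_of_eq_of_mem (uc 0 k) (mv 2)⟩
        · exact Or.inr (Or.inl ⟨s, h0, h1, rfl, uc s k⟩)
    · rw [P_lower_add h0 h1.le]
      fin_cases e
      · exact Or.inl ⟨m3 s h0 h1.le, mem_of_eq_of_mem (la s k h0 h1.le) (m2 s h0 h1.le)⟩
      · rcases le_or_gt s 1 with hs | hs
        · exact Or.inl ⟨m4 s h0 hs, mem_of_eq_of_mem (lb s k h0 hs) (m1 s h0 hs)⟩
        · exact Or.inr (Or.inr ⟨s, hs, h1, rfl, lb' s k hs.le h1.le⟩)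
      · rcases h0.eq_or_lt with rfl | h0
        · exact Or.inl ⟨mv' 2, mem_of_eq_of_mem (lc 0 k h0 h1.le) (mv 2)⟩
        · exact Or.inr (Or.inl ⟨s, h0, h1, rfl, lc s k h0.le h1.le⟩)
  · intro s k; rw [seg_apply, mul_one, zero_add]; exact ua s k
  · intro s k; rw [seg_apply, mul_one]; exact la s k s.2.1 s.2.2
  · intro s k; rw [seg_apply, mul_one]; exact ub s k
  · intro s k; rw [seg_apply, mul_one, zero_add]; exact lb s k s.2.1 s.2.2

end

section

variable {t : ℝ} {j : Fin 2}

/-! ### The absolute periods -/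

/-- The position in a strip of the point with coordinates `x`, `s` of the model. -/
def coord (t : ℝ) (j : Fin 2) (x s : ℝ) : ℂ := x + s * topPt t j

lemma re_coord (x s : ℝ) : (coord t j x s).re = x + s * sh t j := by simp [coord, topPt]

lemma im_coord (x s : ℝ) : (coord t j x s).im = s * ht j := by simp [coord, topPt]

lemma P_coord (x s : ℝ) : P t j (coord t j x s) = pt j x s := by
  have := (ht_pos j).ne'
  rw [P, re_coord, im_coord]
  congr 1 <;> field_simp
  ring

lemma coord_mem_strip {s : ℝ} (h0 : 0 ≤ s) (h1 : s ≤ 1) (x : ℝ) : coord t j x s ∈ strip j := by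
  have := ht_pos j
  exact ⟨by rw [im_coord]; positivity, by rw [im_coord]; nlinarith⟩

lemma pt_inj {i : Fin 2} {x x' s s' : ℝ} (h0 : 0 < s) (h1 : s < 1) (h0' : 0 ≤ s') (h1' : s' ≤ 1)
    (h : pt j x s = pt i x' s') : i = j ∧ s' = s ∧ ∃ k : ℤ, x' = x + k * circ j := by
  have := congrArg Subtype.val h
  rw [pt_val h0.le h1.le, pt_val h0' h1'] at this
  exact cyl_inj h0 h1 h0' h1' this

lemma pt_ne_E {x s : ℝ} (h0 : 0 < s) (h1 : s < 1) (e : Fin 3) (s' : ℝ) : pt j x s ≠ E e s' := by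
  have := ht_pos j
  rw [← P_coord (t := 0)]
  exact P_ne_E (by rw [im_coord]; positivity) (by rw [im_coord]; nlinarith) e s'

lemma pt_upper {e : Fin 3} (s : ℝ) (k : ℤ) :
    pt (upBand e) (upPos e + s + k * circ (upBand e)) 0 = E e s := by
  rw [← P_upper_add (t := 0) s k, ← P_coord (t := 0)]
  congr 1
  simp [coord, upperPt]

lemma pt_lower {e : Fin 3} {s : ℝ} (h0 : 0 ≤ s) (h1 : s ≤ len e) (k : ℤ) :
    pt (loBand e) (loPos e + s + k * circ (loBand e)) 1 = E e s := by
  rw [← P_lower_add (t := 0) h0 h1 k, ← P_coord (t := 0)]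
  congr 1
  simp [coord, lowerPt]; ring

/-- Maps into the surface that are given in the coordinates of one cylinder develop as the
corresponding maps into the strip. -/
lemma eventually_dev_coord {D : Set ℂ} {x s : ℂ → ℝ} (hx : ContinuousOn x D) (hs : ContinuousOn s D)
    (h01 : ∀ z ∈ D, 0 ≤ s z ∧ s z ≤ 1) {z : ℂ} (hz : z ∈ D) :
    ∀ᶠ z' in 𝓝[D] z, (surf t).dev (pt j (x z) (s z)) (pt j (x z') (s z')) =
      coord t j (x z') (s z') - coord t j (x z) (s z) := by
  have h1 := develops_surf t j _ (coord_mem_strip (t := t) (h01 z hz).1 (h01 z hz).2 (x z))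
  have h2 : Tendsto (fun z' => coord t j (x z') (s z')) (𝓝[D] z)
      (𝓝[strip j] (coord t j (x z) (s z))) := by
    refine tendsto_nhdsWithin_iff.2 ⟨?_, ?_⟩
    · have : ContinuousOn (fun z' => coord t j (x z') (s z')) D := by
        unfold coord
        exact (Complex.continuous_ofReal.comp_continuousOn hx).add
          ((Complex.continuous_ofReal.comp_continuousOn hs).mul continuousOn_const)
      exact this z hz
    · filter_upwards [self_mem_nhdsWithin] with z' hz'
      exact coord_mem_strip (h01 z' hz').1 (h01 z' hz').2 _
  filter_upwards [h2.eventually h1] with z' h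
  rwa [P_coord, P_coord] at h

/-- Position coordinate, in the long cylinder, of the collar of the slit. -/
def xA (z : ℂ) : ℝ := z.re + z.im / 2 * (z.re - 1)

/-- Height coordinate, in the long cylinder, of the collar of the slit. -/
def sA (z : ℂ) : ℝ := z.im / 2 * (1 - |z.re - 1|)

/-- Position coordinate, in the short cylinder, of the collar of the slit. -/
def xB (z : ℂ) : ℝ := 3 - z.re + z.im / 2 * (5 - 2 * z.re)

/-- Height coordinate, in the short cylinder, of the collar of the slit. -/
def sB (z : ℂ) : ℝ := 1 - z.im / 2 * (1 - |2 * z.re - 5|)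

lemma continuous_xA : Continuous xA := by unfold xA; fun_prop
lemma continuous_sA : Continuous sA := by unfold sA; fun_prop
lemma continuous_xB : Continuous xB := by unfold xB; fun_prop
lemma continuous_sB : Continuous sB := by unfold sB; fun_prop

/-- The period `k` of the covering of the collar to which a point belongs. -/
def turn (z : ℂ) : ℤ := ⌊z.re / 3⌋

/-- The covering of the collar of a slit: the slit consists of the short edge and of the first part
of the edge number `2`.  The boundary circle `im z = 0` is the boundary of the left side of the
slit: the short edge from above (`0 ≤ re z ≤ 1`), the edge number `2` from above
(`1 ≤ re z ≤ 2`) and from below, backwards (`2 ≤ re z ≤ 3`). -/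
def collar (z : ℂ) : Model :=
  if z.re - 3 * turn z ≤ 2 then pt 1 (xA (z - 3 * turn z)) (sA (z - 3 * turn z))
  else pt 0 (xB (z - 3 * turn z)) (sB (z - 3 * turn z))

/-- The developing map of the covering of the collar. -/
def collarDev (t : ℝ) (z : ℂ) : ℂ :=
  if z.re - 3 * turn z ≤ 2 then coord t 1 (xA (z - 3 * turn z)) (sA (z - 3 * turn z)) + turn z
  else 1 + coord t 0 (xB (z - 3 * turn z)) (sB (z - 3 * turn z)) - topPt t 0 + turn z

lemma collar_add (z : ℂ) (k : ℤ) : collar (z + 3 * k) = collar z := by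
  have h : turn (z + 3 * k) = turn z + k := by
    simp only [turn, Complex.add_re, Complex.mul_re, Complex.intCast_re, Complex.intCast_im]
    rw [show ((z.re + ((3 : ℂ).re * (k : ℝ) - (3 : ℂ).im * 0)) / 3) = z.re / 3 + k by
      simp; ring, Int.floor_add_intCast]
  have e : z + 3 * k - 3 * ((turn z + k : ℤ) : ℂ) = z - 3 * turn z := by push_cast; ring
  have e2 : (z + 3 * k).re - 3 * ((turn z + k : ℤ) : ℝ) = z.re - 3 * turn z := by
    simp; ring
  rw [collar, collar, h, e, e2]

lemma collarDev_add (t : ℝ) (z : ℂ) (k : ℤ) : collarDev t (z + 3 * k) = collarDev t z + k := by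
  have h : turn (z + 3 * k) = turn z + k := by
    simp only [turn, Complex.add_re, Complex.mul_re, Complex.intCast_re, Complex.intCast_im]
    rw [show ((z.re + ((3 : ℂ).re * (k : ℝ) - (3 : ℂ).im * 0)) / 3) = z.re / 3 + k by
      simp; ring, Int.floor_add_intCast]
  have e : z + 3 * k - 3 * ((turn z + k : ℤ) : ℂ) = z - 3 * turn z := by push_cast; ring
  have e2 : (z + 3 * k).re - 3 * ((turn z + k : ℤ) : ℝ) = z.re - 3 * turn z := by
    simp; ring
  rw [collarDev, collarDev, h, e, e2]
  split_ifs <;> push_cast <;> ring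

lemma abs_sub_one_le {x : ℝ} (h0 : 0 ≤ x) (h2 : x ≤ 2) : |x - 1| ≤ 1 := by
  rw [abs_le]; constructor <;> linarith

lemma abs_two_mul_sub_le {x : ℝ} (h0 : 2 ≤ x) (h2 : x ≤ 3) : |2 * x - 5| ≤ 1 := by
  rw [abs_le]; constructor <;> linarith

lemma xA_right {z : ℂ} (h : z.re = 2) : xA z = 2 + z.im / 2 ∧ sA z = 0 ∧
    xB z = 1 + z.im / 2 ∧ sB z = 1 := by
  simp only [xA, sA, xB, sB, h]; norm_num

lemma xB_right {z : ℂ} (h : z.re = 3) : xB z = - (z.im / 2) ∧ sB z = 1 := by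
  simp only [xB, sB, h]; norm_num

lemma xA_left {z : ℂ} (h : z.re = 0) : xA z = - (z.im / 2) ∧ sA z = 0 := by
  simp only [xA, sA, h]; norm_num

lemma pt_c_start {r : ℝ} (h0 : 0 ≤ r) (h1 : r ≤ 1) : pt 1 (2 + r / 2) 0 = E 2 (1 + r / 2) ∧
    pt 0 (1 + r / 2) 1 = E 2 (1 + r / 2) := by
  have hL := two_lt_longLen
  constructor
  · have := pt_upper (e := 2) (1 + r / 2) 0
    rw [← this]; simp [upBand, upPos]; congr 1; ring
  · have := pt_lower (e := 2) (s := 1 + r / 2) (by positivity) (by simp [len]; linarith) 0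
    rw [← this]; simp [loBand, loPos]

lemma pt_c_end {r : ℝ} (h0 : 0 ≤ r) (h1 : r ≤ 1) : pt 1 (-(r / 2)) 0 = E 2 (longLen - r / 2) ∧
    pt 0 (-(r / 2)) 1 = E 2 (longLen - r / 2) := by
  have hL := two_lt_longLen
  constructor
  · have := pt_upper (e := 2) (longLen - r / 2) (-1)
    rw [← this]; simp [upBand, upPos, circ]; congr 1; ring
  · have := pt_lower (e := 2) (s := longLen - r / 2) (by linarith) (by simp [len]; linarith) (-1)
    rw [← this]; simp [loBand, loPos, circ]; congr 1; ring

/-- The parts of the covering of the collar that lie in the long cylinder. -/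
def partA (k : ℤ) : Set ℂ := {z | 3 * k ≤ z.re ∧ z.re ≤ 3 * k + 2 ∧ 0 ≤ z.im ∧ z.im ≤ 1}

/-- The parts of the covering of the collar that lie in the short cylinder. -/
def partB (k : ℤ) : Set ℂ := {z | 3 * k + 2 ≤ z.re ∧ z.re ≤ 3 * k + 3 ∧ 0 ≤ z.im ∧ z.im ≤ 1}

lemma isClosed_partA (k : ℤ) : IsClosed (partA k) := by
  have : partA k = {z : ℂ | 3 * k ≤ z.re} ∩ ({z | z.re ≤ 3 * k + 2} ∩ ({z | 0 ≤ z.im} ∩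
    {z | z.im ≤ 1})) := rfl
  rw [this]
  refine IsClosed.inter ?_ (IsClosed.inter ?_ (IsClosed.inter ?_ ?_)) <;>
    exact isClosed_le (by fun_prop) (by fun_prop)

lemma isClosed_partB (k : ℤ) : IsClosed (partB k) := by
  have : partB k = {z : ℂ | 3 * k + 2 ≤ z.re} ∩ ({z | z.re ≤ 3 * k + 3} ∩ ({z | 0 ≤ z.im} ∩
    {z | z.im ≤ 1})) := rfl
  rw [this]
  refine IsClosed.inter ?_ (IsClosed.inter ?_ (IsClosed.inter ?_ ?_)) <;>
    exact isClosed_le (by fun_prop) (by fun_prop)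

lemma collar_of_partA {k : ℤ} {z : ℂ} (hz : z ∈ partA k) :
    collar z = pt 1 (xA (z - 3 * k)) (sA (z - 3 * k)) ∧
      collarDev t z = coord t 1 (xA (z - 3 * k)) (sA (z - 3 * k)) + k := by
  have h : turn z = k := by
    rw [turn, Int.floor_eq_iff]
    constructor <;> linarith [hz.1, hz.2.1]
  have h2 : z.re - 3 * k ≤ 2 := by linarith [hz.2.1]
  rw [collar, collarDev, h, if_pos h2, if_pos h2]
  exact ⟨rfl, rfl⟩

lemma collar_of_partB {k : ℤ} {z : ℂ} (hz : z ∈ partB k) :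
    collar z = pt 0 (xB (z - 3 * k)) (sB (z - 3 * k)) ∧
      collarDev t z = 1 + coord t 0 (xB (z - 3 * k)) (sB (z - 3 * k)) - topPt t 0 + k := by
  have him : ∀ k : ℤ, (z - 3 * k).im = z.im := fun k => by simp
  have hre : ∀ k : ℤ, (z - 3 * k).re = z.re - 3 * k := fun k => by simp
  rcases hz.2.1.eq_or_lt with h3 | h3
  · have hA : z ∈ partA (k + 1) := by
      refine ⟨?_, ?_, hz.2.2⟩ <;> rw [h3] <;> push_cast <;> linarith
    obtain ⟨a1, a2⟩ := collar_of_partA (t := t) hA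
    obtain ⟨b1, b2⟩ := xA_left (z := z - 3 * (k + 1 : ℤ)) (by rw [hre]; push_cast; linarith)
    obtain ⟨b3, b4⟩ := xB_right (z := z - 3 * k) (by rw [hre]; linarith)
    obtain ⟨c1, c2⟩ := pt_c_end hz.2.2.1 hz.2.2.2
    rw [a1, a2, b1, b2, b3, b4, him, him, c1, c2]
    refine ⟨rfl, ?_⟩
    simp [coord]; ring
  · have h : turn z = k := by
      rw [turn, Int.floor_eq_iff]
      constructor <;> linarith [hz.1]
    rcases hz.1.eq_or_lt with h2 | h2
    · have h2' : z.re - 3 * k ≤ 2 := by linarith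
      obtain ⟨b1, b2, b3, b4⟩ := xA_right (z := z - 3 * k) (by rw [hre]; linarith)
      obtain ⟨c1, c2⟩ := pt_c_start hz.2.2.1 hz.2.2.2
      rw [collar, collarDev, h, if_pos h2', if_pos h2', b1, b2, b3, b4, him, c1, c2]
      refine ⟨rfl, ?_⟩
      simp [coord]; ring
    · have h2' : ¬ z.re - 3 * k ≤ 2 := by linarith
      rw [collar, collarDev, h, if_neg h2', if_neg h2']
      exact ⟨rfl, rfl⟩

lemma sA_mem {k : ℤ} {z : ℂ} (hz : z ∈ partA k) :
    0 ≤ sA (z - 3 * k) ∧ sA (z - 3 * k) ≤ 1 := by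
  have hre : (z - 3 * k).re = z.re - 3 * k := by simp
  have him : (z - 3 * k).im = z.im := by simp
  have := abs_sub_one_le (x := z.re - 3 * k) (by linarith [hz.1]) (by linarith [hz.2.1])
  have h0 := abs_nonneg (z.re - 3 * k - 1)
  rw [sA, hre, him]
  have := hz.2.2.1
  have := hz.2.2.2
  constructor <;> nlinarith

lemma sB_mem {k : ℤ} {z : ℂ} (hz : z ∈ partB k) :
    0 ≤ sB (z - 3 * k) ∧ sB (z - 3 * k) ≤ 1 := by
  have hre : (z - 3 * k).re = z.re - 3 * k := by simp
  have him : (z - 3 * k).im = z.im := by simp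
  have := abs_two_mul_sub_le (x := z.re - 3 * k) (by linarith [hz.1]) (by linarith [hz.2.1])
  have h0 := abs_nonneg (2 * (z.re - 3 * k) - 5)
  rw [sB, hre, him]
  have := hz.2.2.1
  have := hz.2.2.2
  constructor <;> nlinarith

/-- The parts that cover two turns of the collar. -/
def part : Fin 2 × Fin 2 → Set ℂ := fun i => if i.2 = 0 then partA i.1 else partB i.1

/-- Two turns of the covering of the collar. -/
def twoTurns : Set ℂ := {z | 0 ≤ z.re ∧ z.re ≤ 6 ∧ 0 ≤ z.im ∧ z.im ≤ 1}

lemma isClosed_part (i : Fin 2 × Fin 2) : IsClosed (part i) := by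
  unfold part; split_ifs
  exacts [isClosed_partA _, isClosed_partB _]

lemma iUnion_part : ⋃ i, part i = twoTurns := by
  ext z
  simp only [mem_iUnion, Prod.exists, Fin.exists_fin_two, part, partA, partB, twoTurns,
    mem_ofPred_eq]
  norm_num
  constructor
  · rintro ((h | h) | h | h) <;> refine ⟨?_, ?_, h.2.2⟩ <;> linarith [h.1, h.2.1]
  · rintro ⟨h0, h1, h2⟩
    rcases le_total z.re 2 with a | a
    · exact Or.inl (Or.inl ⟨h0, a, h2⟩)
    rcases le_total z.re 3 with b | b
    · exact Or.inl (Or.inr ⟨a, b, h2⟩)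
    rcases le_total z.re 5 with d | d
    · exact Or.inr (Or.inl ⟨b, d, h2⟩)
    · exact Or.inr (Or.inr ⟨d, h1, h2⟩)

lemma continuousOn_collar : ContinuousOn collar twoTurns := by
  rw [← iUnion_part]
  refine (locallyFinite_of_finite _).continuousOn_iUnion isClosed_part fun i => ?_
  unfold part; split_ifs
  · refine ContinuousOn.congr ?_ fun z hz => (collar_of_partA (t := 0) hz).1
    have h : Continuous fun z : ℂ => (xA (z - 3 * ((i.1 : ℤ) : ℂ)), sA (z - 3 * ((i.1 : ℤ) : ℂ))) :=
      (continuous_xA.comp (by fun_prop)).prodMk (continuous_sA.comp (by fun_prop))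
    have h2 := (continuous_pt 1).comp h
    unfold Function.comp at h2
    exact h2.continuousOn
  · refine ContinuousOn.congr ?_ fun z hz => (collar_of_partB (t := 0) hz).1
    have h : Continuous fun z : ℂ => (xB (z - 3 * ((i.1 : ℤ) : ℂ)), sB (z - 3 * ((i.1 : ℤ) : ℂ))) :=
      (continuous_xB.comp (by fun_prop)).prodMk (continuous_sB.comp (by fun_prop))
    have h2 := (continuous_pt 0).comp h
    unfold Function.comp at h2
    exact h2.continuousOn

lemma continuousOn_collarDev (t : ℝ) : ContinuousOn (collarDev t) twoTurns := by
  have hA := continuous_xA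
  have hA' := continuous_sA
  have hB := continuous_xB
  have hB' := continuous_sB
  rw [← iUnion_part]
  refine (locallyFinite_of_finite _).continuousOn_iUnion isClosed_part fun i => ?_
  unfold part; split_ifs
  · refine ContinuousOn.congr ?_ fun z hz => (collar_of_partA (t := t) hz).2
    unfold coord
    fun_prop
  · refine ContinuousOn.congr ?_ fun z hz => (collar_of_partB (t := t) hz).2
    unfold coord
    fun_prop

lemma eventually_dev_collar (t : ℝ) (z : ℂ) : ∀ᶠ z' in 𝓝[twoTurns] z,
    (surf t).dev (collar z) (collar z') = collarDev t z' - collarDev t z := by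
  rw [← iUnion_part, (locallyFinite_of_finite part).nhdsWithin_iUnion, eventually_iSup]
  intro i
  by_cases hi : z ∈ part i
  · unfold part at hi ⊢; split_ifs at hi ⊢
    · have := eventually_dev_coord (t := t) (j := 1) (D := partA i.1)
        (x := fun z => xA (z - 3 * ((i.1 : ℤ) : ℂ))) (s := fun z => sA (z - 3 * ((i.1 : ℤ) : ℂ)))
        (continuous_xA.comp (by fun_prop)).continuousOn
        (continuous_sA.comp (by fun_prop)).continuousOn (fun z hz => sA_mem hz) hi
      filter_upwards [this, self_mem_nhdsWithin] with z' h hz'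
      rw [(collar_of_partA (t := t) hi).1, (collar_of_partA (t := t) hz').1, h,
        (collar_of_partA (t := t) hi).2, (collar_of_partA (t := t) hz').2]
      ring
    · have := eventually_dev_coord (t := t) (j := 0) (D := partB i.1)
        (x := fun z => xB (z - 3 * ((i.1 : ℤ) : ℂ))) (s := fun z => sB (z - 3 * ((i.1 : ℤ) : ℂ)))
        (continuous_xB.comp (by fun_prop)).continuousOn
        (continuous_sB.comp (by fun_prop)).continuousOn (fun z hz => sB_mem hz) hi
      filter_upwards [this, self_mem_nhdsWithin] with z' h hz'
      rw [(collar_of_partB (t := t) hi).1, (collar_of_partB (t := t) hz').1, h,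
        (collar_of_partB (t := t) hi).2, (collar_of_partB (t := t) hz').2]
      ring
  · rw [← (isClosed_part i).closure_eq, mem_closure_iff_nhdsWithin_neBot, not_neBot] at hi
    rw [hi]; exact eventually_bot

end

section

variable {t : ℝ} {j : Fin 2}

/-! ### The Dehn twist in the collar -/

/-- The two equations determine `a` and `b`, because both `b` and `1 - a` decrease with `a`. -/
lemma collar_coords_unique {a b a' b' : ℝ} (hb : 0 ≤ b) (ha : a ≤ 1) (hb' : 0 ≤ b') (ha' : a' ≤ 1)
    (h : a + b = a' + b') (hm : b * (1 - a) = b' * (1 - a')) : a = a' ∧ b = b' := by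
  have : a = a' := by
    rcases lt_trichotomy a a' with h1 | h1 | h1
    · nlinarith
    · exact h1
    · nlinarith
  exact ⟨this, by linarith⟩

/-- The point at horizontal distance `x` and vertical distance `s` of the slit lies in the collar
of width `R`. -/
lemma exists_collar_coords {R x s : ℝ} (hR : 0 < R) (hx : 0 ≤ x) (hs : 0 ≤ s)
    (h : (1 + R) * s + R * x ≤ R * (1 + R)) :
    ∃ a b, 0 ≤ a ∧ a ≤ 1 ∧ 0 ≤ b ∧ b ≤ R ∧ a * (1 + b) = x ∧ b * (1 - a) = s := by
  have hxs : x + s ≤ 1 + R := by nlinarith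
  have hlo : max 0 (x + s - R) ≤ min 1 (x + s) :=
    max_le (le_min zero_le_one (by positivity)) (le_min (by linarith) (by linarith))
  have hf : ContinuousOn (fun a => (x + s - a) * (1 - a)) (Icc (max 0 (x + s - R)) (min 1 (x + s))) := by
    fun_prop
  have hs1 : (x + s - min 1 (x + s)) * (1 - min 1 (x + s)) ≤ s := by
    rcases min_choice 1 (x + s) with h1 | h1 <;> rw [h1] <;> simp [hs]
  have hs2 : s ≤ (x + s - max 0 (x + s - R)) * (1 - max 0 (x + s - R)) := by
    rcases max_choice 0 (x + s - R) with h1 | h1 <;> rw [h1]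
    · linarith
    · nlinarith
  obtain ⟨a, ⟨ha0, ha1⟩, ha⟩ := intermediate_value_Icc' hlo hf ⟨hs1, hs2⟩
  rw [max_le_iff] at ha0
  rw [le_min_iff] at ha1
  simp only at ha
  exact ⟨a, x + s - a, ha0.1, ha1.1, by linarith [ha1.2], by linarith [ha0.2], by linarith, ha⟩

lemma mem_part_zero {z : ℂ} (h0 : 0 ≤ z.re) (h3 : z.re ≤ 3) (hz : 0 ≤ z.im ∧ z.im ≤ 1) :
    (z ∈ partA 0 ∧ z.re ≤ 2) ∨ (z ∈ partB 0 ∧ 2 < z.re) := by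
  rcases le_or_gt z.re 2 with h | h
  · exact Or.inl ⟨⟨by simpa using h0, by simpa using h, hz⟩, h⟩
  · exact Or.inr ⟨⟨by simpa using h.le, by simpa using h3, hz⟩, h⟩

lemma collar_A {z : ℂ} (hz : z ∈ partA 0) : collar z = pt 1 (xA z) (sA z) := by
  simpa using (collar_of_partA (t := 0) hz).1

lemma collar_B {z : ℂ} (hz : z ∈ partB 0) : collar z = pt 0 (xB z) (sB z) := by
  simpa using (collar_of_partB (t := 0) hz).1

lemma collar_zero {z : ℂ} (h0 : 0 ≤ z.re) (h3 : z.re ≤ 3) (hz : z.im = 0) :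
    ∃ e s, collar z = E e s ∧ e ≠ 1 ∧ 0 ≤ s ∧ s ≤ 1 := by
  have hL := two_lt_longLen
  have h01 : 0 ≤ z.im ∧ z.im ≤ 1 := by simp [hz]
  rcases mem_part_zero h0 h3 h01 with ⟨h, h2⟩ | ⟨h, h2⟩
  · rw [collar_A h, xA, sA, hz]
    rcases le_total z.re 1 with h1 | h1
    · refine ⟨0, z.re, ?_, by decide, h0, h1⟩
      rw [← pt_upper z.re 0]; simp [upBand, upPos]
    · refine ⟨2, z.re - 1, ?_, by decide, by linarith, by linarith⟩
      rw [← pt_upper (z.re - 1) 0]; simp [upBand, upPos]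
  · rw [collar_B h, xB, sB, hz]
    refine ⟨2, 3 - z.re, ?_, by decide, by linarith, by linarith⟩
    rw [← pt_lower (by linarith) (by simp [len]; linarith) 0]; simp [loBand, loPos]

/-- The points of a fundamental domain of the covering of the collar that lie on an edge of the
surface: those of the slit (`im z = 0`) and those of the two radii at the ends of the slit. -/
def OnEdge (z : ℂ) : Prop :=
  ∃ e s, collar z = E e s ∧ 0 ≤ s ∧ s ≤ len e ∧ ((z.im = 0 ∧ e ≠ 1 ∧ s ≤ 1) ∨
    (0 < z.im ∧ e = 2 ∧ ((z.re = 2 ∧ s = 1 + z.im / 2) ∨ (z.re = 0 ∧ s = longLen - z.im / 2))))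

lemma collar_cases {z : ℂ} (h0 : 0 ≤ z.re) (h3 : z.re < 3) (hz : 0 ≤ z.im ∧ z.im ≤ 1) :
    (collar z = pt 1 (xA z) (sA z) ∧ 0 < z.re ∧ z.re < 2 ∧ 0 < z.im ∧ 0 < sA z ∧ sA z < 1) ∨
    (collar z = pt 0 (xB z) (sB z) ∧ 2 < z.re ∧ 0 < z.im ∧ 0 < sB z ∧ sB z < 1) ∨ OnEdge z := by
  have hL := two_lt_longLen
  rcases hz.1.eq_or_lt with hr | hr
  · obtain ⟨e, s, h1, h2, h4, h5⟩ := collar_zero h0 h3.le hr.symm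
    refine Or.inr (Or.inr ⟨e, s, h1, h4, h5.trans ?_, Or.inl ⟨hr.symm, h2, h5⟩⟩)
    fin_cases e <;> simp [len] <;> linarith
  rcases mem_part_zero h0 h3.le hz with ⟨h, h2⟩ | ⟨h, h2⟩
  · rw [collar_A h]
    rcases h0.eq_or_lt with e0 | e0
    · obtain ⟨a, b⟩ := xA_left e0.symm
      refine Or.inr (Or.inr ⟨2, longLen - z.im / 2, ?_, by linarith [hz.2], ?_,
        Or.inr ⟨hr, rfl, Or.inr ⟨e0.symm, rfl⟩⟩⟩)
      · rw [collar_A h, a, b]; exact (pt_c_end hz.1 hz.2).1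
      · simp [len]; linarith
    rcases h2.eq_or_lt with e2 | e2
    · obtain ⟨a, b, -⟩ := xA_right e2
      refine Or.inr (Or.inr ⟨2, 1 + z.im / 2, ?_, by linarith [hz.2], ?_,
        Or.inr ⟨hr, rfl, Or.inl ⟨e2, rfl⟩⟩⟩)
      · rw [collar_A h, a, b]; exact (pt_c_start hz.1 hz.2).1
      · simp [len]; linarith [hz.2]
    have h1 : |z.re - 1| < 1 := by rw [abs_lt]; constructor <;> linarith
    have := abs_nonneg (z.re - 1)
    refine Or.inl ⟨rfl, e0, e2, hr, ?_, ?_⟩ <;> rw [sA] <;> nlinarith [hz.2]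
  · have h1 : |2 * z.re - 5| < 1 := by rw [abs_lt]; constructor <;> linarith
    have := abs_nonneg (2 * z.re - 5)
    refine Or.inr (Or.inl ⟨collar_B h, h2, hr, ?_, ?_⟩) <;> rw [sB] <;> nlinarith [hz.2]

lemma abs_xA {z : ℂ} (hz : 0 ≤ z.im) : |xA z - 1| = |z.re - 1| * (1 + z.im / 2) := by
  rw [xA, show z.re + z.im / 2 * (z.re - 1) - 1 = (z.re - 1) * (1 + z.im / 2) by ring, abs_mul,
    abs_of_nonneg (a := 1 + z.im / 2) (by positivity)]

lemma abs_xB {z : ℂ} (hz : 0 ≤ z.im) : |2 * xB z - 1| = |2 * z.re - 5| * (1 + z.im) := by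
  rw [xB, show 2 * (3 - z.re + z.im / 2 * (5 - 2 * z.re)) - 1 = - ((2 * z.re - 5) * (1 + z.im)) by
    ring, abs_neg, abs_mul, abs_of_nonneg (a := 1 + z.im) (by positivity)]

lemma xA_bounds {z : ℂ} (h0 : 0 ≤ z.re) (h2 : z.re ≤ 2) (hz : 0 ≤ z.im ∧ z.im ≤ 1) :
    |xA z - 1| ≤ 3 / 2 := by
  rw [abs_xA hz.1]
  have := abs_sub_one_le h0 h2
  nlinarith [hz.1, hz.2, abs_nonneg (z.re - 1)]

lemma xB_bounds {z : ℂ} (h0 : 2 ≤ z.re) (h2 : z.re ≤ 3) (hz : 0 ≤ z.im ∧ z.im ≤ 1) :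
    |2 * xB z - 1| ≤ 2 := by
  rw [abs_xB hz.1]
  have := abs_two_mul_sub_le h0 h2
  nlinarith [hz.1, hz.2, abs_nonneg (2 * z.re - 5)]

lemma eq_of_coords_A {z w : ℂ} (h0 : 0 ≤ z.re) (h2 : z.re ≤ 2) (hz : 0 ≤ z.im) (h0' : 0 ≤ w.re)
    (h2' : w.re ≤ 2) (hw : 0 ≤ w.im) (hx : xA z = xA w) (hs : sA z = sA w) : z = w := by
  have e1 := abs_xA hz
  rw [hx, abs_xA hw] at e1
  have e2 := hs
  rw [sA, sA] at e2
  obtain ⟨-, b⟩ := collar_coords_unique (by positivity) (abs_sub_one_le h0 h2) (by positivity)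
    (abs_sub_one_le h0' h2') (by linarith : |z.re - 1| + z.im / 2 = |w.re - 1| + w.im / 2) e2
  rw [xA, xA, ← b] at hx
  refine Complex.ext ?_ (by linarith)
  exact mul_right_cancel₀ (b := 1 + z.im / 2) (by positivity) (by linarith)

lemma eq_of_coords_B {z w : ℂ} (h0 : 2 ≤ z.re) (h2 : z.re ≤ 3) (hz : 0 ≤ z.im) (h0' : 2 ≤ w.re)
    (h2' : w.re ≤ 3) (hw : 0 ≤ w.im) (hx : xB z = xB w) (hs : sB z = sB w) : z = w := by
  have e1 := abs_xB hz
  rw [hx, abs_xB hw] at e1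
  have e2 := hs
  rw [sB, sB] at e2
  obtain ⟨-, b⟩ := collar_coords_unique hz (abs_two_mul_sub_le h0 h2) hw
    (abs_two_mul_sub_le h0' h2') (by linarith : |2 * z.re - 5| + z.im = |2 * w.re - 5| + w.im)
    (by linarith)
  rw [xB, xB, ← b] at hx
  refine Complex.ext ?_ b
  exact mul_right_cancel₀ (b := 1 + z.im) (by positivity) (by linarith)

lemma OnEdge.im_eq {z w : ℂ} (hz : OnEdge z) (hw : OnEdge w) (hz1 : z.im ≤ 1) (hw1 : w.im ≤ 1)
    (h : collar z = collar w) : z.im = w.im ∧ (z.im = 0 ∨ z = w) := by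
  have hL := two_lt_longLen
  have key : ∀ {z w : ℂ}, OnEdge z → OnEdge w → z.im ≤ 1 → w.im ≤ 1 → collar z = collar w →
      0 < z.im → z = w := by
    rintro z w ⟨e, s, h1, h2, h3, ⟨h4, -⟩ | ⟨h4, rfl, h5⟩⟩ ⟨e', s', h1', h2', h3', h6⟩ hz hw h hpos
    · linarith
    have hs : 0 < s ∧ s < len 2 := by
      rw [show len 2 = longLen by simp [len]]
      constructor <;> rcases h5 with ⟨-, h5⟩ | ⟨-, h5⟩ <;> linarith
    obtain ⟨rfl, rfl⟩ := E_inj hs.1 hs.2 h2' h3' (h1.symm.trans (h.trans h1'))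
    rcases h6 with ⟨h6, -, h7⟩ | ⟨h6, -, h7⟩
    · rcases h5 with ⟨-, h5⟩ | ⟨-, h5⟩ <;> linarith
    rcases h5 with ⟨h8, h5⟩ | ⟨h8, h5⟩ <;> rcases h7 with ⟨h9, h7⟩ | ⟨h9, h7⟩
    · exact Complex.ext (h8.trans h9.symm) (by linarith)
    · linarith
    · linarith
    · exact Complex.ext (h8.trans h9.symm) (by linarith)
  have h0 : ∀ {z : ℂ}, OnEdge z → z.im = 0 ∨ 0 < z.im := by
    rintro z ⟨e, s, -, -, -, ⟨h, -⟩ | ⟨h, -⟩⟩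
    exacts [Or.inl h, Or.inr h]
  rcases h0 hz with h1 | h1
  · rcases h0 hw with h2 | h2
    · exact ⟨h1.trans h2.symm, Or.inl h1⟩
    · obtain rfl := key hw hz hw1 hz1 h.symm h2
      exact ⟨rfl, Or.inr rfl⟩
  · obtain rfl := key hz hw hz1 hw1 h h1
    exact ⟨rfl, Or.inr rfl⟩

lemma collar_inj_of_lt {z w : ℂ} (h0 : 0 ≤ z.re) (h3 : z.re < 3) (hz : 0 ≤ z.im ∧ z.im ≤ 1)
    (h0' : 0 ≤ w.re) (h3' : w.re < 3) (hw : 0 ≤ w.im ∧ w.im ≤ 1) (h : collar z = collar w) :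
    z.im = w.im ∧ (z.im = 0 ∨ z = w) := by
  have hL := two_lt_longLen
  suffices hmain : OnEdge z ∧ OnEdge w ∨ z = w by
    rcases hmain with ⟨h1, h2⟩ | rfl
    · exact h1.im_eq h2 hz.2 hw.2 h
    · exact ⟨rfl, Or.inr rfl⟩
  rcases collar_cases h0 h3 hz with ⟨a, a1, a2, a3, a4, a5⟩ | ⟨a, a1, a3, a4, a5⟩ | a
  · rcases collar_cases h0' h3' hw with ⟨b, b1, b2, b3, b4, b5⟩ | ⟨b, b1, b3, b4, b5⟩ | b
    · rw [a, b] at h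
      obtain ⟨-, h1, k, h2⟩ := pt_inj a4 a5 b4.le b5.le h
      have ha := abs_le.1 (xA_bounds h0 a2.le hz)
      have hb := abs_le.1 (xA_bounds h0' b2.le hw)
      rw [eq_zero_of_abs_lt (k := k) (circ_pos 1) (by
        rw [abs_lt]; simp only [circ, Matrix.cons_val_one, Matrix.cons_val_zero] at h2 ⊢
        constructor <;> linarith)] at h2
      exact Or.inr (eq_of_coords_A h0 a2.le hz.1 h0' b2.le hw.1 (by simpa using h2.symm) h1.symm)
    · rw [a, b] at h
      exact absurd (pt_inj a4 a5 b4.le b5.le h).1 (by decide)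
    · obtain ⟨e, s, b, -⟩ := b
      exact absurd (a.symm.trans (h.trans b)) (pt_ne_E a4 a5 e s)
  · rcases collar_cases h0' h3' hw with ⟨b, b1, b2, b3, b4, b5⟩ | ⟨b, b1, b3, b4, b5⟩ | b
    · rw [a, b] at h
      exact absurd (pt_inj a4 a5 b4.le b5.le h).1 (by decide)
    · rw [a, b] at h
      obtain ⟨-, h1, k, h2⟩ := pt_inj a4 a5 b4.le b5.le h
      have ha := abs_le.1 (xB_bounds a1.le h3.le hz)
      have hb := abs_le.1 (xB_bounds b1.le h3'.le hw)
      rw [eq_zero_of_abs_lt (k := k) (circ_pos 0) (by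
        rw [abs_lt]; simp only [circ, Matrix.cons_val_zero] at h2 ⊢
        constructor <;> linarith)] at h2
      exact Or.inr (eq_of_coords_B a1.le h3.le hz.1 b1.le h3'.le hw.1 (by simpa using h2.symm) h1.symm)
    · obtain ⟨e, s, b, -⟩ := b
      exact absurd (a.symm.trans (h.trans b)) (pt_ne_E a4 a5 e s)
  · rcases collar_cases h0' h3' hw with ⟨b, b1, b2, b3, b4, b5⟩ | ⟨b, b1, b3, b4, b5⟩ | b
    · obtain ⟨e, s, a, -⟩ := a
      exact absurd (b.symm.trans (h.symm.trans a)) (pt_ne_E b4 b5 e s)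
    · obtain ⟨e, s, a, -⟩ := a
      exact absurd (b.symm.trans (h.symm.trans a)) (pt_ne_E b4 b5 e s)
    · exact Or.inl ⟨a, b⟩

lemma exists_reduced (z : ℂ) : ∃ k : ℤ, 0 ≤ (z + 3 * k).re ∧ (z + 3 * k).re < 3 := by
  refine ⟨-⌊z.re / 3⌋, ?_⟩
  have h1 := Int.floor_le (z.re / 3)
  have h2 := Int.lt_floor_add_one (z.re / 3)
  have : (z + 3 * ((-⌊z.re / 3⌋ : ℤ) : ℂ)).re = z.re - 3 * ⌊z.re / 3⌋ := by
    simp; ring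
  rw [this]
  constructor <;> linarith

lemma im_add_three_mul (z : ℂ) (k : ℤ) : (z + 3 * k).im = z.im := by simp

/-- The covering of the collar is injective modulo its period, except on the slit. -/
lemma collar_inj {z w : ℂ} (hz : 0 ≤ z.im ∧ z.im ≤ 1) (hw : 0 ≤ w.im ∧ w.im ≤ 1)
    (h : collar z = collar w) : z.im = w.im ∧ (z.im = 0 ∨ ∃ k : ℤ, w = z + 3 * k) := by
  obtain ⟨k, hk0, hk3⟩ := exists_reduced z
  obtain ⟨l, hl0, hl3⟩ := exists_reduced w
  have := collar_inj_of_lt hk0 hk3 (by rwa [im_add_three_mul]) hl0 hl3 (by rwa [im_add_three_mul])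
    (by rw [collar_add, collar_add, h])
  rw [im_add_three_mul, im_add_three_mul] at this
  refine ⟨this.1, this.2.imp_right fun h => ⟨k - l, ?_⟩⟩
  push_cast
  linear_combination -h

end

section

variable {t : ℝ} {j : Fin 2}

/-- A function on each cylinder (in its coordinates) that is negative inside the collar and zero
on its outer boundary. -/
def slitDist : Fin 2 → ℂ → ℝ :=
  ![fun z => 4 * (1 - z.im) + |2 * z.re - 1| - 2, fun z => 6 * z.im + 2 * |z.re - 1| - 3]

lemma continuous_slitDist (j : Fin 2) : Continuous (slitDist j) := by
  fin_cases j
  · show Continuous fun z : ℂ => 4 * (1 - z.im) + |2 * z.re - 1| - 2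
    fun_prop
  · show Continuous fun z : ℂ => 6 * z.im + 2 * |z.re - 1| - 3
    fun_prop

/-- The part of each cylinder, in its coordinates, outside the collar of the slit. -/
def outside (j : Fin 2) : Set ℂ :=
  {z | -(1 / 2) ≤ z.re ∧ z.re ≤ circ j - 1 / 2 ∧ 0 ≤ z.im ∧ z.im ≤ 1 ∧ 0 ≤ slitDist j z}

/-- One turn of the covering of the collar. -/
def oneTurn : Set ℂ := {z | 0 ≤ z.re ∧ z.re ≤ 3 ∧ 0 ≤ z.im ∧ z.im ≤ 1}

lemma isCompact_outside (j : Fin 2) : IsCompact (outside j) := by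
  have : outside j = (Icc (-(1 / 2)) (circ j - 1 / 2) ×ℂ Icc 0 1) ∩ {z | 0 ≤ slitDist j z} := by
    ext z; simp [outside, Complex.mem_reProdIm, and_assoc]
  rw [this]
  exact (isCompact_Icc.reProdIm isCompact_Icc).inter_right
    (isClosed_le continuous_const (continuous_slitDist j))

lemma isCompact_oneTurn : IsCompact oneTurn := by
  have : oneTurn = Icc 0 3 ×ℂ Icc 0 1 := by
    ext z; simp [oneTurn, Complex.mem_reProdIm, and_assoc]
  rw [this]
  exact isCompact_Icc.reProdIm isCompact_Icc

lemma outside_boundary {z : ℂ} (hz : z ∈ outside j) (hs : ¬ (0 < z.im ∧ z.im < 1)) :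
    ∃ e s, pt j z.re z.im = E e s ∧ 0 ≤ s ∧ s ≤ len e ∧
      (e = 2 → 3 / 2 ≤ s ∧ s ≤ longLen - 1 / 2) ∧
      (if j = 0 then z.im else 1 - z.im) = (if e = 2 then 1 else 0) := by
  have hL := two_lt_longLen
  obtain ⟨h1, h2, h3, h4, h5⟩ := hz
  have hs' : z.im = 0 ∨ z.im = 1 := by
    rcases h3.eq_or_lt with h | h
    · exact Or.inl h.symm
    · rcases h4.eq_or_lt with h' | h'
      exacts [Or.inr h', absurd ⟨h, h'⟩ hs]
  fin_cases j <;> rcases hs' with hs' | hs' <;> simp only [hs']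
  · obtain ⟨e, s, k, e1, e2, e3, e4⟩ := exists_upper 0 z.re
    refine ⟨e, s, ?_, e2, e3.le, ?_, ?_⟩
    · have := pt_upper (e := e) s k
      rw [e1, ← e4] at this
      exact this
    · rintro rfl; exact absurd e1 (by decide)
    · have : e ≠ 2 := by rintro rfl; exact absurd e1 (by decide)
      simp [this]
  · have h5' : 2 ≤ |2 * z.re - 1| := by
      simp [slitDist, hs'] at h5; linarith
    simp only [circ, Fin.zero_eta, Matrix.cons_val_zero] at h2
    rcases le_abs.1 h5' with h | h
    · refine ⟨2, z.re, ?_, by linarith, by simp [len]; linarith, fun _ => ⟨by linarith, h2⟩, by simp⟩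
      rw [← pt_lower (by linarith) (by simp [len]; linarith) 0]; simp [loBand, loPos]
    · have : z.re = -(1 / 2) := by linarith
      refine ⟨2, longLen - 1 / 2, ?_, by linarith, by simp [len], fun _ => ⟨by linarith, le_rfl⟩,
        by simp⟩
      have := (pt_c_end (r := 1) (by norm_num) le_rfl).2
      simp only [‹z.re = _›]
      exact this
  · have h5' : 3 / 2 ≤ |z.re - 1| := by
      simp [slitDist, hs'] at h5; linarith
    simp only [circ, Fin.mk_one, Matrix.cons_val_one, Matrix.cons_val_zero] at h2
    rcases le_abs.1 h5' with h | h
    · refine ⟨2, z.re - 1, ?_, by linarith, by simp [len]; linarith,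
        fun _ => ⟨by linarith, by linarith⟩, by simp⟩
      rw [← pt_upper _ 0]; simp [upBand, upPos]
    · have : z.re = -(1 / 2) := by linarith
      refine ⟨2, longLen - 1 / 2, ?_, by linarith, by simp [len], fun _ => ⟨by linarith, le_rfl⟩,
        by simp⟩
      have := (pt_c_end (r := 1) (by norm_num) le_rfl).1
      simp only [‹z.re = _›]
      exact this
  · obtain ⟨e, s, k, e1, e2, e3, e4⟩ := exists_lower 1 z.re
    refine ⟨e, s, ?_, e2, e3.le, ?_, ?_⟩
    · have := pt_lower e2 e3.le k
      rw [e1, ← e4] at this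
      exact this
    · rintro rfl; exact absurd e1 (by decide)
    · have : e ≠ 2 := by rintro rfl; exact absurd e1 (by decide)
      simp [this]

/-- Inside the collar, the change of the developing map is that of the twist parameter. -/
def collarJump (z : ℂ) : ℝ := if z.re ≤ 2 then 1 - sA z else sB z

/-- The collar meets its outside only in the two boundary circles. -/
lemma collar_eq_outside {z w : ℂ} (h0 : 0 ≤ z.re) (h3 : z.re < 3) (hz : 0 ≤ z.im ∧ z.im ≤ 1)
    (hw : w ∈ outside j) (h : collar z = pt j w.re w.im) :
    (z.im = 0 ∧ (if j = 0 then w.im else 1 - w.im) = 0) ∨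
      (z.im = 1 ∧ (if j = 0 then w.im else 1 - w.im) = collarJump z) := by
  have hL := two_lt_longLen
  have hw' := hw
  obtain ⟨h1, h2, h4, h5, h6⟩ := hw'
  rcases collar_cases h0 h3 hz with ⟨a, a1, a2, a3, a4, a5⟩ | ⟨a, a1, a3, a4, a5⟩ | ⟨e, s, a, a1, a2, a3⟩
  · obtain ⟨rfl, b1, k, b2⟩ := pt_inj a4 a5 h4 h5 (a.symm.trans h)
    have ha := abs_le.1 (xA_bounds h0 a2.le hz)
    have hk : k = 0 := by
      by_contra hk
      simp only [circ, Matrix.cons_val_one, Matrix.cons_val_zero] at h2 b2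
      have h7 : |z.re - 1| < 1 := by rw [abs_lt]; constructor <;> linarith
      have h8 : |xA z - 1| < 3 / 2 := by
        rw [abs_xA hz.1]; nlinarith [hz.1, hz.2, abs_nonneg (z.re - 1)]
      have ha := abs_lt.1 h8
      rcases lt_or_gt_of_ne hk with h9 | h9
      · have : (k : ℝ) ≤ -1 := by exact_mod_cast Int.le_sub_one_of_lt h9
        nlinarith
      · have : (1 : ℝ) ≤ k := by exact_mod_cast h9
        nlinarith
    rw [hk] at b2
    have b3 : w.re = xA z := by simpa using b2
    have h7 := abs_sub_one_le h0 a2.le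
    have h8 := abs_nonneg (z.re - 1)
    have h9 : z.im = 1 := by
      simp only [slitDist, Matrix.cons_val_one, Matrix.cons_val_zero, b1, b3, abs_xA hz.1, sA] at h6
      have : 0 ≤ (z.im - 1) * (3 - 2 * |z.re - 1|) := by nlinarith
      nlinarith [hz.2]
    refine Or.inr ⟨h9, ?_⟩
    rw [collarJump, if_pos a2.le, b1]; simp
  · obtain ⟨rfl, b1, k, b2⟩ := pt_inj a4 a5 h4 h5 (a.symm.trans h)
    have ha := abs_le.1 (xB_bounds a1.le h3.le hz)
    have hk : k = 0 := by
      by_contra hk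
      simp only [circ, Matrix.cons_val_zero] at h2 b2
      have h7 : |2 * z.re - 5| < 1 := by rw [abs_lt]; constructor <;> linarith
      have h8 : |2 * xB z - 1| < 2 := by
        rw [abs_xB hz.1]; nlinarith [hz.1, hz.2, abs_nonneg (2 * z.re - 5)]
      have ha := abs_lt.1 h8
      rcases lt_or_gt_of_ne hk with h9 | h9
      · have : (k : ℝ) ≤ -1 := by exact_mod_cast Int.le_sub_one_of_lt h9
        nlinarith
      · have : (1 : ℝ) ≤ k := by exact_mod_cast h9
        nlinarith
    rw [hk] at b2
    have b3 : w.re = xB z := by simpa using b2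
    have h7 := abs_two_mul_sub_le a1.le h3.le
    have h8 := abs_nonneg (2 * z.re - 5)
    have h9 : z.im = 1 := by
      simp only [slitDist, Matrix.cons_val_zero, b1, b3, abs_xB hz.1, sB] at h6
      have : 0 ≤ (z.im - 1) * (2 - |2 * z.re - 5|) := by nlinarith
      nlinarith [hz.2]
    refine Or.inr ⟨h9, ?_⟩
    rw [if_pos rfl, b1, collarJump, if_neg (by linarith)]
  · have hb : ¬ (0 < w.im ∧ w.im < 1) := fun hb => pt_ne_E hb.1 hb.2 e s (h.symm.trans a)
    obtain ⟨e', s', b1, b2, b3, b4, b5⟩ := outside_boundary hw hb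
    rw [b5]
    have hE : E e s = E e' s' := a.symm.trans (h.trans b1)
    rcases a3 with ⟨a4, a5, a6⟩ | ⟨a4, rfl, a5⟩
    · refine Or.inl ⟨a4, ?_⟩
      rw [if_neg]
      rintro rfl
      obtain ⟨c1, c2⟩ := b4 rfl
      have := E_inj (e := 2) (by linarith) (by simp [len]; linarith) a1 a2 hE.symm
      linarith [this.2]
    · have hs : 0 < s ∧ s < len 2 := by
        rw [show len 2 = longLen by simp [len]]
        constructor <;> rcases a5 with ⟨-, h5⟩ | ⟨-, h5⟩ <;> linarith
      obtain ⟨rfl, rfl⟩ := E_inj hs.1 hs.2 b2 b3 hE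
      obtain ⟨c1, c2⟩ := b4 rfl
      have h9 : z.im = 1 := by rcases a5 with ⟨-, h5⟩ | ⟨-, h5⟩ <;> linarith
      refine Or.inr ⟨h9, ?_⟩
      rcases a5 with ⟨h5, -⟩ | ⟨h5, -⟩ <;> norm_num [collarJump, sA, h5]

/-- The collar and its outside cover the model. -/
lemma exists_outside_or_collar (x : Model) :
    (∃ j, ∃ z ∈ outside j, pt j z.re z.im = x) ∨ ∃ z ∈ oneTurn, collar z = x := by
  obtain ⟨j, w, hw, hx⟩ := exists_P_eq 0 x
  obtain ⟨y, k, hy0, hy1, hy⟩ := exists_eq_add (circ j) (circ_pos j)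
    (w.re - w.im / ht j * sh 0 j + 1 / 2)
  have hh := ht_pos j
  set s := w.im / ht j with hs
  have hs0 : 0 ≤ s := div_nonneg hw.1 hh.le
  have hs1 : s ≤ 1 := div_le_one_of_le₀ hw.2 hh.le
  have hx' : pt j (y - 1 / 2) s = x := by
    rw [← hx, P, ← hs, show w.re - s * sh 0 j = y - 1 / 2 + k * circ j by linarith]
    apply Subtype.ext
    rw [pt_val hs0 hs1, pt_val hs0 hs1, cyl_add]
  by_cases hd : 0 ≤ slitDist j ⟨y - 1 / 2, s⟩
  · exact Or.inl ⟨j, ⟨y - 1 / 2, s⟩, ⟨by simpa using hy0, by simpa using hy1.le, hs0, hs1, hd⟩, hx'⟩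
  refine Or.inr ?_
  push Not at hd
  fin_cases j
  · simp only [slitDist, Fin.zero_eta, Matrix.cons_val_zero] at hd
    obtain ⟨a, b, ha0, ha1, hb0, hb1, e1, e2⟩ := exists_collar_coords (R := 1)
      (x := |2 * (y - 1 / 2) - 1|) (s := 2 * (1 - s)) one_pos (abs_nonneg _) (by linarith)
      (by linarith)
    obtain ⟨θ, hθ, hθ'⟩ : ∃ θ, |2 * θ - 5| = a ∧ (5 - 2 * θ) * (1 + b) = 2 * (y - 1 / 2) - 1 := by
      rcases abs_choice (2 * (y - 1 / 2) - 1) with h | h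
      · refine ⟨(5 - a) / 2, ?_, by rw [← h, ← e1]; ring⟩
        rw [show 2 * ((5 - a) / 2) - 5 = -a by ring, abs_neg, abs_of_nonneg ha0]
      · refine ⟨(5 + a) / 2, ?_, by linarith⟩
        rw [show 2 * ((5 + a) / 2) - 5 = a by ring, abs_of_nonneg ha0]
    have hθ2 := abs_le.1 (hθ.le.trans ha1)
    have hz : (⟨θ, b⟩ : ℂ) ∈ partB 0 :=
      ⟨by simp; linarith, by simp; linarith, hb0, hb1⟩
    refine ⟨⟨θ, b⟩, ⟨by simp; linarith, by simp; linarith, hb0, hb1⟩, ?_⟩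
    rw [collar_B hz, xB, sB]
    simp only [hθ]
    refine Eq.trans ?_ hx'
    congr 1 <;> linarith
  · simp only [slitDist, Fin.mk_one, Matrix.cons_val_one, Matrix.cons_val_zero] at hd
    obtain ⟨a, b, ha0, ha1, hb0, hb1, e1, e2⟩ := exists_collar_coords (R := 1 / 2)
      (x := |y - 1 / 2 - 1|) (s := s) (by norm_num) (abs_nonneg _) hs0 (by linarith)
    obtain ⟨θ, hθ, hθ'⟩ : ∃ θ, |θ - 1| = a ∧ (θ - 1) * (1 + b) = y - 1 / 2 - 1 := by
      rcases abs_choice (y - 1 / 2 - 1) with h | h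
      · refine ⟨1 + a, ?_, by rw [← h, ← e1]; ring⟩
        rw [show 1 + a - 1 = a by ring, abs_of_nonneg ha0]
      · refine ⟨1 - a, ?_, by linarith⟩
        rw [show 1 - a - 1 = -a by ring, abs_neg, abs_of_nonneg ha0]
    have hθ2 := abs_le.1 (hθ.le.trans ha1)
    have hz : (⟨θ, 2 * b⟩ : ℂ) ∈ partA 0 :=
      ⟨by simp; linarith, by simp; linarith, by simpa using hb0, by simp; linarith⟩
    refine ⟨⟨θ, 2 * b⟩, ⟨by simp; linarith, by simp; linarith, by simpa using hb0,
      by simp; linarith⟩, ?_⟩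
    rw [collar_A hz, xA, sA]
    simp only [hθ]
    refine Eq.trans ?_ hx'
    congr 1 <;> linarith

end

section

variable {t : ℝ} {j : Fin 2}

/-- The affine Dehn twist on the covering of the collar. -/
def twist (z : ℂ) : ℂ := z + 3 * (z.im : ℂ)

lemma im_twist (z : ℂ) : (twist z).im = z.im := by simp [twist]

lemma re_twist (z : ℂ) : (twist z).re = z.re + 3 * z.im := by simp [twist]

lemma continuous_twist : Continuous twist := by unfold twist; fun_prop

/-- The pieces of the presentation that defines the Dehn twist: the collar and its outside. -/
def twistDom : Option (Fin 2) → Set ℂ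
  | some j => outside j
  | none => oneTurn

/-- The map to the surface on each piece. -/
def untwisted : Option (Fin 2) → ℂ → Model
  | some j => fun z => pt j z.re z.im
  | none => collar

/-- The map to the surface on each piece, after the Dehn twist. -/
def twisted : Option (Fin 2) → ℂ → Model
  | some j => fun z => pt j z.re z.im
  | none => fun z => collar (twist z)

/-- The developing map on each piece. -/
def untwistedDev (t : ℝ) : Option (Fin 2) → ℂ → ℂ
  | some j => fun z => coord t j z.re z.im
  | none => collarDev t

/-- The developing map, after the Dehn twist, of the surface with the next twist parameter. -/
def twistedDev (t : ℝ) : Option (Fin 2) → ℂ → ℂ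
  | some j => fun z => coord (t + 1) j z.re z.im + if j = 0 then 0 else 1
  | none => fun z => collarDev (t + 1) (twist z)

/-- Two turns of the covering are collapsed to one turn. -/
lemma exists_oneTurn {z : ℂ} (hz : 0 ≤ z.im ∧ z.im ≤ 1) : ∃ k : ℤ, z + 3 * k ∈ oneTurn ∧
    (z + 3 * k).re < 3 := by
  obtain ⟨k, h0, h3⟩ := exists_reduced z
  exact ⟨k, ⟨h0, h3.le, by rwa [im_add_three_mul]⟩, h3⟩

lemma oneTurn_subset : oneTurn ⊆ twoTurns := fun _ hz => ⟨hz.1, by linarith [hz.2.1], hz.2.2⟩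

lemma mapsTo_twist : MapsTo twist oneTurn twoTurns := fun z hz => by
  obtain ⟨h0, h3, hz0, hz1⟩ := hz
  refine ⟨?_, ?_, ?_⟩ <;> simp only [re_twist, im_twist]
  · linarith
  · linarith
  · exact ⟨hz0, hz1⟩

lemma isCompact_twistDom (i : Option (Fin 2)) : IsCompact (twistDom i) := by
  cases i
  exacts [isCompact_oneTurn, isCompact_outside _]

lemma continuous_pt_re_im (j : Fin 2) : Continuous fun z : ℂ => pt j z.re z.im := by
  have h : Continuous fun z : ℂ => (z.re, z.im) := by fun_prop
  have h2 := (continuous_pt j).comp h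
  unfold Function.comp at h2
  exact h2

lemma isPresentation_untwisted : IsPresentation twistDom untwisted := by
  refine IsPresentation.of_isCompact isCompact_twistDom (fun i => ?_) fun x => ?_
  · cases i with
    | none => exact continuousOn_collar.mono oneTurn_subset
    | some j => exact (continuous_pt_re_im j).continuousOn
  · rcases exists_outside_or_collar x with ⟨j, z, hz, h⟩ | ⟨z, hz, h⟩
    · exact ⟨some j, z, hz, h⟩
    · exact ⟨none, z, hz, h⟩

lemma isPresentation_twisted : IsPresentation twistDom twisted := by
  refine IsPresentation.of_isCompact isCompact_twistDom (fun i => ?_) fun x => ?_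
  · cases i with
    | none => exact continuousOn_collar.comp continuous_twist.continuousOn mapsTo_twist
    | some j => exact (continuous_pt_re_im j).continuousOn
  · rcases exists_outside_or_collar x with ⟨j, z, hz, h⟩ | ⟨z, hz, h⟩
    · exact ⟨some j, z, hz, h⟩
    · have him : (z - 3 * (z.im : ℂ)).im = z.im := by simp
      obtain ⟨k, hk, -⟩ := exists_oneTurn (z := z - 3 * (z.im : ℂ)) (by rw [him]; exact hz.2.2)
      refine ⟨none, _, hk, ?_⟩
      have : twist (z - 3 * (z.im : ℂ) + 3 * k) = z + 3 * k := by
        rw [twist, im_add_three_mul, him]; ring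
      show collar (twist _) = x
      rw [this, collar_add, h]

lemma twist_eq_add {z : ℂ} (h : z.im = 0 ∨ z.im = 1) : ∃ k : ℤ, twist z = z + 3 * k := by
  rcases h with h | h
  · exact ⟨0, by simp [twist, h]⟩
  · exact ⟨1, by simp [twist, h]⟩

lemma collar_eq_outside_iff {z w : ℂ} (hz : 0 ≤ z.im ∧ z.im ≤ 1) (hw : w ∈ outside j) :
    collar z = pt j w.re w.im ↔ collar (twist z) = pt j w.re w.im := by
  have key : ∀ {z : ℂ}, 0 ≤ z.im ∧ z.im ≤ 1 → collar z = pt j w.re w.im → z.im = 0 ∨ z.im = 1 := by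
    intro z hz h
    obtain ⟨k, hk, hk3⟩ := exists_oneTurn hz
    have := collar_eq_outside hk.1 hk3 hk.2.2 hw (by rw [collar_add, h])
    rw [im_add_three_mul] at this
    exact this.imp And.left And.left
  have key2 : z.im = 0 ∨ z.im = 1 → collar (twist z) = collar z := fun h => by
    obtain ⟨k, hk⟩ := twist_eq_add h
    rw [hk, collar_add]
  constructor
  · intro h
    rw [key2 (key hz h), h]
  · intro h
    rw [← key2, h]
    have := key (z := twist z) (by rwa [im_twist]) h
    rwa [im_twist] at this

lemma collar_twist_iff {z w : ℂ} (hz : 0 ≤ z.im ∧ z.im ≤ 1) (hw : 0 ≤ w.im ∧ w.im ≤ 1) :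
    collar z = collar w ↔ collar (twist z) = collar (twist w) := by
  have h0 : ∀ {z : ℂ}, z.im = 0 → twist z = z := fun h => by simp [twist, h]
  constructor
  · intro h
    obtain ⟨h1, h2 | ⟨k, rfl⟩⟩ := collar_inj hz hw h
    · rw [h0 h2, h0 (h1 ▸ h2), h]
    · rw [show twist (z + 3 * k) = twist z + 3 * k by
        rw [twist, twist, im_add_three_mul]; ring, collar_add]
  · intro h
    obtain ⟨h1, h2 | ⟨k, hk⟩⟩ := collar_inj (by rwa [im_twist]) (by rwa [im_twist]) h
    · rw [im_twist] at h1 h2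
      rw [im_twist] at h1
      rwa [h0 h2, h0 (h1 ▸ h2)] at h
    · rw [im_twist, im_twist] at h1
      rw [twist, twist, h1] at hk
      rw [show w = z + 3 * k by linear_combination hk, collar_add]

lemma untwisted_eq_iff (i k : Option (Fin 2)) (z : ℂ) (hz : z ∈ twistDom i) (w : ℂ)
    (hw : w ∈ twistDom k) : untwisted i z = untwisted k w ↔ twisted i z = twisted k w := by
  cases i with
  | none =>
    cases k with
    | none => exact collar_twist_iff hz.2.2 hw.2.2
    | some k => exact collar_eq_outside_iff hz.2.2 hw
  | some i =>
    cases k with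
    | none =>
      rw [eq_comm, eq_comm (a := twisted _ _)]
      exact collar_eq_outside_iff hw.2.2 hz
    | some k => exact Iff.rfl

lemma topPt_add_one (t : ℝ) (j : Fin 2) :
    topPt (t + 1) j = topPt t j + if j = 0 then 1 else -1 := by
  fin_cases j <;> apply Complex.ext <;> simp [topPt, sh]
  ring

lemma coord_add_one (t x s : ℝ) (j : Fin 2) :
    coord (t + 1) j x s = coord t j x s + if j = 0 then (s : ℂ) else -s := by
  rw [coord, coord, topPt_add_one]
  split_ifs <;> ring

lemma collarDev_add_one (t : ℝ) {z : ℂ} (h0 : 0 ≤ z.re) (h3 : z.re ≤ 3)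
    (hz : 0 ≤ z.im ∧ z.im ≤ 1) : collarDev (t + 1) z = collarDev t z + (collarJump z - 1 : ℝ) := by
  rcases mem_part_zero h0 h3 hz with ⟨h, h2⟩ | ⟨h, h2⟩
  · rw [(collar_of_partA h).2, (collar_of_partA h).2, coord_add_one, collarJump, if_pos h2,
      if_neg (by decide)]
    simp
  · rw [(collar_of_partB h).2, (collar_of_partB h).2, coord_add_one, topPt_add_one, if_pos rfl,
      if_pos rfl, collarJump, if_neg (by linarith)]
    simp; ring

lemma collarJump_zero {z : ℂ} (hz : z.im = 0) : collarJump z = 1 := by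
  simp [collarJump, sA, sB, hz]

lemma continuousOn_twistedDev_sub (t : ℝ) (i : Option (Fin 2)) :
    ContinuousOn (fun z => twistedDev t i z - untwistedDev t i z) (twistDom i) := by
  cases i with
  | none =>
    exact ((continuousOn_collarDev (t + 1)).comp continuous_twist.continuousOn mapsTo_twist).sub
      ((continuousOn_collarDev t).mono oneTurn_subset)
  | some j =>
    refine Continuous.continuousOn ?_
    simp only [twistedDev, untwistedDev, coord]
    fun_prop

lemma twistedDev_sub_some (t : ℝ) (j : Fin 2) (z : ℂ) :
    twistedDev t (some j) z - untwistedDev t (some j) z =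
      ((if j = 0 then z.im else 1 - z.im : ℝ) : ℂ) := by
  simp only [twistedDev, untwistedDev, coord_add_one]
  split_ifs <;> push_cast <;> ring

lemma twistedDev_sub_none_add (t : ℝ) (z : ℂ) (k : ℤ) :
    twistedDev t none (z + 3 * k) - untwistedDev t none (z + 3 * k) =
      twistedDev t none z - untwistedDev t none z := by
  simp only [twistedDev, untwistedDev]
  rw [show twist (z + 3 * k) = twist z + 3 * k by
    rw [twist, twist, im_add_three_mul]; ring, collarDev_add, collarDev_add]
  ring

/-- The change of the developing map vanishes on the slit, and agrees on the outer boundary of the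
collar with the change outside. -/
lemma twistedDev_sub_none (t : ℝ) {z : ℂ} (h0 : 0 ≤ z.re) (h3 : z.re ≤ 3) :
    (z.im = 0 → twistedDev t none z - untwistedDev t none z = 0) ∧
      (z.im = 1 → twistedDev t none z - untwistedDev t none z = (collarJump z : ℂ)) := by
  simp only [twistedDev, untwistedDev]
  refine ⟨fun h => ?_, fun h => ?_⟩
  · rw [show twist z = z by simp [twist, h], collarDev_add_one t h0 h3 (by simp [h]),
      collarJump_zero h]
    simp
  · rw [show twist z = z + 3 * (1 : ℤ) by simp [twist, h], collarDev_add,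
      collarDev_add_one t h0 h3 (by simp [h])]
    push_cast; ring

lemma outside_jump_unique {i k : Fin 2} {z w : ℂ} (hz : z ∈ outside i) (hw : w ∈ outside k)
    (h : pt i z.re z.im = pt k w.re w.im) :
    (if i = 0 then z.im else 1 - z.im) = if k = 0 then w.im else 1 - w.im := by
  have hL := two_lt_longLen
  by_cases h1 : 0 < z.im ∧ z.im < 1
  · obtain ⟨rfl, h2, -⟩ := pt_inj h1.1 h1.2 hw.2.2.1 hw.2.2.2.1 h
    rw [h2]
  by_cases h2 : 0 < w.im ∧ w.im < 1
  · obtain ⟨rfl, h3, -⟩ := pt_inj h2.1 h2.2 hz.2.2.1 hz.2.2.2.1 h.symm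
    rw [h3]
  obtain ⟨e, s, a1, a2, a3, a4, a5⟩ := outside_boundary hz h1
  obtain ⟨e', s', b1, b2, b3, b4, b5⟩ := outside_boundary hw h2
  rw [a5, b5]
  have hE : E e s = E e' s' := a1.symm.trans (h.trans b1)
  by_cases he : e = 2
  · obtain ⟨c1, c2⟩ := a4 he
    subst he
    rw [(E_inj (by linarith) (by simp [len]; linarith) b2 b3 hE).1]
  · by_cases he' : e' = 2
    · obtain ⟨c1, c2⟩ := b4 he'
      subst he'
      rw [(E_inj (by linarith) (by simp [len]; linarith) a2 a3 hE.symm).1]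
    · rw [if_neg he, if_neg he']

lemma twistedDev_sub_collar_outside (t : ℝ) {z w : ℂ} (hz : z ∈ oneTurn) (hw : w ∈ outside j)
    (h : collar z = pt j w.re w.im) : twistedDev t none z - untwistedDev t none z =
      twistedDev t (some j) w - untwistedDev t (some j) w := by
  obtain ⟨k, hk, hk3⟩ := exists_oneTurn hz.2.2
  rw [twistedDev_sub_some, ← twistedDev_sub_none_add t z k]
  have hn := twistedDev_sub_none t hk.1 hk.2.1
  rcases collar_eq_outside hk.1 hk3 hk.2.2 hw (by rw [collar_add, h]) with ⟨h1, h2⟩ | ⟨h1, h2⟩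
  · rw [h2, hn.1 h1]; simp
  · rw [h2, hn.2 h1]

lemma twistedDev_sub_eq (t : ℝ) (i k : Option (Fin 2)) (z : ℂ) (hz : z ∈ twistDom i) (w : ℂ)
    (hw : w ∈ twistDom k) (h : untwisted i z = untwisted k w) :
    twistedDev t i z - untwistedDev t i z = twistedDev t k w - untwistedDev t k w := by
  cases i with
  | none =>
    cases k with
    | none =>
      obtain ⟨h1, h2 | ⟨k, rfl⟩⟩ := collar_inj hz.2.2 hw.2.2 h
      · rw [(twistedDev_sub_none t hz.1 hz.2.1).1 h2,
          (twistedDev_sub_none t hw.1 hw.2.1).1 (h1 ▸ h2)]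
      · rw [twistedDev_sub_none_add]
    | some k => exact twistedDev_sub_collar_outside t hz hw h
  | some i =>
    cases k with
    | none => exact (twistedDev_sub_collar_outside t hw hz h.symm).symm
    | some k =>
      rw [twistedDev_sub_some, twistedDev_sub_some, outside_jump_unique hz hw h]

lemma develops_untwisted (t : ℝ) :
    Develops (surf t) twistDom untwisted (untwistedDev t) := by
  intro i z hz
  cases i with
  | none => exact (eventually_dev_collar t z).filter_mono (nhdsWithin_mono _ oneTurn_subset)
  | some j =>
    exact eventually_dev_coord Complex.continuous_re.continuousOn Complex.continuous_im.continuousOn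
      (fun z hz => ⟨hz.2.2.1, hz.2.2.2.1⟩) hz

lemma develops_twisted (t : ℝ) :
    Develops (surf (t + 1)) twistDom twisted (twistedDev t) := by
  intro i z hz
  cases i with
  | none =>
    have h := eventually_dev_collar (t + 1) (twist z)
    have ht : Tendsto twist (𝓝[oneTurn] z) (𝓝[twoTurns] (twist z)) :=
      continuous_twist.continuousWithinAt.tendsto_nhdsWithin mapsTo_twist
    exact ht.eventually h
  | some j =>
    have := eventually_dev_coord (t := t + 1) (j := j) (D := outside j)
      Complex.continuous_re.continuousOn Complex.continuous_im.continuousOn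
      (fun z hz => ⟨hz.2.2.1, hz.2.2.2.1⟩) hz
    filter_upwards [this] with w hw
    refine hw.trans ?_
    simp only [twistedDev]
    ring

/-- The left surgery does not change the absolute periods.  The obvious identification of the
cylinders changes the developing map by a closed form dual to the boundary of a collar of the slit;
composing with a Dehn twist in this collar makes the change exact. -/
lemma sameAbsolutePeriods_add_one (t : ℝ) : (surf t).SameAbsolutePeriods (surf (t + 1)) :=
  sameAbsolutePeriods_of_presentations (S := surf t) (T := surf (t + 1)) isPresentation_untwisted
    isPresentation_twisted untwisted_eq_iff (develops_untwisted t) (develops_twisted t)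
    (continuousOn_twistedDev_sub t) (twistedDev_sub_eq t)

lemma sameAbsolutePeriods_surf (n : ℤ) : (surf 0).SameAbsolutePeriods (surf n) := by
  induction n with
  | zero => simpa using SameAbsolutePeriods.refl _
  | succ n ih => simpa using ih.trans (sameAbsolutePeriods_add_one _)
  | pred n ih =>
    refine ih.trans (SameAbsolutePeriods.symm ?_)
    have := sameAbsolutePeriods_add_one ((-(n : ℤ) - 1 : ℤ) : ℝ)
    simpa using this

end

section

variable {t : ℝ} {j : Fin 2}

/-! ### Rigidity: surgeries are unique, and different twists give different surfaces -/

lemma comp_seg_short {S : TranslationSurface} {e : S ≃ₜ surf t} (he : IsTranslationMap e)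
    {γ : C(I, S)} (h : S.IsUnitHorizontalSaddle γ) : (e : C(S, surf t)).comp γ = seg t 0 0 1 :=
  eq_of_isUnitHorizontalSaddle (h.map he)

lemma comp_twin_upper {S : TranslationSurface} {e : S ≃ₜ surf t} (he : IsTranslationMap e)
    {γ η : C(I, S)} (h : S.IsUnitHorizontalSaddle γ) (hη : S.IsSegment η 1)
    (hH : S.HalfDiscAt {z | 0 ≤ z.im} γ η) : (e : C(S, surf t)).comp η = seg t 2 0 1 := by
  have := hH.map he (by simp)
  rw [comp_seg_short he h] at this
  exact this.eq_of_isSegment isPreconnected_upperHalfDisc_diff (by simp) (halfDiscAt_upper t)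
    (hη.map he) (isSegment_seg_one t 2)

lemma comp_twin_lower {S : TranslationSurface} {e : S ≃ₜ surf t} (he : IsTranslationMap e)
    {γ η : C(I, S)} (h : S.IsUnitHorizontalSaddle γ) (hη : S.IsSegment η 1)
    (hH : S.HalfDiscAt {z | z.im ≤ 0} γ η) : (e : C(S, surf t)).comp η = seg t 1 0 1 := by
  have := hH.map he (by simp)
  rw [comp_seg_short he h] at this
  exact this.eq_of_isSegment isPreconnected_lowerHalfDisc_diff (by simp) (halfDiscAt_lower t)
    (hη.map he) (isSegment_seg_one t 1)

lemma IsLeftSurgery.isSurgery {S T : TranslationSurface} (h : S.IsLeftSurgery T) {e : S ≃ₜ surf t}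
    (he : IsTranslationMap e) : (surf t).IsSurgery T (seg t 0 0 1) (seg t 2 0 1) 1 := by
  obtain ⟨γ, η, hγ, hη, -, hH, hs⟩ := h
  have := hs.map he
  rwa [comp_seg_short he hγ, comp_twin_upper he hγ hη.2.1 hH] at this

lemma IsRightSurgery.isSurgery {S T : TranslationSurface} (h : S.IsRightSurgery T)
    {e : S ≃ₜ surf t} (he : IsTranslationMap e) :
    (surf t).IsSurgery T (seg t 0 0 1) (seg t 1 0 1) 1 := by
  obtain ⟨γ, η, hγ, hη, -, hH, hs⟩ := h
  have := hs.map he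
  rwa [comp_seg_short he hγ, comp_twin_lower he hγ hη.2.1 hH] at this

lemma isTranslationMap_refl (S : TranslationSurface) : IsTranslationMap (Homeomorph.refl S) :=
  fun _ => Eventually.of_forall fun _ => rfl

lemma IsLeftSurgery.isomorphic {S T : TranslationSurface} (h : S.IsLeftSurgery T)
    (hS : S.Isomorphic (surf t)) : T.Isomorphic (surf (t + 1)) := by
  obtain ⟨e, he⟩ := hS
  exact (h.isSurgery he).isomorphic ((isLeftSurgery_surf t).isSurgery (isTranslationMap_refl _))
    (isSimpleCut_seg (by decide)) (isSegment_seg_one t 0) (isSegment_seg_one t 2)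

lemma IsRightSurgery.isomorphic {S T : TranslationSurface} (h : S.IsRightSurgery T)
    (hS : S.Isomorphic (surf t)) : T.Isomorphic (surf (t - 1)) := by
  obtain ⟨e, he⟩ := hS
  exact (h.isSurgery he).isomorphic ((isRightSurgery_surf t).isSurgery (isTranslationMap_refl _))
    (isSimpleCut_seg (by decide)) (isSegment_seg_one t 0) (isSegment_seg_one t 1)

lemma IsOctFamily.isomorphic {Oct : ℤ → TranslationSurface} (h : IsOctFamily Oct)
    (h0 : (Oct 0).Isomorphic (surf 0)) (n : ℤ) : (Oct n).Isomorphic (surf n) := by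
  induction n with
  | zero => simpa using h0
  | succ n ih => simpa using (h.left n (by positivity)).isomorphic ih
  | pred n ih => simpa using (h.right (-n) (by simp)).isomorphic ih

/-- The vertical segment that crosses the short cylinder upwards. -/
def crossing (t x : ℝ) : C(I, surf t) :=
  ⟨fun s => P t 0 (x + s * Complex.I), (continuous_P t 0).comp (by fun_prop)⟩

lemma crossing_apply (t x : ℝ) (s : I) : crossing t x s = P t 0 (x + s * Complex.I) := rfl

lemma isSegment_crossing (t x : ℝ) : (surf t).IsSegment (crossing t x) Complex.I where
  ne_zero := Complex.I_ne_zero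
  straight s := by
    have hc : Continuous fun s : I => (x + s * Complex.I : ℂ) := by fun_prop
    filter_upwards [eventually_dev_of_strip (t := t) (j := 0) hc
      (fun s => by simp [strip, ht, s.2.1, s.2.2]) s] with s' h
    rw [crossing_apply, crossing_apply, h]
    push_cast
    ring
  regular s hs0 hs1 := by
    have hs0' : (0 : ℝ) < s := hs0
    have hs1' : (s : ℝ) < 1 := hs1
    exact isRegular_surf (P_ne_vertex (by simpa using hs0') (by simpa [ht] using hs1'))

lemma crossing_zero (t x : ℝ) : crossing t x 0 = E 1 x := by
  rw [crossing_apply]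
  have h := P_upper (t := t) (e := 1) x
  simp only [upperPt, upPos, upBand, Matrix.cons_val_one, Matrix.cons_val_zero, zero_add] at h
  have e : (x : ℂ) + (0 : I) * Complex.I = x := by simp
  rw [e]
  exact h

lemma crossing_one (t x : ℝ) : ∃ s, ∃ k : ℤ, 0 ≤ s ∧ s < longLen ∧ x - t = s + k * longLen ∧
    crossing t x 1 = E 2 s := by
  obtain ⟨s, k, h0, h1, h⟩ := exists_eq_add longLen longLen_pos (x - t)
  refine ⟨s, k, h0, h1, h, ?_⟩
  have h2 := P_lower_add (t := t) (e := 2) h0 (by simpa [len] using h1.le) k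
  rw [crossing_apply, ← h2]
  have hx : (x : ℂ) = t + s + k * longLen := by
    rw [show x = t + s + k * longLen by linarith]; push_cast; ring
  show P t 0 _ = P t 0 _
  congr 1
  rw [hx]
  apply Complex.ext <;> simp [lowerPt, topPt, sh, ht, loBand, loPos, circ]

/-- A translation that maps the beginning of an edge to the beginning of that edge maps the
whole edge accordingly. -/
lemma map_edge {t' : ℝ} {f : surf t ≃ₜ surf t'} (hf : IsTranslationMap f) {e : Fin 3}
    (h : (f : C(surf t, surf t')).comp (seg t e 0 1) = seg t' e 0 1) {s : ℝ}
    (hs0 : 0 ≤ s) (hs1 : s ≤ len e) : f (E e s) = E e s := by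
  have hl := len_pos e
  have hl1 := one_le_len e
  have h1 := (isSegment_seg t (e := e) le_rfl hl (zero_add _).le).map hf
  have h2 := isSegment_seg t' (e := e) le_rfl hl (zero_add _).le
  have key : ∀ s : ℝ, 0 ≤ s → s ≤ len e → ∃ p : I, (p : ℝ) * len e = s := fun s h0 h1 =>
    ⟨⟨s / len e, by positivity, by rwa [div_le_one hl]⟩, div_mul_cancel₀ _ hl.ne'⟩
  obtain ⟨p, hp⟩ := key (1 / 2) (by norm_num) (by linarith)
  obtain ⟨q, hq⟩ := key s hs0 hs1
  have hp0 : (0 : ℝ) < p := by by_contra hc; push Not at hc; nlinarith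
  have hp1 : (p : ℝ) < 1 := by by_contra hc; push Not at hc; nlinarith
  obtain ⟨u, hu⟩ : ∃ u : I, (u : ℝ) = 1 / 2 := ⟨⟨1 / 2, by norm_num, by norm_num⟩, rfl⟩
  have h3 : f (E e (0 + u * 1)) = E e (0 + u * 1) := DFunLike.congr_fun h u
  rw [mul_one, hu, ← hp] at h3
  have h6 : f (E e (0 + q * len e)) = E e (0 + q * len e) :=
    DFunLike.congr_fun (h1.eq_of_apply_eq h2 (t₀ := p) hp0 hp1 h3) q
  rwa [hq, zero_add] at h6

/-- The twist modulo the length of the long edges is preserved by translations: the image of the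
long edges is determined by the twins of the short saddle connection, hence so is the place where a
vertical segment that starts on one of them meets the other. -/
lemma exists_of_isomorphic {t' : ℝ} (h : (surf t).Isomorphic (surf t')) :
    ∃ k : ℤ, t - t' = k * longLen := by
  obtain ⟨f, hf⟩ := h
  have hL := two_lt_longLen
  have hu := comp_twin_upper hf (isUnitHorizontalSaddle_seg t) (isSegment_seg_one t 2)
    (halfDiscAt_upper t)
  have hl := comp_twin_lower hf (isUnitHorizontalSaddle_seg t) (isSegment_seg_one t 1)
    (halfDiscAt_lower t)
  have hcr : (f : C(surf t, surf t')).comp (crossing t 1) = crossing t' 1 := by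
    have h0 : (f : C(surf t, surf t')).comp (crossing t 1) 0 = E 1 1 := by
      exact (congrArg f (crossing_zero t 1)).trans (map_edge hf hl zero_le_one (one_le_len 1))
    refine ((isSegment_crossing t 1).map hf).eq_of_start_isRegular (isSegment_crossing t' 1) ?_ ?_
    · exact h0.trans (crossing_zero t' 1).symm
    · rw [h0]
      exact isRegular_surf (E_ne_vertex one_pos (by simp [len]; linarith))
  obtain ⟨s, k, h0, h1, h2, h3⟩ := crossing_one t 1
  obtain ⟨s', k', h0', h1', h2', h3'⟩ := crossing_one t' 1
  have hlen : len 2 = longLen := len_of_ne_zero (by decide)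
  have h4 : f (crossing t 1 1) = crossing t' 1 1 := DFunLike.congr_fun hcr 1
  replace h4 := ((map_edge hf hu h0 (h1.le.trans_eq hlen.symm)).symm.trans (congrArg f h3).symm).trans (h4.trans h3')
  have hss : s = s' := by
    rcases h0.eq_or_lt with e | e
    · rcases h0'.eq_or_lt with e' | e'
      · rw [← e, ← e']
      · rw [← e] at h4
        exact absurd (h4.symm.trans (E_zero 2)) (E_ne_vertex e' (by rwa [hlen]))
    · exact (E_inj e (by rwa [hlen]) h0' (by rw [hlen]; exact h1'.le) h4).2.symm
  refine ⟨k' - k, ?_⟩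
  push_cast
  linarith

lemma not_isomorphic_surf {n m : ℤ} (h : n ≠ m) : ¬ (surf n).Isomorphic (surf m) := by
  intro hi
  obtain ⟨k, hk⟩ := exists_of_isomorphic hi
  have hk0 : k ≠ 0 := by
    rintro rfl
    simp only [Int.cast_zero, zero_mul, sub_eq_zero, Int.cast_inj] at hk
    exact h hk
  have hirr : Irrational (k * longLen) := by
    have := ((irrational_sqrt_two.intCast_add 1).intCast_mul hk0)
    simpa [longLen] using this
  exact hirr ⟨(n - m : ℤ), by push_cast; exact hk⟩

end

section

variable {t : ℝ} {j : Fin 2}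

/-! ### The genus -/

lemma continuousOn_symm_of_isCompact {X Y : Type*} [TopologicalSpace X] [TopologicalSpace Y]
    [T2Space Y] {f : PartialEquiv X Y} {K : Set X} (hK : IsCompact K) (hf : ContinuousOn f K)
    (hs : f.source ⊆ K) (hinj : ∀ z ∈ f.source, ∀ w ∈ K, f z = f w → z = w) :
    ContinuousOn f.symm f.target := by
  intro y hy V hV
  have hz := f.map_target hy
  obtain ⟨U, hUV, hU, hyU⟩ := mem_nhds_iff.1 hV
  have hclosed : IsClosed (f '' (K \ U)) :=
    ((hK.diff hU).image_of_continuousOn (hf.mono sdiff_subset)).isClosed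
  have hy' : y ∉ f '' (K \ U) := by
    rintro ⟨w, ⟨hw, hwU⟩, h⟩
    rw [← f.right_inv hy] at h
    exact hwU (hinj _ hz w hw h.symm ▸ hyU)
  have h1 : ∀ᶠ x in 𝓝[f.target] y, x ∉ f '' (K \ U) :=
    nhdsWithin_le_nhds (hclosed.isOpen_compl.mem_nhds hy')
  have h2 : ∀ᶠ x in 𝓝[f.target] y, x ∈ f.target := self_mem_nhdsWithin
  refine (h1.and h2).mono fun x ⟨hx, hxt⟩ => hUV ?_
  by_contra hcon
  exact hx ⟨f.symm x, ⟨hs (f.map_target hxt), hcon⟩, f.right_inv hxt⟩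

/-- The cells of a cell decomposition of the model: the vertex; the three edges, and one arc
across each of the two cylinders; the two cylinders, cut along these arcs. -/
def Cell : ℕ → Type
  | 0 => Unit
  | 1 => Fin 3 ⊕ Fin 2
  | 2 => Fin 2
  | _ => Empty

instance finite_cell : ∀ n, Finite (Cell n)
  | 0 => inferInstanceAs (Finite Unit)
  | 1 => inferInstanceAs (Finite (Fin 3 ⊕ Fin 2))
  | 2 => inferInstanceAs (Finite (Fin 2))
  | _ + 3 => inferInstanceAs (Finite Empty)

/-- The characteristic maps of the cell decomposition. -/
def cellMap : (n : ℕ) → Cell n → (Fin n → ℝ) → Model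
  | 0, _, _ => vertex
  | 1, .inl e, z => E e (len e * ((1 + z 0) / 2))
  | 1, .inr j, z => pt j 0 ((1 + z 0) / 2)
  | 2, j, z => pt j (circ j * ((1 + z 0) / 2)) ((1 + z 1) / 2)
  | _ + 3, i, _ => nomatch (show Empty from i)

lemma continuous_pt_comp {X : Type*} [TopologicalSpace X] {x s : X → ℝ} (hx : Continuous x)
    (hs : Continuous s) : Continuous fun z => pt j (x z) (s z) := by
  have h := (continuous_pt j).comp (hx.prodMk hs)
  unfold Function.comp at h
  exact h

lemma continuous_cellMap (n : ℕ) (i : Cell n) : Continuous (cellMap n i) := by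
  match n, i with
  | 0, _ => exact continuous_const
  | 1, .inl e =>
    have h : Continuous fun z : Fin 1 → ℝ => len e * ((1 + z 0) / 2) := by fun_prop
    have h2 := (continuous_E e).comp h
    unfold Function.comp at h2
    exact h2
  | 1, .inr j =>
    have h : Continuous fun z : Fin 1 → ℝ => (1 + z 0) / 2 := by fun_prop
    exact continuous_pt_comp (j := j) (continuous_const (y := 0)) h
  | 2, j =>
    have h : Continuous fun z : Fin 2 → ℝ => circ j * ((1 + z 0) / 2) := by fun_prop
    have h2 : Continuous fun z : Fin 2 → ℝ => (1 + z 1) / 2 := by fun_prop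
    exact continuous_pt_comp (j := j) h h2
  | n + 3, i => exact nomatch (show Empty from i)

lemma half_mem_of_closedBall {n : ℕ} {z : Fin n → ℝ} (hz : z ∈ Metric.closedBall 0 1) (i : Fin n) :
    0 ≤ (1 + z i) / 2 ∧ (1 + z i) / 2 ≤ 1 := by
  rw [mem_closedBall_zero_iff, pi_norm_le_iff_of_nonneg zero_le_one] at hz
  have := abs_le.1 (hz i)
  constructor <;> linarith

lemma half_mem_of_ball {n : ℕ} {z : Fin n → ℝ} (hz : z ∈ Metric.ball 0 1) (i : Fin n) :
    0 < (1 + z i) / 2 ∧ (1 + z i) / 2 < 1 := by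
  rw [mem_ball_zero_iff, pi_norm_lt_iff zero_lt_one] at hz
  have := abs_lt.1 (hz i)
  constructor <;> linarith

lemma pt_zero_zero (j : Fin 2) : pt j 0 0 = vertex := by
  apply Subtype.ext
  rw [pt_val le_rfl zero_le_one, vertex_val, cyl_vertex]

lemma pt_zero_one (j : Fin 2) : pt j 0 1 = vertex := by
  fin_cases j
  · have := pt_lower (e := 2) le_rfl (len_pos 2).le 0
    rw [E_zero] at this
    simpa [loBand, loPos] using this
  · have := pt_lower (e := 0) le_rfl (len_pos 0).le 0
    rw [E_zero] at this
    simpa [loBand, loPos] using this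

lemma pt_ne_vertex {x s : ℝ} (h0 : 0 < s) (h1 : s < 1) : pt j x s ≠ vertex := fun h =>
  pt_ne_E h0 h1 0 0 (h.trans (E_zero 0).symm)

lemma pt_add_circ (j : Fin 2) (x s : ℝ) (k : ℤ) : pt j (x + k * circ j) s = pt j x s :=
  Subtype.ext (cyl_add j x _ k)

/-- An interior point of a cell is different from all other points of cells whose dimension is at
most the same. -/
lemma cellMap_inj {n m : ℕ} {i : Cell n} {k : Cell m} {z : Fin n → ℝ} {w : Fin m → ℝ} (hmn : m ≤ n)
    (hz : z ∈ Metric.ball 0 1) (hw : w ∈ Metric.closedBall 0 1)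
    (h : cellMap n i z = cellMap m k w) :
    (⟨⟨n, i⟩, z⟩ : Σ p : (Σ n, Cell n), (Fin p.1 → ℝ)) = ⟨⟨m, k⟩, w⟩ := by
  have hz' := half_mem_of_ball hz
  have hw' := half_mem_of_closedBall hw
  match n, m, i, k, z, w, hmn with
  | 0, 0, _, _, z, w, _ => rw [Subsingleton.elim z w]; rfl
  | 1, 0, .inl e, _, z, w, _ =>
    have hl := len_pos e
    exact absurd h (E_ne_vertex (mul_pos hl (hz' 0).1) (by nlinarith [(hz' 0).2]))
  | 1, 0, .inr j, _, z, w, _ => exact absurd h (pt_ne_vertex (hz' 0).1 (hz' 0).2)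
  | 1, 1, .inl e, .inl e', z, w, _ =>
    have hl := len_pos e
    obtain ⟨rfl, h1⟩ := E_inj (mul_pos hl (hz' 0).1) (by nlinarith [(hz' 0).2])
      (mul_nonneg (len_pos e').le (hw' 0).1) (by nlinarith [(hw' 0).2, len_pos e']) h
    have h2 : w 0 = z 0 := by linarith [mul_left_cancel₀ hl.ne' h1]
    have : z = w := by ext i; rw [Subsingleton.elim i 0, h2]
    rw [this]
  | 1, 1, .inl e, .inr j, z, w, _ =>
    have hl := len_pos e
    have hne : cellMap 1 (.inl e) z ≠ vertex :=
      E_ne_vertex (mul_pos hl (hz' 0).1) (by nlinarith [(hz' 0).2])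
    rcases (hw' 0).1.eq_or_lt with h0 | h0
    · refine absurd (h.trans ?_) hne
      show pt j 0 _ = _
      rw [← h0, pt_zero_zero]
    rcases (hw' 0).2.eq_or_lt with h1 | h1
    · refine absurd (h.trans ?_) hne
      show pt j 0 _ = _
      rw [h1, pt_zero_one]
    · exact absurd h.symm (pt_ne_E h0 h1 _ _)
  | 1, 1, .inr j, .inl e, z, w, _ => exact absurd h (pt_ne_E (hz' 0).1 (hz' 0).2 _ _)
  | 1, 1, .inr j, .inr j', z, w, _ =>
    obtain ⟨rfl, h1, -⟩ := pt_inj (hz' 0).1 (hz' 0).2 (hw' 0).1 (hw' 0).2 h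
    have : z = w := by ext i; rw [Subsingleton.elim i 0]; linarith
    rw [this]
  | 2, 0, j, _, z, w, _ => exact absurd h (pt_ne_vertex (hz' 1).1 (hz' 1).2)
  | 2, 1, j, .inl e, z, w, _ => exact absurd h (pt_ne_E (hz' 1).1 (hz' 1).2 _ _)
  | 2, 1, j, .inr j', z, w, _ =>
    obtain ⟨-, -, k, hk⟩ := pt_inj (hz' 1).1 (hz' 1).2 (hw' 0).1 (hw' 0).2 h
    exfalso
    have hl := circ_pos j
    have := (hz' 0).1
    have := (hz' 0).2
    rw [eq_zero_of_abs_lt (k := k) hl (by rw [abs_lt]; constructor <;> nlinarith)] at hk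
    simp only [Int.cast_zero, zero_mul, add_zero] at hk
    nlinarith
  | 2, 2, j, j', z, w, _ =>
    obtain ⟨hj, h1, k, hk⟩ := pt_inj (hz' 1).1 (hz' 1).2 (hw' 1).1 (hw' 1).2 h
    obtain rfl : j' = j := hj
    have hl := circ_pos j'
    have a1 := (hz' 0).1
    have a2 := (hz' 0).2
    have b1 := (hw' 0).1
    have b2 := (hw' 0).2
    rw [eq_zero_of_abs_lt (k := k) hl (by rw [abs_lt]; constructor <;> nlinarith)] at hk
    have h2 : (1 + w 0) / 2 = (1 + z 0) / 2 := mul_left_cancel₀ hl.ne' (by simpa using hk)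
    have : z = w := by
      ext i
      fin_cases i
      · show z 0 = w 0
        linarith
      · show z 1 = w 1
        linarith
    rw [this]
  | n + 3, _, i, _, _, _, _ => exact nomatch (show Empty from i)

/-- The partial equivalence defined by a characteristic map. -/
def cellEquiv (n : ℕ) (i : Cell n) : PartialEquiv (Fin n → ℝ) Model :=
  (InjOn.bijOn_image (s := Metric.ball 0 1) (f := cellMap n i) fun z hz w hw h => by
    have := cellMap_inj le_rfl hz (Metric.ball_subset_closedBall hw) h
    simpa using this).toPartialEquiv (cellMap n i) _ _

lemma exists_one_cell_of_sphere {j : Fin 2} {z : Fin 2 → ℝ} (hz : z ∈ Metric.sphere 0 1) :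
    ∃ k : Cell 1, ∃ w ∈ Metric.closedBall (0 : Fin 1 → ℝ) 1,
      cellMap 1 k w = cellMap 2 j z := by
  have hz' := half_mem_of_closedBall (Metric.sphere_subset_closedBall hz)
  have hmem : ∀ s : ℝ, 0 ≤ s → s ≤ 1 →
      (fun _ => 2 * s - 1 : Fin 1 → ℝ) ∈ Metric.closedBall (0 : Fin 1 → ℝ) 1 := fun s h0 h1 => by
    rw [mem_closedBall_zero_iff, pi_norm_le_iff_of_nonneg zero_le_one]
    intro i
    rw [Real.norm_eq_abs, abs_le]
    constructor <;> linarith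
  have hE : ∀ e s, 0 ≤ s → s < len e → E e s = cellMap 2 j z → ∃ k : Cell 1,
      ∃ w ∈ Metric.closedBall (0 : Fin 1 → ℝ) 1, cellMap 1 k w = cellMap 2 j z := by
    intro e s h0 h1 h
    have hl := len_pos e
    refine ⟨.inl e, _, hmem (s / len e) (by positivity) ((div_le_one hl).2 h1.le), ?_⟩
    rw [← h]
    show E e _ = E e s
    congr 1
    field_simp
    ring
  have hδ : cellMap 2 j z = pt j 0 ((1 + z 1) / 2) → ∃ k : Cell 1,
      ∃ w ∈ Metric.closedBall (0 : Fin 1 → ℝ) 1, cellMap 1 k w = cellMap 2 j z := by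
    intro h
    refine ⟨.inr j, _, hmem ((1 + z 1) / 2) (hz' 1).1 (hz' 1).2, ?_⟩
    rw [h]
    show pt j 0 _ = pt j 0 _
    congr 1
    ring
  have hcell : cellMap 2 j z = pt j (circ j * ((1 + z 0) / 2)) ((1 + z 1) / 2) := rfl
  have h1 : |z 0| = 1 ∨ |z 1| = 1 := by
    by_contra! hcon
    rw [mem_sphere_zero_iff_norm] at hz
    have hle := fun i => norm_le_pi_norm z i
    rw [hz] at hle
    have : ‖z‖ < 1 := (pi_norm_lt_iff zero_lt_one).2 fun i => by
      fin_cases i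
      · exact lt_of_le_of_ne (hle 0) hcon.1
      · exact lt_of_le_of_ne (hle 1) hcon.2
    linarith
  rcases h1 with h | h <;> rcases eq_or_eq_neg_of_abs_eq h with h | h
  · refine hδ ?_
    rw [hcell, h, ← pt_add_circ j 0 _ 1]
    congr 1
    simp
  · refine hδ ?_
    rw [hcell, h]
    congr 1
    norm_num
  · obtain ⟨e, s, k, e1, e2, e3, e4⟩ := exists_lower j (circ j * ((1 + z 0) / 2))
    refine hE e s e2 e3 ?_
    rw [← pt_lower e2 e3.le k, hcell, e1, e4, h]
    norm_num
  · obtain ⟨e, s, k, e1, e2, e3, e4⟩ := exists_upper j (circ j * ((1 + z 0) / 2))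
    refine hE e s e2 e3 ?_
    rw [← pt_upper s k, hcell, e1, e4, h]
    norm_num

lemma exists_lower_cell_of_sphere {n : ℕ} {i : Cell n} {z : Fin n → ℝ}
    (hz : z ∈ Metric.sphere 0 1) : ∃ m < n, ∃ k : Cell m, ∃ w ∈ Metric.closedBall 0 1,
      cellMap m k w = cellMap n i z := by
  match n, i with
  | 0, _ =>
    rw [mem_sphere_zero_iff_norm, Subsingleton.elim z 0, norm_zero] at hz
    exact absurd hz zero_ne_one
  | 1, i =>
    refine ⟨0, one_pos, (), 0, by simp, ?_⟩
    have h1 : |z 0| = 1 := by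
      rw [mem_sphere_zero_iff_norm, Pi.norm_def] at hz
      simpa using hz
    show vertex = _
    rcases eq_or_eq_neg_of_abs_eq h1 with h | h <;> rcases i with e | j
    · show _ = E e _
      rw [h, ← E_len e]; norm_num
    · show _ = pt j 0 _
      rw [h, ← pt_zero_one j]; norm_num
    · show _ = E e _
      rw [h, ← E_zero e]; norm_num
    · show _ = pt j 0 _
      rw [h, ← pt_zero_zero j]; norm_num
  | 2, j =>
    obtain ⟨k, w, hw, h⟩ := exists_one_cell_of_sphere (j := j) hz
    exact ⟨1, one_lt_two, k, w, hw, h⟩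
  | n + 3, i => exact nomatch (show Empty from i)

lemma exists_two_cell (x : Model) : ∃ (j : Cell 2), ∃ w ∈ Metric.closedBall 0 1,
    cellMap 2 j w = x := by
  obtain ⟨v, hv⟩ := x
  rw [modelSet_eq] at hv
  obtain ⟨j, ⟨x, s⟩, ⟨⟨h0, h1⟩, h2, h3⟩, hxs⟩ := mem_iUnion.1 hv
  have hl := circ_pos j
  simp only at h0 h1 h2 h3
  have hx1 : x / circ j ≤ 1 := (div_le_one hl).2 h1
  have hx0 : 0 ≤ x / circ j := by positivity
  refine ⟨j, ![2 * (x / circ j) - 1, 2 * s - 1], ?_, ?_⟩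
  · rw [mem_closedBall_zero_iff, pi_norm_le_iff_of_nonneg zero_le_one]
    intro i
    rw [Real.norm_eq_abs, abs_le]
    fin_cases i <;> simp <;> constructor <;> linarith
  · apply Subtype.ext
    refine Eq.trans ?_ hxs
    show (pt j (circ j * ((1 + (2 * (x / circ j) - 1)) / 2)) ((1 + (2 * s - 1)) / 2)).1 = _
    rw [show (1 + (2 * s - 1)) / 2 = s by ring, pt_val h2 h3]
    show cyl j _ s = cyl j x s
    congr 1
    field_simp
    ring

/-- The cell decomposition has one vertex, five edges and two faces. -/
lemma hasGenus_surf (t : ℝ) : (surf t).HasGenus 2 := by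
  let cw : CWComplex (univ : Set Model) := CWComplex.mkFinite univ Cell cellEquiv
    (eventually_atTop.2 ⟨3, fun n hn => by
      obtain ⟨m, rfl⟩ := Nat.exists_eq_add_of_le' hn
      exact inferInstanceAs (IsEmpty Empty)⟩)
    finite_cell (fun _ _ => rfl) (fun n i => (continuous_cellMap n i).continuousOn)
    (fun n i => continuousOn_symm_of_isCompact (isCompact_closedBall 0 1)
      (continuous_cellMap n i).continuousOn Metric.ball_subset_closedBall
      fun z hz w hw h => by simpa using cellMap_inj le_rfl hz hw h)
    (by
      have key : ∀ {n m : ℕ} {i : Cell n} {k : Cell m} {z : Fin n → ℝ} {w : Fin m → ℝ},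
          z ∈ Metric.ball 0 1 → w ∈ Metric.ball 0 1 → cellMap n i z = cellMap m k w →
          (⟨n, i⟩ : Σ n, Cell n) = ⟨m, k⟩ := by
        intro n m i k z w hz hw h
        rcases le_total m n with hmn | hmn
        · exact congrArg Sigma.fst (cellMap_inj hmn hz (Metric.ball_subset_closedBall hw) h)
        · exact (congrArg Sigma.fst
            (cellMap_inj hmn hw (Metric.ball_subset_closedBall hz) h.symm)).symm
      rintro ⟨n, i⟩ - ⟨m, k⟩ - hne
      refine disjoint_left.2 ?_
      rintro _ ⟨z, hz, rfl⟩ ⟨w, hw, h⟩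
      exact hne (key hz hw h.symm))
    (fun n i z hz => by
      obtain ⟨m, hm, k, w, hw, h⟩ := exists_lower_cell_of_sphere (i := i) hz
      simp only [mem_iUnion]
      exact ⟨m, hm, k, w, hw, h⟩)
    (eq_univ_of_forall fun x => by
      obtain ⟨j, w, hw, h⟩ := exists_two_cell x
      simp only [mem_iUnion]
      exact ⟨2, j, w, hw, h⟩)
  refine ⟨cw, finite_cell, fun n hn => ?_, ?_⟩
  · obtain ⟨m, rfl⟩ := Nat.exists_eq_add_of_le' hn
    exact inferInstanceAs (IsEmpty Empty)
  · have h0 : Nat.card (Cell 0) = 1 := by simp [Cell]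
    have h1 : Nat.card (Cell 1) = 5 := by simp [Cell]
    have h2 : Nat.card (Cell 2) = 2 := by simp [Cell]
    show (Nat.card (Cell 0) : ℤ) - Nat.card (Cell 1) + Nat.card (Cell 2) = 2 - 2 * (2 : ℕ)
    rw [h0, h1, h2]
    norm_num

lemma inH2_surf (t : ℝ) : (surf t).InH2 :=
  ⟨hasGenus_surf t, vertex, hasConeAngle_vertex t, fun _ hq => isRegular_surf hq⟩

end

section

variable {t : ℝ} {j : Fin 2}

/-! ### The regular octagon -/

/-- The coordinates `√2 / 2` of the direction of the first diagonal edge of the octagon. -/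
def diag : ℝ := √2 / 2

lemma diag_pos : 0 < diag := by unfold diag; positivity

lemma diag_mul_diag : diag * diag = 1 / 2 := by
  have := Real.mul_self_sqrt (show (0 : ℝ) ≤ 2 by norm_num)
  unfold diag; linarith

lemma longLen_eq : longLen = 1 + 2 * diag := by unfold longLen diag; ring

lemma octEdge_add (i k : ℕ) : octEdge (i + k) = octEdge i * octEdge k := pow_add _ _ _

lemma octEdge_zero : octEdge 0 = 1 := pow_zero _

lemma octEdge_one : octEdge 1 = ⟨diag, diag⟩ := by
  have h : (Real.pi : ℂ) * Complex.I / 4 = ((Real.pi / 4 : ℝ) : ℂ) * Complex.I := by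
    push_cast; ring
  rw [octEdge, pow_one, h, Complex.exp_mul_I, ← Complex.ofReal_cos, ← Complex.ofReal_sin,
    Real.cos_pi_div_four, Real.sin_pi_div_four]
  apply Complex.ext <;> simp [diag]

lemma octEdge_two : octEdge 2 = Complex.I := by
  have := diag_mul_diag
  rw [show 2 = 1 + 1 by norm_num, octEdge_add, octEdge_one]
  apply Complex.ext
  · simp
  · simp; linarith

lemma octEdge_three : octEdge 3 = ⟨-diag, diag⟩ := by
  rw [show 3 = 2 + 1 by norm_num, octEdge_add, octEdge_two, octEdge_one]
  apply Complex.ext <;> simp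

lemma octEdge_add_four (k : ℕ) : octEdge (k + 4) = -octEdge k := by
  rw [octEdge_add, show 4 = 2 + 2 by norm_num, octEdge_add, octEdge_two, Complex.I_mul_I]
  ring

lemma octVertex_succ (k : ℕ) : octVertex (k + 1) = octVertex k + octEdge k :=
  Finset.sum_range_succ _ _

lemma octVertex_zero : octVertex 0 = 0 := Finset.sum_range_zero _

lemma octVertex_one : octVertex 1 = 1 := by
  rw [octVertex_succ 0, octVertex_zero, octEdge_zero, zero_add]

lemma octVertex_two : octVertex 2 = ⟨1 + diag, diag⟩ := by
  rw [octVertex_succ 1, octVertex_one, octEdge_one]; apply Complex.ext <;> simp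

lemma octVertex_three : octVertex 3 = ⟨1 + diag, 1 + diag⟩ := by
  rw [octVertex_succ 2, octVertex_two, octEdge_two]; apply Complex.ext <;> simp [add_comm]

lemma octVertex_four : octVertex 4 = ⟨1, 1 + 2 * diag⟩ := by
  rw [octVertex_succ 3, octVertex_three, octEdge_three]; apply Complex.ext <;> simp; ring

lemma octVertex_five : octVertex 5 = ⟨0, 1 + 2 * diag⟩ := by
  rw [octVertex_succ 4, octVertex_four, octEdge_add_four 0, octEdge_zero]
  apply Complex.ext <;> simp

lemma octVertex_six : octVertex 6 = ⟨-diag, 1 + diag⟩ := by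
  rw [octVertex_succ 5, octVertex_five, octEdge_add_four 1, octEdge_one]
  apply Complex.ext <;> simp; ring

lemma octVertex_seven : octVertex 7 = ⟨-diag, diag⟩ := by
  rw [octVertex_succ 6, octVertex_six, octEdge_add_four 2, octEdge_two]
  apply Complex.ext <;> simp

lemma octVertex_eight : octVertex 8 = 0 := by
  rw [octVertex_succ 7, octVertex_seven, octEdge_add_four 3, octEdge_three]
  apply Complex.ext <;> simp

lemma octEdge_add_eight (k : ℕ) : octEdge (k + 8) = octEdge k := by
  rw [show k + 8 = k + 4 + 4 by ring, octEdge_add_four, octEdge_add_four, neg_neg]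

lemma octVertex_add_eight (k : ℕ) : octVertex (k + 8) = octVertex k := by
  induction k with
  | zero => rw [zero_add, octVertex_eight, octVertex_zero]
  | succ k ih =>
    rw [show k + 1 + 8 = k + 8 + 1 by ring, octVertex_succ, ih, octEdge_add_eight, octVertex_succ]

lemma octVertex_add_mul_eight (k n : ℕ) : octVertex (k + 8 * n) = octVertex k := by
  induction n with
  | zero => simp
  | succ n ih => rw [show k + 8 * (n + 1) = k + 8 * n + 8 by ring, octVertex_add_eight, ih]

lemma octEdge_add_mul_eight (k n : ℕ) : octEdge (k + 8 * n) = octEdge k := by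
  induction n with
  | zero => simp
  | succ n ih => rw [show k + 8 * (n + 1) = k + 8 * n + 8 by ring, octEdge_add_eight, ih]

/-- The gluing of the octagon, with a bounded number of edges and up to symmetry. -/
lemma octGlue_cases {z w : ℂ} (h : octGlue z w) : ∃ i < 4, ∃ s ∈ Icc (0 : ℝ) 1,
    (z = octVertex i + s * octEdge i ∧ w = octVertex (i + 5) + s * octEdge i) ∨
    (w = octVertex i + s * octEdge i ∧ z = octVertex (i + 5) + s * octEdge i) := by
  obtain ⟨j, s, hs, rfl, rfl⟩ := h
  obtain ⟨n, r, hr, rfl⟩ : ∃ n r, r < 8 ∧ j = r + 8 * n :=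
    ⟨j / 8, j % 8, Nat.mod_lt _ (by norm_num), (Nat.mod_add_div j 8).symm⟩
  rw [octVertex_add_mul_eight, octEdge_add_mul_eight, show r + 8 * n + 5 = r + 5 + 8 * n by ring,
    octVertex_add_mul_eight]
  rcases lt_or_ge r 4 with h | h
  · exact ⟨r, h, s, hs, Or.inl ⟨rfl, rfl⟩⟩
  · obtain ⟨i, rfl⟩ := Nat.exists_eq_add_of_le' h
    refine ⟨i, by omega, 1 - s, ⟨by linarith [hs.2], by linarith [hs.1]⟩, Or.inr ⟨?_, ?_⟩⟩
    · rw [show i + 4 + 5 = i + 1 + 8 by ring, octVertex_add_eight, octVertex_succ, octEdge_add_four]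
      push_cast; ring
    · rw [show i + 5 = i + 4 + 1 by ring, octVertex_succ (i + 4), octEdge_add_four]
      push_cast; ring

/-- All vertices of the octagon are identified, since `5` generates `ℤ / 8ℤ`. -/
lemma eqvGen_octVertex (k : ℕ) : Relation.EqvGen octGlue (octVertex 0) (octVertex k) := by
  have h : ∀ n : ℕ, Relation.EqvGen octGlue (octVertex 0) (octVertex (5 * n)) := by
    intro n
    induction n with
    | zero => exact Relation.EqvGen.refl _
    | succ n ih =>
      refine ih.trans _ _ _ (Relation.EqvGen.rel _ _ ⟨5 * n, 0, by simp, by simp, ?_⟩)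
      simp [show 5 * (n + 1) = 5 * n + 5 by ring]
  have := h (5 * k)
  rwa [show 5 * (5 * k) = k + 8 * (3 * k) by ring, octVertex_add_mul_eight] at this

/-- The inequalities that define the octagon. -/
def octRegion : Set ℂ := {z | 0 ≤ z.im ∧ z.im ≤ 1 + 2 * diag ∧ -diag ≤ z.re ∧ z.re ≤ 1 + diag ∧
  0 ≤ z.re + z.im ∧ z.re + z.im ≤ 2 + 2 * diag ∧ z.re - z.im ≤ 1 ∧ z.im - z.re ≤ 1 + 2 * diag}

lemma octagon_subset : octagon ⊆ octRegion := by
  have hd := diag_pos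
  refine convexHull_min ?_ ?_
  · rintro _ ⟨k, hk, rfl⟩
    have hk' : k < 8 := hk
    interval_cases k <;>
      simp only [octVertex_zero, octVertex_one, octVertex_two, octVertex_three, octVertex_four,
        octVertex_five, octVertex_six, octVertex_seven, octRegion, mem_ofPred_eq, Complex.zero_re,
        Complex.zero_im, Complex.one_re, Complex.one_im] <;>
      refine ⟨?_, ?_, ?_, ?_, ?_, ?_, ?_, ?_⟩ <;> linarith
  · intro z ⟨a1, a2, a3, a4, a5, a6, a7, a8⟩ w ⟨b1, b2, b3, b4, b5, b6, b7, b8⟩ a b ha hb hab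
    obtain rfl : b = 1 - a := by linarith
    simp only [octRegion, mem_ofPred_eq, Complex.add_re, Complex.add_im, Complex.real_smul,
      Complex.mul_re, Complex.mul_im, Complex.ofReal_re, Complex.ofReal_im, zero_mul, sub_zero,
      add_zero]
    refine ⟨?_, ?_, ?_, ?_, ?_, ?_, ?_, ?_⟩ <;> nlinarith

lemma octVertex_mem (k : ℕ) (hk : k < 8) : octVertex k ∈ octagon :=
  subset_convexHull ℝ _ ⟨k, hk, rfl⟩

/-- A horizontal chord between two sides lies in the octagon. -/
lemma chord_mem {i k i' k' : ℕ} (hi : i < 8) (hk : k < 8) (hi' : i' < 8) (hk' : k' < 8) {s : ℝ}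
    (hs0 : 0 ≤ s) (hs1 : s ≤ 1) {z : ℂ}
    (him : (octVertex i + s * (octVertex k - octVertex i)).im = z.im)
    (him' : (octVertex i' + s * (octVertex k' - octVertex i')).im = z.im)
    (hl : (octVertex i + s * (octVertex k - octVertex i)).re ≤ z.re)
    (hr : z.re ≤ (octVertex i' + s * (octVertex k' - octVertex i')).re) : z ∈ octagon := by
  have hc : Convex ℝ octagon := convex_convexHull ℝ _
  have h1 := hc.add_smul_sub_mem (octVertex_mem i hi) (octVertex_mem k hk) ⟨hs0, hs1⟩
  have h2 := hc.add_smul_sub_mem (octVertex_mem i' hi') (octVertex_mem k' hk') ⟨hs0, hs1⟩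
  rw [Complex.real_smul] at h1 h2
  set p := octVertex i + s * (octVertex k - octVertex i)
  set r := octVertex i' + s * (octVertex k' - octVertex i')
  rcases (hl.trans hr).eq_or_lt with h | h
  · have : z = p := Complex.ext (by linarith) him.symm
    rwa [this]
  · have hpos : 0 < r.re - p.re := by linarith
    have := hc.add_smul_sub_mem h1 h2 (t := (z.re - p.re) / (r.re - p.re))
      ⟨div_nonneg (by linarith) hpos.le, (div_le_one hpos).2 (by linarith)⟩
    convert this using 1
    apply Complex.ext
    · simp only [Complex.add_re, Complex.smul_re, Complex.sub_re, smul_eq_mul]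
      rw [div_mul_cancel₀ _ hpos.ne']; ring
    · simp only [Complex.add_im, Complex.smul_im, Complex.sub_im, smul_eq_mul, him, him']
      ring

lemma mem_octagon_lower {z : ℂ} (h0 : 0 ≤ z.im) (h1 : z.im ≤ diag) (hl : -z.im ≤ z.re)
    (hr : z.re ≤ 1 + z.im) : z ∈ octagon := by
  have hd := diag_pos
  have h := div_mul_cancel₀ z.im hd.ne'
  refine chord_mem (i := 0) (k := 7) (i' := 1) (k' := 2) (s := z.im / diag) (by norm_num)
    (by norm_num) (by norm_num) (by norm_num) (by positivity) ((div_le_one hd).2 h1) ?_ ?_ ?_ ?_ <;>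
  simp only [octVertex_zero, octVertex_seven, octVertex_one, octVertex_two] <;> simp [h] <;> linarith

lemma mem_octagon_middle {z : ℂ} (h0 : diag ≤ z.im) (h1 : z.im ≤ 1 + diag) (hl : -diag ≤ z.re)
    (hr : z.re ≤ 1 + diag) : z ∈ octagon := by
  have hd := diag_pos
  refine chord_mem (i := 7) (k := 6) (i' := 2) (k' := 3) (s := z.im - diag) (by norm_num)
    (by norm_num) (by norm_num) (by norm_num) (by linarith) (by linarith) ?_ ?_ ?_ ?_ <;>
  simp only [octVertex_six, octVertex_seven, octVertex_two, octVertex_three] <;> simp <;> linarith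

lemma mem_octagon_upper {z : ℂ} (h0 : 1 + diag ≤ z.im) (h1 : z.im ≤ 1 + 2 * diag)
    (hl : z.im - z.re ≤ 1 + 2 * diag) (hr : z.re + z.im ≤ 2 + 2 * diag) : z ∈ octagon := by
  have hd := diag_pos
  have h := div_mul_cancel₀ (z.im - (1 + diag)) hd.ne'
  refine chord_mem (i := 6) (k := 5) (i' := 3) (k' := 4) (s := (z.im - (1 + diag)) / diag)
    (by norm_num) (by norm_num) (by norm_num) (by norm_num) (div_nonneg (by linarith) hd.le)
    ((div_le_one hd).2 (by linarith)) ?_ ?_ ?_ ?_ <;>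
  simp only [octVertex_five, octVertex_six, octVertex_four, octVertex_three] <;> simp <;> nlinarith

lemma isCompact_octagon : IsCompact octagon :=
  ((Set.finite_lt_nat 8).image _).isCompact_convexHull ℝ

lemma IsOctagon.exists_presentation {S : TranslationSurface} (h : S.IsOctagon) : ∃ π : ℂ → S,
    IsPresentation (fun _ : Unit => octagon) (fun _ => π) ∧
    Develops S (fun _ : Unit => octagon) (fun _ => π) (fun _ z => z) ∧
    ∀ z ∈ octagon, ∀ w ∈ octagon, π z = π w ↔ Relation.EqvGen octGlue z w := by
  obtain ⟨π, h1, h2, h3, h4⟩ := h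
  refine ⟨π, IsPresentation.of_isCompact (fun _ => isCompact_octagon) (fun _ => h1) fun x => ?_,
    fun _ => h4, h3⟩
  obtain ⟨z, hz, hx⟩ := h2.ge (mem_univ x)
  exact ⟨(), z, hz, hx⟩

lemma IsOctagon.isomorphic {S T : TranslationSurface} (h : S.IsOctagon) (h' : T.IsOctagon) :
    S.Isomorphic T := by
  obtain ⟨π, h1, h2, h3⟩ := h.exists_presentation
  obtain ⟨π', h1', h2', h3'⟩ := h'.exists_presentation
  exact isomorphic_of_presentations h1 h1'
    (fun _ _ z hz w hw => (h3 z hz w hw).trans (h3' z hz w hw).symm) h2 h2'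

end

section

variable {t : ℝ} {j : Fin 2}

/-- The octagon is cut by two horizontal diagonals into two trapezoids, which form the long
cylinder, and a rectangle, which forms the short cylinder. -/
def octBand : Fin 3 → Fin 2 := ![1, 0, 1]

/-- The translations that move the three horizontal pieces of the octagon to the strips. -/
def octShift : Fin 3 → ℂ := ![0, ⟨-diag, diag⟩, ⟨-1 - diag, 1 + diag⟩]

/-- The three horizontal pieces of the octagon. -/
def octPiece (i : Fin 3) : Set ℂ := octagon ∩ {z | z - octShift i ∈ strip (octBand i)}

/-- The map that folds the octagon to the surface without twist. -/
def octMap (z : ℂ) : Model :=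
  if z.im ≤ diag then P 0 1 z
  else if z.im ≤ 1 + diag then P 0 0 (z - octShift 1) else P 0 1 (z - octShift 2)

lemma ht_one : ht 1 = diag := rfl

lemma ht_zero : ht 0 = 1 := rfl

lemma mem_octPiece_zero {z : ℂ} : z ∈ octPiece 0 ↔ z ∈ octagon ∧ 0 ≤ z.im ∧ z.im ≤ diag := by
  simp [octPiece, octShift, octBand, strip, ht_one]

lemma mem_octPiece_one {z : ℂ} :
    z ∈ octPiece 1 ↔ z ∈ octagon ∧ diag ≤ z.im ∧ z.im ≤ 1 + diag := by
  simp [octPiece, octShift, octBand, strip, ht_zero]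

lemma mem_octPiece_two {z : ℂ} :
    z ∈ octPiece 2 ↔ z ∈ octagon ∧ 1 + diag ≤ z.im ∧ z.im ≤ 1 + 2 * diag := by
  have : z.im ≤ diag + (1 + diag) ↔ z.im ≤ 1 + 2 * diag := by constructor <;> intro h <;> linarith
  simp [octPiece, octShift, octBand, strip, ht_one, this]

/-- The points of the two horizontal diagonals, and of the two horizontal edges. -/
lemma octagon_horizontal {x : ℝ} :
    (0 ≤ x → x ≤ longLen → P 0 1 (⟨-diag, diag⟩ + x) = E 1 x) ∧
    P 0 0 (x : ℂ) = E 1 x ∧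
    (0 ≤ x → x ≤ longLen → P 0 0 (Complex.I + x) = E 2 x) ∧ P 0 1 (1 + (x : ℂ)) = E 2 x ∧
    P 0 1 (x : ℂ) = E 0 x ∧ (0 ≤ x → x ≤ 1 → P 0 1 (⟨1 + diag, diag⟩ + x) = E 0 x) := by
  refine ⟨fun h0 h1 => ?_, ?_, fun h0 h1 => ?_, ?_, ?_, fun h0 h1 => ?_⟩
  · have := P_lower_add (t := 0) (e := 1) h0 (by simpa [len] using h1) (-1)
    rw [← this]
    show P 0 1 _ = P 0 1 _
    congr 1
    apply Complex.ext <;> simp [lowerPt, topPt, sh, ht, loBand, loPos, circ, longLen_eq, diag]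
    ring
  · have := P_upper (t := 0) (e := 1) x
    rw [← this]
    show P 0 0 _ = P 0 0 _
    congr 1
    simp [upperPt, upPos]
  · have := P_lower (t := 0) (e := 2) h0 (by simpa [len] using h1)
    rw [← this]
    show P 0 0 _ = P 0 0 _
    congr 1
    apply Complex.ext <;> simp [lowerPt, topPt, sh, ht, loBand, loPos]
  · have := P_upper (t := 0) (e := 2) x
    rw [← this]
    show P 0 1 _ = P 0 1 _
    congr 1
    simp [upperPt, upPos]
  · have := P_upper (t := 0) (e := 0) x
    rw [← this]
    show P 0 1 _ = P 0 1 _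
    congr 1
    simp [upperPt, upPos]
  · have := P_lower (t := 0) (e := 0) h0 (by simpa [len] using h1)
    rw [← this]
    show P 0 1 _ = P 0 1 _
    congr 1
    apply Complex.ext <;> simp [lowerPt, topPt, sh, ht, loBand, loPos, diag]

lemma octMap_eq {i : Fin 3} {z : ℂ} (hz : z ∈ octPiece i) :
    octMap z = P 0 (octBand i) (z - octShift i) := by
  have hd := diag_pos
  fin_cases i
  · obtain ⟨-, -, h1⟩ := mem_octPiece_zero.1 hz
    rw [octMap, if_pos h1]
    show _ = P 0 1 (z - 0)
    rw [sub_zero]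
  · obtain ⟨h, h0, h1⟩ := mem_octPiece_one.1 hz
    obtain ⟨a1, a2, a3, a4, -⟩ := octagon_subset h
    show _ = P 0 0 (z - octShift 1)
    rcases h0.eq_or_lt with e | e
    · obtain ⟨b1, b2, -⟩ := octagon_horizontal (x := z.re + diag)
      rw [octMap, if_pos e.ge, show z - octShift 1 = ((z.re + diag : ℝ) : ℂ) by
        apply Complex.ext <;> simp [octShift, e], b2, ← b1 (by linarith) (by
          rw [longLen_eq]; linarith)]
      congr 1
      apply Complex.ext <;> simp [e]
    · rw [octMap, if_neg (not_le.2 e), if_pos h1]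
  · obtain ⟨h, h0, h1⟩ := mem_octPiece_two.1 hz
    obtain ⟨a1, a2, a3, a4, -⟩ := octagon_subset h
    show _ = P 0 1 (z - octShift 2)
    rcases h0.eq_or_lt with e | e
    · obtain ⟨-, -, b1, b2, -⟩ := octagon_horizontal (x := z.re + diag)
      rw [octMap, if_neg (by linarith), if_pos e.ge, show z - octShift 2 =
        1 + ((z.re + diag : ℝ) : ℂ) by
          apply Complex.ext <;> simp [octShift, ← e]; ring, b2, ← b1 (by linarith) (by
          rw [longLen_eq]; linarith)]
      congr 1
      apply Complex.ext <;> simp [octShift, ← e]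
    · rw [octMap, if_neg (by linarith), if_neg (by linarith)]

lemma iUnion_octPiece : ⋃ i, octPiece i = octagon := by
  refine (iUnion_subset fun i => inter_subset_left).antisymm fun z hz => mem_iUnion.2 ?_
  obtain ⟨a1, a2, -⟩ := octagon_subset hz
  rcases le_total z.im diag with h | h
  · exact ⟨0, mem_octPiece_zero.2 ⟨hz, a1, h⟩⟩
  · rcases le_total z.im (1 + diag) with h' | h'
    · exact ⟨1, mem_octPiece_one.2 ⟨hz, h, h'⟩⟩
    · exact ⟨2, mem_octPiece_two.2 ⟨hz, h', a2⟩⟩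

lemma isClosed_octPiece (i : Fin 3) : IsClosed (octPiece i) := by
  refine isCompact_octagon.isClosed.inter ?_
  have : IsClosed (strip (octBand i)) :=
    (isClosed_le continuous_const Complex.continuous_im).inter
      (isClosed_le Complex.continuous_im continuous_const)
  exact this.preimage (f := fun z => z - octShift i) (by fun_prop)

lemma continuousOn_octMap : ContinuousOn octMap octagon := by
  rw [← iUnion_octPiece]
  refine (locallyFinite_of_finite _).continuousOn_iUnion isClosed_octPiece fun i => ?_
  refine ContinuousOn.congr ?_ fun z hz => octMap_eq hz
  exact ((continuous_P 0 _).comp (continuous_id.sub continuous_const)).continuousOn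

lemma eventually_dev_octMap (z : ℂ) : ∀ᶠ w in 𝓝[octagon] z,
    (surf 0).dev (octMap z) (octMap w) = w - z := by
  rw [← iUnion_octPiece, (locallyFinite_of_finite octPiece).nhdsWithin_iUnion, eventually_iSup]
  intro i
  by_cases hi : z ∈ octPiece i
  · have h1 := develops_surf 0 (octBand i) (z - octShift i) hi.2
    have h2 : Tendsto (fun w => w - octShift i) (𝓝[octPiece i] z)
        (𝓝[strip (octBand i)] (z - octShift i)) :=
      (show Continuous fun w : ℂ => w - octShift i by fun_prop).continuousWithinAt.tendsto_nhdsWithin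
        fun w hw => hw.2
    filter_upwards [h2.eventually h1, self_mem_nhdsWithin] with w hw hwi
    rw [octMap_eq hi, octMap_eq hwi]
    refine hw.trans ?_
    ring
  · rw [← (isClosed_octPiece i).closure_eq, mem_closure_iff_nhdsWithin_neBot, not_neBot] at hi
    rw [hi]; exact eventually_bot

lemma exists_octMap_eq (x : Model) : ∃ z ∈ octagon, octMap z = x := by
  have hd := diag_pos
  obtain ⟨j, w, hw, rfl⟩ := exists_P_eq 0 x
  have key : ∀ (i : Fin 3) (k : ℤ) (y : ℝ), octBand i = j → w.re = y + k * circ j →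
      ⟨y, w.im⟩ + octShift i ∈ octagon → ∃ z ∈ octagon, octMap z = P 0 j w := by
    rintro i k y rfl hy h
    refine ⟨_, h, ?_⟩
    have hw' : w = ⟨y, w.im⟩ + k * circ (octBand i) := by
      apply Complex.ext <;> simp [hy]
    rw [octMap_eq (i := i) ⟨h, ?_⟩, add_sub_cancel_right, hw', P_add, ← hw']
    show (⟨y, w.im⟩ + octShift i : ℂ) - octShift i ∈ strip (octBand i)
    rw [add_sub_cancel_right]
    exact hw
  obtain rfl | rfl : j = 0 ∨ j = 1 := by fin_cases j <;> simp
  · obtain ⟨y, k, h0, h1, h⟩ := exists_eq_add (circ 0) (circ_pos 0) w.re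
    have hc : circ 0 = 1 + 2 * diag := longLen_eq
    have hw1 : w.im ≤ 1 := hw.2
    have hw0 := hw.1
    refine key 1 k y rfl h (mem_octagon_middle ?_ ?_ ?_ ?_) <;> simp [octShift] <;> linarith
  · obtain ⟨y, k, h0, h1, h⟩ := exists_eq_add (circ 1) (circ_pos 1) (w.re + w.im)
    have hc : circ 1 = 1 + (1 + 2 * diag) := by rw [← longLen_eq]; rfl
    have hw1 : w.im ≤ diag := hw.2
    have hw0 := hw.1
    rcases le_total (y - w.im) (1 + w.im) with h2 | h2
    · refine key 0 k (y - w.im) rfl (by linarith) (mem_octagon_lower ?_ ?_ ?_ ?_) <;>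
        simp [octShift] <;> linarith
    · refine key 2 k (y - w.im) rfl (by linarith) (mem_octagon_upper ?_ ?_ ?_ ?_) <;>
        simp [octShift] <;> linarith

lemma octMap_eq_of_octGlue {z w : ℂ} (h : octGlue z w) : octMap z = octMap w := by
  have hd := diag_pos
  have hL := longLen_eq
  obtain ⟨i, hi, s, ⟨h0, h1⟩, h⟩ := octGlue_cases h
  suffices octMap (octVertex i + s * octEdge i) = octMap (octVertex (i + 5) + s * octEdge i) by
    rcases h with ⟨rfl, rfl⟩ | ⟨rfl, rfl⟩
    exacts [this, this.symm]
  interval_cases i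
  · obtain ⟨-, -, -, -, b1, b2⟩ := octagon_horizontal (x := s)
    have e1 : octVertex 0 + s * octEdge 0 ∈ octPiece 0 := by
      rw [octVertex_zero, octEdge_zero, mem_octPiece_zero]
      exact ⟨mem_octagon_lower (by simp) (by simp; linarith) (by simpa using h0)
        (by simpa using h1), by simp, by simp; linarith⟩
    have e2 : octVertex 5 + s * octEdge 0 ∈ octPiece 2 := by
      rw [octVertex_five, octEdge_zero, mem_octPiece_two]
      exact ⟨mem_octagon_upper (by simp; linarith) (by simp) (by simpa using h0)
        (by simp; linarith), by simp; linarith, by simp⟩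
    rw [octMap_eq e1, octMap_eq e2]
    refine Eq.trans (Eq.trans ?_ (b1.trans (b2 h0 h1).symm)) ?_
    · show P 0 1 _ = P 0 1 _
      congr 1
      simp [octVertex_zero, octEdge_zero, octShift]
    · show P 0 1 _ = P 0 1 _
      congr 1
      rw [octVertex_five, octEdge_zero]
      apply Complex.ext <;> simp [octShift] <;> ring
  · have e1 : octVertex 1 + s * octEdge 1 ∈ octPiece 0 := by
      rw [octVertex_one, octEdge_one, mem_octPiece_zero]
      exact ⟨mem_octagon_lower (by simp; positivity) (by simp; nlinarith) (by simp; nlinarith)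
        (by simp), by simp; positivity, by simp; nlinarith⟩
    have e2 : octVertex 6 + s * octEdge 1 ∈ octPiece 2 := by
      rw [octVertex_six, octEdge_one, mem_octPiece_two]
      exact ⟨mem_octagon_upper (by simp; positivity) (by simp; nlinarith) (by simp; linarith)
        (by simp; nlinarith), by simp; positivity, by simp; nlinarith⟩
    rw [octMap_eq e1, octMap_eq e2]
    show P 0 1 _ = P 0 1 _
    congr 1
    rw [octVertex_one, octVertex_six, octEdge_one]
    apply Complex.ext <;> simp [octShift]
    ring
  · have e1 : octVertex 2 + s * octEdge 2 ∈ octPiece 1 := by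
      rw [octVertex_two, octEdge_two, mem_octPiece_one]
      exact ⟨mem_octagon_middle (by simp [h0]) (by simp; linarith) (by simp; linarith)
        (by simp), by simp [h0], by simp; linarith⟩
    have e2 : octVertex 7 + s * octEdge 2 ∈ octPiece 1 := by
      rw [octVertex_seven, octEdge_two, mem_octPiece_one]
      exact ⟨mem_octagon_middle (by simp [h0]) (by simp; linarith) (by simp)
        (by simp; linarith), by simp [h0], by simp; linarith⟩
    rw [octMap_eq e1, octMap_eq e2, ← P_add 0 _ (octVertex 7 + s * octEdge 2 - octShift 1) 1]
    show P 0 0 _ = P 0 0 _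
    congr 1
    rw [octVertex_two, octVertex_seven, octEdge_two]
    apply Complex.ext <;> simp [octShift, octBand, circ, hL]
    ring
  · have e1 : octVertex 3 + s * octEdge 3 ∈ octPiece 2 := by
      rw [octVertex_three, octEdge_three, mem_octPiece_two]
      exact ⟨mem_octagon_upper (by simp; positivity) (by simp; nlinarith) (by simp; nlinarith)
        (by simp; linarith), by simp; positivity, by simp; nlinarith⟩
    have e2 : octVertex 8 + s * octEdge 3 ∈ octPiece 0 := by
      rw [octVertex_eight, octEdge_three, mem_octPiece_zero]
      exact ⟨mem_octagon_lower (by simp; positivity) (by simp; nlinarith) (by simp)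
        (by simp; nlinarith), by simp; positivity, by simp; nlinarith⟩
    rw [octMap_eq e1, octMap_eq e2, ← P_add 0 _ (octVertex 8 + s * octEdge 3 - octShift 0) 1]
    show P 0 1 _ = P 0 1 _
    congr 1
    rw [octVertex_three, octVertex_eight, octEdge_three]
    apply Complex.ext <;> simp [octShift, octBand, circ, hL]
    ring

/-- The left end of the horizontal edge or diagonal of the octagon that is mapped to an edge. -/
def octLeft : Fin 3 → ℂ := ![0, ⟨-diag, diag⟩, ⟨-diag, 1 + diag⟩]

lemma octagon_cases {z : ℂ} (hz : z ∈ octagon) :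
    (∃ i, 0 < (z - octShift i).im ∧ (z - octShift i).im < ht (octBand i) ∧ z ∈ octPiece i) ∨
    ∃ e x, 0 ≤ x ∧ x ≤ len e ∧ octMap z = E e x ∧
      (z = octLeft e + x ∨ e = 0 ∧ z = octVertex 5 + x) := by
  have hd := diag_pos
  have hL := longLen_eq
  obtain ⟨a1, a2, a3, a4, a5, a6, a7, a8⟩ := octagon_subset hz
  have l0 : len 0 = 1 := rfl
  have l1 : len 1 = longLen := rfl
  have l2 : len 2 = longLen := rfl
  rcases a1.eq_or_lt with h0 | h0
  · obtain ⟨-, -, -, -, b, -⟩ := octagon_horizontal (x := z.re)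
    have hz' : z = z.re := Complex.ext (by simp) (by simp [← h0])
    refine Or.inr ⟨0, z.re, by linarith, by linarith, ?_, Or.inl ?_⟩
    · rw [octMap, if_pos (by linarith), ← b, ← hz']
    · rw [show octLeft 0 = 0 from rfl, zero_add, ← hz']
  rcases lt_trichotomy z.im diag with h1 | h1 | h1
  · refine Or.inl ⟨0, ?_, ?_, mem_octPiece_zero.2 ⟨hz, a1, h1.le⟩⟩ <;>
      simp [octShift, octBand, ht_one, h0, h1]
  · obtain ⟨b, -⟩ := octagon_horizontal (x := z.re + diag)
    have hz' : z = ⟨-diag, diag⟩ + ((z.re + diag : ℝ) : ℂ) := Complex.ext (by simp) (by simp [h1])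
    refine Or.inr ⟨1, z.re + diag, by linarith, by linarith, ?_, Or.inl hz'⟩
    rw [octMap, if_pos h1.le, ← b (by linarith) (by linarith), ← hz']
  rcases lt_trichotomy z.im (1 + diag) with h2 | h2 | h2
  · refine Or.inl ⟨1, ?_, ?_, mem_octPiece_one.2 ⟨hz, h1.le, h2.le⟩⟩ <;>
      simp [octShift, octBand, ht_zero] <;> linarith
  · obtain ⟨-, -, b, -⟩ := octagon_horizontal (x := z.re + diag)
    refine Or.inr ⟨2, z.re + diag, by linarith, by linarith, ?_, Or.inl ?_⟩
    · rw [octMap, if_neg (by linarith), if_pos h2.le, ← b (by linarith) (by linarith)]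
      congr 1
      apply Complex.ext <;> simp [octShift, h2]
    · apply Complex.ext <;> simp [octLeft, h2]
  rcases a2.eq_or_lt with h3 | h3
  · obtain ⟨-, -, -, -, -, b⟩ := octagon_horizontal (x := z.re)
    refine Or.inr ⟨0, z.re, by linarith, by linarith, ?_, Or.inr ⟨rfl, ?_⟩⟩
    · rw [octMap, if_neg (by linarith), if_neg (by linarith), ← b (by linarith) (by linarith)]
      congr 1
      apply Complex.ext <;> simp [octShift, h3] <;> ring
    · rw [octVertex_five]
      apply Complex.ext <;> simp [h3]
  · refine Or.inl ⟨2, ?_, ?_, mem_octPiece_two.2 ⟨hz, h2.le, a2⟩⟩ <;>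
      simp [octShift, octBand, ht_one] <;> linarith

end

section

variable {t : ℝ} {j : Fin 2}

/-- Points of the octagon that represent the same point of an edge are identified by the gluing. -/
lemma eqvGen_of_boundary {z w : ℂ} {e e' : Fin 3} {x y : ℝ} (hx0 : 0 ≤ x) (hx1 : x ≤ len e)
    (hy0 : 0 ≤ y) (hy1 : y ≤ len e') (hz : z = octLeft e + x ∨ e = 0 ∧ z = octVertex 5 + x)
    (hw : w = octLeft e' + y ∨ e' = 0 ∧ w = octVertex 5 + y) (h : E e x = E e' y) :
    Relation.EqvGen octGlue z w := by
  have hL := longLen_eq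
  have hvertex : ∀ {z : ℂ} {e : Fin 3} {x : ℝ}, x = 0 ∨ x = len e →
      (z = octLeft e + x ∨ e = 0 ∧ z = octVertex 5 + x) → ∃ k, z = octVertex k := by
    intro z e x hx hz
    rcases hz with rfl | ⟨rfl, rfl⟩
    · rcases hx with rfl | rfl <;> fin_cases e
      · exact ⟨0, by rw [octVertex_zero]; simp [octLeft]⟩
      · exact ⟨7, by rw [octVertex_seven]; simp [octLeft]⟩
      · exact ⟨6, by rw [octVertex_six]; simp [octLeft]⟩
      · exact ⟨1, by rw [octVertex_one]; simp [octLeft, len]⟩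
      · refine ⟨2, ?_⟩
        rw [octVertex_two]
        apply Complex.ext <;> simp [octLeft, len, hL]
        ring
      · refine ⟨3, ?_⟩
        rw [octVertex_three]
        apply Complex.ext <;> simp [octLeft, len, hL]
        ring
    · rcases hx with rfl | rfl
      · exact ⟨5, by simp⟩
      · refine ⟨4, ?_⟩
        rw [octVertex_four, octVertex_five]
        apply Complex.ext <;> simp [len]
  have hE : ∀ {e : Fin 3} {x : ℝ}, x = 0 ∨ x = len e → E e x = vertex := by
    rintro e x (rfl | rfl)
    exacts [E_zero e, E_len e]
  have hcases : ∀ {e : Fin 3} {x : ℝ}, 0 ≤ x → x ≤ len e →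
      (x = 0 ∨ x = len e) ∨ (0 < x ∧ x < len e) := by
    intro e x h0 h1
    rcases h0.eq_or_lt with h | h
    · exact Or.inl (Or.inl h.symm)
    · rcases h1.eq_or_lt with h' | h'
      exacts [Or.inl (Or.inr h'), Or.inr ⟨h, h'⟩]
  rcases hcases hx0 hx1 with h1 | h1
  · rcases hcases hy0 hy1 with h2 | h2
    · obtain ⟨k, rfl⟩ := hvertex h1 hz
      obtain ⟨l, rfl⟩ := hvertex h2 hw
      exact ((eqvGen_octVertex k).symm _ _).trans _ _ _ (eqvGen_octVertex l)
    · exact absurd (h.symm.trans (hE h1)) (E_ne_vertex h2.1 h2.2)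
  · obtain ⟨rfl, rfl⟩ := E_inj h1.1 h1.2 hy0 hy1 h
    have hg : y ≤ len 0 → octGlue (octLeft 0 + y) (octVertex 5 + y) := fun h =>
      ⟨0, y, ⟨hy0, h⟩, by simp [octVertex_zero, octEdge_zero, octLeft],
        by simp [octEdge_zero]⟩
    rcases hz with rfl | ⟨rfl, rfl⟩ <;> rcases hw with rfl | ⟨he, rfl⟩
    · exact .refl _
    · subst he
      exact .rel _ _ (hg hy1)
    · exact .symm _ _ (.rel _ _ (hg hy1))
    · exact .refl _

/-- Points in pieces of the same cylinder that differ by a multiple of the circumference are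
identified by the gluing of the octagon. -/
lemma eqvGen_of_interior {z w : ℂ} {i i' : Fin 3} (hii : i ≤ i') (hz : z ∈ octPiece i)
    (hw : w ∈ octPiece i') (hb : octBand i' = octBand i) {k : ℤ}
    (hk : w - octShift i' = z - octShift i + k * circ (octBand i)) :
    Relation.EqvGen octGlue z w := by
  have hd := diag_pos
  have hL := longLen_eq
  have hc0 : circ 0 = 1 + 2 * diag := hL
  have hc1 : circ 1 = 2 + 2 * diag := by show 1 + longLen = _; linarith
  obtain ⟨a1, a2, a3, a4, a5, a6, a7, a8⟩ := octagon_subset hz.1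
  obtain ⟨b1, b2, b3, b4, b5, b6, b7, b8⟩ := octagon_subset hw.1
  have hre := congrArg Complex.re hk
  have him := congrArg Complex.im hk
  have hself : i = i' → k = 0 → Relation.EqvGen octGlue z w := by
    rintro rfl rfl
    have : w = z := by simpa using hk
    rw [this]; exact .refl _
  have hpos : 0 < k → (1 : ℝ) ≤ k := fun h => by exact_mod_cast h
  have hneg : k < 0 → (k : ℝ) ≤ -1 := fun h => by exact_mod_cast Int.le_sub_one_of_lt h
  fin_cases i <;> fin_cases i'
  · obtain ⟨-, -, c1⟩ := mem_octPiece_zero.1 hz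
    simp [octShift, octBand] at hre him
    refine hself rfl (eq_zero_of_abs_lt (circ_pos 1) ?_)
    rw [abs_lt]
    constructor <;> linarith
  · exact absurd hb (by decide)
  · obtain ⟨-, -, c1⟩ := mem_octPiece_zero.1 hz
    simp [octShift, octBand] at hre him
    rw [hc1] at hre
    rcases lt_trichotomy k 0 with h | h | h
    · nlinarith [hneg h]
    · simp only [h, Int.cast_zero, zero_mul, add_zero] at hre
      refine .rel _ _ ⟨1, z.im / diag, ⟨by positivity, (div_le_one hd).2 c1⟩, ?_, ?_⟩
      · rw [octVertex_one, octEdge_one]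
        apply Complex.ext <;> simp [div_mul_cancel₀ _ hd.ne']
        linarith
      · rw [octVertex_six, octEdge_one]
        apply Complex.ext <;> simp [div_mul_cancel₀ _ hd.ne'] <;> linarith
    · rcases (Int.add_one_le_iff.2 h).eq_or_lt with h' | h'
      · simp only [← h', zero_add, Int.cast_one, one_mul] at hre
        refine .symm _ _ (.rel _ _ ⟨3, z.im / diag, ⟨by positivity, (div_le_one hd).2 c1⟩, ?_, ?_⟩)
        · rw [octVertex_three, octEdge_three]
          apply Complex.ext <;> simp [div_mul_cancel₀ _ hd.ne'] <;> linarith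
        · rw [octVertex_eight, octEdge_three]
          apply Complex.ext <;> simp [div_mul_cancel₀ _ hd.ne']
          linarith
      · have : (2 : ℝ) ≤ k := by exact_mod_cast h'
        nlinarith
  · exact absurd hii (by decide)
  · obtain ⟨-, c0, c1⟩ := mem_octPiece_one.1 hz
    simp [octShift, octBand] at hre him
    rw [hc0] at hre
    rcases lt_trichotomy k 0 with h | h | h
    · have h2 : z.re = 1 + diag ∧ w.re = -diag := by
        constructor <;> nlinarith [hneg h]
      refine .rel _ _ ⟨2, z.im - diag, ⟨by linarith, by linarith⟩, ?_, ?_⟩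
      · rw [octVertex_two, octEdge_two]
        apply Complex.ext <;> simp [h2]
      · rw [octVertex_seven, octEdge_two]
        apply Complex.ext <;> simp [h2, him]
    · exact hself rfl h
    · have h2 : w.re = 1 + diag ∧ z.re = -diag := by
        constructor <;> nlinarith [hpos h]
      refine .symm _ _ (.rel _ _ ⟨2, z.im - diag, ⟨by linarith, by linarith⟩, ?_, ?_⟩)
      · rw [octVertex_two, octEdge_two]
        apply Complex.ext <;> simp [h2, him]
      · rw [octVertex_seven, octEdge_two]
        apply Complex.ext <;> simp [h2]
  · exact absurd hb (by decide)
  · exact absurd hii (by decide)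
  · exact absurd hii (by decide)
  · obtain ⟨-, c0, c1⟩ := mem_octPiece_two.1 hz
    simp [octShift, octBand] at hre him
    refine hself rfl (eq_zero_of_abs_lt (circ_pos 1) ?_)
    rw [abs_lt]
    constructor <;> linarith

lemma octMap_eq_iff {z w : ℂ} (hz : z ∈ octagon) (hw : w ∈ octagon) :
    octMap z = octMap w ↔ Relation.EqvGen octGlue z w := by
  constructor
  · intro h
    rcases octagon_cases hz with ⟨i, h0, h1, hi⟩ | ⟨e, x, hx0, hx1, hx, hz'⟩ <;>
      rcases octagon_cases hw with ⟨i', h0', h1', hi'⟩ | ⟨e', y, hy0, hy1, hy, hw'⟩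
    · rw [octMap_eq hi, octMap_eq hi'] at h
      rcases le_total i i' with hii | hii
      · obtain ⟨hb, k, hk⟩ := P_inj h0 h1 hi'.2 h
        exact eqvGen_of_interior hii hi hi' hb hk
      · obtain ⟨hb, k, hk⟩ := P_inj h0' h1' hi.2 h.symm
        exact .symm _ _ (eqvGen_of_interior hii hi' hi hb hk)
    · rw [octMap_eq hi, hy] at h
      exact absurd h (P_ne_E h0 h1 _ _)
    · rw [octMap_eq hi', hx] at h
      exact absurd h.symm (P_ne_E h0' h1' _ _)
    · exact eqvGen_of_boundary hx0 hx1 hy0 hy1 hz' hw' (hx.symm.trans (h.trans hy))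
  · intro h
    clear hz hw
    induction h with
    | rel _ _ h => exact octMap_eq_of_octGlue h
    | refl _ => rfl
    | symm _ _ _ ih => exact ih.symm
    | trans _ _ _ _ _ ih ih' => exact ih.trans ih'

lemma isOctagon_surf : (surf 0).IsOctagon :=
  ⟨octMap, continuousOn_octMap, eq_univ_of_forall fun x => by
    obtain ⟨z, hz, h⟩ := exists_octMap_eq x
    exact ⟨z, hz, h⟩, fun _ hz _ hw => octMap_eq_iff hz hw, fun z _ => eventually_dev_octMap z⟩

end

end TranslationSurface

end

theorem theorem1 :
    ∃ Oct : ℤ → TranslationSurface, TranslationSurface.IsOctFamily Oct ∧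
      (∀ Oct' : ℤ → TranslationSurface, TranslationSurface.IsOctFamily Oct' →
        ∀ n, (Oct' n).Isomorphic (Oct n)) ∧
      (∀ n, ∃! γ : C(unitInterval, Oct n), (Oct n).IsUnitHorizontalSaddle γ) ∧
      (∀ n, (Oct n).InH2) ∧
      (∀ n, (Oct 0).SameAbsolutePeriods (Oct n)) ∧
      (∀ n, n ≠ 0 → (Oct 0).IsFake (Oct n)) ∧
      (∀ n m, n ≠ m → ¬ (Oct n).Isomorphic (Oct m)) := by
  have h0 : TranslationSurface.surf ((0 : ℤ) : ℝ) = TranslationSurface.surf 0 := by simp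
  have hper : ∀ n : ℤ, (TranslationSurface.surf ((0 : ℤ) : ℝ)).SameAbsolutePeriods
      (TranslationSurface.surf n) := fun n => h0 ▸ TranslationSurface.sameAbsolutePeriods_surf n
  have hoct : (TranslationSurface.surf ((0 : ℤ) : ℝ)).IsOctagon :=
    h0 ▸ TranslationSurface.isOctagon_surf
  refine ⟨fun n => TranslationSurface.surf n, ⟨hoct, fun n _ => ?_, fun n _ => ?_⟩,
    fun Oct' h n => ?_, fun n => TranslationSurface.existsUnique_isUnitHorizontalSaddle _,
    fun n => TranslationSurface.inH2_surf _, hper,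
    fun n hn => ⟨TranslationSurface.not_isomorphic_surf hn, hper n,
      TranslationSurface.inH2_surf _⟩,
    fun n m h => TranslationSurface.not_isomorphic_surf h⟩
  · simpa using TranslationSurface.isLeftSurgery_surf n
  · simpa using TranslationSurface.isRightSurgery_surf n
  · exact h.isomorphic (h0 ▸ h.zero.isomorphic hoct) n
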